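/- **Setting.** The type \emph{set} has operations $\mathrm{insert}(v)$, $\mathrm{remove}(v)$, $\mathrm{contains}(v)$ ($v\in\mathbb Z$) on finite sets of integers, initially $\emptyset$, with Boolean responses. $LL$ is its sequential implementation by a sorted linked list with a head (value $-\infty$) and a tail (value $+\infty$): an operation with parameter $v$ reads the elements (value and successor together) from the head up to the first one with value $\ge v$; a successful insert then writes a fresh element and its predecessor, a successful remove writes the predecessor. A concurrent implementation for $n$ processes replaces the reads and writes of $LL$, and the completion at the end of every operation (release of locks, commit), by algorithms over shared base objects with atomic primitives. These algorithms know the process, its local state, the object, the value written and the name of the operation (insert, remove, contains), but do not receive its parameter $v$. They may return $\bot$, which aborts the operation. A history consists of the invocations and responses of operations, reads and writes, without the reads and writes that return $\bot$. Implementations are assumed obedient: after a complete sequential execution, reads executed one after the other return the last values written by non-aborted operations. An implementation is \emph{LS-linearizable} w.r.t. $(LL,set)$ if in each of its histories every operation has the same events as in some sequential history of $LL$, and the high-level history of the non-aborted operations is linearizable w.r.t. \emph{set}. A \emph{schedule} is a history without the values returned by reads and the responses of operations. An implementation \emph{accepts} a schedule $\sigma$ if it has a finite execution in whose history the events of the operations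 that returned a non-$\bot$ response form $\sigma$. $\mathcal P$ is the class of obedient LS-linearizable implementations that are pessimistic (no operation ever returns $\bot$) and deadlock-free (if all processes with pending operations keep taking steps, some operation returns). $\mathcal{SM}$ is the class of obedient LS-linearizable TM-based implementations (every operation is a transaction, and the algorithms do not depend on the operation) all of whose executions $\alpha$ are safe-strict serializable: (1) the committed transactions and some of the commit-pending ones have a legal serialization that respects the real-time order, and (2) for every incomplete or aborted transaction $\pi$ some transactions that committed or were commit-pending in the prefix of $\alpha$ up to the last event of $\pi$, followed by $\pi$, form a legal sequential execution. A TM-based implementation is \emph{progressive} if a transaction aborts only when a concurrent transaction accesses a common object that at least one of the two writes. $I^H$ is the lock-based implementation in which contains traverses the list with hand-over-hand shared locks, while insert and remove hold an exclusive lock on the head from their first read until they end, read the other elements without locks, and write an element other than the head under an exclusive lock on it. **Theorem.** For every number $n\ge 2$ of processes there are schedules $\sigma_0$ and $\sigma$ of $(LL,set)$ such that 1. $I^H\in\mathcal P$, $I^H$ accepts $\sigma_0$, and no implementation in $\mathcal{SM}$ accepts $\sigma_0$; 2. some progressive implementation $I^C\in\mathcal{SM}$ accepts $\sigma$, and no implementation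 in $\mathcal P$ accepts $\sigma$. -/

import Mathlib

namespace ListSet

/-! ### The type `set` -/

/-- Operations of the type `set`. -/
inductive SetOp
  | insert (v : ℤ)
  | remove (v : ℤ)
  | contains (v : ℤ)
  deriving DecidableEq

/-- Names of the operations, without their parameters. -/
inductive OpName
  | insert
  | remove
  | contains
  deriving DecidableEq

def SetOp.name : SetOp → OpName
  | .insert _ => .insert
  | .remove _ => .remove
  | .contains _ => .contains

def SetOp.arg : SetOp → ℤ
  | .insert v => v
  | .remove v => v
  | .contains v => v

/-- The transition relation of the type `set`; states are the finite sets of integers. -/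
def SetDelta (q : Finset ℤ) : SetOp → Finset ℤ → Bool → Prop
  | .contains v, q', r => q' = q ∧ r = decide (v ∈ q)
  | .insert v, q', r => q' = insert v q ∧ r = decide (v ∉ q)
  | .remove v, q', r => q' = q.erase v ∧ r = decide (v ∈ q)

/-- A sequence of operations with responses is consistent with the type `set` from state `q`. -/
def SetConsistent : Finset ℤ → List (SetOp × Bool) → Prop
  | _, [] => True
  | q, (o, r) :: l => ∃ q', SetDelta q o q' r ∧ SetConsistent q' l

/-! ### The sequential implementation `LL`

Objects are the elements of the list.  Every operation has a unique identifier `a : ℕ`; the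
element that it may allocate is the fresh object `node a`. -/

/-- Elements of the list. -/
inductive Obj
  | head
  | tail
  | node (a : ℕ)
  deriving DecidableEq

/-- The contents of an element; both fields are accessed atomically.  The field `next` of the
tail is never followed. -/
structure Cell where
  val : WithBot (WithTop ℤ)
  next : Obj
  deriving DecidableEq

/-- Initial contents: `head.next = tail`, `head.val = -∞`, `tail.val = +∞`.  The value of an
element that is not allocated yet is irrelevant. -/
def initMem : Obj → Cell
  | .head => ⟨⊥, .tail⟩
  | .tail => ⟨⊤, .tail⟩
  | .node _ => ⟨⊤, .tail⟩

/-- Control points of the sequential code. -/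
inductive Loc
  /-- the next step is to read the head -/
  | start
  /-- the element `prev` was read and held `pcell`; the next step is to read `curr` -/
  | traverse (prev : Obj) (pcell : Cell) (curr : Obj)
  /-- the next step is to write `c` to the new element `new` -/
  | create (prev : Obj) (pcell : Cell) (new : Obj) (c : Cell)
  /-- the next step is to write `c` to `prev` -/
  | update (prev : Obj) (c : Cell)
  /-- the code has computed the response `r` -/
  | done (r : Bool)

/-- The next command of the sequential code. -/
inductive Cmd
  | read (X : Obj)
  | write (X : Obj) (c : Cell)
  | ret (r : Bool)

def Loc.cmd : Loc → Cmd
  | .start => .read .head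
  | .traverse _ _ curr => .read curr
  | .create _ _ new c => .write new c
  | .update prev c => .write prev c
  | .done r => .ret r

/-- The parameter of an operation, as the value of an element. -/
noncomputable def key (op : SetOp) : WithBot (WithTop ℤ) := ((op.arg : WithTop ℤ) : WithBot (WithTop ℤ))

/-- Control point after a read that returned `c`, in operation `op` with identifier `a`.
The traversal stops at the first element with value at least the parameter of `op`. -/
noncomputable def Loc.afterRead (op : SetOp) (a : ℕ) : Loc → Cell → Loc
  | .start, c => .traverse .head c c.next
  | .traverse prev pcell curr, c =>
      if c.val < key op then .traverse curr c c.next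
      else match op with
        | .contains _ => .done (decide (c.val = key op))
        | .insert _ =>
            if c.val = key op then .done false
            else .create prev pcell (.node a) ⟨key op, curr⟩
        | .remove _ =>
            if c.val = key op then .update prev ⟨pcell.val, c.next⟩
            else .done false
  | l, _ => l

/-- Control point after a write. -/
def Loc.afterWrite : Loc → Loc
  | .create prev pcell new _ => .update prev ⟨pcell.val, new⟩
  | .update _ _ => .done true
  | l => l

/-! ### Events -/

/-- Kinds of events of an execution.  `abort` is the response `⊥`, `startCommit` is the moment at
which the operation, all its reads and writes being done, starts its completion, and `step` is
the application of a primitive to a base object. -/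
inductive Act
  | invOp (op : SetOp)
  | resOp (r : Bool)
  | abort
  | invRead (X : Obj)
  | resRead (X : Obj) (c : Cell)
  | invWrite (X : Obj) (c : Cell)
  | resWrite (X : Obj) (c : Cell)
  | startCommit
  | step
  deriving DecidableEq

/-- An event of process `proc` within the operation with identifier `oid`. -/
structure Event (n : ℕ) where
  proc : Fin n
  oid : ℕ
  act : Act
  deriving DecidableEq

/-- The event with which a command starts. -/
def Cmd.start : Cmd → Act
  | .read X => .invRead X
  | .write X c => .invWrite X c
  | .ret _ => .startCommit

/-- The event with which a command returns normally (`c` matters only for reads). -/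
def Cmd.finish : Cmd → Cell → Act
  | .read X, c => .resRead X c
  | .write X v, _ => .resWrite X v
  | .ret r, _ => .resOp r

/-- What a process is doing. -/
inductive Phase
  /-- no operation is pending -/
  | idle
  /-- in operation `op` with identifier `a`, about to start the command at `l` -/
  | ready (op : SetOp) (a : ℕ) (l : Loc)
  /-- in operation `op` with identifier `a`, executing the command at `l` -/
  | busy (op : SetOp) (a : ℕ) (l : Loc)

/-- Phase after the command at `l` returned normally (`c` matters only for reads). -/
noncomputable def Phase.after (op : SetOp) (a : ℕ) (l : Loc) (c : Cell) : Phase :=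
  match l.cmd with
  | .read _ => .ready op a (l.afterRead op a c)
  | .write _ _ => .ready op a l.afterWrite
  | .ret _ => .idle

/-! ### Histories of the sequential implementation -/

structure SeqConfig (n : ℕ) where
  mem : Obj → Cell
  phase : Fin n → Phase
  used : Finset ℕ

def SeqConfig.initial (n : ℕ) : SeqConfig n := ⟨initMem, fun _ => .idle, ∅⟩

/-- Steps of the sequential implementation: an operation is invoked only when none is pending. -/
inductive SeqStep {n : ℕ} : SeqConfig n → Event n → SeqConfig n → Prop
  | invoke (c : SeqConfig n) (p : Fin n) (op : SetOp) (a : ℕ) :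
      (∀ q, c.phase q = .idle) → a ∉ c.used →
      SeqStep c ⟨p, a, .invOp op⟩
        { c with phase := Function.update c.phase p (.ready op a .start)
                 used := insert a c.used }
  | call (c : SeqConfig n) (p : Fin n) (op : SetOp) (a : ℕ) (l : Loc) :
      c.phase p = .ready op a l → (∀ r, l.cmd ≠ .ret r) →
      SeqStep c ⟨p, a, l.cmd.start⟩
        { c with phase := Function.update c.phase p (.busy op a l) }
  | read (c : SeqConfig n) (p : Fin n) (op : SetOp) (a : ℕ) (l : Loc) (X : Obj) :
      c.phase p = .busy op a l → l.cmd = .read X →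
      SeqStep c ⟨p, a, .resRead X (c.mem X)⟩
        { c with phase := Function.update c.phase p (.ready op a (l.afterRead op a (c.mem X))) }
  | write (c : SeqConfig n) (p : Fin n) (op : SetOp) (a : ℕ) (l : Loc) (X : Obj) (v : Cell) :
      c.phase p = .busy op a l → l.cmd = .write X v →
      SeqStep c ⟨p, a, .resWrite X v⟩
        { c with mem := Function.update c.mem X v
                 phase := Function.update c.phase p (.ready op a l.afterWrite) }
  | ret (c : SeqConfig n) (p : Fin n) (op : SetOp) (a : ℕ) (l : Loc) (r : Bool) :
      c.phase p = .ready op a l → l.cmd = .ret r →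
      SeqStep c ⟨p, a, .resOp r⟩
        { c with phase := Function.update c.phase p .idle }

inductive SeqReach {n : ℕ} : List (Event n) → SeqConfig n → Prop
  | nil : SeqReach [] (SeqConfig.initial n)
  | snoc {S : List (Event n)} {c c' : SeqConfig n} {e : Event n} :
      SeqReach S c → SeqStep c e c' → SeqReach (S ++ [e]) c'

/-- `S` is a (finite) history of the sequential implementation `LL`. -/
def IsSeqHistory {n : ℕ} (S : List (Event n)) : Prop := ∃ c, SeqReach S c

/-! ### Concurrent implementations -/

/-- What the sequential code asks of a concurrent implementation: to read or to write an object,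
or, at the end of the operation, to complete it (release locks, commit). -/
inductive Call
  | read (X : Obj)
  | write (X : Obj) (c : Cell)
  | complete

def Cmd.toCall : Cmd → Call
  | .read X => .read X
  | .write X c => .write X c
  | .ret _ => .complete

/-- The next action of a process within the algorithm of a read, a write or a completion: apply
atomically a primitive to one base object, or return.  `none` is `⊥`; otherwise the cell is
the value of a read, and is ignored for writes and completions. -/
inductive Action (Base : Type) (State : Base → Type) (Local : Type)
  | prim (b : Base) (f : State b → State b × Local)
  | ret (r : Option Cell)

/-- A concurrent implementation of the reads and writes of `LL` for `n` processes, from base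
objects with arbitrary primitives.  The algorithms depend on the process, on the name of the
operation that performs the read or write, on the object (and the value to write) and on the
local state of the process, but do not receive the parameter of the operation. -/
structure ConcImpl (n : ℕ) where
  Base : Type
  decBase : DecidableEq Base
  State : Base → Type
  base₀ : (b : Base) → State b
  Local : Type
  local₀ : Fin n → Local
  /-- local state with which the algorithm of a call starts -/
  call : Fin n → OpName → Call → Local → Local
  /-- next action of the current algorithm -/
  next : Fin n → Local → Action Base State Local

attribute [instance] ConcImpl.decBase

structure Config {n : ℕ} (I : ConcImpl n) where
  base : (b : I.Base) → I.State b
  loc : Fin n → I.Local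
  phase : Fin n → Phase
  /-- identifiers of the operations invoked so far -/
  used : Finset ℕ

def Config.initial {n : ℕ} (I : ConcImpl n) : Config I :=
  ⟨I.base₀, I.local₀, fun _ => .idle, ∅⟩

/-- Steps of a concurrent implementation.  Idle processes may invoke any operation; the other
ones run the code of `LL`, with the reads, writes and completion implemented by `I`. -/
inductive Step {n : ℕ} (I : ConcImpl n) : Config I → Event n → Config I → Prop
  | invoke (c : Config I) (p : Fin n) (op : SetOp) (a : ℕ) :
      c.phase p = .idle → a ∉ c.used →
      Step I c ⟨p, a, .invOp op⟩
        { c with phase := Function.update c.phase p (.ready op a .start)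
                 used := insert a c.used }
  | call (c : Config I) (p : Fin n) (op : SetOp) (a : ℕ) (l : Loc) :
      c.phase p = .ready op a l →
      Step I c ⟨p, a, l.cmd.start⟩
        { c with phase := Function.update c.phase p (.busy op a l)
                 loc := Function.update c.loc p (I.call p op.name l.cmd.toCall (c.loc p)) }
  | prim (c : Config I) (p : Fin n) (op : SetOp) (a : ℕ) (l : Loc)
      (b : I.Base) (f : I.State b → I.State b × I.Local) :
      c.phase p = .busy op a l → I.next p (c.loc p) = .prim b f →
      Step I c ⟨p, a, .step⟩
        { c with base := Function.update c.base b (f (c.base b)).1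
                 loc := Function.update c.loc p (f (c.base b)).2 }
  | ret (c : Config I) (p : Fin n) (op : SetOp) (a : ℕ) (l : Loc) (v : Cell) :
      c.phase p = .busy op a l → I.next p (c.loc p) = .ret (some v) →
      Step I c ⟨p, a, l.cmd.finish v⟩
        { c with phase := Function.update c.phase p (Phase.after op a l v) }
  | abort (c : Config I) (p : Fin n) (op : SetOp) (a : ℕ) (l : Loc) :
      c.phase p = .busy op a l → I.next p (c.loc p) = .ret none →
      Step I c ⟨p, a, .abort⟩
        { c with phase := Function.update c.phase p .idle }

/-- `Reach I t c`: the finite execution `t` of `I` leads to the configuration `c`. -/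
inductive Reach {n : ℕ} (I : ConcImpl n) : List (Event n) → Config I → Prop
  | nil : Reach I [] (Config.initial I)
  | snoc {t : List (Event n)} {c c' : Config I} {e : Event n} :
      Reach I t c → Step I c e c' → Reach I (t ++ [e]) c'

/-- `t` is a finite execution of `I`. -/
def IsExecution {n : ℕ} (I : ConcImpl n) (t : List (Event n)) : Prop := ∃ c, Reach I t c

/-- An infinite execution, with its configurations. -/
def IsInfExecution {n : ℕ} (I : ConcImpl n) (c : ℕ → Config I) (e : ℕ → Event n) : Prop :=
  c 0 = Config.initial I ∧ ∀ i, Step I (c i) (e i) (c (i + 1))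

/-! ### Operations in an execution -/

section Traces

variable {n : ℕ}

def Appears (t : List (Event n)) (a : ℕ) : Prop := ∃ e ∈ t, e.oid = a

def Invoked (t : List (Event n)) (a : ℕ) (op : SetOp) : Prop :=
  ∃ e ∈ t, e.oid = a ∧ e.act = .invOp op

def Responded (t : List (Event n)) (a : ℕ) (r : Bool) : Prop :=
  ∃ e ∈ t, e.oid = a ∧ e.act = .resOp r

/-- The operation returned a matching response. -/
def Committed (t : List (Event n)) (a : ℕ) : Prop := ∃ r, Responded t a r

/-- The operation returned `⊥`. -/
def Aborted (t : List (Event n)) (a : ℕ) : Prop := ∃ e ∈ t, e.oid = a ∧ e.act = .abort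

/-- The operation started its completion and has not returned. -/
def CommitPending (t : List (Event n)) (a : ℕ) : Prop :=
  (∃ e ∈ t, e.oid = a ∧ e.act = .startCommit) ∧ ¬ Committed t a ∧ ¬ Aborted t a

/-- The response of `a` occurs before the invocation of `b`. -/
def Precedes (t : List (Event n)) (a b : ℕ) : Prop :=
  ∃ e f : Event n, List.Sublist [e, f] t ∧ e.oid = a ∧ f.oid = b ∧
    ((∃ r, e.act = .resOp r) ∨ e.act = .abort) ∧ ∃ op, f.act = .invOp op

def Concurrent (t : List (Event n)) (a b : ℕ) : Prop :=
  Appears t a ∧ Appears t b ∧ ¬ Precedes t a b ∧ ¬ Precedes t b a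

/-- No two operations are concurrent. -/
def Sequential (t : List (Event n)) : Prop := ∀ a b, a ≠ b → ¬ Concurrent t a b

/-- Every operation returned. -/
def Complete (t : List (Event n)) : Prop := ∀ a, Appears t a → Committed t a ∨ Aborted t a

/-- The events of operation `a`. -/
def opEvents (t : List (Event n)) (a : ℕ) : List (Event n) := t.filter (fun e => e.oid = a)

/-- The read or write of `a` that is pending before `t` returns `⊥` in `t`. -/
def ReturnsAbort (t : List (Event n)) (a : ℕ) : Prop :=
  ((opEvents t a).find? (fun e => e.act ≠ .step)).map Event.act = some .abort

instance (t : List (Event n)) (a : ℕ) : Decidable (ReturnsAbort t a) := by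
  unfold ReturnsAbort; infer_instance

/-- The history exported by an execution: invocations and responses of operations, reads and
writes, except for the reads and writes that return `⊥`. -/
def history : List (Event n) → List (Event n)
  | [] => []
  | e :: t =>
    match e.act with
    | .step => history t
    | .startCommit => history t
    | .invRead _ => if ReturnsAbort t e.oid then history t else e :: history t
    | .invWrite _ _ => if ReturnsAbort t e.oid then history t else e :: history t
    | _ => e :: history t

/-! ### LS-linearizability -/

/-- Every operation locally observes some history of the sequential implementation (the
response `⊥` is not part of the local history). -/
def LocallySerializable (t : List (Event n)) : Prop :=
  ∀ a, ∃ S : List (Event n), IsSeqHistory S ∧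
    opEvents S a = (opEvents (history t) a).filter (fun e => e.act ≠ .abort)

/-- The high-level history (of the non-aborted operations) is linearizable with respect to the
type `set`: `L` lists, in the order of the linearization, the completed operations and some of
the incomplete ones, with their responses. -/
def Linearizable (t : List (Event n)) : Prop :=
  ∃ L : List (ℕ × SetOp × Bool),
    (L.map Prod.fst).Nodup ∧
    (∀ x ∈ L, Invoked t x.1 x.2.1 ∧ ¬ Aborted t x.1 ∧ ∀ r, Responded t x.1 r → r = x.2.2) ∧
    (∀ a, Committed t a → a ∈ L.map Prod.fst) ∧
    (∀ a ∈ L.map Prod.fst, ∀ b ∈ L.map Prod.fst, Precedes t a b →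
      List.Sublist [a, b] (L.map Prod.fst)) ∧
    SetConsistent ∅ (L.map Prod.snd)

/-- LS-linearizability with respect to `(LL, set)`. -/
def LSLinearizable (t : List (Event n)) : Prop := LocallySerializable t ∧ Linearizable t

def LSL (I : ConcImpl n) : Prop := ∀ t, IsExecution I t → LSLinearizable t

/-! ### Obedient implementations -/

/-- The values of the objects after the writes of `t`, in order. -/
def memAfter (t : List (Event n)) : Obj → Cell :=
  t.foldl (fun m e => match e.act with
    | .resWrite X c => Function.update m X c
    | _ => m) initMem

open Classical in
/-- The events that do not belong to aborted operations. -/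
noncomputable def nonAborted (t : List (Event n)) : List (Event n) :=
  t.filter (fun e => ¬ Aborted t e.oid)

/-- Sequences of complete executions of reads, and of the invocations of the operations that
perform them. -/
inductive ReadSequence : List (Event n) → Prop
  | nil : ReadSequence []
  | invoke {ρ : List (Event n)} (p : Fin n) (a : ℕ) (op : SetOp) :
      ReadSequence ρ → ReadSequence (ρ ++ [⟨p, a, .invOp op⟩])
  | read {ρ s : List (Event n)} (p : Fin n) (a : ℕ) (X : Obj) (c : Cell) :
      ReadSequence ρ → (∀ e ∈ s, e = ⟨p, a, .step⟩) →
      ReadSequence (ρ ++ ⟨p, a, .invRead X⟩ :: (s ++ [⟨p, a, .resRead X c⟩]))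

/-- After a complete sequential execution, reads executed one after the other return the value
of the last write that does not belong to an aborted operation. -/
def Obedient (I : ConcImpl n) : Prop :=
  ∀ t ρ : List (Event n), IsExecution I (t ++ ρ) → Complete t → Sequential t →
    ReadSequence ρ →
    ∀ e ∈ ρ, ∀ X c, e.act = .resRead X c → c = memAfter (nonAborted t) X

/-! ### Schedules -/

/-- Events of a schedule: the values of reads and the responses of operations are left out. -/
inductive SchedAct
  | invOp (op : SetOp)
  | resOp
  | invRead (X : Obj)
  | resRead (X : Obj)
  | invWrite (X : Obj) (c : Cell)
  | resWrite (X : Obj)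

/-- A schedule: a history in which the responses of reads and operations are not specified. -/
abbrev Schedule (n : ℕ) := List (Fin n × SchedAct)

def Act.toSched : Act → Option SchedAct
  | .invOp op => some (.invOp op)
  | .resOp _ => some .resOp
  | .invRead X => some (.invRead X)
  | .resRead X _ => some (.resRead X)
  | .invWrite X c => some (.invWrite X c)
  | .resWrite X _ => some (.resWrite X)
  | .abort => none
  | .startCommit => none
  | .step => none

/-- The schedule of a history: its events in order, without values of reads and responses. -/
def scheduleOf (H : List (Event n)) : Schedule n :=
  H.filterMap (fun e => e.act.toSched.map (fun s => (e.proc, s)))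

open Classical in
/-- The events of the operations that returned a matching response. -/
noncomputable def completePart (H : List (Event n)) : List (Event n) :=
  H.filter (fun e => Committed H e.oid)

/-- `I` accepts the schedule `σ`. -/
def Accepts (I : ConcImpl n) (σ : Schedule n) : Prop :=
  ∃ t, IsExecution I t ∧ scheduleOf (completePart (history t)) = σ

/-! ### The class `P` -/

/-- No execution has an operation that returns `⊥`. -/
def Pessimistic (I : ConcImpl n) : Prop := ∀ t, IsExecution I t → ∀ a, ¬ Aborted t a

/-- In every infinite execution in which every process keeps taking steps while it has a pending
operation, whenever an operation is pending some operation later returns a matching response. -/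
def DeadlockFree (I : ConcImpl n) : Prop :=
  ∀ (c : ℕ → Config I) (e : ℕ → Event n), IsInfExecution I c e →
    (∀ p i, (c i).phase p ≠ .idle → ∃ j ≥ i, (e j).proc = p) →
    ∀ i, (∃ p, (c i).phase p ≠ .idle) → ∃ j ≥ i, ∃ r, (e j).act = .resOp r

/-- Deadlock-free pessimistic LS-linearizable implementations. -/
structure ClassP (I : ConcImpl n) : Prop where
  obedient : Obedient I
  lsl : LSL I
  pessimistic : Pessimistic I
  deadlockFree : DeadlockFree I

/-! ### The class `SM` -/

/-- Every operation is run as a transaction: the algorithms of reads, writes and commits are the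
same for all operations. -/
def TMBased (I : ConcImpl n) : Prop :=
  ∀ p (m m' : OpName) (k : Call) (ℓ : I.Local), I.call p m k ℓ = I.call p m' k ℓ

/-- Every read returns the last value written before it. -/
def Legal (t : List (Event n)) : Prop :=
  ∀ (t₁ t₂ : List (Event n)) (e : Event n) (X : Obj) (c : Cell),
    t = t₁ ++ e :: t₂ → e.act = .resRead X c → c = memAfter t₁ X

/-- The sequential execution of the transactions `L` with their events in `t`. -/
def serial (t : List (Event n)) (L : List ℕ) : List (Event n) := L.flatMap (opEvents t)

/-- The committed transactions and some of those that started committing have a legal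
serialization that respects the real-time order. -/
def StrictlySerializable (t : List (Event n)) : Prop :=
  ∃ L : List ℕ, L.Nodup ∧
    (∀ a, Committed t a → a ∈ L) ∧
    (∀ a ∈ L, Committed t a ∨ CommitPending t a) ∧
    (∀ a ∈ L, ∀ b ∈ L, Precedes t a b → List.Sublist [a, b] L) ∧
    Legal (serial t L)

/-- The prefix of `t` up to the last event of `a`. -/
def prefixUpTo (t : List (Event n)) (a : ℕ) : List (Event n) :=
  t.rdropWhile (fun e => e.oid ≠ a)

/-- The execution is strictly serializable and every incomplete or aborted transaction `a`
observes a serial execution of some transactions that committed, or started committing, before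
the last event of `a`. -/
def SafeStrictSerializable (t : List (Event n)) : Prop :=
  StrictlySerializable t ∧
  ∀ a, Appears t a → ¬ Committed t a →
    ∃ L : List ℕ, L.Nodup ∧ a ∉ L ∧
      (∀ b ∈ L, Committed (prefixUpTo t a) b ∨ CommitPending (prefixUpTo t a) b) ∧
      Legal (serial (prefixUpTo t a) (L ++ [a]))

/-- LS-linearizable implementations based on a safe-strict serializable TM. -/
structure ClassSM (I : ConcImpl n) : Prop where
  obedient : Obedient I
  lsl : LSL I
  tmBased : TMBased I
  safe : ∀ t, IsExecution I t → SafeStrictSerializable t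

def Writes (t : List (Event n)) (a : ℕ) (X : Obj) : Prop :=
  ∃ e ∈ t, e.oid = a ∧ ∃ c, e.act = .invWrite X c

def Accesses (t : List (Event n)) (a : ℕ) (X : Obj) : Prop :=
  (∃ e ∈ t, e.oid = a ∧ e.act = .invRead X) ∨ Writes t a X

/-- A transaction aborts only if it conflicts with a concurrent transaction. -/
def Progressive (I : ConcImpl n) : Prop :=
  ∀ t, IsExecution I t → ∀ a, Aborted t a →
    ∃ b, b ≠ a ∧ Concurrent t a b ∧
      ∃ X, Accesses t a X ∧ Accesses t b X ∧ (Writes t a X ∨ Writes t b X)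

end Traces

/-! ### The hand-over-hand implementation -/

namespace HandOverHand

/-- Every object has a lock and a base object that stores its value. -/
inductive Base
  | lock (X : Obj)
  | value (X : Obj)
  deriving DecidableEq

/-- The state of a lock is the queue of the requests that are not released yet, in order of
arrival; `true` is exclusive mode and `false` shared mode. -/
def State (n : ℕ) : Base → Type
  | .lock _ => List (Fin n × Bool)
  | .value _ => Cell

def base₀ (n : ℕ) : (b : Base) → State n b
  | .lock _ => ([] : List (Fin n × Bool))
  | .value X => initMem X

/-- The request of `p` in mode `m` is granted: it is the first one, or it is shared and all the
earlier ones are shared. -/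
def granted {n : ℕ} (q : List (Fin n × Bool)) (p : Fin n) (m : Bool) : Prop :=
  ∀ x ∈ q.takeWhile (fun x => x.1 ≠ p), m = false ∧ x.2 = false

instance {n : ℕ} (q : List (Fin n × Bool)) (p : Fin n) (m : Bool) :
    Decidable (granted q p m) := by
  unfold granted; infer_instance

/-- Program counter within the algorithm of a call. -/
inductive Pc
  | request
  | wait
  | access
  | release

/-- Local state: the current call, the mode of the lock that it acquires on its object (if any),
the program counter, the lock kept between calls, the lock to release before the call returns,
and the value to return. -/
structure Local where
  call : Call
  mode : Option Bool
  pc : Pc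
  held : Option Obj
  old : Option Obj
  out : Cell

/-- Locks acquired by calls: shared locks by the reads of `contains`; exclusive locks by the
read of the head and by all other writes than those to the head (which is locked already) of
`insert` and `remove`. -/
def lockMode : OpName → Call → Option Bool
  | .contains, .read _ => some false
  | .contains, _ => none
  | _, .read .head => some true
  | _, .read _ => none
  | _, .write .head _ => none
  | _, .write _ _ => some true
  | _, .complete => none

/-- The start of a call.  The completion of an operation releases the lock still held. -/
def start (m : OpName) (k : Call) (ℓ : Local) : Local :=
  match k with
  | .complete => { ℓ with call := k, mode := none, pc := .release, old := ℓ.held, held := none }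
  | _ =>
    { ℓ with
      call := k
      mode := lockMode m k
      pc := if (lockMode m k).isSome then .request else .access
      old := none }

/-- Request a lock, or wait for it, on `X`. -/
def lockAction {n : ℕ} (p : Fin n) (ℓ : Local) (X : Obj) (m : Bool) :
    Action Base (State n) Local :=
  match ℓ.pc with
  | .request => .prim (.lock X) (fun (q : List (Fin n × Bool)) =>
      (q ++ [(p, m)], { ℓ with pc := .wait }))
  | _ => .prim (.lock X) (fun (q : List (Fin n × Bool)) =>
      (q, if granted q p m then { ℓ with pc := .access } else ℓ))

/-- Release the lock on `ℓ.old`, if any, and return. -/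
def releaseAction {n : ℕ} (p : Fin n) (ℓ : Local) : Action Base (State n) Local :=
  match ℓ.old with
  | some Y => .prim (.lock Y) (fun (q : List (Fin n × Bool)) =>
      (q.filter (fun x => x.1 ≠ p), { ℓ with old := none }))
  | none => .ret (some ℓ.out)

/-- A read that acquires a lock keeps it, and then releases the lock acquired before it (if any);
a write that acquires a lock releases it. -/
def next {n : ℕ} (p : Fin n) (ℓ : Local) : Action Base (State n) Local :=
  match ℓ.call, ℓ.pc with
  | .read X, .access => .prim (.value X) (fun (c : Cell) =>
      (c, if ℓ.mode.isSome
          then { ℓ with out := c, pc := .release, old := ℓ.held, held := some X }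
          else { ℓ with out := c, pc := .release }))
  | .write X v, .access => .prim (.value X) (fun (_ : Cell) =>
      (v, { ℓ with pc := .release, old := if ℓ.mode.isSome then some X else none }))
  | .read X, .request => lockAction p ℓ X (ℓ.mode.getD true)
  | .read X, .wait => lockAction p ℓ X (ℓ.mode.getD true)
  | .write X _, .request => lockAction p ℓ X (ℓ.mode.getD true)
  | .write X _, .wait => lockAction p ℓ X (ℓ.mode.getD true)
  | _, _ => releaseAction p ℓ

end HandOverHand

/-- The hand-over-hand lock-based implementation `I^H` of `(LL, set)`: `contains` traverses the
list with hand-over-hand shared locks; `insert` and `remove` hold an exclusive lock on the head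
from their first read to their end, read the other elements without locks, and write under an
exclusive lock on the element. -/
def handOverHand (n : ℕ) : ConcImpl n where
  Base := HandOverHand.Base
  decBase := inferInstance
  State := HandOverHand.State n
  base₀ := HandOverHand.base₀ n
  Local := HandOverHand.Local
  local₀ := fun _ => ⟨.complete, none, .release, none, none, initMem .tail⟩
  call := fun _ m k ℓ => HandOverHand.start m k ℓ
  next := HandOverHand.next

end ListSet

/-! Common ground. The parameter `V a` of operation `a` is also the value of `node a` for ever. In a
well-formed memory (`WF`) the values strictly increase along `next`, so the elements reachable from
the head form a sorted list that represents a set (`Abs`). An operation reads before it writes;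
hence its run is governed by the single memory `m` from which it reads, and `LocOK` tracks its
control point and its own writes relative to `m`.

Local serializability needs very little. If every cell that an operation reads has the right value
and points to an element of larger value, then its reads form an increasing chain, each cell
pointing to the next element that is read. Such a chain is the initial part of a real list, which a
sequential history of inserts builds; the operation then runs on it (`OpRun.pathOK`,
`Reach.locallySerializable`).

`handOverHand n` is in `ClassP`. Updates hold the head exclusively, so at most one of them is past
its first access, and between that access and its end the memory changes only by its own writes. A
`contains` overlaps with updates but is linearizable by hindsight. An element off the list is never
written again, so whatever cell a traversal reads was the content of that element at some earlier
moment, after the invocation, at which the element was still linked (`Trace.hindsight`). At such a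
moment for the last element passed, the sorted list decides the response. Successful updates take
effect at their write to the predecessor, unsuccessful ones at their last read. Deadlock is
impossible because a process waits for an element of larger value than the one that it holds
(`held_lt`, `not_all_stuck`); livelock is excluded by a measure that every other step decreases
(`measure_step`).

`lockSchedule` separates the classes in one direction. There `contains 5` reads the head pointing to
the node of 2; then another process removes 2 and afterwards inserts 5; then `contains` reads the
node of 5. In a serialization `contains` comes after the insertion, whose node it reads, hence after
the removal, which precedes the insertion in real time. But then the removed node is off the list
for good, while `contains` saw it behind the head (`not_strictlySerializable_of_removed`). The locks
do not object, because `contains` has left the head before the removal starts.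

`overlapSchedule` separates them in the other direction. After a first insertion of 5, the
operations `insert 3` and `insert 5` of two processes both read the head and then the node of 5; one
goes on to write, the other returns without writing. The algorithms do not see parameters, so up to
this moment the execution is indistinguishable from one in which both operations insert the same
integer, smaller than all parameters in use (`Reach.reparam`). In that execution both are committed
to creating a node. A pessimistic implementation cannot abort either of them, deadlock-freedom makes
both return once no new operation is invoked, and both return `true`; two successful insertions of
an integer that nobody removes contradict linearizability (`ClassP.not_both_create`).

The transactional memory that accepts it, `locking n`, keeps read and write locks to the end of the
transaction and aborts on the first conflict. The order of commits is a serialization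
(`Serialized`), and from it follow safe-strict serializability and LS-linearizability. In
`overlapSchedule` the read-only insertion commits before the other one writes, so no conflict
arises. -/

namespace ListSet

variable {n : ℕ} {I : ConcImpl n} {t u : List (Event n)} {c c' d : Config I} {e f : Event n}
  {a b : ℕ} {p p' : Fin n} {op : SetOp} {s s' : Stat} {l : Loc} {X : Obj} {V : ℕ → ℤ}
  {m m' : Obj → Cell} {xs : List Act}

/-! ### Values and ranks -/

/-- An integer as the value of an element. -/
def keyVal (v : ℤ) : WithBot (WithTop ℤ) := ((v : WithTop ℤ) : WithBot (WithTop ℤ))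

theorem key_eq (op : SetOp) : key op = keyVal op.arg := rfl

@[simp] theorem keyVal_lt {v w : ℤ} : keyVal v < keyVal w ↔ v < w := by
  simp [keyVal]

@[simp] theorem keyVal_inj {v w : ℤ} : keyVal v = keyVal w ↔ v = w := by
  simp [keyVal]

@[simp] theorem bot_lt_keyVal (v : ℤ) : ⊥ < keyVal v := by simp [keyVal]

theorem keyVal_lt_top (v : ℤ) : keyVal v < ⊤ := by
  have : ((v : WithTop ℤ) : WithBot (WithTop ℤ)) < ((⊤ : WithTop ℤ) : WithBot (WithTop ℤ)) :=
    WithBot.coe_lt_coe.2 (WithTop.coe_lt_top v)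
  exact this

@[simp] theorem keyVal_ne_top (v : ℤ) : keyVal v ≠ ⊤ := (keyVal_lt_top v).ne

@[simp] theorem keyVal_ne_bot (v : ℤ) : keyVal v ≠ ⊥ := (bot_lt_keyVal v).ne'

/-- The value of an element, if the node `b` has value `V b`. -/
def rank (V : ℕ → ℤ) : Obj → WithBot (WithTop ℤ)
  | .head => ⊥
  | .tail => ⊤
  | .node b => keyVal (V b)

theorem rank_ne_top (h : X ≠ .tail) : rank V X ≠ ⊤ := by
  cases X
  · exact bot_ne_top
  · exact absurd rfl h
  · exact keyVal_ne_top _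

theorem rank_eq_keyVal {v : ℤ} (h : rank V X = keyVal v) :
    ∃ b, X = .node b ∧ V b = v := by
  cases X with
  | head => exact absurd h.symm (keyVal_ne_bot v)
  | tail => exact absurd h.symm (keyVal_ne_top v)
  | node b => exact ⟨b, rfl, keyVal_inj.1 h⟩

theorem ne_head_of_rank_lt {x : WithBot (WithTop ℤ)} (h : x < rank V X) :
    X ≠ .head := by
  rintro rfl
  exact not_lt_bot h

/-! ### Well-formed memories -/

/-- The element has been written (or is one of the two sentinels). -/
def Made (m : Obj → Cell) (X : Obj) : Prop := X = .tail ∨ (m X).val ≠ ⊤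

/-- Possible contents of the element `X`. -/
def GoodCell (V : ℕ → ℤ) (X : Obj) (c : Cell) : Prop :=
  c.val = rank V X ∧ (X = .tail → c.next = .tail) ∧ (X ≠ .tail → rank V X < rank V c.next)

/-- Only made elements are constrained. They are closed under `next`, so a path from the head never
meets an element that was not written, and the strict growth of the values makes such a path sorted
and free of cycles. -/
structure WF (V : ℕ → ℤ) (m : Obj → Cell) : Prop where
  head_val : (m .head).val = ⊥
  tail_eq : m .tail = ⟨⊤, .tail⟩
  cell : ∀ X, X ≠ .tail → Made m X →
    (m X).val = rank V X ∧ Made m (m X).next ∧ rank V X < rank V (m X).next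

theorem made_tail (m : Obj → Cell) : Made m .tail := Or.inl rfl

theorem WF.made_head (h : WF V m) : Made m .head :=
  Or.inr (by rw [h.head_val]; exact bot_ne_top)

theorem WF.val (h : WF V m) (hX : Made m X) :
    (m X).val = rank V X := by
  by_cases ht : X = .tail
  · subst ht; rw [h.tail_eq]; rfl
  · exact (h.cell X ht hX).1

theorem WF.good (h : WF V m) (hX : Made m X) :
    GoodCell V X (m X) := by
  refine ⟨h.val hX, ?_, fun ht => (h.cell X ht hX).2.2⟩
  rintro rfl
  rw [h.tail_eq]

theorem WF.made_next (h : WF V m) (hX : Made m X) :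
    Made m (m X).next := by
  by_cases ht : X = .tail
  · subst ht; rw [h.tail_eq]; exact made_tail m
  · exact (h.cell X ht hX).2.1

theorem WF.initMem (V : ℕ → ℤ) : WF V initMem := by
  refine ⟨rfl, rfl, ?_⟩
  rintro (_ | _ | b) ht hm
  · exact ⟨rfl, made_tail _, bot_lt_top⟩
  · exact absurd rfl ht
  · rcases hm with hm | hm
    · exact absurd hm ht
    · exact absurd rfl hm

theorem not_made_initMem (b : ℕ) : ¬ Made initMem (.node b) := by
  rintro (h | h)
  · cases h
  · exact h rfl

theorem Made.update {X Y : Obj} {c : Cell} (hY : Made m Y)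
    (hX : X ≠ .tail) (hc : c.val = rank V X) : Made (Function.update m X c) Y := by
  by_cases h : Y = X
  · subst h
    right
    rw [Function.update_self, hc]
    exact rank_ne_top hX
  · rcases hY with hY | hY
    · exact Or.inl hY
    · right
      rwa [Function.update_of_ne h]

theorem WF.update (h : WF V m) {c : Cell}
    (hX : X ≠ .tail) (hc : GoodCell V X c) (hn : Made (Function.update m X c) c.next) :
    WF V (Function.update m X c) := by
  refine ⟨?_, ?_, ?_⟩
  · by_cases hh : X = .head
    · subst hh; rw [Function.update_self, hc.1]; rfl
    · rw [Function.update_of_ne (Ne.symm hh), h.head_val]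
  · rw [Function.update_of_ne (Ne.symm hX), h.tail_eq]
  · intro Y hY hm
    by_cases hYX : Y = X
    · subst hYX
      rw [Function.update_self]
      exact ⟨hc.1, hn, hc.2.2 hX⟩
    · have hm' : Made m Y := by
        rcases hm with hm | hm
        · exact Or.inl hm
        · right; rwa [Function.update_of_ne hYX] at hm
      rw [Function.update_of_ne hYX]
      obtain ⟨h1, h2, h3⟩ := h.cell Y hY hm'
      exact ⟨h1, h2.update hX hc.1, h3⟩

/-! ### Reachable elements -/

/-- The tail has no successor: in a well-formed memory its `next` field is a dummy that points back
to the tail. -/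
def Succ (m : Obj → Cell) (X Y : Obj) : Prop := X ≠ .tail ∧ Y = (m X).next

/-- The elements of the list held in memory `m`, with its head and tail. -/
def Linked (m : Obj → Cell) (X : Obj) : Prop := Relation.ReflTransGen (Succ m) .head X

theorem Linked.head (m : Obj → Cell) : Linked m .head := .refl

theorem Linked.next (h : Linked m X) (ht : X ≠ .tail) :
    Linked m (m X).next := .tail h ⟨ht, rfl⟩

theorem Linked.induction {P : Obj → Prop} (h0 : P .head)
    (hs : ∀ X, Linked m X → X ≠ .tail → P X → P (m X).next) (h : Linked m X) : P X := by
  unfold Linked at h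
  induction h with
  | refl => exact h0
  | tail h1 h2 ih =>
    obtain ⟨ht, rfl⟩ := h2
    exact hs _ h1 ht ih

theorem Linked.made (hm : WF V m) (h : Linked m X) :
    Made m X :=
  h.induction hm.made_head (fun _ _ _ ih => hm.made_next ih)

/-- Every element has at most one successor, so of two paths from the head one extends the other. -/
theorem Linked.comparable {X Y : Obj} (hX : Linked m X) (hY : Linked m Y) :
    Relation.ReflTransGen (Succ m) X Y ∨ Relation.ReflTransGen (Succ m) Y X :=
  Relation.ReflTransGen.total_of_right_unique
    (fun _ _ _ h1 h2 => h1.2.trans h2.2.symm) hX hY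

theorem rank_le_of_path (hm : WF V m) {X Y : Obj} (hX : Made m X)
    (h : Relation.ReflTransGen (Succ m) X Y) : Made m Y ∧ rank V X ≤ rank V Y := by
  induction h with
  | refl => exact ⟨hX, le_rfl⟩
  | tail h1 h2 ih =>
    obtain ⟨ht, rfl⟩ := h2
    have := hm.cell _ ht ih.1
    exact ⟨this.2.1, ih.2.trans this.2.2.le⟩

/-- Values increase along the list, so no element of it lies strictly between `X` and its successor.
This gap property decides membership when a traversal stops. -/
theorem Linked.le_or_next_le (hm : WF V m) {X Y : Obj} (hX : Linked m X) (hY : Linked m Y) :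
    rank V Y < rank V X ∨ Y = X ∨ (X ≠ .tail ∧ rank V (m X).next ≤ rank V Y) := by
  rcases hX.comparable hY with h | h
  · rcases Relation.ReflTransGen.cases_head h with h | ⟨Z, ⟨ht, rfl⟩, h2⟩
    · exact Or.inr (Or.inl h.symm)
    · exact Or.inr (Or.inr ⟨ht, (rank_le_of_path hm (hm.made_next (hX.made hm)) h2).2⟩)
  · rcases Relation.ReflTransGen.cases_head h with h | ⟨Z, ⟨ht, rfl⟩, h2⟩
    · exact Or.inr (Or.inl h)
    · left
      exact (hm.cell Y ht (hY.made hm)).2.2.trans_le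
        (rank_le_of_path hm (hm.made_next (hY.made hm)) h2).2

/-- Of two distinct elements, one comes later in the list, hence not before the successor of the
other; a common successor would be larger than itself. -/
theorem Linked.pred_unique (hm : WF V m) {X Y : Obj}
    (hX : Linked m X) (hY : Linked m Y) (hXt : X ≠ .tail) (hYt : Y ≠ .tail)
    (h : (m X).next = (m Y).next) : X = Y := by
  have hXr := (hm.cell X hXt (hX.made hm)).2.2
  have hYr := (hm.cell Y hYt (hY.made hm)).2.2
  rcases hX.le_or_next_le hm hY with h1 | h1 | ⟨_, h1⟩
  · rcases hY.le_or_next_le hm hX with h2 | h2 | ⟨_, h2⟩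
    · exact absurd h1 h2.asymm
    · exact h2
    · rw [← h] at h2; exact absurd hXr h2.not_gt
  · exact h1.symm
  · rw [h] at h1; exact absurd hYr h1.not_gt

/-- Only the contents of the elements of the list matter. Each direction walks along the list from
the head in one of the two memories. -/
theorem linked_congr (h : ∀ X, Linked m X → m' X = m X) (Z : Obj) :
    Linked m' Z ↔ Linked m Z := by
  constructor
  · intro hZ
    refine hZ.induction (Linked.head m) (fun X _ ht hX => ?_)
    rw [h X hX]
    exact hX.next ht
  · intro hZ
    refine hZ.induction (Linked.head m') (fun X hX ht hX' => ?_)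
    rw [← h X hX]
    exact hX'.next ht

/-- The paths in the new memory are the old ones with a detour through the new node between `prev`
and its former successor. -/
theorem linked_insert {prev : Obj} (hp : Linked m prev)
    (hpt : prev ≠ .tail) (h : ∀ X, Linked m X → X ≠ prev → m' X = m X)
    (h1 : (m' prev).next = .node a) (h2 : (m' (.node a)).next = (m prev).next) (Z : Obj) :
    Linked m' Z ↔ Linked m Z ∨ Z = .node a := by
  have back : ∀ Z, Linked m Z → Linked m' Z := by
    intro Z hZ
    refine hZ.induction (Linked.head m') (fun X hX ht hX' => ?_)
    by_cases hXp : X = prev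
    · subst hXp
      rw [← h2]
      refine Linked.next ?_ (by simp)
      rw [← h1]
      exact hX'.next ht
    · rw [← h X hX hXp]
      exact hX'.next ht
  constructor
  · intro hZ
    refine hZ.induction (P := fun Z => Linked m Z ∨ Z = .node a) (Or.inl (Linked.head m)) (fun X _ ht hX => ?_)
    rcases hX with hX | rfl
    · by_cases hXp : X = prev
      · subst hXp; exact Or.inr h1
      · rw [h X hX hXp]; exact Or.inl (hX.next ht)
    · rw [h2]; exact Or.inl (hp.next hpt)
  · rintro (hZ | rfl)
    · exact back Z hZ
    · rw [← h1]; exact (back prev hp).next hpt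

/-- The paths in the new memory jump from `prev` over its former successor, and by
`Linked.pred_unique` no other element of the list leads to it. -/
theorem linked_remove (hm : WF V m) {prev : Obj}
    (hp : Linked m prev) (hpt : prev ≠ .tail) (hct : (m prev).next ≠ .tail)
    (h : ∀ X, Linked m X → X ≠ prev → m' X = m X)
    (h1 : (m' prev).next = (m (m prev).next).next) (Z : Obj) :
    Linked m' Z ↔ Linked m Z ∧ Z ≠ (m prev).next := by
  have hpr := (hm.cell prev hpt (hp.made hm)).2.2
  have hcur := hp.next hpt
  have hcr := (hm.cell _ hct (hcur.made hm)).2.2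
  constructor
  · intro hZ
    refine hZ.induction (P := fun Z => Linked m Z ∧ Z ≠ (m prev).next)
      ⟨Linked.head m, (ne_head_of_rank_lt hpr).symm⟩ (fun X _ ht hX => ?_)
    obtain ⟨hX, hne⟩ := hX
    by_cases hXp : X = prev
    · subst hXp
      rw [h1]
      exact ⟨hcur.next hct, fun he => by rw [he] at hcr; exact lt_irrefl _ hcr⟩
    · rw [h X hX hXp]
      exact ⟨hX.next ht, fun he => hXp (hX.pred_unique hm hp ht hpt he)⟩
  · rintro ⟨hZ, hne⟩
    -- An induction along the old list passes through the removed element, which is not linked any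
    -- more; what is carried over it is that its successor is linked.
    have key : ∀ Z, Linked m Z → (Z ≠ (m prev).next → Linked m' Z) ∧
        (Z = (m prev).next → Linked m' (m Z).next) := by
      intro Z hZ
      refine hZ.induction (P := fun Z => (Z ≠ (m prev).next → Linked m' Z) ∧
        (Z = (m prev).next → Linked m' (m Z).next)) ⟨fun _ => Linked.head m', fun he => ?_⟩
        (fun X hX ht ih => ?_)
      · exact absurd he (ne_head_of_rank_lt hpr).symm
      · by_cases hXc : X = (m prev).next
        · refine ⟨fun _ => ih.2 hXc, fun he => ?_⟩
          have := (hm.cell X ht (hX.made hm)).2.2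
          rw [he, hXc] at this
          exact absurd this (lt_irrefl _)
        · have hX' := ih.1 hXc
          by_cases hXp : X = prev
          · subst hXp
            refine ⟨fun hn => absurd rfl hn, fun _ => ?_⟩
            rw [← h1]
            exact hX'.next ht
          · refine ⟨fun _ => ?_, fun he => absurd (hX.pred_unique hm hp ht hpt he) hXp⟩
            rw [← h X hX hXp]
            exact hX'.next ht
    exact (key Z hZ).1 hne

/-! ### The represented set -/

/-- The list in memory `m` represents the set `q`. -/
def Abs (V : ℕ → ℤ) (m : Obj → Cell) (q : Finset ℤ) : Prop :=
  ∀ v, v ∈ q ↔ ∃ b, Linked m (.node b) ∧ V b = v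

theorem Abs.unique {q q' : Finset ℤ} (h : Abs V m q) (h' : Abs V m q') : q = q' := by
  ext v
  rw [h v, h' v]

theorem Abs.congr {q : Finset ℤ} (h : Abs V m q)
    (hl : ∀ Z, Linked m' Z ↔ Linked m Z) : Abs V m' q := by
  intro v
  simp only [hl]
  exact h v

theorem linked_initMem (h : Linked initMem X) : X = .head ∨ X = .tail := by
  refine h.induction (P := fun X => X = .head ∨ X = .tail) (Or.inl rfl) (fun X _ ht hX => ?_)
  rcases hX with rfl | rfl
  · exact Or.inr rfl
  · exact absurd rfl ht

theorem Abs.initMem (V : ℕ → ℤ) : Abs V initMem ∅ := by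
  intro v
  constructor
  · intro h; simp at h
  · rintro ⟨b, hb, _⟩
    rcases linked_initMem hb with h | h <;> cases h

/-- The traversal of `op` has passed the element `prev`. -/
structure Passed (m : Obj → Cell) (op : SetOp) (prev : Obj) : Prop where
  linked : Linked m prev
  ne_tail : prev ≠ .tail
  lt : (m prev).val < key op

/-- In the sorted list `Z` comes after `prev`, whose value is below the key, and not after the
successor of `prev`, whose value is not below the key. -/
theorem Passed.eq_next (hm : WF V m) {prev Z : Obj}
    (h : Passed m op prev) (hc : ¬ (m (m prev).next).val < key op) (hZ : Linked m Z)
    (hv : rank V Z = key op) : Z = (m prev).next := by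
  have hn := h.linked.next h.ne_tail
  rw [hm.val (hn.made hm)] at hc
  have hp := h.lt
  rw [hm.val (h.linked.made hm), ← hv] at hp
  rcases h.linked.le_or_next_le hm hZ with h1 | h1 | ⟨_, h1⟩
  · exact absurd h1 hp.asymm
  · rw [h1] at hp; exact absurd hp (lt_irrefl _)
  · rcases hn.le_or_next_le hm hZ with h2 | h2 | ⟨ht, h2⟩
    · exact absurd h2 h1.not_gt
    · exact h2
    · have h3 := (hm.cell _ ht (hn.made hm)).2.2
      rw [← hv] at hc
      exact absurd (h3.trans_le h2) hc

/-- The place where a traversal stops decides membership: by `Passed.eq_next` the key can only be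
found in the successor of `prev`. -/
theorem Passed.mem_iff (hm : WF V m) {prev : Obj}
    (h : Passed m op prev) (hc : ¬ (m (m prev).next).val < key op) {q : Finset ℤ}
    (hq : Abs V m q) : op.arg ∈ q ↔ (m (m prev).next).val = key op := by
  have hn := h.linked.next h.ne_tail
  rw [hq, hm.val (hn.made hm)]
  constructor
  · rintro ⟨b, hb, hv⟩
    have hr : rank V (.node b) = key op := by rw [key_eq, ← hv]; rfl
    rw [← h.eq_next hm hc hb hr, hr]
  · intro hr
    obtain ⟨b, hb, hv⟩ := rank_eq_keyVal hr
    rw [hb] at hn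
    exact ⟨b, hn, hv⟩

/-! ### Operations run on a memory -/

/-- Effect on the memory `m`, turning it into `m'`, of the operation `op` with identifier `a`
and response `r`. -/
structure Effect (V : ℕ → ℤ) (op : SetOp) (a : ℕ) (r : Bool) (m m' : Obj → Cell) : Prop where
  wf : WF V m'
  linked : ∀ Z, Linked m' Z → Linked m Z ∨ Z = .node a
  made : ∀ b, Made m' (.node b) → Made m (.node b) ∨ b = a
  delta : ∀ q, Abs V m q → ∃ q', Abs V m' q' ∧ SetDelta q op q' r

def SetOp.IsInsert (op : SetOp) : Prop := ∃ v, op = .insert v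
def SetOp.IsRemove (op : SetOp) : Prop := ∃ v, op = .remove v

/-- Control points of the operation `op` when its steps so far turned `m` into `m'`. -/
def LocOK (V : ℕ → ℤ) (op : SetOp) (a : ℕ) (l : Loc) (m m' : Obj → Cell) : Prop :=
  match l with
  | .start => m' = m
  | .traverse prev pcell curr =>
      m' = m ∧ Passed m op prev ∧ pcell = m prev ∧ curr = (m prev).next
  | .create prev pcell new c =>
      m' = m ∧ op.IsInsert ∧ Passed m op prev ∧ pcell = m prev ∧
      key op < (m (m prev).next).val ∧ new = .node a ∧ c = ⟨key op, (m prev).next⟩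
  | .update prev c =>
      Passed m op prev ∧
      ((op.IsInsert ∧ key op < (m (m prev).next).val ∧
          m' = Function.update m (.node a) ⟨key op, (m prev).next⟩ ∧
          c = ⟨(m prev).val, .node a⟩) ∨
        (op.IsRemove ∧ (m (m prev).next).val = key op ∧ m' = m ∧
          c = ⟨(m prev).val, (m (m prev).next).next⟩))
  | .done r => Effect V op a r m m'

theorem Effect.readOnly {r : Bool}
    (hm : WF V m) (h : ∀ q, Abs V m q → SetDelta q op q r) : Effect V op a r m m :=
  ⟨hm, fun _ h => Or.inl h, fun _ h => Or.inl h, fun q hq => ⟨q, hq, h q hq⟩⟩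

/-- Reads come before the writes of the same operation, so the memory is still `m`. Where the
traversal ends without a write, `Passed.mem_iff` shows that the response is the one of `set`. -/
theorem LocOK.read (hm : WF V m) (h : LocOK V op a l m m') (hl : l.cmd = .read X) :
    m' = m ∧ Linked m X ∧ LocOK V op a (l.afterRead op a (m X)) m m' := by
  cases l with
  | start =>
    cases hl
    refine ⟨h, Linked.head m, h, ⟨Linked.head m, by simp, ?_⟩, rfl, rfl⟩
    rw [hm.head_val, key_eq]
    exact bot_lt_keyVal _
  | traverse prev pcell curr =>
    cases hl
    obtain ⟨rfl, hp, rfl, rfl⟩ := h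
    have hn := hp.linked.next hp.ne_tail
    refine ⟨rfl, hn, ?_⟩
    by_cases hlt : (m' (m' prev).next).val < key op
    · simp only [Loc.afterRead, if_pos hlt]
      refine ⟨rfl, ⟨hn, ?_, hlt⟩, rfl, rfl⟩
      intro ht
      rw [ht, hm.tail_eq] at hlt
      exact not_top_lt hlt
    · have hmem := fun q hq => hp.mem_iff hm hlt (q := q) hq
      cases op with
      | contains v =>
        simp only [Loc.afterRead, if_neg hlt]
        refine Effect.readOnly hm (fun q hq => ⟨rfl, ?_⟩)
        have := hmem q hq
        simp only [SetOp.arg] at this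
        simp [this]
      | insert v =>
        simp only [Loc.afterRead, if_neg hlt]
        by_cases he : (m' (m' prev).next).val = key (.insert v)
        · rw [if_pos he]
          refine Effect.readOnly hm (fun q hq => ?_)
          have : v ∈ q := (hmem q hq).2 he
          simp [SetDelta, this]
        · rw [if_neg he]
          exact ⟨rfl, ⟨v, rfl⟩, hp, rfl, lt_of_le_of_ne (not_lt.1 hlt) (Ne.symm he), rfl, rfl⟩
      | remove v =>
        simp only [Loc.afterRead, if_neg hlt]
        by_cases he : (m' (m' prev).next).val = key (.remove v)
        · rw [if_pos he]
          exact ⟨hp, Or.inr ⟨⟨v, rfl⟩, he, rfl, rfl⟩⟩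
        · rw [if_neg he]
          refine Effect.readOnly hm (fun q hq => ?_)
          have : v ∉ q := fun hv => he ((hmem q hq).1 hv)
          simp [SetDelta, this]
  | create => cases hl
  | update => cases hl
  | done => cases hl

theorem WF.update_node {prev : Obj} (hm : WF V m) (hV : V a = op.arg) (hp : Passed m op prev)
    (hk : key op < (m (m prev).next).val) :
    WF V (Function.update m (.node a) ⟨key op, (m prev).next⟩) := by
  have hn := (hp.linked.next hp.ne_tail).made hm
  have hv : (⟨key op, (m prev).next⟩ : Cell).val = rank V (.node a) := by
    rw [key_eq, ← hV]; rfl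
  refine hm.update (by simp) ⟨hv, by simp, fun _ => ?_⟩ (hn.update (by simp) hv)
  rw [← hv]
  rwa [hm.val hn] at hk

/-- Elements of the list are made, so the new node is not one of them and nobody sees the write. -/
theorem linked_update_node {c : Cell} (hm : WF V m) (ha : ¬ Made m (.node a)) (Z : Obj) :
    Linked (Function.update m (.node a) c) Z ↔ Linked m Z := by
  refine linked_congr (fun X hX => Function.update_of_ne ?_ _ _) Z
  rintro rfl
  exact ha (hX.made hm)

theorem Made.of_update {X Y : Obj} {c : Cell}
    (h : Made (Function.update m X c) Y) : Made m Y ∨ Y = X := by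
  by_cases hYX : Y = X
  · exact Or.inr hYX
  · left
    rcases h with h | h
    · exact Or.inl h
    · right; rwa [Function.update_of_ne hYX] at h

/-- The write to the new node leaves the list alone. The write to the predecessor links or unlinks
one element, by `linked_insert` or `linked_remove`, and this is the effect of the operation on the
set. -/
theorem LocOK.write {c : Cell} (hm : WF V m) (ha : ¬ Made m (.node a)) (hV : V a = op.arg)
    (h : LocOK V op a l m m') (hl : l.cmd = .write X c) :
    LocOK V op a l.afterWrite m (Function.update m' X c) := by
  cases l with
  | start => cases hl
  | traverse => cases hl
  | done => cases hl
  | create prev pcell new c' =>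
    cases hl
    obtain ⟨rfl, hi, hp, rfl, hk, rfl, rfl⟩ := h
    exact ⟨hp, Or.inl ⟨hi, hk, rfl, rfl⟩⟩
  | update prev c' =>
    cases hl
    obtain ⟨hp, h⟩ := h
    have hpm := hp.linked.made hm
    have hn := hp.linked.next hp.ne_tail
    have hne : X ≠ .node a := by rintro rfl; exact ha hpm
    rcases h with ⟨⟨v, rfl⟩, hk, rfl, rfl⟩ | ⟨⟨v, rfl⟩, hk, rfl, rfl⟩
    · have hwf := hm.update_node hV hp hk
      have hma : Made (Function.update m (Obj.node a) ⟨key (.insert v), (m X).next⟩) (.node a) := by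
        right; rw [Function.update_self]; exact keyVal_ne_top _
      have hlink : ∀ Z, Linked (Function.update (Function.update m (Obj.node a)
          ⟨key (.insert v), (m X).next⟩) X ⟨(m X).val, .node a⟩) Z ↔ Linked m Z ∨ Z = .node a := by
        refine linked_insert hp.linked hp.ne_tail (fun Y hY hYp => ?_) ?_ ?_
        · rw [Function.update_of_ne hYp, Function.update_of_ne]
          rintro rfl; exact ha (hY.made hm)
        · rw [Function.update_self]
        · rw [Function.update_of_ne (Ne.symm hne), Function.update_self]
      refine ⟨?_, fun Z hZ => (hlink Z).1 hZ, fun b hb => ?_, fun q hq => ⟨insert v q, ?_, rfl, ?_⟩⟩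
      · refine hwf.update hp.ne_tail ⟨hm.val hpm, fun ht => absurd ht hp.ne_tail, fun _ => ?_⟩
          (hma.update hp.ne_tail (hm.val hpm))
        rw [← hm.val hpm]
        have := hp.lt
        rw [key_eq, ← hV] at this
        exact this
      · rcases hb.of_update with hb | hb
        · rcases hb.of_update with hb | hb
          · exact Or.inl hb
          · cases hb; exact Or.inr rfl
        · left; rw [hb]; exact hpm
      · intro w
        rw [Finset.mem_insert, hq w]
        constructor
        · rintro (rfl | ⟨b, hb, hbw⟩)
          · exact ⟨a, (hlink _).2 (Or.inr rfl), hV⟩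
          · exact ⟨b, (hlink _).2 (Or.inl hb), hbw⟩
        · rintro ⟨b, hb, hbw⟩
          rcases (hlink _).1 hb with hb | hb
          · exact Or.inr ⟨b, hb, hbw⟩
          · cases hb; exact Or.inl (hbw.symm.trans hV)
      · have hv : v ∉ q := fun hv => hk.ne' ((hp.mem_iff hm hk.not_gt hq).1 hv)
        simp [hv]
    · have hct : (m' (m' X).next).val ≠ ⊤ := by rw [hk]; exact keyVal_ne_top _
      have hct' : (m' X).next ≠ .tail := by
        intro ht; rw [ht, hm.tail_eq] at hct; exact hct rfl
      have hlink : ∀ Z, Linked (Function.update m' X ⟨(m' X).val, (m' (m' X).next).next⟩) Z ↔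
          Linked m' Z ∧ Z ≠ (m' X).next := by
        refine linked_remove hm hp.linked hp.ne_tail hct' (fun Y hY hYp => ?_) ?_
        · rw [Function.update_of_ne hYp]
        · rw [Function.update_self]
      have hmc := hm.cell X hp.ne_tail hpm
      have hmcc := hm.cell _ hct' (hn.made hm)
      refine ⟨?_, fun Z hZ => Or.inl ((hlink Z).1 hZ).1, fun b hb => ?_,
        fun q hq => ⟨q.erase v, ?_, rfl, ?_⟩⟩
      · exact hm.update hp.ne_tail ⟨hmc.1, fun ht => absurd ht hp.ne_tail,
          fun _ => hmc.2.2.trans hmcc.2.2⟩ (hmcc.2.1.update hp.ne_tail hmc.1)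
      · rcases hb.of_update with hb | hb
        · exact Or.inl hb
        · left; rw [hb]; exact hpm
      · have hcv : rank V (m' X).next = keyVal v := (hm.val (hn.made hm)).symm.trans hk
        intro w
        rw [Finset.mem_erase, hq w]
        constructor
        · rintro ⟨hwv, b, hb, hbw⟩
          refine ⟨b, (hlink _).2 ⟨hb, fun he => hwv ?_⟩, hbw⟩
          rw [← he] at hcv
          exact hbw.symm.trans (keyVal_inj.1 hcv)
        · rintro ⟨b, hb, hbw⟩
          obtain ⟨hb, hne'⟩ := (hlink _).1 hb
          refine ⟨fun hwv => hne' ?_, b, hb, hbw⟩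
          refine hp.eq_next hm (by rw [hk]; exact lt_irrefl _) hb ?_
          show keyVal (V b) = keyVal v
          rw [hbw, hwv]
      · have hv : v ∈ q := (hp.mem_iff hm (by rw [hk]; exact lt_irrefl _) hq).2 hk
        simp [hv]

/-! ### Runs of single operations -/

/-- Status of an operation. -/
inductive Stat
  | ready (l : Loc)
  | busy (l : Loc)
  | fin (r : Bool)
  | aborted

noncomputable def Stat.after (op : SetOp) (a : ℕ) (l : Loc) (c : Cell) : Stat :=
  match l.cmd with
  | .read _ => .ready (l.afterRead op a c)
  | .write _ _ => .ready l.afterWrite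
  | .ret r => .fin r

def Stat.Pending : Stat → Prop
  | .ready _ => True
  | .busy _ => True
  | _ => False

/-- The phase of a process whose last operation has the given status. -/
def Stat.phase (op : SetOp) (a : ℕ) : Stat → Phase
  | .ready l => .ready op a l
  | .busy l => .busy op a l
  | _ => .idle

def Phase.oid : Phase → Option ℕ
  | .idle => none
  | .ready _ a _ => some a
  | .busy _ a _ => some a

theorem Phase.after_eq (op : SetOp) (a : ℕ) (l : Loc) (c : Cell) :
    Phase.after op a l c = (Stat.after op a l c).phase op a := by
  cases l <;> rfl

theorem Stat.oid_phase : (s.phase op a).oid = some b ↔ s.Pending ∧ a = b := by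
  cases s <;> simp [Stat.phase, Phase.oid, Stat.Pending]

theorem Stat.phase_ne_idle :
    s.phase op a ≠ .idle ↔ s.Pending := by
  cases s <;> simp [Stat.phase, Stat.Pending]

/-- One event of the operation `op` with identifier `a`. -/
inductive OpStep (op : SetOp) (a : ℕ) : Stat → Act → Stat → Prop
  | call (l : Loc) : OpStep op a (.ready l) l.cmd.start (.busy l)
  | step (l : Loc) : OpStep op a (.busy l) .step (.busy l)
  | ret (l : Loc) (c : Cell) : OpStep op a (.busy l) (l.cmd.finish c) (Stat.after op a l c)
  | abort (l : Loc) : OpStep op a (.busy l) .abort .aborted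

/-- No memory occurs here: the values returned by reads are arbitrary, and legality is imposed
separately by `LegalFrom`. -/
inductive OpRun (op : SetOp) (a : ℕ) : Stat → List Act → Stat → Prop
  | nil (s : Stat) : OpRun op a s [] s
  | cons {s s' s'' : Stat} {x : Act} {xs : List Act} :
      OpStep op a s x s' → OpRun op a s' xs s'' → OpRun op a s (x :: xs) s''

theorem OpRun.append {s s' s'' : Stat} {xs ys : List Act}
    (h : OpRun op a s xs s') (h' : OpRun op a s' ys s'') : OpRun op a s (xs ++ ys) s'' := by
  induction h with
  | nil => exact h'
  | cons h1 _ ih => exact .cons h1 (ih h')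

theorem OpRun.snoc {s s' s'' : Stat} {x : Act}
    (h : OpRun op a s xs s') (h' : OpStep op a s' x s'') : OpRun op a s (xs ++ [x]) s'' :=
  h.append (.cons h' (.nil _))

theorem OpStep.pending {x : Act} (h : OpStep op a s x s') :
    s.Pending := by
  cases h <;> trivial

theorem OpRun.nil_of_not_pending
    (h : OpRun op a s xs s') (hs : ¬ s.Pending) : xs = [] ∧ s' = s := by
  cases h with
  | nil => exact ⟨rfl, rfl⟩
  | cons h1 _ => exact absurd h1.pending hs

theorem Cmd.finish_eq_resOp {k : Cmd} {c : Cell} {r : Bool} (h : k.finish c = .resOp r) :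
    k = .ret r := by
  cases k <;> simp_all [Cmd.finish]

theorem Loc.cmd_eq_ret {r : Bool} (h : l.cmd = .ret r) : l = .done r := by
  cases l <;> simp_all [Loc.cmd]

theorem Stat.after_ret {c : Cell} {r : Bool} (h : l.cmd = .ret r) :
    Stat.after op a l c = .fin r := by
  simp [Stat.after, h]

theorem OpRun.resOp_mem {r : Bool} (h : OpRun op a s xs s') (hr : .resOp r ∈ xs) : s' = .fin r := by
  induction h with
  | nil => simp at hr
  | cons h1 h2 ih =>
    rcases List.mem_cons.1 hr with hr | hr
    · cases h1 with
      | call l => cases l <;> cases hr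
      | step l => cases hr
      | abort l => cases hr
      | ret l c =>
        rw [Stat.after_ret (Cmd.finish_eq_resOp hr.symm)] at h2
        exact (h2.nil_of_not_pending (by simp [Stat.Pending])).2
    · exact ih hr

theorem OpRun.abort_mem (h : OpRun op a s xs s') (hr : .abort ∈ xs) : s' = .aborted := by
  induction h with
  | nil => simp at hr
  | cons h1 h2 ih =>
    rcases List.mem_cons.1 hr with hr | hr
    · cases h1 with
      | call l => cases l <;> cases hr
      | step l => cases hr
      | abort l => exact (h2.nil_of_not_pending (by simp [Stat.Pending])).2
      | ret l c => cases l <;> cases hr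
    · exact ih hr

theorem OpRun.mem_of_fin {r : Bool}
    (h : OpRun op a s xs s') (hs : s.Pending) (hr : s' = .fin r) : .resOp r ∈ xs := by
  induction h with
  | nil s => subst hr; simp [Stat.Pending] at hs
  | @cons s s1 s2 x xs h1 h2 ih =>
    by_cases hp : s1.Pending
    · exact List.mem_cons_of_mem _ (ih hp hr)
    · have hs1 : s1 = .fin r := (h2.nil_of_not_pending hp).2.symm.trans hr
      cases h1 with
      | ret l c => cases l <;> simp_all [Stat.after, Loc.cmd, Cmd.finish]
      | _ => simp_all

theorem OpRun.mem_of_aborted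
    (h : OpRun op a s xs s') (hs : s.Pending) (hr : s' = .aborted) : .abort ∈ xs := by
  induction h with
  | nil s => subst hr; simp [Stat.Pending] at hs
  | @cons s s1 s2 x xs h1 h2 ih =>
    by_cases hp : s1.Pending
    · exact List.mem_cons_of_mem _ (ih hp hr)
    · have hs1 : s1 = .aborted := (h2.nil_of_not_pending hp).2.symm.trans hr
      cases h1 with
      | abort l => simp
      | ret l c => cases l <;> simp_all [Stat.after, Loc.cmd]
      | _ => simp_all

theorem OpRun.no_invOp {op op' : SetOp} (h : OpRun op a s xs s') : Act.invOp op' ∉ xs := by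
  induction h with
  | nil => simp
  | cons h1 h2 ih =>
    intro hr
    rcases List.mem_cons.1 hr with hr | hr
    · cases h1 with
      | call l => cases l <;> cases hr
      | step l => cases hr
      | abort l => cases hr
      | ret l c => cases l <;> cases hr
    · exact ih hr

/-- The operation has passed its last read and write. -/
def Stat.Completing : Stat → Prop
  | .busy (.done _) => True
  | .fin _ => True
  | .aborted => True
  | _ => False

/-- The disjunction in the hypothesis makes the induction work: an operation that is completing
never goes back to reading or writing. -/
theorem OpRun.startCommit_mem
    (h : OpRun op a s xs s') (hr : .startCommit ∈ xs ∨ s.Completing) : s'.Completing := by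
  induction h with
  | nil => simpa using hr
  | @cons s s1 s2 x xs h1 h2 ih =>
    refine ih ?_
    rcases hr with hr | hr
    · rcases List.mem_cons.1 hr with hr | hr
      · right
        cases h1 with
        | call l =>
          cases l with
          | done r => trivial
          | _ => cases hr
        | step l => cases hr
        | abort l => cases hr
        | ret l c => cases l <;> cases hr
      · exact Or.inl hr
    · right
      cases h1 with
      | call l => simp [Stat.Completing] at hr
      | step l => exact hr
      | abort l => trivial
      | ret l c => cases l <;> simp_all [Stat.Completing, Stat.after, Loc.cmd]

theorem OpRun.startCommit_of_done {r : Bool}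
    (h : OpRun op a s xs s') (hs : s ≠ .busy (.done r)) (hs' : s' = .busy (.done r)) :
    .startCommit ∈ xs := by
  induction h with
  | nil => exact absurd hs' hs
  | @cons s s1 s2 x xs h1 h2 ih =>
    by_cases he : s1 = .busy (.done r)
    · subst he
      generalize hg : Stat.busy (.done r) = g at h1
      cases h1 with
      | call l => cases hg; simp [Loc.cmd, Cmd.start]
      | step l => cases hg; exact absurd rfl hs
      | abort l => cases hg
      | ret l c => cases l <;> simp_all [Stat.after, Loc.cmd]
    · exact List.mem_cons_of_mem _ (ih he hs')

/-! ### Memory after a sequence of events, and legality -/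

def actMem (m : Obj → Cell) : Act → (Obj → Cell)
  | .resWrite X c => Function.update m X c
  | _ => m

/-- Recursive form of `Legal`, from an arbitrary initial memory and without processes and
identifiers; see `legal_iff`. -/
def LegalFrom : (Obj → Cell) → List Act → Prop
  | _, [] => True
  | m, x :: xs => (∀ X c, x = .resRead X c → c = m X) ∧ LegalFrom (actMem m x) xs

theorem LegalFrom.append {xs ys : List Act} :
    LegalFrom m (xs ++ ys) ↔ LegalFrom m xs ∧ LegalFrom (xs.foldl actMem m) ys := by
  induction xs generalizing m with
  | nil => simp [LegalFrom]
  | cons x xs ih => simp [LegalFrom, ih, and_assoc]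

theorem foldl_memAfter (m : Obj → Cell) (t : List (Event n)) :
    t.foldl (fun m e => match e.act with
      | .resWrite X c => Function.update m X c
      | _ => m) m = (t.map Event.act).foldl actMem m := by
  induction t generalizing m with
  | nil => rfl
  | cons e t ih =>
    simp only [List.foldl_cons, List.map_cons]
    rw [ih]
    congr 1

theorem memAfter_eq (t : List (Event n)) :
    memAfter t = (t.map Event.act).foldl actMem initMem := foldl_memAfter _ t

theorem legal_iff (t : List (Event n)) : Legal t ↔ LegalFrom initMem (t.map Event.act) := by
  unfold Legal
  simp only [memAfter_eq]
  constructor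
  · intro h
    induction t using List.reverseRecOn with
    | nil => trivial
    | append_singleton t e ih =>
      rw [List.map_append, LegalFrom.append]
      refine ⟨ih (fun t₁ t₂ e' X c ht => h t₁ (t₂ ++ [e]) e' X c (by simp [ht])), ?_, trivial⟩
      intro X c hx
      exact h t [] e X c rfl hx
  · rintro h t₁ t₂ e X c rfl hx
    rw [List.map_append, LegalFrom.append] at h
    exact h.2.1 X c hx

/-! ### Events of the operations of an execution -/

/-- The events of the operation `a`, without its process and its identifier. -/
def acts (t : List (Event n)) (a : ℕ) : List Act := (opEvents t a).map Event.act

theorem opEvents_append (t u : List (Event n)) (a : ℕ) :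
    opEvents (t ++ u) a = opEvents t a ++ opEvents u a := by
  simp [opEvents]

theorem acts_append (t u : List (Event n)) (a : ℕ) : acts (t ++ u) a = acts t a ++ acts u a := by
  simp [acts, opEvents_append]

theorem acts_singleton_self (e : Event n) : acts [e] e.oid = [e.act] := by
  simp [acts, opEvents]

theorem acts_singleton_ne (h : e.oid ≠ a) : acts [e] a = [] := by
  simp [acts, opEvents, h]

theorem mem_acts {x : Act} :
    x ∈ acts t a ↔ ∃ e ∈ t, e.oid = a ∧ e.act = x := by
  simp [acts, opEvents, and_assoc]

theorem acts_eq_nil : acts t a = [] ↔ ¬ Appears t a := by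
  simp [acts, opEvents, Appears]

theorem responded_iff {r : Bool} :
    Responded t a r ↔ .resOp r ∈ acts t a := mem_acts.symm

theorem aborted_iff : Aborted t a ↔ .abort ∈ acts t a := mem_acts.symm

theorem invoked_iff :
    Invoked t a op ↔ .invOp op ∈ acts t a := mem_acts.symm

theorem Invoked.appears (h : Invoked t a op) :
    Appears t a := by
  obtain ⟨e, he, h, _⟩ := h
  exact ⟨e, he, h⟩

theorem Committed.appears (h : Committed t a) : Appears t a := by
  obtain ⟨r, e, he, h, _⟩ := h
  exact ⟨e, he, h⟩

/-- A step is an invocation or an event of a pending operation. -/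
theorem Step.cases_stat (h : Step I c e c') :
    (∃ op, c.phase e.proc = .idle ∧ e.oid ∉ c.used ∧ e.act = .invOp op ∧
      c'.phase = Function.update c.phase e.proc (.ready op e.oid .start) ∧
      c'.used = insert e.oid c.used) ∨
    ∃ op s s', c.phase e.proc = Stat.phase op e.oid s ∧ s.Pending ∧ OpStep op e.oid s e.act s' ∧
      c'.phase = Function.update c.phase e.proc (Stat.phase op e.oid s') ∧ c'.used = c.used := by
  cases h with
  | invoke p op a hp ha => exact Or.inl ⟨op, hp, ha, rfl, rfl, rfl⟩
  | call p op a l hp => exact Or.inr ⟨op, .ready l, .busy l, hp, trivial, .call l, rfl, rfl⟩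
  | prim p op a l b f hp hn =>
    refine Or.inr ⟨op, .busy l, .busy l, hp, trivial, .step l, ?_, rfl⟩
    have : Stat.phase op a (.busy l) = c.phase p := hp.symm
    simp [this]
  | ret p op a l v hp hn =>
    refine Or.inr ⟨op, .busy l, _, hp, trivial, .ret l v, ?_, rfl⟩
    simp [Phase.after_eq]
  | abort p op a l hp hn =>
    exact Or.inr ⟨op, .busy l, .aborted, hp, trivial, .abort l, rfl, rfl⟩

/-- The operation `a` was invoked by `p` as `op`, and its status is `s`. -/
structure OpState (t : List (Event n)) (c : Config I) (a : ℕ) (p : Fin n) (op : SetOp)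
    (s : Stat) : Prop where
  proc : ∀ e ∈ t, e.oid = a → e.proc = p
  run : ∃ xs, acts t a = .invOp op :: xs ∧ OpRun op a (.ready .start) xs s
  phase : s.Pending → c.phase p = Stat.phase op a s
  only : ∀ q, (c.phase q).oid = some a → q = p ∧ s.Pending

/-- Bookkeeping valid for every implementation: identifiers are not reused, and the events of an
operation, all by one process, form a run of the sequential code whose status agrees with the phase
of that process. -/
structure TraceInv (t : List (Event n)) (c : Config I) : Prop where
  used : ∀ a, a ∈ c.used ↔ Appears t a
  pending : ∀ p a, (c.phase p).oid = some a → a ∈ c.used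
  state : ∀ a, Appears t a → ∃ p op s, OpState t c a p op s

theorem appears_snoc :
    Appears (t ++ [e]) a ↔ Appears t a ∨ e.oid = a := by
  simp [Appears, or_and_right, exists_or]

theorem OpState.snoc_of_ne
 (h : OpState t c a p op s) (hne : e.oid ≠ a)
    {ph : Phase} (hph : c'.phase = Function.update c.phase e.proc ph) (hph' : ph.oid ≠ some a)
    (hold : (c.phase e.proc).oid ≠ some a) : OpState (t ++ [e]) c' a p op s := by
  refine ⟨?_, ?_, fun hs => ?_, fun q hq => ?_⟩
  · intro e' he' ha
    rcases List.mem_append.1 he' with he' | he'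
    · exact h.proc e' he' ha
    · rw [List.mem_singleton.1 he'] at ha
      exact absurd ha hne
  · rw [acts_append, acts_singleton_ne hne, List.append_nil]
    exact h.run
  · rw [hph, Function.update_of_ne, h.phase hs]
    rintro rfl
    rw [h.phase hs] at hold
    exact hold (Stat.oid_phase.2 ⟨hs, rfl⟩)
  · rw [hph] at hq
    by_cases hqp : q = e.proc
    · subst hqp
      rw [Function.update_self] at hq
      exact absurd hq hph'
    · rw [Function.update_of_ne hqp] at hq
      exact h.only q hq

theorem Reach.traceInv (h : Reach I t c) : TraceInv t c := by
  induction h with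
  | nil =>
    refine ⟨?_, ?_, ?_⟩
    · intro a; simp [Config.initial, Appears]
    · intro p a h; simp [Config.initial, Phase.oid] at h
    · rintro a ⟨e, he, _⟩; simp at he
  | @snoc t c c' e h1 h2 ih =>
    rcases h2.cases_stat with ⟨op, hidle, hused, hact, hph, hus⟩ |
      ⟨op, s, s', hph0, hs, hstep, hph, hus⟩
    · refine ⟨?_, ?_, ?_⟩
      · intro a
        rw [hus, Finset.mem_insert, ih.used, appears_snoc, or_comm, eq_comm]
      · intro p a hp
        rw [hus, Finset.mem_insert]
        rw [hph] at hp
        by_cases hpe : p = e.proc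
        · subst hpe
          rw [Function.update_self] at hp
          left; simpa [Phase.oid] using hp.symm
        · rw [Function.update_of_ne hpe] at hp
          exact Or.inr (ih.pending p a hp)
      · intro a ha
        by_cases hne : e.oid = a
        · subst hne
          have hna : ¬ Appears t e.oid := fun h => hused ((ih.used _).2 h)
          refine ⟨e.proc, op, .ready .start, ?_, ?_, ?_, ?_⟩
          · intro e' he' ha'
            rcases List.mem_append.1 he' with he' | he'
            · exact absurd ⟨e', he', ha'⟩ hna
            · rw [List.mem_singleton.1 he']
          · refine ⟨[], ?_, .nil _⟩
            rw [acts_append, acts_singleton_self, acts_eq_nil.2 hna, hact]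
            rfl
          · intro _; rw [hph, Function.update_self]; rfl
          · intro q hq
            by_cases hqp : q = e.proc
            · exact ⟨hqp, trivial⟩
            · rw [hph, Function.update_of_ne hqp] at hq
              exact absurd (ih.pending q _ hq) hused
        · have ha' : Appears t a := (appears_snoc.1 ha).resolve_right hne
          obtain ⟨p, op', s, hst⟩ := ih.state a ha'
          refine ⟨p, op', s, hst.snoc_of_ne hne hph (by simpa [Phase.oid] using hne) ?_⟩
          rw [hidle]; simp [Phase.oid]
    · have hoid : (c.phase e.proc).oid = some e.oid := by
        rw [hph0]; exact Stat.oid_phase.2 ⟨hs, rfl⟩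
      have happ : Appears t e.oid := (ih.used _).1 (ih.pending _ _ hoid)
      refine ⟨?_, ?_, ?_⟩
      · intro a
        rw [hus, ih.used, appears_snoc]
        constructor
        · exact Or.inl
        · rintro (h | rfl)
          · exact h
          · exact happ
      · intro p a hp
        rw [hus]
        rw [hph] at hp
        by_cases hpe : p = e.proc
        · subst hpe
          rw [Function.update_self] at hp
          rw [← (Stat.oid_phase.1 hp).2]
          exact (ih.used _).2 happ
        · rw [Function.update_of_ne hpe] at hp
          exact ih.pending p a hp
      · intro a ha
        by_cases hne : e.oid = a
        · subst hne
          obtain ⟨p, op', s0, hst⟩ := ih.state e.oid happ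
          obtain ⟨rfl, hs0⟩ := hst.only _ hoid
          have hphs := hst.phase hs0
          rw [hph0] at hphs
          have hos : op = op' ∧ s = s0 := by
            cases s <;> cases s0 <;> simp_all [Stat.phase, Stat.Pending]
          obtain ⟨rfl, rfl⟩ := hos
          obtain ⟨xs, hxs, hrun⟩ := hst.run
          refine ⟨e.proc, op, s', ?_, ?_, ?_, ?_⟩
          · intro e' he' ha'
            rcases List.mem_append.1 he' with he' | he'
            · exact hst.proc e' he' ha'
            · rw [List.mem_singleton.1 he']
          · refine ⟨xs ++ [e.act], ?_, hrun.snoc hstep⟩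
            rw [acts_append, acts_singleton_self, hxs]
            rfl
          · intro _; rw [hph, Function.update_self]
          · intro q hq
            by_cases hqp : q = e.proc
            · subst hqp
              rw [hph, Function.update_self] at hq
              exact ⟨rfl, (Stat.oid_phase.1 hq).1⟩
            · rw [hph, Function.update_of_ne hqp] at hq
              exact absurd (hst.only q hq).1 hqp
        · have ha' : Appears t a := (appears_snoc.1 ha).resolve_right hne
          obtain ⟨p, op', s0, hst⟩ := ih.state a ha'
          refine ⟨p, op', s0, hst.snoc_of_ne hne hph ?_ ?_⟩
          · rw [Ne, Stat.oid_phase]; exact fun h => hne h.2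
          · rw [hoid]; simpa using hne

theorem OpState.invoked
 (h : OpState t c a p op s) : Invoked t a op := by
  obtain ⟨xs, hxs, _⟩ := h.run
  rw [invoked_iff, hxs]
  simp

theorem OpState.invoked_unique
    {op op' : SetOp} (h : OpState t c a p op s) (h' : Invoked t a op') : op' = op := by
  obtain ⟨xs, hxs, hr⟩ := h.run
  rw [invoked_iff, hxs, List.mem_cons] at h'
  rcases h' with h' | h'
  · cases h'; rfl
  · exact absurd h' hr.no_invOp

theorem OpState.responded
 (h : OpState t c a p op s) (r : Bool) :
    Responded t a r ↔ s = .fin r := by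
  obtain ⟨xs, hxs, hr⟩ := h.run
  rw [responded_iff, hxs]
  constructor
  · intro hm
    exact hr.resOp_mem (by simpa using hm)
  · intro hs
    exact List.mem_cons_of_mem _ (hr.mem_of_fin trivial hs)

theorem OpState.aborted
 (h : OpState t c a p op s) : Aborted t a ↔ s = .aborted := by
  obtain ⟨xs, hxs, hr⟩ := h.run
  rw [aborted_iff, hxs]
  constructor
  · intro hm
    exact hr.abort_mem (by simpa using hm)
  · intro hs
    exact List.mem_cons_of_mem _ (hr.mem_of_aborted trivial hs)

theorem OpState.commitPending
 (h : OpState t c a p op s) :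
    CommitPending t a ↔ ∃ r, s = .busy (.done r) := by
  obtain ⟨xs, hxs, hr⟩ := h.run
  unfold CommitPending Committed
  rw [h.aborted]
  simp only [h.responded]
  rw [← mem_acts, hxs]
  constructor
  · rintro ⟨h1, h2, h3⟩
    have := hr.startCommit_mem (Or.inl (by simpa using h1))
    match s, this with
    | .busy (.done r), _ => exact ⟨r, rfl⟩
    | .fin r, _ => exact absurd ⟨r, rfl⟩ h2
    | .aborted, _ => exact absurd rfl h3
  · rintro ⟨r, rfl⟩
    exact ⟨List.mem_cons_of_mem _ (hr.startCommit_of_done (by simp) rfl), by simp, by simp⟩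

/-- The parameters of the operations of an execution. -/
theorem Reach.exists_arg (h : Reach I t c) :
    ∃ V : ℕ → ℤ, ∀ a op, Invoked t a op → V a = op.arg := by
  classical
  refine ⟨fun a => if h : ∃ op, Invoked t a op then h.choose.arg else 0, fun a op ha => ?_⟩
  have hex : ∃ op, Invoked t a op := ⟨op, ha⟩
  simp only [dif_pos hex]
  obtain ⟨p, op', s, hst⟩ := h.traceInv.state a ha.appears
  rw [hst.invoked_unique ha, hst.invoked_unique hex.choose_spec]

/-! ### Prefixes and continuations of executions -/

inductive Run (I : ConcImpl n) : Config I → List (Event n) → Config I → Prop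
  | nil (c : Config I) : Run I c [] c
  | snoc {c d d' : Config I} {t : List (Event n)} {e : Event n} :
      Run I c t d → Step I d e d' → Run I c (t ++ [e]) d'

theorem Reach.run (h : Reach I t c) (h' : Run I c u d) :
    Reach I (t ++ u) d := by
  induction h' with
  | nil => simpa using h
  | snoc h1 h2 ih =>
    rw [← List.append_assoc]
    exact .snoc ih h2

theorem Run.trans {b c d : Config I} (h : Run I b t c) (h' : Run I c u d) :
    Run I b (t ++ u) d := by
  induction h' with
  | nil => simpa using h
  | snoc h1 h2 ih =>
    rw [← List.append_assoc]
    exact .snoc ih h2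

theorem Run.single (h : Step I c e d) : Run I c [e] d :=
  .snoc (.nil c) h

theorem Reach.inv_snoc (h : Reach I (t ++ [e]) c) : ∃ d, Reach I t d ∧ Step I d e c := by
  generalize hu : t ++ [e] = u at h
  cases h with
  | nil => simp at hu
  | snoc h1 h2 =>
    obtain ⟨rfl, h3⟩ := List.append_inj' hu rfl
    cases h3
    exact ⟨_, h1, h2⟩

theorem Reach.split (h : Reach I (t ++ u) c) :
    ∃ d, Reach I t d ∧ Run I d u c := by
  induction u using List.reverseRecOn generalizing c with
  | nil => exact ⟨c, by simpa using h, .nil c⟩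
  | append_singleton u e ih =>
    rw [← List.append_assoc] at h
    obtain ⟨d, hd, hs⟩ := h.inv_snoc
    obtain ⟨d', hd', hr⟩ := ih hd
    exact ⟨d', hd', .snoc hr hs⟩

/-- The configurations of a finite execution. -/
theorem Reach.configs (h : Reach I t c) :
    ∃ cs : ℕ → Config I, cs 0 = Config.initial I ∧ cs t.length = c ∧
      (∀ i (hi : i < t.length), Step I (cs i) t[i] (cs (i + 1))) ∧
      ∀ i ≤ t.length, Reach I (t.take i) (cs i) := by
  induction h with
  | nil =>
    refine ⟨fun _ => Config.initial I, rfl, rfl, by simp, ?_⟩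
    intro i hi
    simpa using Reach.nil
  | @snoc t c c' e h1 h2 ih =>
    obtain ⟨cs, h0, hl, hs, hr⟩ := ih
    refine ⟨fun i => if i ≤ t.length then cs i else c', by simp [h0], by simp, ?_, ?_⟩
    · intro i hi
      rw [List.length_append, List.length_singleton] at hi
      by_cases hil : i < t.length
      · simp only [if_pos hil.le, if_pos (Nat.succ_le_of_lt hil)]
        rw [List.getElem_append_left hil]
        exact hs i hil
      · have : i = t.length := by omega
        subst this
        simpa [hl] using h2
    · intro i hi
      rw [List.length_append, List.length_singleton] at hi
      by_cases hil : i ≤ t.length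
      · simp only [if_pos hil]
        rw [List.take_append_of_le_length hil]
        exact hr i hil
      · have : i = t.length + 1 := by omega
        subst this
        simp only [if_neg hil]
        rw [List.take_of_length_le (by simp)]
        exact .snoc h1 h2

/-! ### Operations that read from a memory -/

/-- Status of the operation `op` when its steps so far turned `m` into `m'`. -/
def StatOK (V : ℕ → ℤ) (op : SetOp) (a : ℕ) (m m' : Obj → Cell) : Stat → Prop
  | .ready l => LocOK V op a l m m'
  | .busy l => LocOK V op a l m m'
  | .fin r => Effect V op a r m m'
  | .aborted => True

/-- All reads of an operation precede its writes, so it never reads back its own writes and legality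
reduces to reading from the initial memory `m`. Legality then keeps the control points in step with
`m`, by `LocOK.read` and `LocOK.write`. -/
theorem OpRun.statOK
 (hm : WF V m) (ha : ¬ Made m (.node a)) (hV : V a = op.arg)
    (h : OpRun op a s xs s') (hs : StatOK V op a m m' s) :
    (LegalFrom m' xs ↔ ∀ X c, .resRead X c ∈ xs → c = m X) ∧
    (LegalFrom m' xs → StatOK V op a m (xs.foldl actMem m') s') := by
  induction h generalizing m' with
  | nil => simp [LegalFrom, hs]
  | @cons s s1 s2 x xs h1 h2 ih =>
    -- Events other than the ends of reads and writes matter neither for the memory nor for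
    -- legality.
    have same : (∀ X c, x ≠ .resRead X c) → (∀ X c, x ≠ .resWrite X c) →
        StatOK V op a m m' s1 →
        (LegalFrom m' (x :: xs) ↔ ∀ X c, .resRead X c ∈ x :: xs → c = m X) ∧
        (LegalFrom m' (x :: xs) → StatOK V op a m ((x :: xs).foldl actMem m') s2) := by
      intro hr hw hst
      have hx : actMem m' x = m' := by
        unfold actMem
        split
        · rename_i X c; exact absurd rfl (hw X c)
        · rfl
      obtain ⟨i1, i2⟩ := ih hst
      refine ⟨?_, ?_⟩
      · simp only [LegalFrom, hx, List.mem_cons]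
        rw [i1]
        constructor
        · rintro ⟨_, h⟩ X c (h' | h')
          · exact absurd h'.symm (hr X c)
          · exact h X c h'
        · intro h
          exact ⟨fun X c h' => absurd h' (hr X c), fun X c h' => h X c (Or.inr h')⟩
      · rintro ⟨_, h⟩
        rw [hx] at h
        simpa [hx] using i2 h
    cases h1 with
    | call l =>
      exact same (by cases l <;> simp [Loc.cmd, Cmd.start])
        (by cases l <;> simp [Loc.cmd, Cmd.start]) hs
    | step l => exact same (by simp) (by simp) hs
    | abort l => exact same (by simp) (by simp) trivial
    | ret l c =>
      have hs' : LocOK V op a l m m' := hs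
      cases hcmd : l.cmd with
      | ret r =>
        rw [hcmd] at same
        rw [Stat.after_ret hcmd] at same
        refine same (by simp [Cmd.finish]) (by simp [Cmd.finish]) ?_
        rw [Loc.cmd_eq_ret hcmd] at hs'
        exact hs'
      | read X =>
        obtain ⟨rfl, _, hl'⟩ := hs'.read hm hcmd
        have hst : Stat.after op a l c = .ready (l.afterRead op a c) := by simp [Stat.after, hcmd]
        rw [hst] at ih h2
        simp only [LegalFrom, Cmd.finish, actMem, List.foldl_cons]
        by_cases hc : c = m' X
        · subst hc
          obtain ⟨i1, i2⟩ := ih hl'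
          refine ⟨?_, fun h => i2 h.2⟩
          rw [i1]
          constructor
          · rintro ⟨_, h⟩ Y c h'
            rcases List.mem_cons.1 h' with h' | h'
            · cases h'; rfl
            · exact h Y c h'
          · intro h
            exact ⟨fun Y c h' => h Y c (by rw [h']; simp),
              fun Y c h' => h Y c (List.mem_cons_of_mem _ h')⟩
        · refine ⟨⟨fun h => absurd (h.1 X c rfl) hc, fun h => absurd (h X c (by simp)) hc⟩,
            fun h => absurd (h.1 X c rfl) hc⟩
      | write X v =>
        have hw := hs'.write hm ha hV hcmd
        have hst : Stat.after op a l c = .ready l.afterWrite := by simp [Stat.after, hcmd]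
        rw [hst] at ih h2
        simp only [LegalFrom, Cmd.finish, actMem, List.foldl_cons]
        obtain ⟨i1, i2⟩ := ih hw
        refine ⟨?_, fun h => i2 h.2⟩
        rw [i1]
        simp

/-! ### Sequential histories that build a given list -/

/-- The memory that holds the list of the nodes `bs`. -/
def pathMem (V : ℕ → ℤ) : List ℕ → Obj → Cell
  | [] => initMem
  | b :: bs =>
    Function.update (Function.update (pathMem V bs) (.node b)
      ⟨keyVal (V b), (pathMem V bs .head).next⟩) .head ⟨⊥, .node b⟩

def firstObj : List ℕ → Obj
  | [] => .tail
  | b :: _ => .node b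

theorem pathMem_head (V : ℕ → ℤ) (bs : List ℕ) : pathMem V bs .head = ⟨⊥, firstObj bs⟩ := by
  cases bs <;> simp [pathMem, firstObj, initMem]

theorem pathMem_cons_self (V : ℕ → ℤ) (b : ℕ) (bs : List ℕ) :
    pathMem V (b :: bs) (.node b) = ⟨keyVal (V b), firstObj bs⟩ := by
  simp [pathMem, pathMem_head]

theorem pathMem_cons_of_ne {bs : List ℕ} (h : X ≠ .head)
    (h' : X ≠ .node b) : pathMem V (b :: bs) X = pathMem V bs X := by
  simp [pathMem, h, h']

theorem made_pathMem {bs : List ℕ} (h : Made (pathMem V bs) (.node b)) :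
    b ∈ bs := by
  induction bs with
  | nil => exact absurd h (not_made_initMem b)
  | cons b' bs ih =>
    by_cases hb : b = b'
    · simp [hb]
    · right
      apply ih
      rcases h with h | h
      · cases h
      · right
        rwa [pathMem_cons_of_ne (by simp) (by simpa using hb)] at h

theorem wf_pathMem {bs : List ℕ} (h : bs.Pairwise (fun b b' => V b < V b')) :
    WF V (pathMem V bs) := by
  induction bs with
  | nil => exact WF.initMem V
  | cons b bs ih =>
    obtain ⟨h1, h2⟩ := List.pairwise_cons.1 h
    have hwf := ih h2
    have hmf : Made (pathMem V bs) (firstObj bs) := by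
      have := hwf.made_next hwf.made_head
      rwa [pathMem_head] at this
    have hlt : keyVal (V b) < rank V (firstObj bs) := by
      cases bs with
      | nil => exact keyVal_lt_top _
      | cons b' bs => simpa [firstObj, rank] using h1 b' (by simp)
    rw [pathMem, pathMem_head]
    have h3 : WF V (Function.update (pathMem V bs) (.node b) ⟨keyVal (V b), firstObj bs⟩) :=
      hwf.update (by simp) ⟨rfl, by simp, fun _ => hlt⟩ (hmf.update (V := V) (by simp) rfl)
    refine h3.update (by simp) ⟨rfl, by simp, fun _ => bot_lt_keyVal _⟩ ?_
    refine Made.update (V := V) (Or.inr ?_) (by simp) rfl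
    rw [Function.update_self]
    exact keyVal_ne_top _

theorem SeqReach.readStep {S : List (Event n)} {d : SeqConfig n}
 (h : SeqReach S d) (hp : d.phase p = .ready op a l) (hl : l.cmd = .read X) :
    SeqReach (S ++ [⟨p, a, .invRead X⟩] ++ [⟨p, a, .resRead X (d.mem X)⟩])
      { d with phase := Function.update d.phase p (.ready op a (l.afterRead op a (d.mem X))) } := by
  have h1 := SeqStep.call d p op a l hp (by simp [hl])
  have h2 := SeqStep.read { d with phase := Function.update d.phase p (.busy op a l) } p op a l X
    (by simp) hl
  simp only [hl, Cmd.start] at h1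
  have := (h.snoc h1).snoc h2
  simpa using this

theorem SeqReach.writeStep {S : List (Event n)} {d : SeqConfig n}
 {c : Cell} (h : SeqReach S d) (hp : d.phase p = .ready op a l) (hl : l.cmd = .write X c) :
    SeqReach (S ++ [⟨p, a, .invWrite X c⟩] ++ [⟨p, a, .resWrite X c⟩])
      { d with mem := Function.update d.mem X c
               phase := Function.update d.phase p (.ready op a l.afterWrite) } := by
  have h1 := SeqStep.call d p op a l hp (by simp [hl])
  have h2 := SeqStep.write { d with phase := Function.update d.phase p (.busy op a l) } p op a l X c
    (by simp) hl
  simp only [hl, Cmd.start] at h1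
  have := (h.snoc h1).snoc h2
  simpa using this

/-- The list of the nodes `bs` is built by a sequential history of inserts. -/
theorem exists_seqReach_pathMem (p : Fin n) {bs : List ℕ}
    (h : bs.Pairwise (fun b b' => V b < V b')) :
    ∃ (S : List (Event n)) (d : SeqConfig n), SeqReach S d ∧ d.phase = (fun _ => .idle) ∧
      d.mem = pathMem V bs ∧ (∀ a, a ∈ d.used ↔ a ∈ bs) ∧ ∀ e ∈ S, e.oid ∈ bs := by
  induction bs with
  | nil => exact ⟨[], _, .nil, rfl, rfl, by simp [SeqConfig.initial], by simp⟩
  | cons b bs ih =>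
    obtain ⟨h1, h2⟩ := List.pairwise_cons.1 h
    obtain ⟨S, d, hd, hidle, hmem, hused, hS⟩ := ih h2
    have hb : b ∉ bs := fun hb => lt_irrefl _ (h1 b hb)
    have hlt : keyVal (V b) < (pathMem V bs (firstObj bs)).val := by
      cases bs with
      | nil => exact keyVal_lt_top _
      | cons b' bs =>
        rw [firstObj, pathMem_cons_self]
        simpa using h1 b' (by simp)
    -- The nodes are inserted in order of decreasing value, so every insertion reads only the head
    -- and the first element and puts its node in front.
    have s1 := hd.snoc (SeqStep.invoke d p (.insert (V b)) b (by simp [hidle])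
      (by rwa [hused]))
    have s2 := s1.readStep (p := p) (op := .insert (V b)) (a := b) (l := .start) (by simp) rfl
    simp only [hmem, pathMem_head, Loc.afterRead, Function.update_idem] at s2
    have s3 := s2.readStep (p := p) (by simp; exact ⟨rfl, rfl, rfl⟩) rfl
    have hcr : (Loc.traverse .head ⟨⊥, firstObj bs⟩ (firstObj bs)).afterRead (.insert (V b)) b
        (pathMem V bs (firstObj bs)) = .create .head ⟨⊥, firstObj bs⟩ (.node b)
          ⟨keyVal (V b), firstObj bs⟩ := by
      have hk : key (.insert (V b)) = keyVal (V b) := rfl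
      simp only [Loc.afterRead]
      rw [if_neg (by rw [hk]; exact hlt.not_gt), if_neg (by rw [hk]; exact hlt.ne'), hk]
    rw [hcr] at s3
    simp only [Function.update_idem] at s3
    have s4 := s3.writeStep (p := p) (by simp; exact ⟨rfl, rfl, rfl⟩) rfl
    simp only [Loc.afterWrite, Function.update_idem] at s4
    have s5 := s4.writeStep (p := p) (by simp; exact ⟨rfl, rfl, rfl⟩) rfl
    simp only [Loc.afterWrite, Function.update_idem] at s5
    have s6 := s5.snoc (SeqStep.ret _ p (.insert (V b)) b (.done true) true (by simp) rfl)
    refine ⟨_, _, s6, ?_, ?_, ?_, ?_⟩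
    · funext q
      simp only [hidle]
      by_cases hq : q = p
      · subst hq; simp
      · simp [hq]
    · simp [pathMem, pathMem_head]
    · intro a
      simp [hused]
    · intro e he
      simp only [List.mem_append, List.mem_singleton] at he
      rcases he with (((((((((he | rfl) | rfl) | rfl) | rfl) | rfl) | rfl) | rfl) | rfl) | rfl) | rfl
      · exact List.mem_cons_of_mem _ (hS e he)
      all_goals simp

/-! ### Histories of single operations -/

/-- The history of a single operation, without the response `⊥`. -/
def localHistory : List Act → List Act
  | [] => []
  | x :: xs =>
    match x with
    | .step => localHistory xs
    | .startCommit => localHistory xs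
    | .abort => localHistory xs
    | .invRead X => if xs.find? (fun y => y ≠ .step) = some .abort then localHistory xs
        else .invRead X :: localHistory xs
    | .invWrite X c => if xs.find? (fun y => y ≠ .step) = some .abort then localHistory xs
        else .invWrite X c :: localHistory xs
    | .invOp op => .invOp op :: localHistory xs
    | .resOp r => .resOp r :: localHistory xs
    | .resRead X c => .resRead X c :: localHistory xs
    | .resWrite X c => .resWrite X c :: localHistory xs

theorem returnsAbort_iff (t : List (Event n)) (a : ℕ) :
    ReturnsAbort t a ↔ (acts t a).find? (fun y => y ≠ .step) = some .abort := by
  unfold ReturnsAbort acts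
  rw [List.find?_map]
  rfl

theorem acts_cons_self (e : Event n) (t : List (Event n)) :
    acts (e :: t) e.oid = e.act :: acts t e.oid := by
  simp [acts, opEvents]

theorem acts_cons_ne (h : e.oid ≠ a) (t : List (Event n)) :
    acts (e :: t) a = acts t a := by
  simp [acts, opEvents, h]

/-- To drop the invocations of aborted calls, `history` looks ahead, but only at events of the same
operation; hence it commutes with the restriction to one operation. -/
theorem history_local (t : List (Event n)) (a : ℕ) :
    ((opEvents (history t) a).filter (fun e => e.act ≠ .abort)).map Event.act =
      localHistory (acts t a) := by
  induction t with
  | nil => rfl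
  | cons e t ih =>
    by_cases he : e.oid = a
    · subst he
      rw [acts_cons_self]
      have hr := returnsAbort_iff t e.oid
      cases hx : e.act <;>
        simp only [history, localHistory, hx, hr] <;>
        first
        | exact ih
        | (split
           · exact ih
           · rw [← ih]; simp [opEvents, hx])
        | (rw [← ih]; simp [opEvents, hx])
    · rw [acts_cons_ne he, ← ih]
      have : ∀ u : List (Event n), opEvents (e :: u) a = opEvents u a := by
        intro u; simp [opEvents, he]
      cases hx : e.act <;> simp only [history, hx] <;>
        first
        | rfl
        | (split
           · rfl
           · rw [this])
        | rw [this]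

theorem mem_history (h : e ∈ history t) : e ∈ t := by
  induction t with
  | nil => simp [history] at h
  | cons f t ih =>
    rw [history] at h
    split at h
    · exact List.mem_cons_of_mem _ (ih h)
    · exact List.mem_cons_of_mem _ (ih h)
    · split at h
      · exact List.mem_cons_of_mem _ (ih h)
      · rcases List.mem_cons.1 h with h | h
        · simp [h]
        · exact List.mem_cons_of_mem _ (ih h)
    · split at h
      · exact List.mem_cons_of_mem _ (ih h)
      · rcases List.mem_cons.1 h with h | h
        · simp [h]
        · exact List.mem_cons_of_mem _ (ih h)
    · rcases List.mem_cons.1 h with h | h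
      · simp [h]
      · exact List.mem_cons_of_mem _ (ih h)

theorem localHistory_of_abort (h : OpRun op a s xs s') (hs : s = .busy l)
    (hx : xs.find? (fun y => y ≠ .step) = some .abort) : localHistory xs = [] := by
  induction h with
  | nil => simp at hx
  | cons h1 h2 ih =>
    subst hs
    generalize hg : Stat.busy l = g at h1
    cases h1 with
    | call l => cases hg
    | step l =>
      cases hg
      exact ih rfl (by simpa using hx)
    | abort l =>
      rw [(h2.nil_of_not_pending (by simp [Stat.Pending])).1]
      rfl
    | ret l c => cases l <;> simp [Loc.cmd, Cmd.finish] at hx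

/-- The phase in a sequential history of an operation of the given status. -/
def Stat.seqPhase (op : SetOp) (a : ℕ) : Stat → Phase
  | .ready l => .ready op a l
  | .busy (.done r) => .ready op a (.done r)
  | .busy l => .busy op a l
  | _ => .idle

theorem Stat.seqPhase_busy (h : ∀ r, l.cmd ≠ .ret r) :
    Stat.seqPhase op a (.busy l) = .busy op a l := by
  cases l with
  | done r => exact absurd rfl (h r)
  | _ => rfl

/-- A call that returns `⊥` vanishes together with its invocation, so the sequential run stops just
before it. The start of the completion is invisible, which is why `Stat.seqPhase` still counts the
operation as ready there. Everything else has a counterpart in the sequential semantics, with values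
of reads granted by legality. -/
theorem OpRun.seqReach
    (h : OpRun op a s xs s') {S : List (Event n)} {d : SeqConfig n} (hd : SeqReach S d)
    (hp : s.Pending → d.phase p = Stat.seqPhase op a s) (hl : LegalFrom d.mem xs)
    (hb : ∀ l, s = .busy l → (∀ r, l.cmd ≠ .ret r) →
      xs.find? (fun y => y ≠ .step) ≠ some .abort) :
    ∃ d', SeqReach (S ++ (localHistory xs).map (fun x => ⟨p, a, x⟩)) d' := by
  induction h generalizing S d with
  | nil => exact ⟨d, by simpa [localHistory] using hd⟩
  | @cons s s1 s2 x xs h1 h2 ih =>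
    cases h1 with
    | call l =>
      by_cases hr : ∀ r, l.cmd ≠ .ret r
      · by_cases hf : xs.find? (fun y => y ≠ .step) = some .abort
        · refine ⟨d, ?_⟩
          have : localHistory (l.cmd.start :: xs) = [] := by
            rw [← localHistory_of_abort h2 rfl hf]
            cases l with
            | done r => exact absurd rfl (hr r)
            | _ => simp only [Loc.cmd, Cmd.start, localHistory, if_pos hf]
          simpa [this] using hd
        · have hd' := hd.snoc (SeqStep.call d p op a l (hp trivial) hr)
          have hl' : LegalFrom d.mem xs := by
            have := hl.2
            cases l <;> exact this
          obtain ⟨d', h'⟩ := ih hd' (by simp [Stat.seqPhase_busy hr]) hl'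
            (fun _ _ _ => hf)
          refine ⟨d', ?_⟩
          have : localHistory (l.cmd.start :: xs) = l.cmd.start :: localHistory xs := by
            cases l with
            | done r => exact absurd rfl (hr r)
            | _ => simp only [Loc.cmd, Cmd.start, localHistory, if_neg hf]
          rw [this]
          simpa using h'
      · push Not at hr
        obtain ⟨r, hr⟩ := hr
        have hl0 := Loc.cmd_eq_ret hr
        subst hl0
        obtain ⟨d', h'⟩ := ih hd (fun _ => hp trivial) hl.2
          (fun l hl hr => by cases hl; exact absurd rfl (hr r))
        exact ⟨d', h'⟩
    | step l =>
      obtain ⟨d', h'⟩ := ih hd hp hl.2 (fun l' hl' hr => by simpa using hb l' hl' hr)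
      exact ⟨d', h'⟩
    | abort l =>
      rw [(h2.nil_of_not_pending (by simp [Stat.Pending])).1]
      exact ⟨d, by simpa [localHistory] using hd⟩
    | ret l c =>
      cases hcmd : l.cmd with
      | ret r =>
        have hl0 := Loc.cmd_eq_ret hcmd
        subst hl0
        have hst : Stat.after op a (.done r) c = .fin r := rfl
        rw [hst] at h2
        have hd' := hd.snoc (SeqStep.ret d p op a (.done r) r (hp trivial) rfl)
        rw [(h2.nil_of_not_pending (by simp [Stat.Pending])).1]
        exact ⟨_, by simpa [localHistory, Cmd.finish] using hd'⟩
      | read X =>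
        have hph := hp trivial
        rw [Stat.seqPhase_busy (by simp [hcmd])] at hph
        rw [hcmd] at hl
        have hc := hl.1 X c rfl
        subst hc
        have hst : Stat.after op a l (d.mem X) = .ready (l.afterRead op a (d.mem X)) := by
          simp [Stat.after, hcmd]
        rw [hst] at h2 ih
        have hd' := hd.snoc (SeqStep.read d p op a l X hph hcmd)
        obtain ⟨d', h'⟩ := ih hd' (by simp [Stat.seqPhase]) hl.2 (by simp)
        exact ⟨d', (by simpa [localHistory, Cmd.finish] using h')⟩
      | write X v =>
        have hph := hp trivial
        rw [Stat.seqPhase_busy (by simp [hcmd])] at hph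
        rw [hcmd] at hl
        have hst : Stat.after op a l c = .ready l.afterWrite := by simp [Stat.after, hcmd]
        rw [hst] at h2 ih
        have hd' := hd.snoc (SeqStep.write d p op a l X v hph hcmd)
        obtain ⟨d', h'⟩ := ih hd' (by simp [Stat.seqPhase]) hl.2 (by simp)
        exact ⟨d', (by simpa [localHistory, Cmd.finish] using h')⟩

/-! ### Local serializability -/

/-- The reads of `xs` come from the list of the nodes `bs`, which starts at `X`. -/
structure ReadsPath (V : ℕ → ℤ) (a : ℕ) (xs : List Act) (bs : List ℕ) (X : Obj) : Prop where
  sorted : bs.Pairwise (fun b b' => V b < V b')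
  first : firstObj bs = X
  not_mem : a ∉ bs
  read : ∀ Y c, .resRead Y c ∈ xs → c = pathMem V bs Y
  le : ∀ Y c, .resRead Y c ∈ xs → rank V X ≤ rank V Y

/-- Here `xs` are the events still to come after the status: the list is assembled from the last
read backwards. After a traversal no reads are left. The next element of a traversal is neither the
head nor the operation's own node, which the two premises record. -/
def Stat.PathOK (V : ℕ → ℤ) (a : ℕ) (xs : List Act) : Stat → Prop
  | .ready .start | .busy .start => ∃ bs X, bs.Pairwise (fun b b' => V b < V b') ∧
      firstObj bs = X ∧ a ∉ bs ∧ ∀ Y c, .resRead Y c ∈ xs → c = pathMem V bs Y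
  | .ready (.traverse _ _ curr) | .busy (.traverse _ _ curr) =>
      curr ≠ .head → curr ≠ .node a → ∃ bs, ReadsPath V a xs bs curr
  | _ => ∀ Y c, .resRead Y c ∉ xs

theorem readsPath_nil (hX : X ≠ .head)
    (hX' : X ≠ .node a) (h : ∀ Y c, .resRead Y c ∉ xs) : ∃ bs, ReadsPath V a xs bs X := by
  cases X with
  | head => exact absurd rfl hX
  | tail => exact ⟨[], by simp, rfl, by simp, fun Y c hc => absurd hc (h Y c),
      fun Y c hc => absurd hc (h Y c)⟩
  | node b =>
    refine ⟨[b], by simp, rfl, ?_, fun Y c hc => absurd hc (h Y c),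
      fun Y c hc => absurd hc (h Y c)⟩
    rintro hb
    rw [List.mem_singleton] at hb
    subst hb
    exact hX' rfl

theorem le_of_mem_sorted {bs : List ℕ} (h : bs.Pairwise (fun b b' => V b < V b')) (hb : b ∈ bs) :
    rank V (firstObj bs) ≤ keyVal (V b) := by
  cases bs with
  | nil => simp at hb
  | cons b' bs =>
    rcases List.mem_cons.1 hb with rfl | hb
    · exact le_rfl
    · exact (keyVal_lt.2 ((List.pairwise_cons.1 h).1 b hb)).le

/-- The cell of `b` points to an element of larger value, and all later reads are of elements at
least as large as that one; so putting `b` in front changes none of the cells read later. -/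
theorem ReadsPath.cons {bs : List ℕ} {c : Cell}
    (h : ReadsPath V a xs bs c.next) (hc : GoodCell V (.node b) c) (hb : b ≠ a) :
    ReadsPath V a (.resRead (.node b) c :: xs) (b :: bs) (.node b) := by
  have hlt := hc.2.2 (by simp)
  refine ⟨?_, rfl, by simp [Ne.symm hb, h.not_mem], ?_, ?_⟩
  · refine List.pairwise_cons.2 ⟨fun b' hb' => ?_, h.sorted⟩
    have h1 := le_of_mem_sorted h.sorted hb'
    rw [h.first] at h1
    exact keyVal_lt.1 (hlt.trans_le h1)
  · intro Y c' hm
    rcases List.mem_cons.1 hm with hm | hm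
    · cases hm
      rw [pathMem_cons_self, h.first]
      cases c
      simp only [Cell.mk.injEq, and_true]
      exact hc.1
    · have hle := h.le Y c' hm
      rw [pathMem_cons_of_ne]
      · exact h.read Y c' hm
      · exact ne_head_of_rank_lt (hlt.trans_le hle)
      · rintro rfl
        exact absurd (hlt.trans_le hle) (lt_irrefl _)
  · intro Y c' hm
    rcases List.mem_cons.1 hm with hm | hm
    · cases hm; exact le_rfl
    · exact hlt.le.trans (h.le Y c' hm)

/-- Induction from the end of the run. Good cells point to larger elements, so the elements read
form an increasing chain in which each cell points to the next element; such a chain occurs in a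
list, whether or not it ever was in memory at one time. -/
theorem OpRun.pathOK (h : OpRun op a s xs s')
    (hg : ∀ X c, .resRead X c ∈ xs → GoodCell V X c ∧ c.next ≠ .node a) :
    s.PathOK V a xs := by
  induction h with
  | nil s =>
    match s with
    | .ready .start | .busy .start => exact ⟨[], _, by simp, rfl, by simp, by simp⟩
    | .ready (.traverse _ _ curr) | .busy (.traverse _ _ curr) =>
      exact fun h1 h2 => readsPath_nil h1 h2 (by simp)
    | .fin _ | .aborted | .ready (.create ..) | .ready (.update ..) | .ready (.done _)
    | .busy (.create ..) | .busy (.update ..) | .busy (.done _) => simp [Stat.PathOK]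
  | @cons s s1 s2 x xs h1 h2 ih =>
    have ih := ih (fun X c hX => hg X c (List.mem_cons_of_mem _ hX))
    have weaken : ∀ {bs X}, ReadsPath V a xs bs X → (∀ Y c, x ≠ .resRead Y c) →
        ReadsPath V a (x :: xs) bs X := by
      intro bs X h hx
      have : ∀ Y c, .resRead Y c ∈ x :: xs → .resRead Y c ∈ xs := fun Y c hm =>
        (List.mem_cons.1 hm).resolve_left (fun he => hx Y c he.symm)
      exact ⟨h.sorted, h.first, h.not_mem, fun Y c hm => h.read Y c (this Y c hm),
        fun Y c hm => h.le Y c (this Y c hm)⟩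
    cases h1 with
    | call l =>
      cases l with
      | start => simpa [Stat.PathOK, Loc.cmd, Cmd.start] using ih
      | traverse prev pcell curr =>
        intro h3 h4
        obtain ⟨bs, hbs⟩ := ih h3 h4
        exact ⟨bs, weaken hbs (by simp [Loc.cmd, Cmd.start])⟩
      | _ => simpa [Stat.PathOK, Loc.cmd, Cmd.start] using ih
    | step l =>
      cases l with
      | start => simpa [Stat.PathOK] using ih
      | traverse prev pcell curr =>
        intro h3 h4
        obtain ⟨bs, hbs⟩ := ih h3 h4
        exact ⟨bs, weaken hbs (by simp)⟩
      | _ => simpa [Stat.PathOK] using ih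
    | abort l =>
      have hxs := (h2.nil_of_not_pending (by simp [Stat.Pending])).1
      subst hxs
      cases l with
      | start => exact ⟨[], _, by simp, rfl, by simp, by simp⟩
      | traverse prev pcell curr => exact fun h1 h2 => readsPath_nil h1 h2 (by simp)
      | _ => simp [Stat.PathOK]
    | ret l c =>
      cases l with
      | start =>
        obtain ⟨hgc, hna⟩ := hg .head c (by simp [Loc.cmd, Cmd.finish])
        obtain ⟨bs, hbs⟩ := ih (ne_head_of_rank_lt (hgc.2.2 (by simp))) hna
        refine ⟨bs, _, hbs.sorted, rfl, hbs.not_mem, fun Y c' hm => ?_⟩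
        rcases List.mem_cons.1 hm with hm | hm
        · cases hm
          rw [pathMem_head, hbs.first]
          cases c
          simp only [Cell.mk.injEq, and_true]
          exact hgc.1
        · exact hbs.read Y c' hm
      | traverse prev pcell curr =>
        intro h3 h4
        simp only [Loc.cmd, Cmd.finish] at hg ⊢
        obtain ⟨hgc, hna⟩ := hg curr c (by simp)
        cases curr with
        | head => exact absurd rfl h3
        | tail =>
          have hct : c = ⟨⊤, .tail⟩ := by
            cases c
            have h5 := hgc.1
            have h6 := hgc.2.1 rfl
            simp only at h5 h6
            rw [h5, h6]; rfl
          have hnr : ∀ Y c, .resRead Y c ∉ xs := by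
            have hlt : ¬ c.val < key op := by rw [hct]; exact not_top_lt
            have hst : ∀ Y c', (Stat.after op a (.traverse prev pcell .tail) c).PathOK V a xs →
                .resRead Y c' ∉ xs := by
              intro Y c'
              simp only [Stat.after, Loc.cmd, Loc.afterRead, if_neg hlt]
              cases op <;> simp only
              · split <;> exact fun h => h Y c'
              · split <;> exact fun h => h Y c'
              · exact fun h => h Y c'
            exact fun Y c' => hst Y c' ih
          refine ⟨[], by simp, rfl, by simp, fun Y c' hm => ?_, fun Y c' hm => ?_⟩
          · rcases List.mem_cons.1 hm with hm | hm
            · cases hm; exact hct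
            · exact absurd hm (hnr Y c')
          · rcases List.mem_cons.1 hm with hm | hm
            · cases hm; exact le_rfl
            · exact absurd hm (hnr Y c')
        | node b =>
          have hb : b ≠ a := fun hb => h4 (by rw [hb])
          have hnh := ne_head_of_rank_lt (hgc.2.2 (by simp))
          by_cases hlt : c.val < key op
          · have hst : Stat.after op a (.traverse prev pcell (.node b)) c =
                .ready (.traverse (.node b) c c.next) := by
              simp [Stat.after, Loc.cmd, Loc.afterRead, hlt]
            rw [hst] at ih
            obtain ⟨bs, hbs⟩ := ih hnh hna
            exact ⟨b :: bs, hbs.cons hgc hb⟩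
          · have hst : ∀ Y c', (Stat.after op a (.traverse prev pcell (.node b)) c).PathOK V a xs →
                .resRead Y c' ∉ xs := by
              intro Y c'
              simp only [Stat.after, Loc.cmd, Loc.afterRead, if_neg hlt]
              cases op <;> simp only
              · split <;> exact fun h => h Y c'
              · split <;> exact fun h => h Y c'
              · exact fun h => h Y c'
            -- The traversal stops at `b` and reads nothing more, but the cell of `b` fixes its
            -- successor: the list that starts with this successor and contains no other node will
            -- do.
            obtain ⟨bs, hbs⟩ := readsPath_nil (V := V) hnh hna (fun Y c' => hst Y c' ih)
            exact ⟨b :: bs, hbs.cons hgc hb⟩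
      | create => simpa [Stat.PathOK, Loc.cmd, Cmd.finish, Stat.after, Loc.afterWrite] using ih
      | update => simpa [Stat.PathOK, Loc.cmd, Cmd.finish, Stat.after, Loc.afterWrite] using ih
      | done => simpa [Stat.PathOK, Loc.cmd, Cmd.finish, Stat.after, Loc.afterWrite] using ih

/-- Every read of the execution returned possible contents of its object. -/
def GoodReads (V : ℕ → ℤ) (t : List (Event n)) : Prop :=
  ∀ e ∈ t, ∀ X c, e.act = .resRead X c → GoodCell V X c ∧ c.next ≠ .node e.oid

theorem opEvents_map (h : ∀ e ∈ t, e.oid = a → e.proc = p) :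
    opEvents t a = (acts t a).map (fun x => ⟨p, a, x⟩) := by
  unfold acts
  rw [List.map_map]
  symm
  refine (List.map_congr_left (fun e he => ?_)).trans (List.map_id _)
  obtain ⟨he, ha⟩ := List.mem_filter.1 he
  have ha : e.oid = a := by simpa using ha
  have hp := h e he ha
  subst ha hp
  rfl

/-- Inserts build the list found by `OpRun.pathOK`, and the operation then runs alone on it. Nothing
is required of the relation between the reads of different operations. -/
theorem Reach.locallySerializable (h : Reach I t c)
 (hV : ∀ a op, Invoked t a op → V a = op.arg) (hg : GoodReads V t) :
    LocallySerializable t := by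
  intro a
  by_cases ha : Appears t a
  · obtain ⟨p, op, s, hst⟩ := h.traceInv.state a ha
    obtain ⟨xs, hxs, hrun⟩ := hst.run
    have hgood : ∀ X c, .resRead X c ∈ xs → GoodCell V X c ∧ c.next ≠ .node a := by
      intro X c hm
      have : Act.resRead X c ∈ acts t a := by rw [hxs]; exact List.mem_cons_of_mem _ hm
      obtain ⟨e, he, rfl, hact⟩ := mem_acts.1 this
      exact hg e he X c hact
    obtain ⟨bs, X, hsort, hfirst, hna, hread⟩ := hrun.pathOK hgood
    obtain ⟨S, d, hS, hidle, hmem, hused, hoid⟩ := exists_seqReach_pathMem p hsort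
    have hinv := hS.snoc (SeqStep.invoke d p op a (by simp [hidle]) (by rwa [hused]))
    have hwf := wf_pathMem hsort
    have hleg : LegalFrom (pathMem V bs) xs :=
      (hrun.statOK hwf (fun h => hna (made_pathMem h)) (hV a op hst.invoked)
        (m' := pathMem V bs) (by rfl)).1.2 hread
    obtain ⟨d', hd'⟩ := hrun.seqReach (p := p) hinv (fun _ => by simp [Stat.seqPhase])
      (by simpa [hmem] using hleg) (by simp)
    refine ⟨_, ⟨d', hd'⟩, ?_⟩
    have h1 : opEvents S a = [] := by
      unfold opEvents
      rw [List.filter_eq_nil_iff]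
      intro e he
      have := hoid e he
      simp only [decide_eq_true_eq]
      rintro rfl
      exact hna this
    have h2 : opEvents (history t) a = (acts (history t) a).map (fun x => ⟨p, a, x⟩) :=
      opEvents_map (fun e he hea => hst.proc e (mem_history he) hea)
    have h3 : (opEvents (history t) a).filter (fun e => e.act ≠ .abort) =
        (localHistory (acts t a)).map (fun x => ⟨p, a, x⟩) := by
      rw [← history_local, h2, List.filter_map, List.map_map, List.map_map]
      rfl
    rw [h3, hxs, opEvents_append, opEvents_append, h1]
    simp [opEvents, localHistory, List.filter_map, Function.comp_def]
  · refine ⟨[], ⟨_, .nil⟩, ?_⟩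
    have h3 := history_local t a
    rw [acts_eq_nil.2 ha] at h3
    have h4 := List.map_eq_nil_iff.1 h3
    rw [h4]
    rfl

/-! ### Linearization points -/

/-- The operations `L` lead from the set `q` to the set `q'`. -/
def SetPath : Finset ℤ → List (SetOp × Bool) → Finset ℤ → Prop
  | q, [], q' => q = q'
  | q, (o, r) :: l, q' => ∃ q₁, SetDelta q o q₁ r ∧ SetPath q₁ l q'

theorem SetPath.append {q q' q'' : Finset ℤ} {l l' : List (SetOp × Bool)} (h : SetPath q l q')
    (h' : SetPath q' l' q'') : SetPath q (l ++ l') q'' := by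
  induction l generalizing q with
  | nil => cases h; exact h'
  | cons x l ih =>
    obtain ⟨q₁, h1, h2⟩ := h
    exact ⟨q₁, h1, ih h2⟩

theorem SetPath.consistent {q q' : Finset ℤ} {l : List (SetOp × Bool)} (h : SetPath q l q') :
    SetConsistent q l := by
  induction l generalizing q with
  | nil => trivial
  | cons x l ih =>
    obtain ⟨q₁, h1, h2⟩ := h
    exact ⟨q₁, h1, ih h2⟩

theorem sublist_pair {α : Type*} {x y : α} {l : List α} :
    List.Sublist [x, y] l → ∃ i j : ℕ, i < j ∧ l[i]? = some x ∧ l[j]? = some y := by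
  induction l with
  | nil => intro h; cases h
  | cons z l ih =>
    intro h
    cases h with
    | cons _ h =>
      obtain ⟨i, j, hij, hi, hj⟩ := ih h
      exact ⟨i + 1, j + 1, by omega, by simpa using hi, by simpa using hj⟩
    | cons_cons _ h =>
      rw [List.singleton_sublist] at h
      obtain ⟨j, hj, rfl⟩ := List.mem_iff_getElem.1 h
      exact ⟨0, j + 1, by omega, rfl, by simp⟩

theorem sublist_flatMap_range {α : Type*} {f : ℕ → List α} {N i j : ℕ} {x y : α} (hij : i < j)
    (hj : j < N) (hx : x ∈ f i) (hy : y ∈ f j) :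
    List.Sublist [x, y] ((List.range N).flatMap f) := by
  have h1 : List.Sublist [i, j] (List.range N) := by
    have h2 : List.Sublist [i] (List.range j) :=
      List.singleton_sublist.2 (List.mem_range.2 hij)
    have h3 : List.Sublist (List.range j ++ [j]) (List.range N) := by
      rw [← List.range_succ]
      exact List.range_sublist.2 hj
    exact (h2.append (List.Sublist.refl [j])).trans h3
  have h4 : List.Sublist ([i, j].flatMap f) ((List.range N).flatMap f) := by
    simpa [List.flatMap] using (h1.map f).flatten
  refine List.Sublist.trans ?_ h4
  simpa using (List.singleton_sublist.2 hx).append (List.singleton_sublist.2 hy)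

/-- An execution is linearizable if its operations can be assigned linearization points.  The
operations `ops i` take effect, in this order, just before the event number `i`. -/
theorem linearizable_of_points (A : ℕ → Finset ℤ) (ops : ℕ → List (ℕ × SetOp × Bool)) (h0 : A 0 = ∅)
    (hstep : ∀ i < t.length, SetPath (A i) ((ops i).map Prod.snd) (A (i + 1)))
    (hnodup : ∀ i, ((ops i).map Prod.fst).Nodup)
    (hdisj : ∀ i j, ∀ x ∈ ops i, ∀ y ∈ ops j, x.1 = y.1 → i = j)
    (hinv : ∀ i, ∀ x ∈ ops i, Invoked t x.1 x.2.1 ∧ ¬ Aborted t x.1 ∧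
      ∀ r, Responded t x.1 r → r = x.2.2)
    (hbefore : ∀ i, ∀ x ∈ ops i, ∀ (k : ℕ) (e : Event n) (op : SetOp), t[k]? = some e → e.oid = x.1 →
      e.act = .invOp op → k < i)
    (hafter : ∀ i, ∀ x ∈ ops i, ∀ (k : ℕ) (e : Event n) (r : Bool), t[k]? = some e → e.oid = x.1 →
      e.act = .resOp r → i ≤ k)
    (hall : ∀ a, Committed t a → ∃ i < t.length, a ∈ (ops i).map Prod.fst) :
    Linearizable t := by
  have hmem : ∀ a, a ∈ ((List.range t.length).flatMap ops).map Prod.fst ↔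
      ∃ i < t.length, a ∈ (ops i).map Prod.fst := by
    intro a
    rw [List.map_flatMap]
    simp only [List.mem_flatMap, List.mem_range]
  refine ⟨(List.range t.length).flatMap ops, ?_, ?_, ?_, ?_, ?_⟩
  · rw [List.map_flatMap, List.nodup_flatMap]
    refine ⟨fun i _ => hnodup i, ?_⟩
    refine List.Pairwise.imp ?_ (List.nodup_range (n := t.length))
    intro i j hij a hi hj
    obtain ⟨x, hx, rfl⟩ := List.mem_map.1 hi
    obtain ⟨y, hy, hxy⟩ := List.mem_map.1 hj
    exact hij (hdisj i j x hx y hy hxy.symm)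
  · intro x hx
    obtain ⟨i, _, hx⟩ := List.mem_flatMap.1 hx
    exact hinv i x hx
  · intro a ha
    exact (hmem a).2 (hall a ha)
  · intro a ha b hb hab
    obtain ⟨i, hi, ha⟩ := (hmem a).1 ha
    obtain ⟨j, hj, hb⟩ := (hmem b).1 hb
    obtain ⟨x, hx, rfl⟩ := List.mem_map.1 ha
    obtain ⟨y, hy, rfl⟩ := List.mem_map.1 hb
    rw [List.map_flatMap]
    refine sublist_flatMap_range ?_ hj ha hb
    obtain ⟨e, f, hef, hea, hfb, hres, op, hop⟩ := hab
    obtain ⟨k1, k2, hk, hk1, hk2⟩ := sublist_pair hef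
    have h2 := hbefore j y hy k2 f op hk2 hfb hop
    rcases hres with ⟨r, hr⟩ | hab
    · have h1 := hafter i x hx k1 e r hk1 hea hr
      omega
    · exact absurd ⟨e, List.mem_of_getElem? hk1, hea, hab⟩ (hinv i x hx).2.1
  · have : ∀ N ≤ t.length, SetPath ∅ (((List.range N).flatMap ops).map Prod.snd) (A N) := by
      intro N
      induction N with
      | zero => intro _; simp [SetPath, h0]
      | succ N ih =>
        intro hN
        rw [List.range_succ, List.flatMap_append, List.map_append]
        refine (ih (by omega)).append ?_
        simpa using hstep N (by omega)
    exact (this t.length le_rfl).consistent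

/-! ### Writes of the operation that holds the list -/

/-- The path from the head to `X` uses only contents of elements of smaller value, which a write to
`X` does not touch. -/
theorem linked_update_self (hm : WF V m) {c : Cell}
    (hX : Linked m X) : Linked (Function.update m X c) X := by
  have key : ∀ Z, Linked m Z → rank V Z ≤ rank V X → Linked (Function.update m X c) Z := by
    intro Z hZ
    refine hZ.induction (P := fun Z => rank V Z ≤ rank V X → Linked (Function.update m X c) Z)
      (fun _ => Linked.head _) (fun Y hY ht ih hle => ?_)
    have hlt := (hm.cell Y ht (hY.made hm)).2.2.trans_le hle
    have hne : Y ≠ X := by rintro rfl; exact lt_irrefl _ hlt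
    have := (ih hlt.le).next ht
    rwa [Function.update_of_ne hne] at this
  exact key X hX le_rfl

def Loc.IsUpdate : Loc → Prop
  | .update _ _ => True
  | _ => False

/-- Describes a write relative to the present memory `m'`, which the other processes see, instead of
the memory `m` at which the operation began. Before the update both hold the same list. -/
theorem LocOK.write_facts {c : Cell} (hm : WF V m) (ha : ¬ Made m (.node a)) (hV : V a = op.arg)
    (h : LocOK V op a l m m') (hl : l.cmd = .write X c) :
    X ≠ .tail ∧ c.val = rank V X ∧ WF V (Function.update m' X c) ∧
    (∀ b, Made (Function.update m' X c) (.node b) → Made m' (.node b) ∨ b = a) ∧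
    ((¬ l.IsUpdate ∧ ¬ Made m' X ∧ ∀ Z, Linked (Function.update m' X c) Z ↔ Linked m' Z) ∨
      (l.IsUpdate ∧ l.afterWrite = .done true ∧ Linked m' X ∧ Linked (Function.update m' X c) X ∧
        ∀ q, Abs V m' q → ∃ q', Abs V (Function.update m' X c) q' ∧ SetDelta q op q' true)) := by
  have hw := h.write hm ha hV hl
  cases l with
  | start => cases hl
  | traverse => cases hl
  | done => cases hl
  | create prev pcell new c' =>
    cases hl
    obtain ⟨rfl, hi, hp, rfl, hk, rfl, rfl⟩ := h
    refine ⟨by simp, by rw [key_eq, ← hV]; rfl, hm.update_node hV hp hk, fun b hb => ?_,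
      Or.inl ⟨by simp [Loc.IsUpdate], ha, linked_update_node hm ha⟩⟩
    rcases hb.of_update with hb | hb
    · exact Or.inl hb
    · cases hb; exact Or.inr rfl
  | update prev c' =>
    cases hl
    have hp := h.1
    have hpm := hp.linked.made hm
    have hne : X ≠ .node a := by rintro rfl; exact ha hpm
    have hlink : ∀ Z, Linked m' Z ↔ Linked m Z := by
      rcases h.2 with ⟨_, _, rfl, _⟩ | ⟨_, _, rfl, _⟩
      · exact linked_update_node hm ha
      · exact fun _ => Iff.rfl
    have hwf' : WF V m' := by
      rcases h.2 with ⟨_, hk, rfl, _⟩ | ⟨_, _, rfl, _⟩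
      · exact hm.update_node hV hp hk
      · exact hm
    have hc : c.val = rank V X := by
      rw [← hm.val hpm]
      rcases h.2 with ⟨_, _, _, rfl⟩ | ⟨_, _, _, rfl⟩ <;> rfl
    have hlX := (hlink X).2 hp.linked
    refine ⟨hp.ne_tail, hc, hw.wf, fun b hb => ?_, Or.inr ⟨trivial, rfl, hlX,
      linked_update_self hwf' hlX, fun q hq => ?_⟩⟩
    · rcases hb.of_update with hb | hb
      · exact Or.inl hb
      · left; rw [hb]; exact hlX.made hwf'
    · exact hw.delta q (hq.congr (fun Z => (hlink Z).symm))

namespace HandOverHand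

/-! ### Steps of the hand-over-hand implementation -/

/-- The object of a read or a write. -/
def _root_.ListSet.Call.obj? : Call → Option Obj
  | .read X => some X
  | .write X _ => some X
  | .complete => none

def mem (c : Config (handOverHand n)) (X : Obj) : Cell := c.base (Base.value X)

def queue (c : Config (handOverHand n)) (X : Obj) : List (Fin n × Bool) := c.base (Base.lock X)

def loc (c : Config (handOverHand n)) (p : Fin n) : Local := c.loc p

/-- Effect of a primitive, from memory `m`, queues `q` and local state `ℓ`. -/
inductive Prim (p : Fin n) (m : Obj → Cell) (q : Obj → List (Fin n × Bool)) (ℓ : Local) :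
    (Obj → Cell) → (Obj → List (Fin n × Bool)) → Local → Prop
  | request (X : Obj) : ℓ.call.obj? = some X → ℓ.pc = .request →
      Prim p m q ℓ m (Function.update q X (q X ++ [(p, ℓ.mode.getD true)])) { ℓ with pc := .wait }
  | grant (X : Obj) : ℓ.call.obj? = some X → ℓ.pc = .wait → granted (q X) p (ℓ.mode.getD true) →
      Prim p m q ℓ m q { ℓ with pc := .access }
  | spin (X : Obj) : ℓ.call.obj? = some X → ℓ.pc = .wait → ¬ granted (q X) p (ℓ.mode.getD true) →
      Prim p m q ℓ m q ℓ
  | read (X : Obj) : ℓ.call = .read X → ℓ.pc = .access →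
      Prim p m q ℓ m q (if ℓ.mode.isSome
          then { ℓ with out := m X, pc := .release, old := ℓ.held, held := some X }
          else { ℓ with out := m X, pc := .release })
  | write (X : Obj) (v : Cell) : ℓ.call = .write X v → ℓ.pc = .access →
      Prim p m q ℓ (Function.update m X v) q
        { ℓ with pc := .release, old := if ℓ.mode.isSome then some X else none }
  | unlock (Y : Obj) : (ℓ.call = .complete ∨ ℓ.pc = .release) → ℓ.old = some Y →
      Prim p m q ℓ m (Function.update q Y ((q Y).filter (fun x => x.1 ≠ p)))
        { ℓ with old := none }

/-- The memory in a shared state. -/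
def memOf (base : (b : Base) → State n b) (X : Obj) : Cell := base (.value X)

/-- The lock queues in a shared state. -/
def queueOf (base : (b : Base) → State n b) (X : Obj) : List (Fin n × Bool) := base (.lock X)

theorem Prim.of_lock {base : (b : Base) → State n b} {ℓ ℓ' : Local} {s : List (Fin n × Bool)}
    (h : Prim p (memOf base) (queueOf base) ℓ (memOf base) (Function.update (queueOf base) X s) ℓ') :
    Prim p (memOf base) (queueOf base) ℓ
      (memOf (Function.update base (.lock X) s)) (queueOf (Function.update base (.lock X) s)) ℓ' := by
  have h1 : memOf (Function.update base (.lock X) s) = memOf base := by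
    funext Y
    exact Function.update_of_ne (by simp) _ _
  have h2 : queueOf (Function.update base (.lock X) s) = Function.update (queueOf base) X s := by
    funext Y
    by_cases hY : Y = X
    · subst hY
      rw [Function.update_self]
      exact Function.update_self _ _ _
    · rw [Function.update_of_ne hY]
      exact Function.update_of_ne (by simpa using hY) _ _
  rwa [h1, h2]

theorem Prim.of_value {base : (b : Base) → State n b} {ℓ ℓ' : Local} {s : Cell}
    (h : Prim p (memOf base) (queueOf base) ℓ (Function.update (memOf base) X s) (queueOf base) ℓ') :
    Prim p (memOf base) (queueOf base) ℓ
      (memOf (Function.update base (.value X) s)) (queueOf (Function.update base (.value X) s)) ℓ' := by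
  have h1 : queueOf (Function.update base (.value X) s) = queueOf base := by
    funext Y
    exact Function.update_of_ne (by simp) _ _
  have h2 : memOf (Function.update base (.value X) s) = Function.update (memOf base) X s := by
    funext Y
    by_cases hY : Y = X
    · subst hY
      rw [Function.update_self]
      exact Function.update_self _ _ _
    · rw [Function.update_of_ne hY]
      exact Function.update_of_ne (by simpa using hY) _ _
  rwa [h1, h2]

theorem prim_release {ℓ : Local} {b : Base} {f : State n b → State n b × Local}
    (hc : ℓ.call = .complete ∨ ℓ.pc = .release) (h : releaseAction p ℓ = .prim b f)
    (base : (b : Base) → State n b) :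
    Prim p (memOf base) (queueOf base) ℓ (memOf (Function.update base b (f (base b)).1))
      (queueOf (Function.update base b (f (base b)).1)) (f (base b)).2 := by
  unfold releaseAction at h
  split at h
  · rename_i Y hY
    cases h
    exact .of_lock (.unlock Y hc hY)
  · cases h

theorem prim_lockAction {ℓ : Local} {b : Base} {f : State n b → State n b × Local}
 (hX : ℓ.call.obj? = some X) (hpc : ℓ.pc = .request ∨ ℓ.pc = .wait)
    (h : lockAction p ℓ X (ℓ.mode.getD true) = .prim b f) (base : (b : Base) → State n b) :
    Prim p (memOf base) (queueOf base) ℓ (memOf (Function.update base b (f (base b)).1))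
      (queueOf (Function.update base b (f (base b)).1)) (f (base b)).2 := by
  unfold lockAction at h
  rcases hpc with hpc | hpc
  · rw [hpc] at h
    cases h
    exact .of_lock (.request X hX hpc)
  · rw [hpc] at h
    cases h
    refine .of_lock ?_
    have : Function.update (queueOf base) X (base (.lock X)) = queueOf base :=
      Function.update_eq_self _ _
    rw [this]
    have key : Prim p (memOf base) (queueOf base) ℓ (memOf base) (queueOf base)
        (if granted (queueOf base X) p (ℓ.mode.getD true) then { ℓ with pc := .access } else ℓ) := by
      split
      · rename_i hg; exact .grant X hX hpc hg
      · rename_i hg; exact .spin X hX hpc hg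
    exact key

theorem prim_of_next {ℓ : Local} {b : Base}
    {f : State n b → State n b × Local} (h : next p ℓ = .prim b f) (base : (b : Base) → State n b) :
    Prim p (memOf base) (queueOf base) ℓ (memOf (Function.update base b (f (base b)).1))
      (queueOf (Function.update base b (f (base b)).1)) (f (base b)).2 := by
  obtain ⟨call, mode, pc, held, old, out⟩ := ℓ
  cases call with
  | complete => cases pc <;> exact prim_release (Or.inl rfl) h base
  | read X =>
    cases pc with
    | request => exact prim_lockAction (ℓ := ⟨.read X, mode, .request, held, old, out⟩) (X := X) rfl (Or.inl rfl) h base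
    | wait => exact prim_lockAction (ℓ := ⟨.read X, mode, .wait, held, old, out⟩) (X := X) rfl (Or.inr rfl) h base
    | release => exact prim_release (Or.inr rfl) h base
    | access =>
      cases h
      refine .of_value ?_
      have : Function.update (memOf base) X (base (.value X)) = memOf base :=
        Function.update_eq_self _ _
      rw [this]
      exact .read X rfl rfl
  | write X v =>
    cases pc with
    | request => exact prim_lockAction (ℓ := ⟨.write X v, mode, .request, held, old, out⟩) (X := X) rfl (Or.inl rfl) h base
    | wait => exact prim_lockAction (ℓ := ⟨.write X v, mode, .wait, held, old, out⟩) (X := X) rfl (Or.inr rfl) h base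
    | release => exact prim_release (Or.inr rfl) h base
    | access =>
      cases h
      exact .of_value (.write X v rfl rfl)

theorem ret_of_next {ℓ : Local} {r : Option Cell}
    (h : (next p ℓ : Action Base (State n) Local) = .ret r) :
    r = some ℓ.out ∧ ℓ.old = none ∧ (ℓ.call = .complete ∨ ℓ.pc = .release) := by
  obtain ⟨call, mode, pc, held, old, out⟩ := ℓ
  have hrel : (releaseAction p ⟨call, mode, pc, held, old, out⟩ : Action Base (State n) Local) =
      .ret r → r = some out ∧ old = none := by
    intro h
    unfold releaseAction at h
    cases old with
    | none => cases h; exact ⟨rfl, rfl⟩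
    | some Y => cases h
  cases call with
  | complete => cases pc <;> exact ⟨(hrel h).1, (hrel h).2, Or.inl rfl⟩
  | read X =>
    cases pc with
    | request => cases h
    | wait => cases h
    | release => exact ⟨(hrel h).1, (hrel h).2, Or.inr rfl⟩
    | access => cases h
  | write X v =>
    cases pc with
    | request => cases h
    | wait => cases h
    | release => exact ⟨(hrel h).1, (hrel h).2, Or.inr rfl⟩
    | access => cases h

/-- Steps of the hand-over-hand implementation. -/
inductive HStep (c c' : Config (handOverHand n)) (e : Event n) : Prop
  | invoke (op : SetOp) : e.act = .invOp op → c.phase e.proc = .idle → e.oid ∉ c.used →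
      mem c' = mem c → queue c' = queue c → loc c' = loc c →
      c'.phase = Function.update c.phase e.proc (.ready op e.oid .start) →
      c'.used = insert e.oid c.used → HStep c c' e
  | call (op : SetOp) (l : Loc) : e.act = l.cmd.start → c.phase e.proc = .ready op e.oid l →
      mem c' = mem c → queue c' = queue c →
      loc c' = Function.update (loc c) e.proc (start op.name l.cmd.toCall (loc c e.proc)) →
      c'.phase = Function.update c.phase e.proc (.busy op e.oid l) →
      c'.used = c.used → HStep c c' e
  | prim (op : SetOp) (l : Loc) (ℓ : Local) : e.act = .step → c.phase e.proc = .busy op e.oid l →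
      Prim e.proc (mem c) (queue c) (loc c e.proc) (mem c') (queue c') ℓ →
      loc c' = Function.update (loc c) e.proc ℓ → c'.phase = c.phase → c'.used = c.used →
      HStep c c' e
  | ret (op : SetOp) (l : Loc) : e.act = l.cmd.finish (loc c e.proc).out →
      c.phase e.proc = .busy op e.oid l → (loc c e.proc).old = none →
      ((loc c e.proc).call = .complete ∨ (loc c e.proc).pc = .release) →
      mem c' = mem c → queue c' = queue c → loc c' = loc c →
      c'.phase = Function.update c.phase e.proc (Phase.after op e.oid l (loc c e.proc).out) →
      c'.used = c.used → HStep c c' e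

theorem hStep {c c' : Config (handOverHand n)}
    (h : Step (handOverHand n) c e c') : HStep c c' e := by
  cases h with
  | invoke p op a hp ha => exact .invoke op rfl hp ha rfl rfl rfl rfl rfl
  | call p op a l hp => exact .call op l rfl hp rfl rfl rfl rfl rfl
  | prim p op a l b f hp hn =>
    exact .prim op l _ rfl hp (prim_of_next hn c.base) rfl rfl rfl
  | ret p op a l v hp hn =>
    obtain ⟨h1, h2, h3⟩ := ret_of_next hn
    cases h1
    exact .ret op l rfl hp h2 h3 rfl rfl rfl rfl rfl
  | abort p op a l hp hn =>
    obtain ⟨h1, -, -⟩ := ret_of_next hn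
    cases h1

/-- By `ret_of_next` the algorithms never return `none`. -/
theorem pessimistic : Pessimistic (handOverHand n) := by
  rintro t ⟨c, hc⟩ a ⟨e, he, -, hab⟩
  induction hc with
  | nil => simp at he
  | snoc h1 h2 ih =>
    rcases List.mem_append.1 he with he | he
    · exact ih he
    · rw [List.mem_singleton.1 he] at hab
      cases hStep h2 with
      | invoke op hact => simp [hact] at hab
      | call op l hact => rw [hact] at hab; cases l <;> cases hab
      | prim op l ℓ hact => simp [hact] at hab
      | ret op l hact => rw [hact] at hab; cases l <;> cases hab

end HandOverHand

theorem Reach.pending_invoked (h : Reach I t c)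
 (hp : c.phase p = Stat.phase op a s) (hs : s.Pending) :
    OpState t c a p op s := by
  have hti := h.traceInv
  have hoid : (c.phase p).oid = some a := by rw [hp]; exact Stat.oid_phase.2 ⟨hs, rfl⟩
  obtain ⟨p', op', s', hst⟩ := hti.state a ((hti.used a).1 (hti.pending p a hoid))
  obtain ⟨rfl, hs'⟩ := hst.only p hoid
  have h1 := hst.phase hs'
  rw [hp] at h1
  have : op = op' ∧ s = s' := by
    cases s <;> cases s' <;> simp_all [Stat.phase, Stat.Pending]
  obtain ⟨rfl, rfl⟩ := this
  exact hst

theorem Reach.pending_unique (h : Reach I t c) {p q : Fin n}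
 (hp : (c.phase p).oid = some a) (hq : (c.phase q).oid = some a) : p = q := by
  have hti := h.traceInv
  obtain ⟨p', op', s', hst⟩ := hti.state a ((hti.used a).1 (hti.pending p a hp))
  exact (hst.only p hp).1.trans (hst.only q hq).1.symm

/-! ### Invariant of the hand-over-hand implementation. -/

namespace HandOverHand

/-- The control point of an operation, after the effect of its current call. -/
noncomputable def eff (op : SetOp) (a : ℕ) (l : Loc) (ℓ : Local) : Loc :=
  match ℓ.pc, l.cmd with
  | .release, .read _ => l.afterRead op a ℓ.out
  | .release, .write _ _ => l.afterWrite
  | _, _ => l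

theorem eff_of_ne {ℓ : Local} (h : ℓ.pc ≠ .release) :
    eff op a l ℓ = l := by
  unfold eff
  split <;> simp_all

theorem eff_read {ℓ : Local} (h : ℓ.pc = .release)
    (hl : l.cmd = .read X) : eff op a l ℓ = l.afterRead op a ℓ.out := by
  simp [eff, h, hl]

theorem eff_write {ℓ : Local} {v : Cell}
    (h : ℓ.pc = .release) (hl : l.cmd = .write X v) : eff op a l ℓ = l.afterWrite := by
  simp [eff, h, hl]

theorem eff_ret {ℓ : Local} {r : Bool} (hl : l.cmd = .ret r) :
    eff op a l ℓ = l := by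
  unfold eff
  split <;> simp_all

/-- `p` has the first request for the lock on the head. -/
def First (q : Obj → List (Fin n × Bool)) (p : Fin n) : Prop :=
  ∃ b rest, q .head = (p, b) :: rest

theorem First.unique {q : Obj → List (Fin n × Bool)} (h : First q p)
    (h' : First q p') : p = p' := by
  obtain ⟨b, r, h⟩ := h
  obtain ⟨b', r', h'⟩ := h'
  rw [h] at h'
  simp only [List.cons.injEq, Prod.mk.injEq] at h'
  exact h'.1.1

/-- Control points of `contains`. -/
def ContOK (V : ℕ → ℤ) (op : SetOp) (m : Obj → Cell) (held : Option Obj) : Loc → Prop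
  | .traverse prev pcell curr => held = some prev ∧ prev ≠ .tail ∧ pcell.val = rank V prev ∧
      pcell.next = curr ∧ rank V prev < rank V curr ∧ Made m curr ∧ pcell.val < key op
  | .done _ => True
  | _ => False

/-- Invariant of the operation `op` of process `p` at the control point `l`. -/
structure LocInv (V : ℕ → ℤ) (m : Obj → Cell) (q : Obj → List (Fin n × Bool)) (p : Fin n)
    (op : SetOp) (a : ℕ) (l : Loc) (held : Option Obj) : Prop where
  start : l = .start → ¬ Made m (.node a) ∧ held = none
  cont : op.name = .contains → l ≠ .start → ¬ Made m (.node a) ∧ ContOK V op m held l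
  upd : op.name ≠ .contains → l ≠ .start → held = some .head ∧ First q p ∧
    ∃ m₀, WF V m₀ ∧ ¬ Made m₀ (.node a) ∧ LocOK V op a l m₀ m

/-- `X` is the object of the current call. The clause `loc` speaks of the control point given by
`eff`: once the primitive on the value of `X` has been applied, the invariant of the next control
point is in force although the call has not returned. Until then `good` and `made` remember what the
read is going to return. -/
structure BusyInv (V : ℕ → ℤ) (m : Obj → Cell) (q : Obj → List (Fin n × Bool)) (p : Fin n)
    (op : SetOp) (a : ℕ) (l : Loc) (X : Obj) (ℓ : Local) : Prop where
  mode : ℓ.mode = lockMode op.name ℓ.call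
  loc : LocInv V m q p op a (eff op a l ℓ) ℓ.held
  request : ℓ.pc = .request → ℓ.mode.isSome
  wait : ℓ.pc = .wait → ℓ.mode.isSome ∧ (p, ℓ.mode.getD true) ∈ q X
  old : ℓ.pc ≠ .release → ℓ.old = none
  first : ℓ.pc = .access → op.name ≠ .contains → l = .start → First q p
  good : ℓ.pc = .release → ∀ Y, l.cmd = .read Y → GoodCell V Y ℓ.out ∧ ℓ.out.next ≠ .node a
  made : ℓ.pc = .release → ∀ Y, l.cmd = .read Y → Made m Y
  old_ne : ℓ.pc = .release → op.name ≠ .contains → ℓ.old ≠ some .head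
  read_only : op.name = .contains → ∀ Y v, l.cmd ≠ .write Y v

/-- The completion has no object and falls outside `BusyInv`: it gives up `held` when it starts and
only has to release `old`. -/
def ProcInv (V : ℕ → ℤ) (m : Obj → Cell) (q : Obj → List (Fin n × Bool)) (p : Fin n) (ℓ : Local) :
    Phase → Prop
  | .idle => ℓ.held = none ∧ ℓ.old = none
  | .ready op a l => ℓ.old = none ∧ LocInv V m q p op a l ℓ.held
  | .busy op a l => ℓ.call = l.cmd.toCall ∧
      (l.cmd.toCall = .complete → ℓ.held = none ∧ ℓ.pc = .release) ∧
      ∀ X, l.cmd.toCall.obj? = some X → BusyInv V m q p op a l X ℓ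

section stable

variable {q q' : Obj → List (Fin n × Bool)}

/-- What a step of another process may do: leave the memory alone if this process is an update past
its first access, and otherwise at most make further elements, but not the node of this operation.
The progress of `contains` depends on the memory only through elements being made. -/
theorem LocInv.stable {held : Option Obj} (h : LocInv V m q p op a l held)
    (h1 : First q p → m' = m) (h2 : ∀ X, Made m X → Made m' X)
    (h3 : Made m' (.node a) → Made m (.node a)) (h4 : First q p → First q' p) :
    LocInv V m' q' p op a l held := by
  refine ⟨fun hl => ⟨fun hm => (h.start hl).1 (h3 hm), (h.start hl).2⟩,
    fun hc hl => ?_, fun hc hl => ?_⟩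
  · obtain ⟨h5, h6⟩ := h.cont hc hl
    refine ⟨fun h => h5 (h3 h), ?_⟩
    cases l with
    | traverse prev pcell curr =>
      obtain ⟨i1, i2, i3, i4, i5, i6, i7⟩ := h6
      exact ⟨i1, i2, i3, i4, i5, h2 _ i6, i7⟩
    | _ => exact h6
  · obtain ⟨h5, h6, m₀, h7, h8, h9⟩ := h.upd hc hl
    exact ⟨h5, h4 h6, m₀, h7, h8, by rw [h1 h6]; exact h9⟩

theorem ProcInv.stable {ℓ : Local} {ph : Phase} (h : ProcInv V m q p ℓ ph)
    (h1 : First q p → m' = m) (h2 : ∀ X, Made m X → Made m' X)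
    (h3 : ∀ a, ph.oid = some a → Made m' (.node a) → Made m (.node a))
    (h4 : First q p → First q' p) (h5 : ∀ X b, (p, b) ∈ q X → (p, b) ∈ q' X) :
    ProcInv V m' q' p ℓ ph := by
  cases ph with
  | idle => exact h
  | ready op a l => exact ⟨h.1, h.2.stable h1 h2 (h3 a rfl) h4⟩
  | busy op a l =>
    refine ⟨h.1, h.2.1, fun X hX => ?_⟩
    have hb := h.2.2 X hX
    exact ⟨hb.mode, hb.loc.stable h1 h2 (h3 a rfl) h4, hb.request,
      fun hw => ⟨(hb.wait hw).1, h5 _ _ (hb.wait hw).2⟩, hb.old,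
      fun i1 i2 i3 => h4 (hb.first i1 i2 i3), hb.good,
      fun i1 Y i2 => h2 Y (hb.made i1 Y i2), hb.old_ne, hb.read_only⟩

end stable

theorem first_append {q : Obj → List (Fin n × Bool)} (h : First q p) (X : Obj)
    (x : Fin n × Bool) : First (Function.update q X (q X ++ [x])) p := by
  obtain ⟨b, r, h⟩ := h
  by_cases hX : X = .head
  · subst hX
    exact ⟨b, r ++ [x], by simp [h]⟩
  · exact ⟨b, r, by simp [Function.update_of_ne (Ne.symm hX), h]⟩

theorem first_filter {q : Obj → List (Fin n × Bool)} (h : First q p) (hne : p ≠ p' ∨ X ≠ .head) :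
    First (Function.update q X ((q X).filter (fun x => x.1 ≠ p'))) p := by
  obtain ⟨b, r, h⟩ := h
  by_cases hX : X = .head
  · subst hX
    have hp := hne.resolve_right (by simp)
    exact ⟨b, r.filter (fun x => x.1 ≠ p'), by simp [h, hp]⟩
  · exact ⟨b, r, by simp [Function.update_of_ne (Ne.symm hX), h]⟩

/-- An exclusive request is granted only when no request of another process is ahead of it. -/
theorem first_of_granted {q : Obj → List (Fin n × Bool)}
    (hq : (p, true) ∈ q .head) (h : granted (q .head) p true) : First q p := by
  cases hh : q .head with
  | nil => rw [hh] at hq; simp at hq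
  | cons x rest =>
    obtain ⟨p', b⟩ := x
    by_cases hp : p' = p
    · subst hp; exact ⟨b, rest, hh⟩
    · unfold granted at h
      have := h (p', b) (by rw [hh]; simp [hp])
      simp at this

theorem Cmd.toCall_inj {k : Cmd} :
    (∀ X, k.toCall = .read X → k = .read X) ∧ (∀ X v, k.toCall = .write X v → k = .write X v) ∧
    (k.toCall = .complete → ∃ r, k = .ret r) := by
  cases k <;> simp [Cmd.toCall]

/-- The invariant of the hand-over-hand implementation. -/
structure Inv (V : ℕ → ℤ) (c : Config (handOverHand n)) : Prop where
  wf : WF V (mem c)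
  made : ∀ b, Made (mem c) (.node b) → b ∈ c.used
  proc : ∀ p, ProcInv V (mem c) (queue c) p (loc c p) (c.phase p)

theorem eff_congr {ℓ ℓ' : Local} (h : ℓ.pc = ℓ'.pc)
    (h' : ℓ.out = ℓ'.out) : eff op a l ℓ = eff op a l ℓ' := by
  unfold eff
  rw [h, h']

theorem lockMode_of_ne_head {nm : OpName} (hn : nm ≠ .contains) (hX : X ≠ .head) :
    lockMode nm (.read X) = none := by
  cases nm <;> cases X <;> simp_all [lockMode]

theorem lockMode_head {nm : OpName} (hn : nm ≠ .contains) :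
    lockMode nm (.read .head) = some true := by
  cases nm <;> simp_all [lockMode]

theorem lockMode_contains (X : Obj) : lockMode .contains (.read X) = some false := rfl

theorem Loc.afterRead_ne_start {c : Cell} (h : l.cmd = .read X) : l.afterRead op a c ≠ .start := by
  cases l with
  | start => simp [Loc.afterRead]
  | traverse prev pcell curr =>
    unfold Loc.afterRead
    dsimp only
    split
    · simp
    · cases op <;> dsimp only <;> first | (split <;> simp) | simp
  | _ => cases h

theorem Loc.afterWrite_ne_start {v : Cell} (h : l.cmd = .write X v) : l.afterWrite ≠ .start := by
  cases l with
  | start => cases h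
  | traverse => cases h
  | done => cases h
  | _ => simp [Loc.afterWrite]

/-- The effect of a primitive on the invariant of the process that applies it, and what it means
for the other ones. -/
theorem prim_inv {q q' : Obj → List (Fin n × Bool)}
 {ℓ ℓ' : Local} (hm : WF V m) (hV : V a = op.arg)
    (hp : ProcInv V m q p ℓ (.busy op a l)) (h : Prim p m q ℓ m' q' ℓ') :
    ProcInv V m' q' p ℓ' (.busy op a l) ∧ WF V m' ∧ (First q p ∨ m' = m) ∧
    (∀ X, Made m X → Made m' X) ∧
    (∀ b, Made m' (.node b) → Made m (.node b) ∨ b = a) ∧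
    (∀ p', p' ≠ p → First q p' → First q' p') ∧
    (∀ p', p' ≠ p → ∀ X b, (p', b) ∈ q X → (p', b) ∈ q' X) := by
  obtain ⟨hcall, hcomp, hbusy⟩ := hp
  have triv : WF V m ∧ (First q p ∨ m = m) ∧ (∀ X, Made m X → Made m X) ∧
      (∀ b, Made m (.node b) → Made m (.node b) ∨ b = a) :=
    ⟨hm, Or.inr rfl, fun _ h => h, fun _ h => Or.inl h⟩
  cases h with
  | request X hX hpc =>
    rw [hcall] at hX
    have hb := hbusy X hX
    have hnr : ℓ.pc ≠ .release := by simp [hpc]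
    have hnc : l.cmd.toCall ≠ .complete := by rintro hc; rw [hc] at hX; cases hX
    refine ⟨⟨hcall, fun hc => absurd hc hnc, fun Y hY => ?_⟩, triv.1, triv.2.1,
      triv.2.2.1, triv.2.2.2, fun p' _ h => first_append h X _, fun p' _ Y b hY => ?_⟩
    · rw [hX] at hY
      cases hY
      have hl := hb.loc
      rw [eff_of_ne hnr] at hl
      refine ⟨hb.mode, ?_, by simp, fun _ => ⟨hb.request hpc, by simp⟩, fun _ => hb.old hnr,
        by simp, by simp, by simp, by simp, hb.read_only⟩
      rw [eff_of_ne (by simp)]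
      exact hl.stable (fun _ => rfl) (fun _ h => h) (fun h => h) (fun h => first_append h X _)
    · by_cases hXY : Y = X
      · subst hXY; simp [hY]
      · rwa [Function.update_of_ne hXY]
  | grant X hX hpc hg =>
    rw [hcall] at hX
    have hb := hbusy X hX
    have hnr : ℓ.pc ≠ .release := by simp [hpc]
    have hnc : l.cmd.toCall ≠ .complete := by rintro hc; rw [hc] at hX; cases hX
    refine ⟨⟨hcall, fun hc => absurd hc hnc, fun Y hY => ?_⟩, triv.1, triv.2.1,
      triv.2.2.1, triv.2.2.2, fun p' _ h => h, fun p' _ Y b hY => hY⟩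
    rw [hX] at hY
    cases hY
    have hl := hb.loc
    rw [eff_of_ne hnr] at hl
    refine ⟨hb.mode, ?_, by simp, by simp, fun _ => hb.old hnr, fun _ hn hs => ?_, by simp, by simp,
      by simp, hb.read_only⟩
    · rw [eff_of_ne (by simp)]
      exact hl
    · subst hs
      cases hX
      have hmode : ℓ.mode = some true := by
        rw [hb.mode, hcall]; exact lockMode_head hn
      have hw := (hb.wait hpc).2
      rw [hmode] at hg hw
      exact first_of_granted hw hg
  | spin X hX hpc hg =>
    exact ⟨⟨hcall, hcomp, hbusy⟩, triv.1, triv.2.1,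
      triv.2.2.1, triv.2.2.2, fun p' _ h => h, fun p' _ Y b hY => hY⟩
  | read X hX hpc =>
    have hlc : l.cmd = .read X := Cmd.toCall_inj.1 X (hcall.symm.trans hX)
    have hXo : l.cmd.toCall.obj? = some X := by rw [hlc]; rfl
    have hb := hbusy X hXo
    have hnr : ℓ.pc ≠ .release := by simp [hpc]
    have hl := hb.loc
    rw [eff_of_ne hnr] at hl
    have hmode := hb.mode
    rw [hX] at hmode
    have hold := hb.old hnr
    set ℓ' := (if ℓ.mode.isSome
          then { ℓ with out := m X, pc := .release, old := ℓ.held, held := some X }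
          else { ℓ with out := m X, pc := .release } : Local) with hℓ'
    have hpc' : ℓ'.pc = .release := by rw [hℓ']; split <;> rfl
    have hout : ℓ'.out = m X := by rw [hℓ']; split <;> rfl
    have hcall' : ℓ'.call = ℓ.call := by rw [hℓ']; split <;> rfl
    have hmode' : ℓ'.mode = ℓ.mode := by rw [hℓ']; split <;> rfl
    have hns := Loc.afterRead_ne_start (op := op) (a := a) (c := m X) hlc
    -- the object that is read has been made, and the node of the operation has not
    have hmade : Made m X ∧ ¬ Made m (.node a) ∧ LocInv V m q p op a (l.afterRead op a (m X)) ℓ'.held ∧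
        (op.name ≠ .contains → ℓ'.old ≠ some .head) := by
      by_cases hn : op.name = .contains
      · have hheld : ℓ'.held = some X := by
          rw [hℓ', hmode, hn, lockMode_contains]; rfl
        have hXm : Made m X ∧ ¬ Made m (.node a) := by
          cases l with
          | start => cases hlc; exact ⟨hm.made_head, (hl.start rfl).1⟩
          | traverse prev pcell curr =>
            cases hlc
            obtain ⟨h1, -, -, -, -, -, h6, -⟩ := hl.cont hn (by simp)
            exact ⟨h6, h1⟩
          | _ => cases hlc
        refine ⟨hXm.1, hXm.2, ⟨fun h => absurd h hns, fun _ _ => ⟨hXm.2, ?_⟩,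
          fun h => absurd hn h⟩, fun h => absurd hn h⟩
        rw [hheld]
        cases l with
        | start =>
          cases hlc
          have h3 := hm.cell .head (by simp) hm.made_head
          exact ⟨rfl, by simp, h3.1, rfl, h3.2.2, h3.2.1, by
            rw [hm.head_val, key_eq]; exact bot_lt_keyVal _⟩
        | traverse prev pcell curr =>
          cases hlc
          by_cases hlt : (m X).val < key op
          · simp only [Loc.afterRead, if_pos hlt]
            have hXt : X ≠ .tail := by
              rintro rfl
              rw [hm.tail_eq] at hlt
              exact not_top_lt hlt
            have h3 := hm.cell X hXt hXm.1
            exact ⟨rfl, hXt, h3.1, rfl, h3.2.2, h3.2.1, hlt⟩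
          · cases op with
            | contains v => simp only [Loc.afterRead, if_neg hlt]; trivial
            | insert v => cases hn
            | remove v => cases hn
        | _ => cases hlc
      · by_cases hs : l = .start
        · subst hs
          cases hlc
          obtain ⟨hna, hheld⟩ := hl.start rfl
          have hmd : ℓ.mode = some true := hmode.trans (lockMode_head hn)
          have hheld' : ℓ'.held = some .head := by rw [hℓ', hmd]; rfl
          have hold' : ℓ'.old = none := by rw [hℓ', hmd]; exact hheld
          have hlk := LocOK.read (V := V) (op := op) (a := a) (l := .start) (m := m) (m' := m) hm
            rfl rfl
          refine ⟨hm.made_head, hna, ⟨fun h => absurd h hns, fun h => absurd h hn, fun _ _ => ?_⟩,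
            fun _ => by rw [hold']; simp⟩
          -- The operation is first in the queue of the head from now on, so the present memory
          -- becomes the memory `m₀` from which it reads to the end.
          exact ⟨hheld', hb.first hpc hn rfl, m, hm, hna, hlk.2.2⟩
        · obtain ⟨hheld, hf, m₀, hm₀, hna, hlk⟩ := hl.upd hn hs
          obtain ⟨rfl, hlX, hlk'⟩ := hlk.read hm₀ hlc
          have hXh : X ≠ .head := by
            cases l with
            | start => exact absurd rfl hs
            | traverse prev pcell curr =>
              cases hlc
              obtain ⟨-, hpp, -, rfl⟩ := hlk
              exact ne_head_of_rank_lt (hm₀.cell prev hpp.ne_tail (hpp.linked.made hm₀)).2.2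
            | _ => cases hlc
          have hmd : ℓ.mode = none := hmode.trans (lockMode_of_ne_head hn hXh)
          have hheld' : ℓ'.held = some .head := by rw [hℓ', hmd]; exact hheld
          have hold' : ℓ'.old = none := by rw [hℓ', hmd]; exact hold
          refine ⟨hlX.made hm₀, hna, ⟨fun h => absurd h hns, fun h => absurd h hn, fun _ _ => ?_⟩,
            fun _ => by rw [hold']; simp⟩
          exact ⟨hheld', hf, _, hm₀, hna, hlk'⟩
    obtain ⟨hXm, hna, hl', hold'⟩ := hmade
    have hnc : l.cmd.toCall ≠ .complete := by rw [hlc]; simp [Cmd.toCall]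
    refine ⟨⟨hcall'.trans hcall, fun hc => absurd hc hnc, fun Y hY => ?_⟩, triv.1, triv.2.1,
      triv.2.2.1, triv.2.2.2, fun p' _ h => h, fun p' _ Y b hY => hY⟩
    · rw [hXo] at hY
      cases hY
      refine ⟨by rw [hmode', hcall']; exact hb.mode, ?_, by simp [hpc'], by simp [hpc'],
        fun h => absurd hpc' h, by simp [hpc'], fun _ Y hY => ?_, fun _ Y hY => ?_, fun _ hn => hold' hn,
        hb.read_only⟩
      · rw [eff_read hpc' hlc, hout]
        exact hl'
      · rw [hlc] at hY
        cases hY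
        rw [hout]
        refine ⟨hm.good hXm, fun he => hna ?_⟩
        rw [← he]
        exact hm.made_next hXm
      · rw [hlc] at hY
        cases hY
        exact hXm
  | write X v hX hpc =>
    have hlc : l.cmd = .write X v := Cmd.toCall_inj.2.1 X v (hcall.symm.trans hX)
    have hXo : l.cmd.toCall.obj? = some X := by rw [hlc]; rfl
    have hb := hbusy X hXo
    have hnr : ℓ.pc ≠ .release := by simp [hpc]
    have hl := hb.loc
    rw [eff_of_ne hnr] at hl
    have hns : l ≠ .start := by rintro rfl; cases hlc
    have hn : op.name ≠ .contains := by
      intro hn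
      have := (hl.cont hn hns).2
      cases l <;> first | exact this | cases hlc
    obtain ⟨hheld, hf, m₀, hm₀, hna, hlk⟩ := hl.upd hn hns
    have hns' := Loc.afterWrite_ne_start hlc
    obtain ⟨w1, w2, w3, w4, -⟩ := hlk.write_facts hm₀ hna hV hlc
    have hnc : l.cmd.toCall ≠ .complete := by rw [hlc]; simp [Cmd.toCall]
    refine ⟨⟨hcall, fun hc => absurd hc hnc, fun Y hY => ?_⟩, w3, Or.inl hf,
      fun Y hY => hY.update w1 w2, w4, fun p' _ h => h, fun p' _ Y b hY => hY⟩
    rw [hXo] at hY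
    cases hY
    refine ⟨hb.mode, ?_, by simp, by simp, by simp, by simp, fun _ Y hY => ?_, fun _ Y hY => ?_,
      fun _ _ => ?_, hb.read_only⟩
    · rw [eff_write rfl hlc]
      exact ⟨fun h => absurd h hns', fun h => absurd h hn,
        fun _ _ => ⟨hheld, hf, m₀, hm₀, hna, hlk.write hm₀ hna hV hlc⟩⟩
    · rw [hlc] at hY; cases hY
    · rw [hlc] at hY; cases hY
    · have hmode := hb.mode
      rw [hX] at hmode
      by_cases hXh : X = .head
      · subst hXh
        have : ℓ.mode = none := by
          rw [hmode]; cases hnm : op.name <;> simp_all [lockMode]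
        simp [this]
      · simp only
        split
        · simpa using hXh
        · simp
  | unlock Y hc hold =>
    refine ⟨⟨hcall, hcomp, fun X hX => ?_⟩, triv.1, triv.2.1,
      triv.2.2.1, triv.2.2.2, fun p' hne h => first_filter h (Or.inl hne), fun p' hne Z b hZ => ?_⟩
    · have hb := hbusy X hX
      have hpc : ℓ.pc = .release := by
        rcases hc with hc | hc
        · rw [hcall] at hc; rw [hc] at hX; cases hX
        · exact hc
      refine ⟨hb.mode, ?_, by simp [hpc], by simp [hpc], by simp [hpc], by simp [hpc],
        fun h => hb.good h, fun h => hb.made h, by simp, hb.read_only⟩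
      have hee : eff op a l { ℓ with old := none } = eff op a l ℓ := eff_congr rfl rfl
      rw [hee]
      by_cases hn : op.name = .contains
      · exact ⟨hb.loc.start, hb.loc.cont, fun h => absurd hn h⟩
      · have hYh := hb.old_ne hpc hn
        rw [hold] at hYh
        exact hb.loc.stable (fun _ => rfl) (fun _ h => h) (fun h => h)
          (fun h => first_filter h (Or.inr (by simpa using hYh)))
    · by_cases hZY : Z = Y
      · subst hZY; simp [hZ, hne]
      · rwa [Function.update_of_ne hZY]

theorem reach_inv {c : Config (handOverHand n)}
    (h : Reach (handOverHand n) t c) (hV : ∀ a op, Invoked t a op → V a = op.arg) : Inv V c := by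
  induction h with
  | nil =>
    refine ⟨WF.initMem V, fun b hb => absurd hb (not_made_initMem b), fun p => ⟨rfl, rfl⟩⟩
  | @snoc t c c' e h1 h2 ih =>
    have hV' : ∀ a op, Invoked t a op → V a = op.arg := by
      rintro a op ⟨e', he', h⟩
      exact hV a op ⟨e', by simp [he'], h⟩
    have ih := ih hV'
    have same : mem c' = mem c → queue c' = queue c → ∀ p,
        ProcInv V (mem c') (queue c') p (loc c p) (c.phase p) := by
      intro i1 i2 p
      rw [i1, i2]
      exact ih.proc p
    cases hStep h2 with
    | invoke op hact hidle hused hmem hq hl hph hus =>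
      refine ⟨by rw [hmem]; exact ih.wf, fun b hb => ?_, fun p => ?_⟩
      · rw [hmem] at hb; rw [hus]; exact Finset.mem_insert_of_mem (ih.made b hb)
      · rw [hl, hph]
        by_cases hp : p = e.proc
        · subst hp
          rw [Function.update_self]
          have := ih.proc e.proc
          rw [hidle] at this
          refine ⟨this.2, fun _ => ⟨fun h => hused (ih.made _ ?_), this.1⟩, fun _ h => absurd rfl h,
            fun _ h => absurd rfl h⟩
          rwa [hmem] at h
        · rw [Function.update_of_ne hp]
          exact same hmem hq p
    | call op l hact hp hmem hq hl hph hus =>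
      refine ⟨by rw [hmem]; exact ih.wf, fun b hb => ?_, fun p => ?_⟩
      · rw [hmem] at hb; rw [hus]; exact ih.made b hb
      · by_cases hpe : p = e.proc
        · subst hpe
          rw [hl, hph, Function.update_self, Function.update_self, hmem, hq]
          have hr := ih.proc e.proc
          rw [hp] at hr
          obtain ⟨hold, hli⟩ := hr
          cases hcmd : l.cmd with
          | ret r =>
            refine ⟨by rw [hcmd]; rfl, fun _ => ⟨rfl, rfl⟩, fun X hX => ?_⟩
            rw [hcmd] at hX; cases hX
          | read X =>
            have hnc : l.cmd.toCall ≠ .complete := by rw [hcmd]; simp [Cmd.toCall]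
            refine ⟨by rw [hcmd]; rfl, fun h => absurd h hnc, fun Y hY => ?_⟩
            rw [hcmd] at hY
            cases hY
            have hpc : (start op.name (Call.read X) (loc c e.proc)).pc =
                if (lockMode op.name (.read X)).isSome then .request else .access := rfl
            have hnr : (start op.name (Call.read X) (loc c e.proc)).pc ≠ .release := by
              rw [hpc]; split <;> simp
            simp only [Cmd.toCall]
            refine ⟨rfl, ?_, fun h => ?_, fun h => ?_, fun _ => rfl, fun h hn hs => ?_,
              fun h => absurd h hnr, fun h => absurd h hnr, fun h => absurd h hnr, fun _ Y v => by rw [hcmd]; simp⟩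
            · rw [eff_of_ne hnr]
              exact hli
            · rw [hpc] at h
              split at h
              · rename_i hm; exact hm
              · cases h
            · rw [hpc] at h; split at h <;> cases h
            · subst hs
              cases hcmd
              rw [hpc, lockMode_head hn] at h
              cases h
          | write X v =>
            have hnc : l.cmd.toCall ≠ .complete := by rw [hcmd]; simp [Cmd.toCall]
            refine ⟨by rw [hcmd]; rfl, fun h => absurd h hnc, fun Y hY => ?_⟩
            rw [hcmd] at hY
            cases hY
            have hpc : (start op.name (Call.write X v) (loc c e.proc)).pc =
                if (lockMode op.name (.write X v)).isSome then .request else .access := rfl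
            have hnr : (start op.name (Call.write X v) (loc c e.proc)).pc ≠ .release := by
              rw [hpc]; split <;> simp
            simp only [Cmd.toCall]
            refine ⟨rfl, ?_, fun h => ?_, fun h => ?_, fun _ => rfl, fun h hn hs => ?_,
              fun h => absurd h hnr, fun h => absurd h hnr, fun h => absurd h hnr, fun hn => ?_⟩
            · rw [eff_of_ne hnr]
              exact hli
            · rw [hpc] at h
              split at h
              · rename_i hm; exact hm
              · cases h
            · rw [hpc] at h; split at h <;> cases h
            · subst hs
              cases hcmd
            · have hns : l ≠ .start := by rintro rfl; cases hcmd
              have := (hli.cont hn hns).2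
              cases l <;> first | exact this.elim | cases hcmd
        · rw [hl, hph, Function.update_of_ne hpe, Function.update_of_ne hpe]
          exact same hmem hq p
    | prim op l ℓ hact hp hprim hl hph hus =>
      have hst := h1.pending_invoked (s := .busy l) hp trivial
      have hpi := ih.proc e.proc
      rw [hp] at hpi
      obtain ⟨i1, i2, i3, i4, i5, i6, i7⟩ := prim_inv ih.wf (hV' _ _ hst.invoked) hpi hprim
      refine ⟨i2, fun b hb => ?_, fun p => ?_⟩
      · rw [hus]
        rcases i5 b hb with hb | rfl
        · exact ih.made b hb
        · exact (h1.traceInv.used _).2 hst.invoked.appears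
      · rw [hl, hph]
        by_cases hpe : p = e.proc
        · subst hpe
          rw [Function.update_self, hp]
          exact i1
        · rw [Function.update_of_ne hpe]
          refine (ih.proc p).stable (fun hf => ?_) i4 (fun a ha hm => ?_) (i6 p hpe) (i7 p hpe)
          -- The memory changes only if the process that moves is first at the head; no two
          -- processes are, so an update never sees the writes of another one.
          · exact i3.resolve_left (fun h => hpe (hf.unique h))
          · rcases i5 a hm with h | rfl
            · exact h
            · exact absurd (h1.pending_unique ha (by rw [hp]; rfl)) hpe
    | ret op l hact hp hold hc hmem hq hl hph hus =>
      refine ⟨by rw [hmem]; exact ih.wf, fun b hb => ?_, fun p => ?_⟩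
      · rw [hmem] at hb; rw [hus]; exact ih.made b hb
      · rw [hl, hph]
        by_cases hpe : p = e.proc
        · subst hpe
          rw [Function.update_self, hmem, hq]
          have hr := ih.proc e.proc
          rw [hp] at hr
          obtain ⟨hcall, hcomp, hbusy⟩ := hr
          cases hcmd : l.cmd with
          | ret r =>
            have : Phase.after op e.oid l (loc c e.proc).out = .idle := by
              simp [Phase.after, hcmd]
            rw [this]
            exact ⟨(hcomp (by rw [hcmd]; rfl)).1, hold⟩
          | read X =>
            have : Phase.after op e.oid l (loc c e.proc).out =
                .ready op e.oid (l.afterRead op e.oid (loc c e.proc).out) := by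
              simp [Phase.after, hcmd]
            rw [this]
            have hb := hbusy X (by rw [hcmd]; rfl)
            have hpc : (loc c e.proc).pc = .release :=
              hc.resolve_left (by rw [hcall, hcmd]; simp [Cmd.toCall])
            have := hb.loc
            rw [eff_read hpc hcmd] at this
            exact ⟨hold, this⟩
          | write X v =>
            have : Phase.after op e.oid l (loc c e.proc).out =
                .ready op e.oid l.afterWrite := by
              simp [Phase.after, hcmd]
            rw [this]
            have hb := hbusy X (by rw [hcmd]; rfl)
            have hpc : (loc c e.proc).pc = .release :=
              hc.resolve_left (by rw [hcall, hcmd]; simp [Cmd.toCall])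
            have := hb.loc
            rw [eff_write hpc hcmd] at this
            exact ⟨hold, this⟩
        · rw [Function.update_of_ne hpe]
          exact same hmem hq p

end HandOverHand

theorem Cmd.finish_eq_resRead {k : Cmd} {c c' : Cell} (h : k.finish c = .resRead X c') :
    k = .read X ∧ c' = c := by
  cases k <;> simp_all [Cmd.finish]

theorem memAfter_snoc (t : List (Event n)) (e : Event n) :
    memAfter (t ++ [e]) = actMem (memAfter t) e.act := by
  simp [memAfter_eq]

theorem actMem_of_ne {x : Act} (h : ∀ X c, x ≠ .resWrite X c) :
    actMem m x = m := by
  cases x <;> simp_all [actMem]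

/-! ### Local serializability and obedience of the hand-over-hand implementation. -/

namespace HandOverHand

theorem Inv.busy {c : Config (handOverHand n)} (hi : Inv V c)
 (hp : c.phase p = .busy op a l) (hX : l.cmd.toCall.obj? = some X) :
    (loc c p).call = l.cmd.toCall ∧ BusyInv V (mem c) (queue c) p op a l X (loc c p) := by
  have := hi.proc p
  rw [hp] at this
  exact ⟨this.1, this.2.2 X hX⟩

/-- The cell is good at the moment when it is fetched, and `BusyInv.good` keeps this until the read
returns, however outdated the cell may be by then. -/
theorem goodReads {c : Config (handOverHand n)}
    (h : Reach (handOverHand n) t c) (hV : ∀ a op, Invoked t a op → V a = op.arg) :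
    GoodReads V t := by
  induction h with
  | nil => intro e he; simp at he
  | @snoc t c c' e h1 h2 ih =>
    have hV' : ∀ a op, Invoked t a op → V a = op.arg := by
      rintro a op ⟨e', he', h⟩
      exact hV a op ⟨e', by simp [he'], h⟩
    intro e' he' X v hact
    rcases List.mem_append.1 he' with he' | he'
    · exact ih hV' e' he' X v hact
    · rw [List.mem_singleton.1 he'] at hact ⊢
      cases hStep h2 with
      | invoke op hact' => rw [hact'] at hact; cases hact
      | call op l hact' => rw [hact'] at hact; cases l <;> cases hact
      | prim op l ℓ hact' => rw [hact'] at hact; cases hact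
      | ret op l hact' hp hold hc =>
        rw [hact'] at hact
        obtain ⟨hl, rfl⟩ := Cmd.finish_eq_resRead hact
        have hinv := reach_inv h1 hV'
        obtain ⟨hcall, hb⟩ := hinv.busy (X := X) hp (by rw [hl]; rfl)
        refine hb.good (hc.resolve_left ?_) X hl
        rw [hcall, hl]
        simp [Cmd.toCall]

theorem locallySerializable (h : IsExecution (handOverHand n) t) :
    LocallySerializable t := by
  obtain ⟨c, h⟩ := h
  obtain ⟨V, hV⟩ := h.exists_arg
  exact h.locallySerializable hV (goodReads h hV)

/-- Process `p` has written `v` to `X`, and the write has not returned. -/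
def Written (c : Config (handOverHand n)) (p : Fin n) (X : Obj) (v : Cell) : Prop :=
  ∃ op a l, c.phase p = .busy op a l ∧ l.cmd = .write X v ∧ (loc c p).pc = .release

/-- Only updates write, and they are first at the head from their first access on. -/
theorem Inv.first_of_write {c : Config (handOverHand n)} (hi : Inv V c)
 {v : Cell} (hp : c.phase p = .busy op a l) (hl : l.cmd = .write X v) : First (queue c) p := by
  obtain ⟨-, hb⟩ := hi.busy (X := X) hp (by rw [hl]; rfl)
  have hns : eff op a l (loc c p) ≠ .start := by
    by_cases hpc : (loc c p).pc = .release
    · rw [eff_write hpc hl]; exact Loc.afterWrite_ne_start hl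
    · rw [eff_of_ne hpc]; rintro rfl; cases hl
  have hn : op.name ≠ .contains := fun hn => hb.read_only hn _ _ hl
  exact (hb.loc.upd hn hns).2.1

/-- The memory is the one after the writes that returned, except for the writes that are about
to return. -/
theorem mem_eq {c : Config (handOverHand n)} (h : Reach (handOverHand n) t c) (X : Obj) :
    (∀ p v, Written c p X v → mem c X = v) ∧
    ((∀ p v, ¬ Written c p X v) → mem c X = memAfter t X) := by
  induction h with
  | nil => exact ⟨fun p v h => (by obtain ⟨op, a, l, hp, -⟩ := h; cases hp), fun _ => rfl⟩
  | @snoc t c c' e h1 h2 ih =>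
    obtain ⟨V, hV⟩ := h1.exists_arg
    have hinv := reach_inv h1 hV
    rw [memAfter_snoc]
    have keep : (∀ X c, e.act ≠ .resWrite X c) → mem c' X = mem c X →
        (∀ p v, Written c' p X v ↔ Written c p X v) →
        (∀ p v, Written c' p X v → mem c' X = v) ∧
        ((∀ p v, ¬ Written c' p X v) → mem c' X = actMem (memAfter t) e.act X) := by
      intro k1 k2 k3
      rw [actMem_of_ne k1, k2]
      simp only [k3]
      exact ih
    cases hStep h2 with
    | invoke op hact hidle hused hmem hq hl hph hus =>
      refine keep (by simp [hact]) (by rw [hmem]) fun p v => ?_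
      unfold Written
      rw [hl, hph]
      by_cases hp : p = e.proc
      · subst hp; simp [hidle]
      · simp [hp]
    | call op l hact hp hmem hq hl hph hus =>
      refine keep (by rw [hact]; cases l <;> simp [Loc.cmd, Cmd.start]) (by rw [hmem]) fun p v => ?_
      unfold Written
      rw [hl, hph]
      by_cases hpe : p = e.proc
      · subst hpe
        simp only [Function.update_self, hp, reduceCtorEq, false_and, exists_false, iff_false]
        rintro ⟨op', a, l', h3, h4, h5⟩
        cases h3
        rw [h4] at h5
        simp only [Cmd.toCall, start] at h5
        by_cases hm : (lockMode op.name (.write X v)).isSome <;> simp [hm] at h5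
      · simp [hpe]
    | prim op l ℓ hact hp hprim hl hph hus =>
      have hw : ∀ p v, p ≠ e.proc → (Written c' p X v ↔ Written c p X v) := by
        intro p v hpe
        unfold Written
        rw [hl, hph, Function.update_of_ne hpe]
      have hself : ∀ v, Written c' e.proc X v ↔ l.cmd = .write X v ∧ ℓ.pc = .release := by
        intro v
        unfold Written
        rw [hl, hph, Function.update_self, hp]
        constructor
        · rintro ⟨op', a, l', h3, h4, h5⟩
          cases h3
          exact ⟨h4, h5⟩
        · rintro ⟨h4, h5⟩
          exact ⟨_, _, _, rfl, h4, h5⟩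
      have hold : ∀ v, Written c e.proc X v ↔ l.cmd = .write X v ∧ (loc c e.proc).pc = .release := by
        intro v
        unfold Written
        rw [hp]
        constructor
        · rintro ⟨op', a, l', h3, h4, h5⟩
          cases h3
          exact ⟨h4, h5⟩
        · rintro ⟨h4, h5⟩
          exact ⟨_, _, _, rfl, h4, h5⟩
      have kk : mem c' X = mem c X →
          (∀ v, l.cmd = .write X v → (ℓ.pc = .release ↔ (loc c e.proc).pc = .release)) →
          (∀ p v, Written c' p X v → mem c' X = v) ∧
          ((∀ p v, ¬ Written c' p X v) → mem c' X = actMem (memAfter t) e.act X) := by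
        intro k1 k2
        refine keep (by simp [hact]) k1 fun p v => ?_
        by_cases hpe : p = e.proc
        · subst hpe
          rw [hself, hold]
          exact and_congr_right (k2 v)
        · exact hw p v hpe
      generalize hm' : mem c' = m' at *
      generalize hq' : queue c' = q' at *
      have hcall : (loc c e.proc).call = l.cmd.toCall := by
        have := hinv.proc e.proc
        rw [hp] at this
        exact this.1
      cases hprim with
      | request Y hY hpc => exact kk rfl (by simp [hpc])
      | grant Y hY hpc => exact kk rfl (by simp [hpc])
      | spin Y hY hpc => exact kk rfl (by simp)
      | read Y hY hpc =>
        refine kk rfl fun v hv => ?_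
        rw [hcall, hv] at hY
        cases hY
      | unlock Y hY => exact kk rfl (by simp)
      | write Y w hY hpc =>
        have hlc : l.cmd = .write Y w := Cmd.toCall_inj.2.1 Y w (hcall.symm.trans hY)
        by_cases hYX : Y = X
        · subst hYX
          refine ⟨fun p v hpv => ?_, fun hno => absurd ((hself w).2 ⟨hlc, rfl⟩) (hno _ _)⟩
          rw [Function.update_self]
          by_cases hpe : p = e.proc
          · subst hpe
            have := ((hself v).1 hpv).1
            rw [hlc] at this
            cases this
            rfl
          · obtain ⟨op', a, l', h3, h4, h5⟩ := (hw p v hpe).1 hpv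
            -- Two writers at the same time would both be first at the head.
            exact absurd ((hinv.first_of_write h3 h4).unique (hinv.first_of_write hp hlc)) hpe
        · refine kk (Function.update_of_ne (Ne.symm hYX) _ _) fun v hv => ?_
          rw [hlc] at hv
          cases hv
          exact absurd rfl hYX
    | ret op l hact hp hold hc hmem hq hl hph hus =>
      have hcall : (loc c e.proc).call = l.cmd.toCall := by
        have := hinv.proc e.proc
        rw [hp] at this
        exact this.1
      have hw : ∀ p v, p ≠ e.proc → (Written c' p X v ↔ Written c p X v) := by
        intro p v hpe
        unfold Written
        rw [hl, hph, Function.update_of_ne hpe]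
      have hself : ∀ v, ¬ Written c' e.proc X v := by
        rintro v ⟨op', a, l', h3, -⟩
        rw [hph, Function.update_self] at h3
        unfold Phase.after at h3
        split at h3 <;> cases h3
      have hno : (∀ v, l.cmd ≠ .write X v) → ∀ v, ¬ Written c e.proc X v := by
        rintro hne v ⟨op', a, l', h3, h4, -⟩
        rw [hp] at h3
        cases h3
        exact hne v h4
      rw [hmem]
      by_cases hlc : ∃ v, l.cmd = .write X v
      · obtain ⟨v, hlc⟩ := hlc
        have hpc : (loc c e.proc).pc = .release :=
          hc.resolve_left (by rw [hcall, hlc]; simp [Cmd.toCall])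
        have hv := ih.1 e.proc v ⟨op, e.oid, l, hp, hlc, hpc⟩
        refine ⟨fun p w hpw => ?_, fun _ => ?_⟩
        · by_cases hpe : p = e.proc
          · subst hpe; exact absurd hpw (hself w)
          · exact ih.1 p w ((hw p w hpe).1 hpw)
        · rw [hact, hlc, hv]
          simp [Cmd.finish, actMem]
      · push Not at hlc
        have hiff : ∀ p v, Written c' p X v ↔ Written c p X v := by
          intro p v
          by_cases hpe : p = e.proc
          · subst hpe
            exact iff_of_false (hself v) (hno hlc v)
          · exact hw p v hpe
        simp only [hiff]
        have : actMem (memAfter t) e.act X = memAfter t X := by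
          rw [hact]
          cases hk : l.cmd with
          | write Y v =>
            have hYX : X ≠ Y := by
              rintro rfl
              exact hlc v hk
            exact Function.update_of_ne hYX _ _
          | _ => rfl
        rw [this]
        exact ih

/-- Steps of a read do not change the memory, from which the value is read. -/
theorem read_steps {M : Obj → Cell} {s : List (Event n)}
    (hs : ∀ e ∈ s, e = ⟨p, a, .step⟩) {c d : Config (handOverHand n)}
    (h : Run (handOverHand n) c s d) (hm : mem c = M) (hcall : (loc c p).call = .read X)
    (hpc : (loc c p).pc ≠ .release) :
    mem d = M ∧ d.phase = c.phase ∧ (loc d p).call = .read X ∧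
      ((loc d p).pc = .release → (loc d p).out = M X) := by
  induction h with
  | nil => exact ⟨hm, rfl, hcall, fun h => absurd h hpc⟩
  | @snoc d d' s e h1 h2 ih =>
    obtain ⟨i1, i2, i3, i4⟩ := ih (fun e he => hs e (by simp [he]))
    have he := hs e (by simp)
    subst he
    cases hStep h2 with
    | invoke op hact => cases hact
    | call op l hact => cases l <;> cases hact
    | ret op l hact => cases l <;> cases hact
    | prim op l ℓ hact hp hprim hl hph hus =>
      rw [hph, hl, Function.update_self, i2]
      generalize hm' : mem d' = m' at *
      generalize hq' : queue d' = q' at *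
      dsimp only at hprim
      cases hprim with
      | request Y hY hpc => exact ⟨i1, rfl, i3, by simp⟩
      | grant Y hY hpc => exact ⟨i1, rfl, i3, by simp⟩
      | spin Y hY hpc => exact ⟨i1, rfl, i3, i4⟩
      | unlock Y hY => exact ⟨i1, rfl, i3, i4⟩
      | write Y w hY hpc => rw [i3] at hY; cases hY
      | read Y hY hpc =>
        rw [i3] at hY
        cases hY
        rw [← i1]
        split <;> exact ⟨rfl, rfl, i3, fun _ => rfl⟩

/-- No call is under way at the start and each read returns before the next event, so no write can
slip in and the memory remains `M`. -/
theorem read_sequence {t ρ : List (Event n)} (hρ : ReadSequence ρ) {M : Obj → Cell}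
    (hidle : ∀ c, Reach (handOverHand n) t c → mem c = M ∧ ∀ p op a l, c.phase p ≠ .busy op a l)
    {d : Config (handOverHand n)} (h : Reach (handOverHand n) (t ++ ρ) d) :
    (mem d = M ∧ ∀ p op a l, d.phase p ≠ .busy op a l) ∧
      ∀ e ∈ ρ, ∀ X v, e.act = .resRead X v → v = M X := by
  induction hρ generalizing d with
  | nil => exact ⟨hidle d (by simpa using h), by simp⟩
  | @invoke ρ p a op hρ ih =>
    rw [← List.append_assoc] at h
    obtain ⟨c, hc, hs⟩ := h.inv_snoc
    obtain ⟨⟨i1, i2⟩, i3⟩ := ih hc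
    refine ⟨?_, fun e he X v hact => ?_⟩
    · cases hStep hs with
      | invoke op' hact hp hused hmem hq hl hph =>
        refine ⟨hmem.trans i1, fun p' op'' a' l' hp' => ?_⟩
        rw [hph] at hp'
        by_cases hpp : p' = p
        · subst hpp; simp at hp'
        · exact i2 p' op'' a' l' (by simpa [hpp] using hp')
      | call op l hact => cases l <;> cases hact
      | ret op l hact => cases l <;> cases hact
      | prim op l ℓ hact => cases hact
    · rcases List.mem_append.1 he with he | he
      · exact i3 e he X v hact
      · rw [List.mem_singleton.1 he] at hact; cases hact
  | @read ρ s p a X v hρ hs ih =>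
    have happ : t ++ (ρ ++ ⟨p, a, .invRead X⟩ :: (s ++ [⟨p, a, .resRead X v⟩])) =
        (t ++ ρ ++ [⟨p, a, .invRead X⟩] ++ s) ++ [⟨p, a, .resRead X v⟩] := by
      simp only [List.append_assoc, List.cons_append, List.nil_append]
    rw [happ] at h
    obtain ⟨d₃, hd₃, hstep₃⟩ := h.inv_snoc
    obtain ⟨d₂, hd₂, hrun⟩ := hd₃.split
    obtain ⟨d₁, hd₁, hstep₁⟩ := hd₂.inv_snoc
    obtain ⟨⟨i1, i2⟩, i3⟩ := ih hd₁
    have h1 : ∃ op l, l.cmd = .read X ∧ d₂.phase = Function.update d₁.phase p (.busy op a l) ∧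
        mem d₂ = M ∧ (loc d₂ p).call = .read X ∧ (loc d₂ p).pc ≠ .release := by
      cases hStep hstep₁ with
      | invoke op hact => cases hact
      | ret op l hact => cases l <;> cases hact
      | prim op l ℓ hact => cases hact
      | call op l hact hp hmem hq hl hph =>
        have hlc : l.cmd = .read X := by
          cases hk : l.cmd <;> rw [hk] at hact <;> cases hact
          rfl
        refine ⟨op, l, hlc, hph, hmem.trans i1, ?_, ?_⟩
        · rw [hl, hlc]; simp [Cmd.toCall, start]
        · rw [hl, hlc]
          simp only [Function.update_self, Cmd.toCall, start]
          by_cases hm : (lockMode op.name (.read X)).isSome <;> simp [hm]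
    obtain ⟨op, l, hlc, hph, hm, hcall, hpc⟩ := h1
    obtain ⟨j1, j2, j3, j4⟩ := read_steps hs hrun hm hcall hpc
    cases hStep hstep₃ with
    | invoke op hact => cases hact
    | call op l hact => cases l <;> cases hact
    | prim op l ℓ hact => cases hact
    | ret op' l' hact hp hold hc hmem hq hl hph' =>
      dsimp only at hact hp hc hph'
      have hout : v = (loc d₃ p).out := (Cmd.finish_eq_resRead hact.symm).2
      have hrel : (loc d₃ p).pc = .release := hc.resolve_left (by rw [j3]; simp)
      refine ⟨⟨hmem.trans j1, fun p' op'' a' l'' hp' => ?_⟩, fun e he Y w hw => ?_⟩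
      · rw [hph', j2, hph] at hp'
        by_cases hpp : p' = p
        · subst hpp
          rw [Function.update_self] at hp'
          unfold Phase.after at hp'
          split at hp' <;> cases hp'
        · exact i2 p' op'' a' l'' (by simpa [hpp] using hp')
      · rcases List.mem_append.1 he with he | he
        · exact i3 e he Y w hw
        · rcases List.mem_cons.1 he with rfl | he
          · cases hw
          · rcases List.mem_append.1 he with he | he
            · rw [hs e he] at hw; cases hw
            · rw [List.mem_singleton.1 he] at hw
              cases hw
              rw [hout, j4 hrel]

/-- When all operations have returned, no write is between its primitive and its return, and
`mem_eq` identifies the memory. -/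
theorem obedient : Obedient (handOverHand n) := by
  rintro t ρ ⟨c, hc⟩ hcomp - hρ e he X v hact
  have hna : nonAborted t = t := by
    unfold nonAborted
    rw [List.filter_eq_self]
    intro e he
    obtain ⟨d, hd, -⟩ := hc.split
    simpa using pessimistic t ⟨d, hd⟩ e.oid
  rw [hna]
  refine (read_sequence (M := memAfter t) hρ (fun d hd => ?_) hc).2 e he X v hact
  have hno : ∀ p op a l, d.phase p ≠ .busy op a l := by
    intro p op a l hp
    have hst := hd.pending_invoked (s := .busy l) hp trivial
    rcases hcomp a hst.invoked.appears with ⟨r, hr⟩ | hab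
    · cases (hst.responded r).1 hr
    · cases hst.aborted.1 hab
  refine ⟨funext fun X => (mem_eq hd X).2 ?_, hno⟩
  rintro p v ⟨op, a, l, hp, -⟩
  exact hno p op a l hp

end HandOverHand

theorem Reach.oid_ne_of_responded (h : Reach I t c)
    {r : Bool} (ha : Responded t a r) (p : Fin n) : (c.phase p).oid ≠ some a := by
  intro hp
  have hap : Appears t a := Committed.appears ⟨r, ha⟩
  obtain ⟨p', op, s, hs⟩ := h.traceInv.state a hap
  have := (hs.responded r).1 ha
  subst this
  exact (hs.only p hp).2

theorem Step.resOp (h : Step I c e c') {r : Bool}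
    (he : e.act = .resOp r) : ∃ op, c.phase e.proc = .busy op e.oid (.done r) := by
  cases h with
  | ret p op a l v hp hn =>
    have := Loc.cmd_eq_ret (Cmd.finish_eq_resOp he)
    subst this
    exact ⟨op, hp⟩
  | call p op a l => cases l <;> cases he
  | _ => cases he

theorem Step.invOp (h : Step I c e c')
    (he : e.act = .invOp op) : e.oid ∉ c.used ∧ e.oid ∈ c'.used := by
  cases h with
  | invoke p op a hp ha => exact ⟨ha, Finset.mem_insert_self _ _⟩
  | call p op a l => cases l <;> cases he
  | ret p op a l => cases l <;> cases he
  | _ => cases he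

theorem Step.used_mono (h : Step I c e c') : c.used ⊆ c'.used := by
  cases h with
  | invoke p op a hp ha => exact Finset.subset_insert _ _
  | _ => exact subset_rfl

/-! ### Linearization points of the hand-over-hand implementation. -/

namespace HandOverHand

/-- Process `p` is in operation `op` with identifier `a`, at the control point `l`, if the effect
of its current call is taken into account. -/
def View (c : Config (handOverHand n)) (p : Fin n) (op : SetOp) (a : ℕ) (l : Loc) : Prop :=
  c.phase p = .ready op a l ∨ ∃ l₀, c.phase p = .busy op a l₀ ∧ l = eff op a l₀ (loc c p)

theorem View.oid {c : Config (handOverHand n)}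
    (h : View c p op a l) : (c.phase p).oid = some a := by
  rcases h with h | ⟨l₀, h, -⟩ <;> rw [h] <;> rfl

theorem View.eq {c : Config (handOverHand n)} {op op' : SetOp} {a a' : ℕ} {l l' : Loc}
    (h : View c p op a l) (h' : View c p op' a' l') : op' = op ∧ a' = a ∧ l' = l := by
  rcases h with h | ⟨l₀, h, rfl⟩ <;> rcases h' with h' | ⟨l₀', h', rfl⟩ <;> rw [h] at h' <;>
    cases h' <;> exact ⟨rfl, rfl, rfl⟩

theorem Inv.view {c : Config (handOverHand n)} (hi : Inv V c)
 (h : View c p op a l) (hl : ∀ r, l.cmd ≠ .ret r) :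
    LocInv V (mem c) (queue c) p op a l (loc c p).held := by
  have hp := hi.proc p
  rcases h with h | ⟨l₀, h, rfl⟩ <;> rw [h] at hp
  · exact hp.2
  · cases hk : l₀.cmd with
    | ret r => rw [eff_ret hk] at hl; exact absurd hk (hl r)
    | read X => exact (hp.2.2 X (by rw [hk]; rfl)).loc
    | write X v => exact (hp.2.2 X (by rw [hk]; rfl)).loc

/-- A process applies the primitive that reads `X` or writes to `X` in a call at `l`. -/
structure AccessAt (c c' : Config (handOverHand n)) (e : Event n) (op : SetOp) (l l' : Loc) :
    Prop where
  act : e.act = .step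
  busy : c.phase e.proc = .busy op e.oid l
  pc : (loc c e.proc).pc = .access
  before : View c e.proc op e.oid l
  after : (View c' e.proc op e.oid l')

/-- The steps, by their effect on the memory and the control points. -/
inductive VStep (c c' : Config (handOverHand n)) (e : Event n) : Prop
  | invoke : mem c' = mem c → e.oid ∉ c.used →
      (∀ op a l, View c' e.proc op a l → a = e.oid ∧ l = .start) → VStep c c' e
  | neutral : mem c' = mem c → (∀ op a l, View c' e.proc op a l → View c e.proc op a l) →
      (∀ op l, c.phase e.proc = .busy op e.oid l → e.act = .step → (loc c e.proc).pc ≠ .access) →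
      VStep c c' e
  | read (op : SetOp) (l : Loc) (X : Obj) : l.cmd = .read X →
      AccessAt c c' e op l (l.afterRead op e.oid (mem c X)) → mem c' = mem c → VStep c c' e
  | write (op : SetOp) (l : Loc) (X : Obj) (v : Cell) : l.cmd = .write X v →
      AccessAt c c' e op l l.afterWrite → mem c' = Function.update (mem c) X v → VStep c c' e

theorem vStep {c c' : Config (handOverHand n)} (hi : Inv V c) (h : Step (handOverHand n) c e c') :
    VStep c c' e ∧ ∀ p ≠ e.proc, ∀ op a l, View c' p op a l ↔ View c p op a l := by
  have hcall : ∀ op l, c.phase e.proc = .busy op e.oid l → (loc c e.proc).call = l.cmd.toCall := by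
    intro op l hp
    have := hi.proc e.proc
    rw [hp] at this
    exact this.1
  have others : ∀ (hph : ∀ p ≠ e.proc, c'.phase p = c.phase p)
      (hl : ∀ p ≠ e.proc, loc c' p = loc c p), ∀ p ≠ e.proc, ∀ op a l,
      View c' p op a l ↔ View c p op a l := by
    intro hph hl p hp op a l
    unfold View
    rw [hph p hp, hl p hp]
  cases hStep h with
  | invoke op hact hidle hused hmem hq hl hph hus =>
    refine ⟨.invoke hmem hused fun op a l hv => ?_, others (fun p hp => by simp [hph, hp])
      (fun p hp => by rw [hl])⟩
    unfold View at hv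
    rw [hph, Function.update_self] at hv
    rcases hv with hv | ⟨l₀, hv, -⟩ <;> cases hv
    exact ⟨rfl, rfl⟩
  | call op l hact hp hmem hq hl hph hus =>
    refine ⟨.neutral hmem (fun op' a l' hv => ?_) (fun op' l' hp' => ?_),
      others (fun p hp => by simp [hph, hp]) (fun p hp => by simp [hl, hp])⟩
    · unfold View at hv
      rw [hph, hl, Function.update_self, Function.update_self] at hv
      rcases hv with hv | ⟨l₀, hv, rfl⟩
      · cases hv
      · cases hv
        left
        rw [hp]
        cases hk : l.cmd with
        | ret r => rw [eff_ret hk]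
        | read X =>
          rw [eff_of_ne]
          simp only [Cmd.toCall, start]
          by_cases hm : (lockMode op.name (.read X)).isSome <;> simp [hm]
        | write X v =>
          rw [eff_of_ne]
          simp only [Cmd.toCall, start]
          by_cases hm : (lockMode op.name (.write X v)).isSome <;> simp [hm]
    · rw [hp] at hp'; cases hp'
  | prim op l ℓ hact hp hprim hl hph hus =>
    refine ⟨?_, others (fun p _ => by rw [hph]) (fun p hp => by simp [hl, hp])⟩
    have hview : ∀ op' a l', View c' e.proc op' a l' ↔
        op' = op ∧ a = e.oid ∧ l' = eff op e.oid l ℓ := by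
      intro op' a l'
      unfold View
      rw [hph, hl, Function.update_self, hp]
      constructor
      · rintro (hv | ⟨l₀, hv, rfl⟩)
        · cases hv
        · cases hv; exact ⟨rfl, rfl, rfl⟩
      · rintro ⟨rfl, rfl, rfl⟩
        exact Or.inr ⟨l, rfl, rfl⟩
    have hold : View c e.proc op e.oid (eff op e.oid l (loc c e.proc)) := Or.inr ⟨l, hp, rfl⟩
    have neu : eff op e.oid l ℓ = eff op e.oid l (loc c e.proc) → (loc c e.proc).pc ≠ .access →
        mem c' = mem c → VStep c c' e := by
      intro h1 h2 h3
      refine .neutral h3 (fun op' a l' hv => ?_) (fun _ _ _ _ => h2)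
      obtain ⟨rfl, rfl, rfl⟩ := (hview op' a l').1 hv
      rw [h1]
      exact hold
    generalize hm' : mem c' = m' at *
    generalize hq' : queue c' = q' at *
    cases hprim with
    | request Y hY hpc =>
      exact neu (by rw [eff_of_ne (by simp), eff_of_ne (by simp [hpc])]) (by simp [hpc]) rfl
    | grant Y hY hpc =>
      exact neu (by rw [eff_of_ne (by simp), eff_of_ne (by simp [hpc])]) (by simp [hpc]) rfl
    | spin Y hY hpc => exact neu rfl (by simp [hpc]) rfl
    | unlock Y hY hold' =>
      refine neu (eff_congr rfl rfl) (fun hpc => ?_) rfl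
      rcases hY with hY | hY
      · have := hi.proc e.proc
        rw [hp] at this
        rw [(this.2.1 (by rw [← hcall op l hp, hY])).2] at hpc
        cases hpc
      · rw [hY] at hpc; cases hpc
    | read X hX hpc =>
      have hlc : l.cmd = .read X := Cmd.toCall_inj.1 X ((hcall op l hp).symm.trans hX)
      rw [eff_of_ne (by simp [hpc])] at hold
      refine .read op l X hlc ⟨hact, hp, hpc, hold, ?_⟩ hm'
      refine (hview _ _ _).2 ⟨rfl, rfl, ?_⟩
      rw [eff_read (by split <;> rfl) hlc]
      split <;> rfl
    | write X v hX hpc =>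
      have hlc : l.cmd = .write X v := Cmd.toCall_inj.2.1 X v ((hcall op l hp).symm.trans hX)
      rw [eff_of_ne (by simp [hpc])] at hold
      refine .write op l X v hlc ⟨hact, hp, hpc, hold, ?_⟩ hm'
      exact (hview _ _ _).2 ⟨rfl, rfl, by rw [eff_write rfl hlc]⟩
  | ret op l hact hp hold hc hmem hq hl hph hus =>
    refine ⟨.neutral hmem (fun op' a l' hv => ?_) (fun op' l' hp' => ?_),
      others (fun p hp => by simp [hph, hp]) (fun p hp => by rw [hl])⟩
    · unfold View at hv
      rw [hph, Function.update_self] at hv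
      have hpc : (∀ r, l.cmd ≠ .ret r) → (loc c e.proc).pc = .release := by
        intro hr
        refine hc.resolve_left ?_
        rw [hcall op l hp]
        cases hk : l.cmd with
        | ret r => exact absurd hk (hr r)
        | read X => simp [Cmd.toCall]
        | write X v => simp [Cmd.toCall]
      cases hk : l.cmd with
      | ret r =>
        simp only [Phase.after, hk] at hv
        rcases hv with hv | ⟨l₀, hv, -⟩ <;> cases hv
      | read X =>
        simp only [Phase.after, hk] at hv
        rcases hv with hv | ⟨l₀, hv, -⟩ <;> cases hv
        exact Or.inr ⟨l, hp, by rw [eff_read (hpc (by simp [hk])) hk]⟩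
      | write X v =>
        simp only [Phase.after, hk] at hv
        rcases hv with hv | ⟨l₀, hv, -⟩ <;> cases hv
        exact Or.inr ⟨l, hp, by rw [eff_write (hpc (by simp [hk])) hk]⟩
    · rw [hact]; cases l <;> simp [Loc.cmd, Cmd.finish]

/-- The configurations of an execution, and the parameters of its operations. -/
structure Trace (V : ℕ → ℤ) (t : List (Event n)) (cs : ℕ → Config (handOverHand n)) : Prop where
  init : cs 0 = Config.initial (handOverHand n)
  step : ∀ i (hi : i < t.length), Step (handOverHand n) (cs i) t[i] (cs (i + 1))
  reach : ∀ i ≤ t.length, Reach (handOverHand n) (t.take i) (cs i)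
  arg : ∀ a op, Invoked t a op → V a = op.arg

/-- An operation that returns `r` and leaves the set unchanged. -/
def ReadOnly (V : ℕ → ℤ) (m : Obj → Cell) (op : SetOp) (r : Bool) : Prop :=
  ∀ q, Abs V m q → SetDelta q op q r

/-- The step number `i` is the one at which the operation `a` changes the set. -/
def UpdateAt (t : List (Event n)) (cs : ℕ → Config (handOverHand n)) (i a : ℕ) (op : SetOp) :
    Prop :=
  ∃ hi : i < t.length, t[i].oid = a ∧ ∃ l X v, l.cmd = .write X v ∧ l.IsUpdate ∧
    AccessAt (cs i) (cs (i + 1)) t[i] op l l.afterWrite ∧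
    mem (cs (i + 1)) = Function.update (mem (cs i)) X v

section

variable {cs : ℕ → Config (handOverHand n)}

theorem Trace.invoked_take (_ : Trace V t cs) {i a : ℕ}
    (ha : Invoked (t.take i) a op) : Invoked t a op :=
  let ⟨e, he, h⟩ := ha
  ⟨e, List.mem_of_mem_take he, h⟩

theorem Trace.inv (h : Trace V t cs) {i : ℕ} (hi : i ≤ t.length) : Inv V (cs i) :=
  reach_inv (h.reach i hi) fun a op ha => h.arg a op (h.invoked_take ha)

theorem Trace.used_mono (h : Trace V t cs) {j i : ℕ} (hji : j ≤ i) (hi : i ≤ t.length) :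
    (cs j).used ⊆ (cs i).used := by
  induction i, hji using Nat.le_induction with
  | base => exact subset_rfl
  | succ i hji ih => exact (ih (by omega)).trans (h.step i (by omega)).used_mono

theorem Trace.view_used (h : Trace V t cs) {i : ℕ} (hi : i ≤ t.length)
 (hv : View (cs i) p op a l) : a ∈ (cs i).used :=
  (h.reach i hi).traceInv.pending p a hv.oid

theorem Trace.view_invoked (h : Trace V t cs) {i : ℕ} (hi : i ≤ t.length)
 (hv : View (cs i) p op a l) : Invoked t a op := by
  rcases hv with hv | ⟨l₀, hv, -⟩
  · exact h.invoked_take ((h.reach i hi).pending_invoked (s := .ready l) hv trivial).invoked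
  · exact h.invoked_take ((h.reach i hi).pending_invoked (s := .busy l₀) hv trivial).invoked

theorem Trace.locOK (h : Trace V t cs) {i : ℕ} (hi : i ≤ t.length)
 (hv : View (cs i) p op a l) (hl : ∀ r, l.cmd ≠ .ret r) (hs : l ≠ .start)
    (hn : op.name ≠ .contains) :
    ∃ m₀, WF V m₀ ∧ ¬ Made m₀ (.node a) ∧ LocOK V op a l m₀ (mem (cs i)) :=
  (((h.inv hi).view hv hl).upd hn hs).2.2

theorem Trace.write_facts (h : Trace V t cs) {i : ℕ} (hi : i < t.length) {l l' : Loc}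
 {v : Cell} (hl : l.cmd = .write X v) (ha : AccessAt (cs i) (cs (i + 1)) t[i] op l l') :
    X ≠ .tail ∧ v.val = rank V X ∧
    ((¬ l.IsUpdate ∧ ¬ Made (mem (cs i)) X ∧
        ∀ Z, Linked (Function.update (mem (cs i)) X v) Z ↔ Linked (mem (cs i)) Z) ∨
      (l.IsUpdate ∧ l.afterWrite = .done true ∧ Linked (Function.update (mem (cs i)) X v) X ∧
        ∀ q, Abs V (mem (cs i)) q →
          ∃ q', Abs V (Function.update (mem (cs i)) X v) q' ∧ SetDelta q op q' true)) := by
  have hn : op.name ≠ .contains := fun hn =>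
    ((h.inv hi.le).busy (X := X) ha.busy (by rw [hl]; rfl)).2.read_only hn _ _ hl
  obtain ⟨m₀, h1, h2, h3⟩ := h.locOK hi.le ha.before (by simp [hl]) (by rintro rfl; cases hl) hn
  obtain ⟨w1, w2, -, -, w3⟩ :=
    h3.write_facts h1 h2 (h.arg _ _ (h.view_invoked hi.le ha.before)) hl
  exact ⟨w1, w2, w3.imp id fun w => ⟨w.1, w.2.1, w.2.2.2.1, w.2.2.2.2⟩⟩

/-- Hindsight: an element that was linked had, at a later time at which it was linked, the
contents that it has now. -/
theorem Trace.hindsight (h : Trace V t cs) {j i : ℕ} (hji : j ≤ i) (hi : i ≤ t.length)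
    (hX : Linked (mem (cs j)) X) :
    ∃ k, j ≤ k ∧ k ≤ i ∧ Linked (mem (cs k)) X ∧ mem (cs k) X = mem (cs i) X ∧
      Made (mem (cs i)) X := by
  induction i, hji using Nat.le_induction with
  | base => exact ⟨j, le_rfl, le_rfl, hX, rfl, hX.made (h.inv hi).wf⟩
  | succ i hji ih =>
    obtain ⟨k, h1, h2, h3, h4, h5⟩ := ih (by omega)
    have hi' : i < t.length := hi
    cases (vStep (h.inv hi'.le) (h.step i hi')).1 with
    | invoke hm => exact ⟨k, h1, h2.trans i.le_succ, h3, by rw [hm, h4], by rwa [hm]⟩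
    | neutral hm => exact ⟨k, h1, h2.trans i.le_succ, h3, by rw [hm, h4], by rwa [hm]⟩
    | read _ _ _ _ _ hm => exact ⟨k, h1, h2.trans i.le_succ, h3, by rw [hm, h4], by rwa [hm]⟩
    | write op l Y v hl ha hm =>
      obtain ⟨w1, w2, w3⟩ := h.write_facts hi' hl ha
      rw [hm]
      -- The element `X` is made already, so a write to it comes from the update of a predecessor,
      -- which is linked also after the write: the moment just after serves. Every other write
      -- leaves the contents of `X` alone. In particular an element off the list is not written
      -- again.
      by_cases hYX : Y = X
      · subst hYX
        rcases w3 with ⟨-, hno, -⟩ | ⟨-, -, hlk, -⟩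
        · exact absurd h5 hno
        · rw [← hm] at hlk ⊢
          exact ⟨i + 1, by omega, le_rfl, hlk, rfl, hlk.made (h.inv hi).wf⟩
      · exact ⟨k, h1, h2.trans i.le_succ, h3,
          by rw [Function.update_of_ne (Ne.symm hYX), h4], h5.update w1 w2⟩

/-- The represented set changes only at writes from an `update` control point: reads and lock
primitives keep the memory, and the write to a new node keeps the list. -/
theorem Trace.abs_step (h : Trace V t cs) {i : ℕ} (hi : i < t.length) {q : Finset ℤ}
    (hq : Abs V (mem (cs i)) q) :
    (Abs V (mem (cs (i + 1))) q ∧ ∀ a op, ¬ UpdateAt t cs i a op) ∨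
      ∃ a op q', UpdateAt t cs i a op ∧ Abs V (mem (cs (i + 1))) q' ∧ SetDelta q op q' true := by
  cases (vStep (h.inv hi.le) (h.step i hi)).1 with
  | write op l X v hl ha hm =>
    obtain ⟨-, -, w3⟩ := h.write_facts hi hl ha
    rcases w3 with ⟨w3, -, w4⟩ | ⟨w3, -, -, w4⟩
    · left
      rw [hm]
      refine ⟨hq.congr w4, fun a op' ⟨_, h1, l', X', v', h2, h3, h4, h5⟩ => w3 ?_⟩
      have h6 := ha.busy
      rw [h4.busy] at h6
      cases h6
      exact h3
    · right
      obtain ⟨q', hq', hd⟩ := w4 q hq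
      exact ⟨_, op, q', ⟨hi, rfl, l, X, v, hl, w3, ha, hm⟩, by rwa [hm], hd⟩
  | invoke hm hu =>
    refine Or.inl ⟨by rwa [hm], fun a op ⟨_, h1, l', X', v', h2, h3, h4, h5⟩ => hu ?_⟩
    exact h.view_used hi.le h4.before
  | neutral hm _ hv =>
    exact Or.inl ⟨by rwa [hm], fun a op ⟨_, h1, l', X', v', h2, h3, h4, h5⟩ =>
      hv _ _ h4.busy h4.act h4.pc⟩
  | read op l X hl ha hm =>
    refine Or.inl ⟨by rwa [hm], fun a op' ⟨_, h1, l', X', v', h2, h3, h4, h5⟩ => ?_⟩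
    have h6 := ha.busy
    rw [h4.busy] at h6
    cases h6
    rw [hl] at h2
    cases h2

end

end HandOverHand

namespace HandOverHand

variable {cs : ℕ → Config (handOverHand n)}

/-- The operation `a` has taken effect before the configuration `i`, with response `r`. -/
def Effective (V : ℕ → ℤ) (t : List (Event n)) (cs : ℕ → Config (handOverHand n)) (i a : ℕ)
    (op : SetOp) (r : Bool) : Prop :=
  (∃ j < i, UpdateAt t cs j a op ∧ r = true) ∨
    ∃ j ≤ i, a ∈ (cs j).used ∧ ReadOnly V (mem (cs j)) op r

theorem Effective.mono {i i' a : ℕ} {r : Bool} (h : Effective V t cs i a op r)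
    (hi : i ≤ i') : Effective V t cs i' a op r := by
  rcases h with ⟨j, hj, h⟩ | ⟨j, hj, h⟩
  · exact Or.inl ⟨j, by omega, h⟩
  · exact Or.inr ⟨j, by omega, h⟩

/-- The clause `traverse` is hindsight for `contains`: at some time since its invocation the last
element passed was on the list with the contents that were read. The clause `update` will exclude a
second update by the same operation. -/
structure PointInv (V : ℕ → ℤ) (t : List (Event n)) (cs : ℕ → Config (handOverHand n)) (i : ℕ) :
    Prop where
  traverse : ∀ p op a prev pcell curr, View (cs i) p op a (.traverse prev pcell curr) →
    op.name = .contains →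
    ∃ j ≤ i, a ∈ (cs j).used ∧ Linked (mem (cs j)) prev ∧ mem (cs j) prev = pcell
  done : ∀ p op a r, View (cs i) p op a (.done r) → Effective V t cs i a op r
  update : ∀ j < i, ∀ a op, UpdateAt t cs j a op → ∀ p op' l, View (cs i) p op' a l →
    l = .done true

theorem Trace.update_used (h : Trace V t cs) {j i a : ℕ} (hu : UpdateAt t cs j a op)
    (hji : j ≤ i) (hi : i ≤ t.length) : a ∈ (cs i).used := by
  obtain ⟨hj, rfl, l, X, v, h2, h3, h4, h5⟩ := hu
  exact h.used_mono hji hi (h.view_used hj.le h4.before)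

theorem readOnly_of_locOK {r : Bool} (h : LocOK V op a (.done r) m m) : ReadOnly V m op r := by
  intro q hq
  obtain ⟨q', hq', hd⟩ := Effect.delta h q hq
  rwa [hq'.unique hq] at hd

/-- The response of `contains`, from an earlier state in which the predecessor of the last element
that was read was linked. -/
theorem readOnly_contains {r : Bool} (hm : WF V m)
    {prev X : Obj} {c : Cell} (hn : op.name = .contains) (hp : Linked m prev) (ht : prev ≠ .tail)
    (hlt : (m prev).val < key op) (hX : (m prev).next = X) (hc : c.val = rank V X)
    (hr : Loc.afterRead op a (.traverse prev (m prev) X) c = .done r) : ReadOnly V m op r := by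
  -- Values of elements never change, so the cell `c`, read at another time, has the value that `X`
  -- has in the earlier memory `m`.
  have hcv : (m X).val = c.val := by rw [hc, ← hX, hm.val ((hp.next ht).made hm)]
  cases op with
  | insert v => cases hn
  | remove v => cases hn
  | contains v =>
    by_cases hcl : c.val < key (.contains v)
    · simp [Loc.afterRead, hcl] at hr
    · simp only [Loc.afterRead, if_neg hcl, Loc.done.injEq] at hr
      intro q hq
      refine ⟨rfl, ?_⟩
      have := Passed.mem_iff (op := .contains v) hm ⟨hp, ht, hlt⟩ (by rwa [hX, hcv]) hq
      rw [hX, hcv] at this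
      rw [← hr]
      exact decide_eq_decide.2 this.symm

theorem Trace.pointInv (h : Trace V t cs) {i : ℕ} (hi : i ≤ t.length) : PointInv V t cs i := by
  induction i with
  | zero =>
    have : ∀ p op a l, ¬ View (cs 0) p op a l := by
      intro p op a l hv
      have := hv.oid
      rw [h.init] at this
      cases this
    exact ⟨fun p op a _ _ _ hv => absurd hv (this _ _ _ _),
      fun p op a _ hv => absurd hv (this _ _ _ _), fun j hj => absurd hj (by omega)⟩
  | succ i ih =>
    have hi' : i < t.length := hi
    have ih := ih hi'.le
    have hinv := h.inv hi'.le
    obtain ⟨hstep, hother⟩ := vStep hinv (h.step i hi')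
    have lift : ∀ p op a l, View (cs i) p op a l →
        (∀ prev pcell curr, l = .traverse prev pcell curr → op.name = .contains →
          ∃ j ≤ i + 1, a ∈ (cs j).used ∧ Linked (mem (cs j)) prev ∧ mem (cs j) prev = pcell) ∧
        (∀ r, l = .done r → Effective V t cs (i + 1) a op r) := by
      intro p op a l hv
      refine ⟨?_, ?_⟩
      · rintro prev pcell curr rfl hn
        obtain ⟨j, hj, hh⟩ := ih.traverse p op a prev pcell curr hv hn
        exact ⟨j, by omega, hh⟩
      · rintro r rfl
        exact (ih.done p op a r hv).mono (by omega)
    -- it suffices to look at the process that took the step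
    have main : ∀ (hnoup : ∀ a op, ¬ UpdateAt t cs i a op),
        (∀ op a l, View (cs (i + 1)) t[i].proc op a l → View (cs i) t[i].proc op a l ∨
          ((∀ prev pcell curr, l = .traverse prev pcell curr → op.name = .contains →
            ∃ j ≤ i + 1, a ∈ (cs j).used ∧ Linked (mem (cs j)) prev ∧ mem (cs j) prev = pcell) ∧
          (∀ r, l = .done r → Effective V t cs (i + 1) a op r) ∧
          ∀ j < i, ∀ op', UpdateAt t cs j a op' → l = .done true)) → PointInv V t cs (i + 1) := by
      intro hnoup hnew
      have hnew' : ∀ p op a l, View (cs (i + 1)) p op a l → View (cs i) p op a l ∨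
          ((∀ prev pcell curr, l = .traverse prev pcell curr → op.name = .contains →
            ∃ j ≤ i + 1, a ∈ (cs j).used ∧ Linked (mem (cs j)) prev ∧ mem (cs j) prev = pcell) ∧
          (∀ r, l = .done r → Effective V t cs (i + 1) a op r) ∧
          ∀ j < i, ∀ op', UpdateAt t cs j a op' → l = .done true) := by
        intro p op a l hv
        by_cases hp : p = t[i].proc
        · subst hp; exact hnew _ _ _ hv
        · exact Or.inl ((hother p hp op a l).1 hv)
      refine ⟨fun p op a prev pcell curr hv hn => ?_, fun p op a r hv => ?_,
        fun j hj a op hu p op' l hv => ?_⟩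
      · rcases hnew' p op a _ hv with hv | hv
        · exact (lift _ _ _ _ hv).1 _ _ _ rfl hn
        · exact hv.1 _ _ _ rfl hn
      · rcases hnew' p op a _ hv with hv | hv
        · exact (lift _ _ _ _ hv).2 _ rfl
        · exact hv.2.1 _ rfl
      · have hji : j < i := by
          rcases Nat.lt_succ_iff_lt_or_eq.1 hj with hj | rfl
          · exact hj
          · exact absurd hu (hnoup a op)
        rcases hnew' p op' a _ hv with hv | hv
        · exact ih.update j hji a op hu p op' l hv
        · exact hv.2.2 j hji op hu
    cases hstep with
    | invoke hm hused hv =>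
      refine main (fun a op ⟨_, h1, l', X', v', h2, h3, h4, h5⟩ =>
        hused (h.view_used hi'.le h4.before)) fun op a l hv' => Or.inr ?_
      obtain ⟨rfl, rfl⟩ := hv _ _ _ hv'
      exact ⟨fun _ _ _ h => (by cases h), fun _ h => (by cases h),
        fun j hj op' hu => absurd (h.update_used hu hj.le hi'.le) hused⟩
    | neutral hm hv hno =>
      exact main (fun a op ⟨_, h1, l', X', v', h2, h3, h4, h5⟩ => hno _ _ h4.busy h4.act h4.pc)
        fun op a l hv' => Or.inl (hv _ _ _ hv')
    | read op l X hl ha hm =>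
      refine main (fun a op' ⟨_, h1, l', X', v', h2, h3, h4, h5⟩ => ?_)
        fun op' a l' hv' => Or.inr ?_
      · have h6 := ha.busy
        rw [h4.busy] at h6
        cases h6
        rw [hl] at h2
        cases h2
      · obtain ⟨rfl, rfl, rfl⟩ := ha.after.eq hv'
        have hau := h.view_used hi'.le ha.before
        have hcmd : ∀ r, l.cmd ≠ .ret r := by simp [hl]
        refine ⟨fun prev pcell curr he hn => ?_, fun r he => ?_, fun j hj op'' hu => ?_⟩
        · cases l with
          | start =>
            cases hl
            simp only [Loc.afterRead, Loc.traverse.injEq] at he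
            obtain ⟨rfl, rfl, rfl⟩ := he
            exact ⟨i, by omega, hau, Linked.head _, rfl⟩
          | traverse prev' pcell' curr' =>
            cases hl
            have hlt : (mem (cs i) X).val < key op' := by
              by_contra hlt
              cases op' with
              | contains v => simp [Loc.afterRead, hlt] at he
              | insert v => cases hn
              | remove v => cases hn
            simp only [Loc.afterRead, if_pos hlt, Loc.traverse.injEq] at he
            obtain ⟨rfl, rfl, rfl⟩ := he
            obtain ⟨j, hj, hj1, hj2, hj3⟩ := ih.traverse _ _ _ _ _ _ ha.before hn
            have hc := ((hinv.view ha.before (by simp [Loc.cmd])).cont hn (by simp)).2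
            obtain ⟨-, hc1, -, hc2, -⟩ := hc
            -- At time `j` the element `X` was on the list, as successor of the previous element;
            -- hindsight moves this to a time at which it was on the list with the contents just
            -- read.
            have hX : Linked (mem (cs j)) X := by
              have := hj2.next hc1
              rwa [hj3, hc2] at this
            obtain ⟨k, hk1, hk2, hk3, hk4, -⟩ := h.hindsight hj hi'.le hX
            exact ⟨k, by omega, h.used_mono hk1 (by omega) hj1, hk3, hk4⟩
          | _ => cases hl
        · by_cases hn : op'.name = .contains
          · cases l with
            | start => simp [Loc.afterRead] at he
            | traverse prev' pcell' curr' =>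
              cases hl
              obtain ⟨j, hj, hj1, hj2, hj3⟩ := ih.traverse _ _ _ _ _ _ ha.before hn
              have hc := ((hinv.view ha.before (by simp [Loc.cmd])).cont hn (by simp)).2
              obtain ⟨-, hc1, -, hc2, -, hc3, hc4⟩ := hc
              subst hj3
              -- The point of `contains` is the earlier time `j`: the last element passed was then
              -- linked and pointed to the element just read, whatever has become of both since.
              exact Or.inr ⟨j, by omega, hj1, readOnly_contains (h.inv (hj.trans hi'.le)).wf hn hj2 hc1
                hc4 hc2 (hinv.wf.val hc3) he⟩
            | _ => cases hl
          -- An insertion or removal without effect still holds the head, so the present memory is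
          -- the one that it has been reading, and its last read is its point.
          · refine Or.inr ⟨i, by omega, hau, ?_⟩
            cases l with
            | start => simp [Loc.afterRead] at he
            | traverse prev' pcell' curr' =>
              obtain ⟨m₀, h1, h2, h3⟩ := h.locOK hi'.le ha.before hcmd (by simp) hn
              obtain ⟨h4, h5, h6⟩ := h3.read h1 hl
              rw [← h4, he] at h6
              exact readOnly_of_locOK h6
            | _ => cases hl
        · have := ih.update j hj _ _ hu _ _ _ ha.before
          subst this
          cases hl
    | write op l X v hl ha hm =>
      have hau := h.view_used hi'.le ha.before
      obtain ⟨-, -, w3⟩ := h.write_facts hi' hl ha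
      have hdone : ∀ r, l.afterWrite = .done r → UpdateAt t cs i t[i].oid op ∧ r = true := by
        intro r hr
        have : l.IsUpdate := by
          cases l with
          | update => trivial
          | create => simp [Loc.afterWrite] at hr
          | _ => cases hl
        refine ⟨⟨hi', rfl, l, X, v, hl, this, ha, hm⟩, ?_⟩
        rcases w3 with ⟨w3, -⟩ | ⟨-, w3, -⟩
        · exact absurd this w3
        · rw [w3] at hr; cases hr; rfl
      have hself : ∀ a op', UpdateAt t cs i a op' → a = t[i].oid ∧ l.afterWrite = .done true := by
        rintro a op' ⟨_, h1, l', X', v', h2, h3, h4, h5⟩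
        have h6 := ha.busy
        rw [h4.busy] at h6
        cases h6
        refine ⟨h1.symm, ?_⟩
        rcases w3 with ⟨w3, -⟩ | ⟨-, w3, -⟩
        · exact absurd h3 w3
        · exact w3
      refine ⟨fun p op' a prev pcell curr hv hn => ?_, fun p op' a r hv => ?_,
        fun j hj a op' hu p op'' l' hv => ?_⟩
      · by_cases hp : p = t[i].proc
        · subst hp
          obtain ⟨rfl, rfl, h3⟩ := ha.after.eq hv
          cases l with
          | update => simp [Loc.afterWrite] at h3
          | create => simp [Loc.afterWrite] at h3
          | _ => cases hl
        · exact (lift _ _ _ _ ((hother p hp _ _ _).1 hv)).1 _ _ _ rfl hn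
      · by_cases hp : p = t[i].proc
        · subst hp
          obtain ⟨rfl, rfl, h3⟩ := ha.after.eq hv
          exact Or.inl ⟨i, by omega, hdone r h3.symm⟩
        · exact (lift _ _ _ _ ((hother p hp _ _ _).1 hv)).2 _ rfl
      · rcases Nat.lt_succ_iff_lt_or_eq.1 hj with hji | rfl
        · by_cases hp : p = t[i].proc
          · subst hp
            obtain ⟨rfl, rfl, h3⟩ := ha.after.eq hv
            have := ih.update j hji _ _ hu _ _ _ ha.before
            subst this
            cases hl
          · exact ih.update j hji _ _ hu _ _ _ ((hother p hp _ _ _).1 hv)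
        · obtain ⟨rfl, hd⟩ := hself a op' hu
          have : p = t[j].proc := (h.reach (j + 1) hi).pending_unique hv.oid ha.after.oid
          subst this
          rw [(ha.after.eq hv).2.2, hd]

/-- After its update an operation is at `done`, from where it cannot write. -/
theorem Trace.update_unique (h : Trace V t cs) {i j a : ℕ} {op op' : SetOp}
    (hi : UpdateAt t cs i a op) (hj : UpdateAt t cs j a op') : i = j := by
  have key : ∀ {i j : ℕ} {op op' : SetOp}, UpdateAt t cs i a op → UpdateAt t cs j a op' →
      ¬ i < j := by
    intro i j op op' hi hj hij
    obtain ⟨hj', rfl, l, X, v, h2, h3, h4, h5⟩ := hj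
    have := (h.pointInv hj'.le).update i hij _ _ hi _ _ _ h4.before
    subst this
    cases h2
  have := key hi hj
  have := key hj hi
  omega

theorem Trace.abs (h : Trace V t cs) {i : ℕ} (hi : i ≤ t.length) :
    ∃ q, Abs V (mem (cs i)) q := by
  induction i with
  | zero => rw [h.init]; exact ⟨∅, Abs.initMem V⟩
  | succ i ih =>
    obtain ⟨q, hq⟩ := ih (by omega)
    rcases h.abs_step hi hq with ⟨h1, -⟩ | ⟨_, _, q', _, h1, _⟩
    · exact ⟨q, h1⟩
    · exact ⟨q', h1⟩

/-- Every completed operation that does not change the set has a point, between its invocation and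
its response, at which it is consistent with the state of the set. -/
theorem Trace.exists_point (h : Trace V t cs) (ha : Committed t a) :
    ∃ op, Invoked t a op ∧ ((∃ j, UpdateAt t cs j a op) ∨
      ∃ r, ∃ j < t.length, Responded t a r ∧ a ∈ (cs j).used ∧ ReadOnly V (mem (cs j)) op r ∧
        ∀ (k : ℕ) (e : Event n) (r : Bool), t[k]? = some e → e.oid = a → e.act = .resOp r → j ≤ k) := by
  obtain ⟨r, e, he, hea, her⟩ := ha
  obtain ⟨k, hk, rfl⟩ := List.mem_iff_getElem.1 he
  obtain ⟨op, hp⟩ := (h.step k hk).resOp her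
  have hv : View (cs k) t[k].proc op t[k].oid (.done r) := Or.inr ⟨_, hp, by rw [eff_ret rfl]⟩
  subst hea
  refine ⟨op, h.view_invoked hk.le hv, ?_⟩
  rcases (h.pointInv hk.le).done _ _ _ _ hv with ⟨j, hj, hu, -⟩ | ⟨j, hj, hu, hro⟩
  · exact Or.inl ⟨j, hu⟩
  · refine Or.inr ⟨r, j, by omega, ⟨t[k], he, rfl, her⟩, hu, hro, fun k' e' r' hk' he' hr' => ?_⟩
    by_contra hlt
    refine (h.reach k hk.le).oid_ne_of_responded (a := t[k].oid) (r := r') ⟨e', ?_, he', hr'⟩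
      t[k].proc (by rw [hp]; rfl)
    have hlt' : k' < k := by omega
    exact List.mem_of_getElem? (i := k') (by rw [List.getElem?_take_of_lt hlt', hk'])

theorem setPath_readOnly {q : Finset ℤ} {l : List (SetOp × Bool)}
    (h : ∀ x ∈ l, SetDelta q x.1 q x.2) : SetPath q l q := by
  induction l with
  | nil => rfl
  | cons x l ih => exact ⟨q, h x (by simp), ih fun y hy => h y (by simp [hy])⟩

-- Operations that leave the set unchanged can be placed at a common point in any order. At the
-- event number `i` they come before the update performed by that event, because their responses are
-- judged in the memory before the event.
open Classical in
theorem linearizable (ht : IsExecution (handOverHand n) t) : Linearizable t := by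
  obtain ⟨c, hc⟩ := ht
  obtain ⟨V, hV⟩ := hc.exists_arg
  obtain ⟨cs, h1, h2, h3, h4⟩ := hc.configs
  have h : Trace V t cs := ⟨h1, h3, h4, hV⟩
  have hab := hc.traceInv
  -- the operations that do not change the set
  let P : ℕ → SetOp → Bool → ℕ → Prop := fun a op r j => Invoked t a op ∧ j < t.length ∧
    Responded t a r ∧ a ∈ (cs j).used ∧ ReadOnly V (mem (cs j)) op r ∧
    ∀ (k : ℕ) (e : Event n) (r : Bool), t[k]? = some e → e.oid = a → e.act = .resOp r → j ≤ k
  let RO : ℕ → Prop := fun a => Committed t a ∧ ∀ j op, ¬ UpdateAt t cs j a op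
  have hRO : ∀ a, ∃ (op : SetOp) (r : Bool) (j : ℕ), RO a → P a op r j := by
    intro a
    by_cases ha : RO a
    · obtain ⟨op, hop, ⟨j, hu⟩ | ⟨r, j, hj, h5⟩⟩ := h.exists_point ha.1
      · exact absurd hu (ha.2 j op)
      · exact ⟨op, r, j, fun _ => ⟨hop, hj, h5⟩⟩
    -- Dummy values for the operations that need no point of this kind.
    · exact ⟨.insert 0, true, 0, fun h => absurd h ha⟩
  choose opOf resOf pointOf hP using hRO
  let A : ℕ → Finset ℤ := fun i => if hq : ∃ q, Abs V (mem (cs i)) q then hq.choose else ∅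
  have hA : ∀ i ≤ t.length, Abs V (mem (cs i)) (A i) := by
    intro i hi
    have hq := h.abs hi
    simp only [A, dif_pos hq]
    exact hq.choose_spec
  -- The identifiers used so far only serve as a finite list from which the operations with point
  -- `i` are selected.
  let ro : ℕ → List ℕ := fun i => (c.used.toList).filter (fun a => RO a ∧ pointOf a = i)
  let up : ℕ → List (ℕ × SetOp × Bool) := fun i =>
    if hu : ∃ a op, UpdateAt t cs i a op then [(hu.choose, hu.choose_spec.choose, true)] else []
  have hup : ∀ i, ∀ x ∈ up i, UpdateAt t cs i x.1 x.2.1 ∧ x.2.2 = true := by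
    intro i x hx
    simp only [up] at hx
    split at hx
    · rename_i hu
      rw [List.mem_singleton.1 hx]
      exact ⟨hu.choose_spec.choose_spec, rfl⟩
    · simp at hx
  have hro : ∀ i, ∀ a ∈ ro i, RO a ∧ pointOf a = i := by
    intro i a ha
    simpa using (List.mem_filter.1 ha).2
  let ops : ℕ → List (ℕ × SetOp × Bool) := fun i =>
    (ro i).map (fun a => (a, opOf a, resOf a)) ++ up i
  have hops : ∀ i, ∀ x ∈ ops i, (RO x.1 ∧ pointOf x.1 = i ∧ x.2 = (opOf x.1, resOf x.1)) ∨
      (UpdateAt t cs i x.1 x.2.1 ∧ x.2.2 = true) := by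
    intro i x hx
    rcases List.mem_append.1 hx with hx | hx
    · obtain ⟨a, ha, rfl⟩ := List.mem_map.1 hx
      exact Or.inl ⟨(hro i a ha).1, (hro i a ha).2, rfl⟩
    · exact Or.inr (hup i x hx)
  have hupinv : ∀ i a op, UpdateAt t cs i a op → Invoked t a op := by
    rintro i a op ⟨hi, rfl, l, X, v, -, -, ha, -⟩
    exact h.view_invoked hi.le ha.before
  -- The update precedes the response of its operation, and from then on the operation is at `done
  -- true`.
  have hnotresp : ∀ i a op, UpdateAt t cs i a op → ∀ (k : ℕ) (e : Event n) (r : Bool), t[k]? = some e →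
      e.oid = a → e.act = .resOp r → i < k ∧ r = true := by
    intro i a op hu k e r hk hea her
    obtain ⟨hk', rfl⟩ := List.getElem?_eq_some_iff.1 hk
    have hu' := hu
    obtain ⟨hi, rfl, l, X, v, hl, -, ha, -⟩ := hu'
    obtain ⟨op', hp⟩ := (h.step k hk').resOp her
    have hik : i < k := by
      by_contra hlt
      rcases Nat.lt_or_eq_of_le (Nat.le_of_not_lt hlt) with hlt | rfl
      · refine (h.reach i hi.le).oid_ne_of_responded (a := t[i].oid) (r := r)
          ⟨t[k], ?_, hea, her⟩ t[i].proc ha.before.oid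
        exact List.mem_of_getElem? (i := k) (by rw [List.getElem?_take_of_lt hlt, hk])
      · rw [ha.act] at her; cases her
    refine ⟨hik, ?_⟩
    have hv : View (cs k) t[k].proc op' t[i].oid (.done r) :=
      Or.inr ⟨_, by rw [hp, hea], by rw [eff_ret rfl]⟩
    have := (h.pointInv hk'.le).update i hik _ _ hu _ _ _ hv
    cases this
    rfl
  refine linearizable_of_points A ops ?_ ?_ ?_ ?_ ?_ ?_ ?_ ?_
  · refine (hA 0 (by omega)).unique ?_
    rw [h1]
    exact Abs.initMem V
  · intro i hi
    have hq := hA i hi.le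
    have hpath1 : SetPath (A i) (((ro i).map (fun a => (a, opOf a, resOf a))).map Prod.snd) (A i) := by
      refine setPath_readOnly fun x hx => ?_
      simp only [List.map_map, List.mem_map] at hx
      obtain ⟨a, ha, rfl⟩ := hx
      obtain ⟨h5, h6⟩ := hro i a ha
      obtain ⟨-, -, -, -, h7, -⟩ := hP a h5
      rw [h6] at h7
      exact h7 _ hq
    simp only [ops, List.map_append]
    refine hpath1.append ?_
    rcases h.abs_step hi hq with ⟨h5, h6⟩ | ⟨a, op, q', h5, h6, h7⟩
    · have : up i = [] := by
        simp only [up]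
        rw [dif_neg]
        rintro ⟨a, op, hu⟩
        exact h6 a op hu
      rw [this]
      exact h5.unique (hA (i + 1) hi)
    · have hu : ∃ a op, UpdateAt t cs i a op := ⟨a, op, h5⟩
      have hu2 := hu.choose_spec.choose_spec
      have he : hu.choose_spec.choose = op := by
        obtain ⟨_, h8, _, _, _, -, -, h9, -⟩ := hu2
        obtain ⟨_, h8', _, _, _, -, -, h9', -⟩ := h5
        have := h9.busy
        rw [h9'.busy] at this
        cases this
        rfl
      simp only [up, dif_pos hu]
      refine ⟨q', ?_, h6.unique (hA (i + 1) hi)⟩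
      rw [he]
      exact h7
  · intro i
    have hnd : ((ro i).map (fun a => (a, opOf a, resOf a))).map Prod.fst = ro i := by
      simp [Function.comp_def]
    simp only [ops, List.map_append, hnd]
    refine List.Nodup.append ((Finset.nodup_toList _).filter _) ?_ ?_
    · simp only [up]
      split <;> simp
    · intro a ha hb
      obtain ⟨x, hx, rfl⟩ := List.mem_map.1 hb
      exact (hro i _ ha).1.2 i _ (hup i x hx).1
  · intro i j x hx y hy hxy
    rcases hops i x hx with ⟨a1, a2, -⟩ | ⟨a1, -⟩ <;> rcases hops j y hy with ⟨b1, b2, -⟩ | ⟨b1, -⟩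
    · rw [← a2, ← b2, hxy]
    · rw [← hxy] at b1; exact absurd b1 (a1.2 _ _)
    · rw [hxy] at a1; exact absurd a1 (b1.2 _ _)
    · rw [← hxy] at b1; exact h.update_unique a1 b1
  · intro i x hx
    refine ⟨?_, pessimistic t ⟨c, hc⟩ x.1, ?_⟩
    · rcases hops i x hx with ⟨a1, -, a3⟩ | ⟨a1, -⟩
      · rw [a3]; exact (hP _ a1).1
      · exact hupinv _ _ _ a1
    · intro r hr
      rcases hops i x hx with ⟨a1, -, a3⟩ | ⟨a1, a2⟩
      · rw [a3]
        obtain ⟨-, -, hr', -⟩ := hP _ a1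
        obtain ⟨p, op, s, hs⟩ := hab.state x.1 (Committed.appears ⟨r, hr⟩)
        have e1 := (hs.responded r).1 hr
        rw [(hs.responded _).1 hr'] at e1
        cases e1
        rfl
      · rw [a2]
        obtain ⟨e, he, hea, her⟩ := hr
        obtain ⟨k, hk, rfl⟩ := List.mem_iff_getElem.1 he
        exact (hnotresp i _ _ a1 k _ r (List.getElem?_eq_getElem hk) hea her).2
  · intro i x hx k e op hk hea hop
    obtain ⟨hk', rfl⟩ := List.getElem?_eq_some_iff.1 hk
    obtain ⟨h5, -⟩ := (h.step k hk').invOp hop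
    by_contra hlt
    refine h5 ?_
    rw [hea]
    rcases hops i x hx with ⟨a1, a2, -⟩ | ⟨a1, -⟩
    · obtain ⟨-, -, -, h6, -⟩ := hP _ a1
      rw [a2] at h6
      exact h.used_mono (by omega) hk'.le h6
    · exact h.update_used a1 (by omega) hk'.le
  · intro i x hx k e r hk hea hr
    rcases hops i x hx with ⟨a1, a2, -⟩ | ⟨a1, -⟩
    · obtain ⟨-, -, -, -, -, h6⟩ := hP _ a1
      rw [← a2]
      exact h6 k e r hk hea hr
    · exact (hnotresp i _ _ a1 k e r hk hea hr).1.le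
  · intro a ha
    by_cases hu : ∃ j op, UpdateAt t cs j a op
    · obtain ⟨j, op, hu⟩ := hu
      refine ⟨j, hu.1, ?_⟩
      have hex : ∃ a op, UpdateAt t cs j a op := ⟨a, op, hu⟩
      have : hex.choose = a := by
        obtain ⟨_, h8, -⟩ := hex.choose_spec.choose_spec
        obtain ⟨_, h8', -⟩ := hu
        rw [← h8, ← h8']
      simp only [ops, up, dif_pos hex, List.map_append, List.mem_append]
      exact Or.inr (by simp [this])
    · push Not at hu
      have hr : RO a := ⟨ha, hu⟩
      refine ⟨pointOf a, (hP a hr).2.1, ?_⟩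
      simp only [ops, List.map_append, List.mem_append, List.map_map]
      refine Or.inl (List.mem_map.2 ⟨a, ?_, rfl⟩)
      simp only [ro, List.mem_filter, Finset.mem_toList, decide_eq_true_eq, and_true]
      exact ⟨(hab.used a).2 ha.appears, hr⟩

theorem lsl : LSL (handOverHand n) := fun _ ht => ⟨locallySerializable ht, linearizable ht⟩

end HandOverHand

theorem IsInfExecution.reach {c : ℕ → Config I} {e : ℕ → Event n} (h : IsInfExecution I c e)
    (i : ℕ) : Reach I ((List.range i).map e) (c i) := by
  induction i with
  | zero => rw [h.1]; exact .nil
  | succ i ih =>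
    rw [List.range_succ, List.map_append]
    exact .snoc ih (h.2 i)

/-- Otherwise the sequence would decrease infinitely often and fall below every bound. -/
theorem eventually_const {f : ℕ → ℕ} {i : ℕ} (h : ∀ j ≥ i, f (j + 1) ≤ f j) :
    ∃ k ≥ i, ∀ j ≥ k, f (j + 1) = f j := by
  by_contra hcon
  push Not at hcon
  have key : ∀ N k, k ≥ i → f k < N → False := by
    intro N
    induction N with
    | zero => intro k _ hk; omega
    | succ N ih =>
      intro k hk hf
      obtain ⟨j, hj, hne⟩ := hcon k hk
      have hmono : ∀ j, k ≤ j → f j ≤ f k := by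
        intro j hj
        induction j, hj using Nat.le_induction with
        | base => exact le_rfl
        | succ j hj ih => exact (h j (by omega)).trans ih
      have h1 := hmono j hj
      have h2 := h j (by omega)
      exact ih (j + 1) (by omega) (by omega)
  exact key (f i + 1) i le_rfl (by omega)

namespace HandOverHand

/-! ### Ownership of locks -/

/-- What a process with a request in the queue of `X` is doing. -/
def Owns (ph : Phase) (ℓ : Local) (X : Obj) : Prop :=
  ℓ.held = some X ∨ ℓ.old = some X ∨
    (ph ≠ .idle ∧ (ℓ.pc = .wait ∨ ℓ.pc = .access) ∧ ℓ.call.obj? = some X ∧ ℓ.mode.isSome ∧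
      ∃ op a l, ph = .busy op a l)

/-- A request stays in a queue from the primitive that appends it to the one that filters it out,
and in between the local state records it: as the call under way, then as `held` or `old`. -/
theorem owns {c : Config (handOverHand n)} (h : Reach (handOverHand n) t c)
 {b : Bool} (hq : (p, b) ∈ queue c X) :
    Owns (c.phase p) (loc c p) X := by
  induction h generalizing X p b with
  | nil => simp [queue, Config.initial, handOverHand, base₀] at hq
  | @snoc t c c' e h1 h2 ih =>
    obtain ⟨V, hV⟩ := h1.exists_arg
    have hinv := reach_inv h1 hV
    cases hStep h2 with
    | invoke op hact hidle hused hmem hqu hl hph hus =>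
      rw [hqu] at hq
      rw [hl, hph]
      have := ih hq
      by_cases hp : p = e.proc
      · subst hp
        rw [hidle] at this
        exact this.imp id (Or.imp id fun h => absurd rfl h.1)
      · rwa [Function.update_of_ne hp]
    | call op l hact hp hmem hqu hl hph hus =>
      rw [hqu] at hq
      rw [hl, hph]
      have := ih hq
      by_cases hpe : p = e.proc
      · subst hpe
        rw [Function.update_self, Function.update_self]
        have hr := hinv.proc e.proc
        rw [hp] at hr this
        rcases this with h | h | ⟨-, -, -, -, op', a, l', h⟩
        · cases l.cmd.toCall with
          | complete => exact Or.inr (Or.inl h)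
          | read Y => exact Or.inl h
          | write Y v => exact Or.inl h
        · rw [hr.1] at h; cases h
        · cases h
      · rwa [Function.update_of_ne hpe, Function.update_of_ne hpe]
    | ret op l hact hp hold hc hmem hqu hl hph hus =>
      rw [hqu] at hq
      rw [hl, hph]
      have := ih hq
      by_cases hpe : p = e.proc
      · subst hpe
        rw [Function.update_self]
        rcases this with h | h | ⟨-, h3, h4, -⟩
        · exact Or.inl h
        · exact Or.inr (Or.inl h)
        · rcases hc with hc | hc
          · rw [hc] at h4; cases h4
          · rw [hc] at h3; rcases h3 with h3 | h3 <;> cases h3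
      · rwa [Function.update_of_ne hpe]
    | prim op l ℓ hact hp hprim hl hph hus =>
      rw [hl, hph]
      have hr := hinv.proc e.proc
      rw [hp] at hr
      obtain ⟨hcall, hcomp, hbusy⟩ := hr
      have ihp : ∀ {X b}, (e.proc, b) ∈ queue c X → Owns (c.phase e.proc) (loc c e.proc) X :=
        fun h => ih h
      by_cases hpe : p = e.proc
      · subst hpe
        rw [Function.update_self, hp]
        rw [hp] at ihp
        have hobj : ∀ Y, (loc c e.proc).call.obj? = some Y →
            BusyInv V (mem c) (queue c) e.proc op e.oid l Y (loc c e.proc) := by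
          intro Y hY
          rw [hcall] at hY
          exact hbusy Y hY
        generalize hm' : mem c' = m' at *
        generalize hq' : queue c' = q' at *
        generalize loc c e.proc = ℓ₀ at *
        cases hprim with
        | request Y hY hpc =>
          by_cases hXY : X = Y
          · subst hXY
            exact Or.inr (Or.inr ⟨by simp, Or.inl rfl, hY, (hobj X hY).request hpc, _, _, _, rfl⟩)
          · rw [Function.update_of_ne hXY] at hq
            refine (ihp hq).imp id (Or.imp id fun h => ?_)
            rw [hpc] at h
            simp at h
        | grant Y hY hpc => exact (ihp hq).imp id (Or.imp id fun h => ⟨h.1, Or.inr rfl, h.2.2⟩)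
        | spin Y hY hpc => exact ihp hq
        | unlock Y hY hold =>
          have hXY : X ≠ Y := by
            rintro rfl
            simp at hq
          rw [Function.update_of_ne hXY] at hq
          refine (ihp hq).imp id (Or.imp (fun h => ?_) id)
          rw [hold] at h
          cases h
          exact absurd rfl hXY
        | read Y hY hpc =>
          have hold := (hobj Y (by rw [hY]; rfl)).old (by simp [hpc])
          rcases ihp hq with h | h | ⟨-, -, h3, h4, -⟩
          · split
            · exact Or.inr (Or.inl h)
            · exact Or.inl h
          · rw [hold] at h; cases h
          · rw [hY] at h3
            cases h3
            rw [if_pos h4]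
            exact Or.inl rfl
        | write Y v hY hpc =>
          have hold := (hobj Y (by rw [hY]; rfl)).old (by simp [hpc])
          rcases ihp hq with h | h | ⟨-, -, h3, h4, -⟩
          · exact Or.inl h
          · rw [hold] at h; cases h
          · rw [hY] at h3
            cases h3
            exact Or.inr (Or.inl (by simp [h4]))
      · rw [Function.update_of_ne hpe]
        generalize hm' : mem c' = m' at *
        generalize hq' : queue c' = q' at *
        refine ih (X := X) (b := b) ?_
        cases hprim with
        | request Y hY hpc =>
          by_cases hXY : X = Y
          · subst hXY
            simpa [hpe] using hq
          · rwa [Function.update_of_ne hXY] at hq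
        | unlock Y hY hold =>
          by_cases hXY : X = Y
          · subst hXY
            simp at hq
            exact hq.1
          · rwa [Function.update_of_ne hXY] at hq
        | _ => exact hq

/-- Process `p` waits for the lock on `X`. -/
def Stuck (c : Config (handOverHand n)) (p : Fin n) (X : Obj) : Prop :=
  ∃ op a l, c.phase p = .busy op a l ∧ (loc c p).call.obj? = some X ∧ (loc c p).pc = .wait ∧
    ¬ granted (queue c X) p ((loc c p).mode.getD true)

/-- The lock order: a process waits for an object after the one whose lock it holds. -/
theorem held_lt {c : Config (handOverHand n)} (hi : Inv V c) {X Y : Obj}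
    (hp : Stuck c p X) (hY : (loc c p).held = some Y) : rank V Y < rank V X := by
  obtain ⟨op, a, l, hph, hX, hpc, -⟩ := hp
  have hpi := hi.proc p
  rw [hph] at hpi
  obtain ⟨hcall, -, hbusy⟩ := hpi
  rw [hcall] at hX
  have hb := hbusy X hX
  have hl := hb.loc
  rw [eff_of_ne (by simp [hpc])] at hl
  have hns : l ≠ .start := by
    intro hs
    rw [(hl.start hs).2] at hY
    cases hY
  by_cases hn : op.name = .contains
  · have hc := (hl.cont hn hns).2
    cases l with
    | traverse prev pcell curr =>
      cases hX
      obtain ⟨h1, -, -, -, h2, -⟩ := hc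
      rw [hY] at h1
      cases h1
      exact h2
    | done r => cases hX
    | _ => exact hc.elim
  · obtain ⟨hh, -, m₀, hm₀, -, hlk⟩ := hl.upd hn hns
    rw [hh] at hY
    cases hY
    have hXh : X ≠ .head := by
      rintro rfl
      have hmode := (hb.wait hpc).1
      rw [hb.mode, hcall] at hmode
      cases l with
      | start => exact hns rfl
      | traverse prev pcell curr =>
        cases hX
        obtain ⟨-, hpp, -, hnx⟩ := hlk
        exact ne_head_of_rank_lt (hm₀.cell prev hpp.ne_tail (hpp.linked.made hm₀)).2.2 hnx.symm
      | create prev pcell new v =>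
        cases hX
        obtain ⟨-, -, -, -, -, hnew, -⟩ := hlk
        cases hnew
      | update prev v =>
        cases hX
        cases hnm : op.name <;> rw [hnm] at hmode <;> simp [Loc.cmd, Cmd.toCall, lockMode] at hmode
      | done r => cases hX
    cases X with
    | head => exact absurd rfl hXh
    | tail => simp [rank]
    | node b => exact bot_lt_keyVal _

/-- Among the stuck processes take one that waits for an object of maximal value, and look at the
first request in the queue of that object. Its process does not wait for this object, since its
request would be granted; so it holds the object and waits for a larger one. A process that is about
to release a lock is not waiting at all. -/
theorem not_all_stuck {c : Config (handOverHand n)}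
    (h : Reach (handOverHand n) t c) (hs : ∀ p, c.phase p ≠ .idle → ∃ X, Stuck c p X)
    {p₀ : Fin n} (hp₀ : c.phase p₀ ≠ .idle) : False := by
  classical
  obtain ⟨V, hV⟩ := h.exists_arg
  have hi := reach_inv h hV
  have : Nonempty Obj := ⟨.head⟩
  choose! W hW using hs
  obtain ⟨p, hp, hmax⟩ := Finset.exists_max_image
    (Finset.univ.filter (fun p : Fin n => c.phase p ≠ .idle)) (fun p => rank V (W p))
    ⟨p₀, by simp [hp₀]⟩
  have hpn : c.phase p ≠ .idle := by simpa using hp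
  -- the first process in the queue of the last object that is waited for
  have hst := hW p hpn
  have hne : queue c (W p) ≠ [] := by
    intro hnil
    obtain ⟨op, a, l, -, -, -, hg⟩ := hst
    rw [hnil] at hg
    exact hg (by simp [granted])
  obtain ⟨⟨q, b⟩, rest, hqr⟩ := List.exists_cons_of_ne_nil hne
  have hown := owns h (X := W p) (p := q) (b := b) (by rw [hqr]; simp)
  have hqn : c.phase q ≠ .idle := by
    intro hidle
    have := hi.proc q
    rw [hidle] at this
    rcases hown with h1 | h1 | h1
    · rw [this.1] at h1; cases h1
    · rw [this.2] at h1; cases h1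
    · exact h1.1 hidle
  have hsq := hW q hqn
  have hle := hmax q (by simp [hqn])
  rcases hown with h1 | h1 | ⟨-, h2, h3, h4, -⟩
  · exact absurd (held_lt hi hsq h1) (not_lt.2 hle)
  · obtain ⟨op, a, l, hph, hX, hpc, -⟩ := hsq
    have hpi := hi.proc q
    rw [hph] at hpi
    rw [hpi.1] at hX
    rw [(hpi.2.2 _ hX).old (by simp [hpc])] at h1
    cases h1
  · obtain ⟨op, a, l, hph, hX, hpc, hg⟩ := hsq
    rw [h3] at hX
    rw [← Option.some.inj hX, hqr] at hg
    exact hg (by simp [granted])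

/-! ### Progress measure -/

open Classical in
/-- Number of steps of the sequential code, if the elements `node b`, `b ∈ U`, are traversed. -/
noncomputable def level (V : ℕ → ℤ) (U : Finset ℕ) : Loc → ℕ
  -- The levels of a traversal lie between 3 and `U.card + 4`, above the levels 2, 1 and 0 of what
  -- follows it. Every node that is passed leaves the filter; the head is not counted in `U`, hence
  -- its extra term.
  | .start => U.card + 5
  | .traverse _ _ curr => (U.filter (fun b => rank V curr ≤ rank V (.node b))).card +
      (if curr = .head then 1 else 0) + 3
  | .create _ _ _ _ => 2
  | .update _ _ => 1
  | .done _ => 0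

theorem level_afterWrite {U : Finset ℕ} {v : Cell}
    (h : l.cmd = .write X v) : level V U l.afterWrite < level V U l := by
  cases l with
  | create => simp [level, Loc.afterWrite]
  | update => simp [level, Loc.afterWrite]
  | _ => cases h

/-- The successor is larger than the element read, so a node that has been passed no longer counts;
when the traversal stops, the level falls to 2 or less. -/
theorem level_afterRead {U : Finset ℕ}
    {c : Cell} (h : l.cmd = .read X) (hc : GoodCell V X c) (hX : ∀ b, X = .node b → b ∈ U) :
    level V U (l.afterRead op a c) < level V U l := by
  classical
  cases l with
  | start =>
    cases h
    have : c.next ≠ .head := ne_head_of_rank_lt (hc.2.2 (by simp))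
    have h2 := Finset.card_filter_le U (fun b => rank V c.next ≤ rank V (.node b))
    simp only [level, Loc.afterRead, if_neg this]
    omega
  | traverse prev pcell curr =>
    cases h
    by_cases hlt : c.val < key op
    · simp only [level, Loc.afterRead, if_pos hlt]
      have hXt : X ≠ .tail := by
        rintro rfl
        rw [hc.1] at hlt
        exact not_top_lt hlt
      have hlt' := hc.2.2 hXt
      have hn : c.next ≠ .head := ne_head_of_rank_lt hlt'
      have hsub : U.filter (fun b => rank V c.next ≤ rank V (.node b)) ⊆
          U.filter (fun b => rank V X ≤ rank V (.node b)) := by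
        intro b hb
        simp only [Finset.mem_filter] at hb ⊢
        exact ⟨hb.1, hlt'.le.trans hb.2⟩
      have h2 := Finset.card_le_card hsub
      rw [if_neg hn]
      cases X with
      | head => simp only [if_true]; omega
      | tail => exact absurd rfl hXt
      | node b =>
        have : (U.filter (fun b' => rank V c.next ≤ rank V (.node b'))).card <
            (U.filter (fun b' => rank V (.node b) ≤ rank V (.node b'))).card := by
          refine Finset.card_lt_card ⟨hsub, fun hcon => ?_⟩
          have := hcon (Finset.mem_filter.2 ⟨hX b rfl, le_rfl⟩)
          exact absurd (Finset.mem_filter.1 this).2 (not_le.2 hlt')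
        omega
    · have h2 : level V U (Loc.afterRead op a (.traverse prev pcell X) c) ≤ 2 := by
        simp only [Loc.afterRead, if_neg hlt]
        cases op with
        | contains v => simp [level]
        | insert v => dsimp only; split <;> simp [level]
        | remove v => dsimp only; split <;> simp [level]
      have : 3 ≤ level V U (.traverse prev pcell X) := by simp [level]
      omega
  | _ => cases h

/-- Number of steps to the end of the current call. -/
def callLevel (ℓ : Local) : ℕ :=
  match ℓ.pc with
  | .request => 5
  | .wait => 4
  | .access => 3
  | .release => if ℓ.old.isSome then 2 else 1

theorem callLevel_le (ℓ : Local) : callLevel ℓ ≤ 5 := by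
  unfold callLevel
  split
  · simp
  · simp
  · simp
  · split <;> simp

theorem callLevel_pos (ℓ : Local) : 1 ≤ callLevel ℓ := by
  unfold callLevel
  split
  · simp
  · simp
  · simp
  · split <;> simp

/-- At level `L` a call runs through the values `7 * L + 6`, then at most `7 * L + 5` and at least
`7 * L + 1`; its return leads to a smaller level, hence to at most `7 * (L - 1) + 6`. -/
noncomputable def procLevel (V : ℕ → ℤ) (U : Finset ℕ) (ℓ : Local) : Phase → ℕ
  | .idle => 0
  | .ready _ _ l => 7 * level V U l + 6
  | .busy _ _ l => 7 * level V U l + callLevel ℓ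

/-- Apart from invocations and responses, only a vain test of a lock makes no progress, and it
leaves phases, local states and queues as they are. The set `c.used` contains the identifiers of all
nodes that can be met and is constant in the absence of invocations. -/
theorem measure_step {c c' : Config (handOverHand n)} (hi : Inv V c)
    (h : Step (handOverHand n) c e c') (hinv : ∀ op, e.act ≠ .invOp op)
    (hres : ∀ r, e.act ≠ .resOp r) :
    c'.used = c.used ∧
    (∑ p, procLevel V c.used (loc c' p) (c'.phase p) < ∑ p, procLevel V c.used (loc c p) (c.phase p) ∨
      (c'.phase = c.phase ∧ loc c' = loc c ∧ queue c' = queue c ∧ ∃ X, Stuck c e.proc X)) := by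
  have hsum : ∀ (hph : ∀ p ≠ e.proc, c'.phase p = c.phase p) (hl : ∀ p ≠ e.proc, loc c' p = loc c p),
      procLevel V c.used (loc c' e.proc) (c'.phase e.proc) <
        procLevel V c.used (loc c e.proc) (c.phase e.proc) →
      ∑ p, procLevel V c.used (loc c' p) (c'.phase p) <
        ∑ p, procLevel V c.used (loc c p) (c.phase p) := by
    intro hph hl hlt
    refine Finset.sum_lt_sum (fun p _ => ?_) ⟨e.proc, Finset.mem_univ _, hlt⟩
    by_cases hp : p = e.proc
    · subst hp; exact hlt.le
    · rw [hph p hp, hl p hp]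
  cases hStep h with
  | invoke op hact => exact absurd hact (hinv op)
  | call op l hact hp hmem hqu hl hph hus =>
    refine ⟨hus, Or.inl (hsum (fun p hp => by simp [hph, hp]) (fun p hp => by simp [hl, hp]) ?_)⟩
    rw [hph, Function.update_self, hp]
    have := callLevel_le (loc c' e.proc)
    simp only [procLevel]
    omega
  | ret op l hact hp hold hc hmem hqu hl hph hus =>
    refine ⟨hus, Or.inl (hsum (fun p hp => by simp [hph, hp]) (fun p hp => by rw [hl]) ?_)⟩
    rw [hph, Function.update_self, hp]
    have hpos := callLevel_pos (loc c e.proc)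
    have hr := hi.proc e.proc
    rw [hp] at hr
    cases hk : l.cmd with
    | ret r =>
      rw [hk] at hact
      exact absurd hact (hres r)
    | read X =>
      have hb := hr.2.2 X (by rw [hk]; rfl)
      have hpc : (loc c e.proc).pc = .release :=
        hc.resolve_left (by rw [hr.1, hk]; simp [Cmd.toCall])
      have := level_afterRead (U := c.used) (op := op) (a := e.oid) hk (hb.good hpc X hk).1
        (fun b hb' => hi.made b (hb' ▸ hb.made hpc X hk))
      simp only [Phase.after, hk, procLevel]
      omega
    | write X v =>
      have := level_afterWrite (V := V) (U := c.used) hk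
      simp only [Phase.after, hk, procLevel]
      omega
  | prim op l ℓ hact hp hprim hl hph hus =>
    refine ⟨hus, ?_⟩
    have hr := hi.proc e.proc
    rw [hp] at hr
    have fin : callLevel ℓ < callLevel (loc c e.proc) →
        ∑ p, procLevel V c.used (loc c' p) (c'.phase p) <
          ∑ p, procLevel V c.used (loc c p) (c.phase p) := by
      intro hlt
      refine hsum (fun p _ => by rw [hph]) (fun p hp => by simp [hl, hp]) ?_
      rw [hph, hl, Function.update_self, hp]
      simp only [procLevel]
      omega
    generalize hm' : mem c' = m' at *
    generalize hq' : queue c' = q' at *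
    cases hprim with
    | request Y hY hpc => exact Or.inl (fin (by simp [callLevel, hpc]))
    | grant Y hY hpc => exact Or.inl (fin (by simp [callLevel, hpc]))
    | read Y hY hpc =>
      refine Or.inl (fin ?_)
      have h1 : callLevel (loc c e.proc) = 3 := by simp [callLevel, hpc]
      rw [h1]
      by_cases hm : (loc c e.proc).mode.isSome
      · rw [if_pos hm]
        simp only [callLevel]
        split <;> simp
      · rw [if_neg hm]
        simp only [callLevel]
        split <;> simp
    | write Y v hY hpc =>
      refine Or.inl (fin ?_)
      have h1 : callLevel (loc c e.proc) = 3 := by simp [callLevel, hpc]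
      rw [h1]
      unfold callLevel
      dsimp only
      split <;> simp
    | unlock Y hY hold =>
      refine Or.inl (fin ?_)
      have hpc : (loc c e.proc).pc = .release := by
        rcases hY with hY | hY
        · exact (hr.2.1 (by rw [← hr.1, hY])).2
        · exact hY
      simp [callLevel, hpc, hold]
    | spin Y hY hpc hg =>
      refine Or.inr ⟨hph, ?_, rfl, Y, op, e.oid, l, hp, hY, hpc, hg⟩
      rw [hl, Function.update_eq_self]

theorem phase_ne_idle {c c' : Config (handOverHand n)}
    (h : Step (handOverHand n) c e c') (hres : ∀ r, e.act ≠ .resOp r) (hp : c.phase p ≠ .idle) :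
    c'.phase p ≠ .idle := by
  by_cases hpe : p = e.proc
  · subst hpe
    cases hStep h with
    | invoke op hact hidle => exact absurd hidle hp
    | call op l hact h1 hmem hqu hl hph hus => simp [hph]
    | prim op l ℓ hact h1 hprim hl hph hus => rwa [hph]
    | ret op l hact h1 hold hc hmem hqu hl hph hus =>
      rw [hph, Function.update_self]
      unfold Phase.after
      cases hk : l.cmd with
      | ret r => rw [hk] at hact; exact absurd hact (hres r)
      | _ => simp
  · have : c'.phase p = c.phase p := by
      cases hStep h with
      | invoke op hact hidle hused hmem hqu hl hph hus => simp [hph, hpe]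
      | call op l hact h1 hmem hqu hl hph hus => simp [hph, hpe]
      | prim op l ℓ hact h1 hprim hl hph hus => rw [hph]
      | ret op l hact h1 hold hc hmem hqu hl hph hus => simp [hph, hpe]
    rwa [this]

/-- Suppose that no operation returns from some moment on. Processes only leave the idle state, so
invocations die out; the measure becomes constant, so all steps are vain tests of locks in an
otherwise frozen configuration. By fairness every pending process takes such a step, so all are
stuck, contrary to `not_all_stuck`. -/
theorem deadlockFree : DeadlockFree (handOverHand n) := by
  classical
  intro c e hexec hfair i₀ ⟨p₀, hp₀⟩
  by_contra hno
  push Not at hno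
  have hpend : ∀ j ≥ i₀, ∀ p, (c j).phase p ≠ .idle → (c (j + 1)).phase p ≠ .idle :=
    fun j hj p hp => phase_ne_idle (hexec.2 j) (hno j hj) hp
  -- eventually there are no invocations
  let idle : ℕ → Finset (Fin n) := fun j => Finset.univ.filter (fun p => (c j).phase p = .idle)
  have hidle : ∀ j ≥ i₀, idle (j + 1) ⊆ idle j := by
    intro j hj p hp
    simp only [idle, Finset.mem_filter, Finset.mem_univ, true_and] at hp ⊢
    by_contra hcon
    exact hpend j hj p hcon hp
  obtain ⟨i₁, hi₁, hconst₁⟩ := eventually_const (f := fun j => (idle j).card)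
    (fun j hj => Finset.card_le_card (hidle j hj))
  have hinv₁ : ∀ j ≥ i₁, ∀ op, (e j).act ≠ .invOp op := by
    intro j hj op hact
    have heq := Finset.eq_of_subset_of_card_le (hidle j (by omega)) (hconst₁ j hj).ge
    cases hStep (hexec.2 j) with
    | invoke op' hact' h1 hused hmem hqu hl hph hus =>
      have h2 : (e j).proc ∈ idle j := by simp [idle, h1]
      rw [← heq] at h2
      simp [idle, hph] at h2
    | call op' l hact' => rw [hact'] at hact; cases l <;> cases hact
    | ret op' l hact' => rw [hact'] at hact; cases l <;> cases hact
    | prim op' l ℓ hact' => rw [hact'] at hact; cases hact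
  obtain ⟨V, hV⟩ := (hexec.reach i₁).exists_arg
  have hinv : ∀ j ≥ i₁, Inv V (c j) := by
    intro j hj
    refine reach_inv (hexec.reach j) fun a op ha => hV a op ?_
    obtain ⟨e', he', hea, hop⟩ := ha
    simp only [List.mem_map, List.mem_range] at he'
    obtain ⟨k, hk, rfl⟩ := he'
    refine ⟨e k, ?_, hea, hop⟩
    simp only [List.mem_map, List.mem_range]
    refine ⟨k, ?_, rfl⟩
    by_contra hcon
    exact hinv₁ k (by omega) op hop
  have hused : ∀ j ≥ i₁, (c j).used = (c i₁).used := by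
    intro j hj
    induction j, hj using Nat.le_induction with
    | base => rfl
    | succ j hj ih =>
      rw [← ih]
      exact (measure_step (hinv j hj) (hexec.2 j) (hinv₁ j hj) (hno j (by omega))).1
  have hstep : ∀ j ≥ i₁, _ := fun j hj =>
    (measure_step (hinv j hj) (hexec.2 j) (hinv₁ j hj) (hno j (by omega))).2
  -- eventually all steps are vain attempts to acquire locks
  obtain ⟨i₂, hi₂, hconst₂⟩ := eventually_const (i := i₁)
    (f := fun j => ∑ p, procLevel V (c i₁).used (loc (c j) p) ((c j).phase p)) (by
      intro j hj
      rcases hstep j hj with h | ⟨h1, h2, -⟩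
      · rw [hused j hj] at h
        exact h.le
      · simp only [h1, h2, le_refl])
  have hspin : ∀ j ≥ i₂, (c (j + 1)).phase = (c j).phase ∧ loc (c (j + 1)) = loc (c j) ∧
      queue (c (j + 1)) = queue (c j) ∧ ∃ X, Stuck (c j) (e j).proc X := by
    intro j hj
    rcases hstep j (by omega) with h | h
    · have := hconst₂ j hj
      rw [hused j (by omega)] at h
      omega
    · exact h
  have hsame : ∀ j ≥ i₂, (c j).phase = (c i₂).phase ∧ loc (c j) = loc (c i₂) ∧
      queue (c j) = queue (c i₂) := by
    intro j hj
    induction j, hj using Nat.le_induction with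
    | base => exact ⟨rfl, rfl, rfl⟩
    | succ j hj ih =>
      obtain ⟨h1, h2, h3, -⟩ := hspin j hj
      exact ⟨h1.trans ih.1, h2.trans ih.2.1, h3.trans ih.2.2⟩
  have hp₂ : ∀ j ≥ i₀, (c j).phase p₀ ≠ .idle := by
    intro j hj
    induction j, hj using Nat.le_induction with
    | base => exact hp₀
    | succ j hj ih => exact hpend j hj p₀ ih
  refine not_all_stuck (hexec.reach i₂) (fun p hp => ?_) (hp₂ i₂ (by omega))
  obtain ⟨j, hj, rfl⟩ := hfair p i₂ hp
  obtain ⟨-, -, -, X, op, a, l, h1, h2, h3, h4⟩ := hspin j hj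
  obtain ⟨s1, s2, s3⟩ := hsame j hj
  rw [s1] at h1
  rw [s2] at h2 h3 h4
  rw [s3] at h4
  exact ⟨X, op, a, l, h1, h2, h3, h4⟩

theorem classP : ClassP (handOverHand n) := ⟨obedient, lsl, pessimistic, deadlockFree⟩

end HandOverHand

/-! ### Construction of executions -/

theorem scheduleOf_append (s t : List (Event n)) :
    scheduleOf (s ++ t) = scheduleOf s ++ scheduleOf t := by
  simp [scheduleOf]

theorem ReturnsAbort.aborted (h : ReturnsAbort t a) :
    ∃ e ∈ t, e.act = .abort := by
  rw [returnsAbort_iff] at h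
  obtain ⟨e, he, -, ha⟩ := mem_acts.1 (List.mem_of_find?_eq_some h)
  exact ⟨e, he, ha⟩

theorem history_eq_filter (h : ∀ e ∈ t, e.act ≠ .abort) :
    history t = t.filter (fun e => e.act ≠ .step ∧ e.act ≠ .startCommit) := by
  induction t with
  | nil => rfl
  | cons e t ih =>
    have ih := ih fun e' he' => h e' (by simp [he'])
    have hn : ¬ ReturnsAbort t e.oid := fun hr =>
      let ⟨e', he', ha⟩ := hr.aborted
      h e' (by simp [he']) ha
    rw [history]
    cases hact : e.act <;> simp [hact, ih, hn]

/-- The schedule of an execution in which all operations completed. -/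
theorem Reach.schedule_eq (h : Reach I t c)
    (hidle : ∀ p, c.phase p = .idle) (hab : ∀ e ∈ t, e.act ≠ .abort) :
    scheduleOf (completePart (history t)) = scheduleOf t := by
  have hcp : completePart (history t) = history t := by
    unfold completePart
    rw [List.filter_eq_self]
    intro e he
    obtain ⟨p, op, s, hs⟩ := h.traceInv.state e.oid ⟨e, mem_history he, rfl⟩
    have hfin : ∃ r, s = .fin r := by
      cases s with
      | ready l => have := hs.phase trivial; rw [hidle p] at this; cases this
      | busy l => have := hs.phase trivial; rw [hidle p] at this; cases this
      | fin r => exact ⟨r, rfl⟩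
      | aborted =>
        obtain ⟨e', he', -, ha⟩ := hs.aborted.2 rfl
        exact absurd ha (hab e' he')
    obtain ⟨r, rfl⟩ := hfin
    obtain ⟨e', he', hea, her⟩ := (hs.responded r).2 rfl
    simp only [decide_eq_true_eq]
    refine ⟨r, e', ?_, hea, her⟩
    rw [history_eq_filter hab, List.mem_filter]
    exact ⟨he', by simp [her]⟩
  rw [hcp, history_eq_filter hab]
  unfold scheduleOf
  rw [List.filterMap_filter]
  congr 1
  funext e
  cases e.act <;> simp [Act.toSched]

/-- From every configuration in `P` there is an execution with schedule `σ`, without aborts, to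
one in `Q`. -/
def Leads (P : Config I → Prop) (σ : Schedule n) (Q : Config I → Prop) : Prop :=
  ∀ c, P c → ∃ s d, Run I c s d ∧ scheduleOf s = σ ∧ (∀ e ∈ s, e.act ≠ .abort) ∧ Q d

theorem Leads.trans {P Q R : Config I → Prop} {σ τ : Schedule n} (h : Leads P σ Q)
    (h' : Leads Q τ R) : Leads P (σ ++ τ) R := by
  intro c hc
  obtain ⟨s, d, h1, h2, h3, h4⟩ := h c hc
  obtain ⟨s', d', h1', h2', h3', h4'⟩ := h' d h4
  refine ⟨s ++ s', d', h1.trans h1', by rw [scheduleOf_append, h2, h2'], fun e he => ?_, h4'⟩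
  rcases List.mem_append.1 he with he | he
  · exact h3 e he
  · exact h3' e he

theorem Leads.accepts {P Q : Config I → Prop} {σ : Schedule n} (h : Leads P σ Q)
    (hP : P (Config.initial I)) (hQ : ∀ c, Q c → ∀ p, c.phase p = .idle) : Accepts I σ := by
  obtain ⟨s, d, h1, h2, h3, h4⟩ := h _ hP
  have hr : Reach I s d := by simpa using Reach.nil.run h1
  exact ⟨s, ⟨d, hr⟩, by rw [hr.schedule_eq (hQ d h4) h3, h2]⟩

theorem Leads.of_step {P Q : Config I → Prop} {σ : Schedule n}
    (h : ∀ c, P c → ∃ e d, Step I c e d ∧ scheduleOf [e] = σ ∧ e.act ≠ .abort ∧ Q d) :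
    Leads P σ Q := by
  intro c hc
  obtain ⟨e, d, h1, h2, h3, h4⟩ := h c hc
  exact ⟨[e], d, .single h1, h2, by simpa using h3, h4⟩

/-- A function that takes the values `x` and `y` at `p` and `p'`. -/
def pair {α : Type*} (p p' : Fin n) (z x y : α) : Fin n → α :=
  Function.update (Function.update (fun _ => z) p' y) p x

theorem pair_left {α : Type*} (p p' : Fin n) (z x y : α) : pair p p' z x y p = x :=
  Function.update_self _ _ _

theorem pair_right {α : Type*} (h : p' ≠ p) (z x y : α) :
    pair p p' z x y p' = y := by
  rw [pair, Function.update_of_ne h, Function.update_self]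

theorem update_pair_left {α : Type*} (p p' : Fin n) (z x y x' : α) :
    Function.update (pair p p' z x y) p x' = pair p p' z x' y :=
  Function.update_idem _ _ _

theorem update_pair_right {α : Type*} (h : p' ≠ p) (z x y y' : α) :
    Function.update (pair p p' z x y) p' y' = pair p p' z x y' := by
  rw [pair, Function.update_comm h.symm, Function.update_idem, pair]

theorem pair_self {α : Type*} (p p' : Fin n) (z : α) (q : Fin n) : pair p p' z z z q = z := by
  unfold pair
  simp [Function.update_apply]

/-! ### Calls of the hand-over-hand implementation without contention. -/

namespace HandOverHand

theorem base_lock {base : (b : Base) → State n b} {s : List (Fin n × Bool)} :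
    memOf (Function.update base (.lock X) s) = memOf base ∧
    queueOf (Function.update base (.lock X) s) = Function.update (queueOf base) X s := by
  refine ⟨funext fun Y => Function.update_of_ne (by simp) _ _, funext fun Y => ?_⟩
  by_cases hY : Y = X
  · subst hY
    rw [Function.update_self]
    exact Function.update_self _ _ _
  · rw [Function.update_of_ne hY]
    exact Function.update_of_ne (by simpa using hY) _ _

theorem base_value {base : (b : Base) → State n b} {s : Cell} :
    memOf (Function.update base (.value X) s) = Function.update (memOf base) X s ∧
    queueOf (Function.update base (.value X) s) = queueOf base := by
  refine ⟨funext fun Y => ?_, funext fun Y => Function.update_of_ne (by simp) _ _⟩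
  by_cases hY : Y = X
  · subst hY
    rw [Function.update_self]
    exact Function.update_self _ _ _
  · rw [Function.update_of_ne hY]
    exact Function.update_of_ne (by simpa using hY) _ _

/-- Every effect of a primitive is the one of some step. -/
theorem next_of_prim {base : (b : Base) → State n b} {ℓ ℓ' : Local}
 {q' : Obj → List (Fin n × Bool)} (h : Prim p (memOf base) (queueOf base) ℓ m' q' ℓ') :
    ∃ (b : Base) (f : State n b → State n b × Local), next p ℓ = .prim b f ∧
      memOf (Function.update base b (f (base b)).1) = m' ∧
      queueOf (Function.update base b (f (base b)).1) = q' ∧ (f (base b)).2 = ℓ' := by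
  obtain ⟨call, mode, pc, held, old, out⟩ := ℓ
  cases h with
  | request X hX hpc =>
    cases hpc
    cases call <;> cases hX <;> exact ⟨_, _, rfl, base_lock.1, base_lock.2, rfl⟩
  | grant X hX hpc hg =>
    cases hpc
    have hid : Function.update base (.lock X) (base (.lock X)) = base :=
      Function.update_eq_self _ _
    cases call <;> cases hX <;>
      exact ⟨_, _, rfl, congrArg memOf hid, congrArg queueOf hid, if_pos hg⟩
  | spin X hX hpc hg =>
    cases hpc
    have hid : Function.update base (.lock X) (base (.lock X)) = base :=
      Function.update_eq_self _ _
    cases call <;> cases hX <;>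
      exact ⟨_, _, rfl, congrArg memOf hid, congrArg queueOf hid, if_neg hg⟩
  | read X hX hpc =>
    cases hpc
    cases hX
    have hid : Function.update base (.value X) (base (.value X)) = base :=
      Function.update_eq_self _ _
    exact ⟨_, _, rfl, congrArg memOf hid, congrArg queueOf hid, rfl⟩
  | write X v hX hpc =>
    cases hpc
    cases hX
    exact ⟨_, _, rfl, base_value.1, base_value.2, rfl⟩
  | unlock Y hc hold =>
    cases hold
    have : (next p ⟨call, mode, pc, held, some Y, out⟩ : Action Base (State n) Local) =
        releaseAction p ⟨call, mode, pc, held, some Y, out⟩ := by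
      rcases hc with hc | hc <;> cases hc
      · cases pc <;> rfl
      · cases call <;> rfl
    rw [this]
    exact ⟨_, _, rfl, base_lock.1, base_lock.2, rfl⟩

/-- Sequences of primitives. -/
inductive Prims (p : Fin n) : (Obj → Cell) → (Obj → List (Fin n × Bool)) → Local →
    (Obj → Cell) → (Obj → List (Fin n × Bool)) → Local → Prop
  | nil (m : Obj → Cell) (q : Obj → List (Fin n × Bool)) (ℓ : Local) : Prims p m q ℓ m q ℓ
  | cons {m m' m'' : Obj → Cell} {q q' q'' : Obj → List (Fin n × Bool)} {ℓ ℓ' ℓ'' : Local} :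
      Prim p m q ℓ m' q' ℓ' → Prims p m' q' ℓ' m'' q'' ℓ'' → (Prims p m q ℓ m'' q'' ℓ'')

/-- The configurations with a given memory, lock queues, locks held, phases, and identifiers. -/
structure At (m : Obj → Cell) (q : Obj → List (Fin n × Bool)) (h : Fin n → Option Obj)
    (ph : Fin n → Phase) (u : Finset ℕ) (c : Config (handOverHand n)) : Prop where
  mem : mem c = m
  queue : queue c = q
  held : ∀ p, (loc c p).held = h p
  phase : c.phase = ph
  used : c.used = u

theorem leads_invoke {q : Obj → List (Fin n × Bool)} {h : Fin n → Option Obj}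
    {ph ph' : Fin n → Phase} {u : Finset ℕ} (p : Fin n) (op : SetOp) (a : ℕ) (hp : ph p = .idle)
    (ha : a ∉ u) (hph' : Function.update ph p (.ready op a .start) = ph') :
    Leads (At m q h ph u) [(p, .invOp op)] (At m q h ph' (insert a u)) := by
  refine Leads.of_step fun c hc => ?_
  obtain ⟨rfl, rfl, h3, rfl, rfl⟩ := hc
  exact ⟨_, _, .invoke c p op a hp ha, rfl, by simp, rfl, rfl, h3, hph', rfl⟩

theorem run_prims {q q' : Obj → List (Fin n × Bool)}
    {ℓ ℓ' : Local} (h : Prims p m q ℓ m' q' ℓ') {c : Config (handOverHand n)} (hm : mem c = m)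
    (hq : queue c = q) (hl : loc c p = ℓ) (hp : c.phase p = .busy op a l) :
    ∃ s d, Run (handOverHand n) c s d ∧ scheduleOf s = [] ∧ (∀ e ∈ s, e.act ≠ .abort) ∧
      mem d = m' ∧ queue d = q' ∧ loc d = Function.update (loc c) p ℓ' ∧ d.phase = c.phase ∧
      d.used = c.used := by
  induction h generalizing c with
  | nil m q ℓ =>
    refine ⟨[], c, .nil c, rfl, by simp, hm, hq, ?_, rfl, rfl⟩
    rw [← hl, Function.update_eq_self]
  | @cons m m₁ m₂ q q₁ q₂ ℓ ℓ₁ ℓ₂ h1 h2 ih =>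
    subst hm hq hl
    obtain ⟨d₀, hst, i1, i2, i3, i4, i5⟩ : ∃ d, Step (handOverHand n) c ⟨p, a, .step⟩ d ∧
        mem d = m₁ ∧ queue d = q₁ ∧ loc d = Function.update (loc c) p ℓ₁ ∧ d.phase = c.phase ∧
        d.used = c.used := by
      obtain ⟨b, f, hn, i1, i2, rfl⟩ := next_of_prim (base := c.base) h1
      exact ⟨_, .prim c p op a l b f hp hn, i1, i2, rfl, rfl, rfl⟩
    obtain ⟨s, d, j1, j2, j3, j4, j5, j6, j7, j8⟩ := ih i1 i2
      (by rw [i3, Function.update_self]) (by rw [i4, hp])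
    rw [i4] at j7
    rw [i5] at j8
    refine ⟨_, d, (Run.single hst).trans j1, ?_, ?_, j4, j5, ?_, j7, j8⟩
    · rw [scheduleOf_append, j2]; rfl
    · intro e he
      rcases List.mem_append.1 he with he | he
      · rw [List.mem_singleton.1 he]; simp
      · exact j3 e he
    · rw [j6, i3, Function.update_idem]

/-- The local state is quantified because `At` fixes only its `held` field; the rest is overwritten
by `start` or irrelevant. -/
theorem leads_call {q q' : Obj → List (Fin n × Bool)}
    {h h' : Fin n → Option Obj} {ph ph' : Fin n → Phase} {u : Finset ℕ}
 {v : Cell} (hp : ph p = .ready op a l) (hprims : ∀ ℓ : Local, ℓ.held = h p → ∃ ℓ' : Local,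
      Prims p m q (start op.name l.cmd.toCall ℓ) m' q' ℓ' ∧ next p ℓ' =
        (.ret (some ℓ'.out) : Action Base (State n) Local) ∧ ((∃ X, l.cmd = .read X) → ℓ'.out = v) ∧
        ℓ'.held = h' p)
    (hh' : ∀ p' ≠ p, h' p' = h p') (hph' : Function.update ph p (Phase.after op a l v) = ph') :
    Leads (At m q h ph u)
      (((l.cmd.start).toSched.map (fun s => (p, s))).toList ++
        ((l.cmd.finish v).toSched.map (fun s => (p, s))).toList) (At m' q' h' ph' u) := by
  intro c hc
  obtain ⟨rfl, rfl, h3, rfl, rfl⟩ := hc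
  obtain ⟨d₀, hst, k1, k2, k3, k4, k5⟩ : ∃ d, Step (handOverHand n) c ⟨p, a, l.cmd.start⟩ d ∧
      mem d = mem c ∧ queue d = queue c ∧
      loc d = Function.update (loc c) p (start op.name l.cmd.toCall (loc c p)) ∧
      d.phase = Function.update c.phase p (.busy op a l) ∧ d.used = c.used :=
    ⟨_, .call c p op a l hp, rfl, rfl, rfl, rfl, rfl⟩
  obtain ⟨ℓ', i1, i2, i3, i4⟩ := hprims (loc c p) (h3 p)
  obtain ⟨s, d, j1, j2, j3, j4, j5, j6, j7, j8⟩ := run_prims i1 k1 k2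
    (by rw [k3, Function.update_self]) (op := op) (a := a) (l := l)
    (by rw [k4, Function.update_self])
  rw [k3, Function.update_idem] at j6
  rw [k4] at j7
  rw [k5] at j8
  obtain ⟨d₁, hret, r1, r2, r3, r4, r5⟩ : ∃ d₁,
      Step (handOverHand n) d ⟨p, a, l.cmd.finish ℓ'.out⟩ d₁ ∧ mem d₁ = mem d ∧
      queue d₁ = queue d ∧ loc d₁ = loc d ∧
      d₁.phase = Function.update d.phase p (Phase.after op a l ℓ'.out) ∧ d₁.used = d.used := by
    refine ⟨_, .ret d p op a l ℓ'.out (by rw [j7, Function.update_self]) ?_, rfl, rfl, rfl, rfl, rfl⟩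
    have : loc d p = ℓ' := by rw [j6, Function.update_self]
    show next p (loc d p) = _
    rw [this]
    exact i2
  have hfin : (l.cmd.finish ℓ'.out).toSched = (l.cmd.finish v).toSched ∧
      Phase.after op a l ℓ'.out = Phase.after op a l v := by
    cases hk : l.cmd with
    | read X => rw [i3 ⟨X, hk⟩]; exact ⟨rfl, rfl⟩
    | _ => exact ⟨rfl, by simp [Phase.after, hk]⟩
  refine ⟨_, d₁, ((Run.single hst).trans j1).trans (Run.single hret), ?_, ?_, ?_⟩
  · rw [scheduleOf_append, scheduleOf_append, j2]
    simp only [scheduleOf, List.filterMap_cons, List.filterMap_nil, hfin.1, List.append_nil]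
    cases l.cmd.start.toSched <;> cases (l.cmd.finish v).toSched <;> rfl
  · intro e he
    rcases List.mem_append.1 he with he | he
    · rcases List.mem_append.1 he with he | he
      · rw [List.mem_singleton.1 he]; cases l <;> simp [Loc.cmd, Cmd.start]
      · exact j3 e he
    · rw [List.mem_singleton.1 he]; cases l <;> simp [Loc.cmd, Cmd.finish]
  · refine ⟨r1.trans j4, r2.trans j5, fun p' => ?_, ?_, r5.trans j8⟩
    · rw [r3, j6]
      by_cases hpp : p' = p
      · subst hpp; rw [Function.update_self, i4]
      · rw [Function.update_of_ne hpp, hh' p' hpp, ← h3 p']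
    · rw [r4, j7, hfin.2, ← hph', Function.update_idem]

section calls

variable {q : Obj → List (Fin n × Bool)} {h h' : Fin n → Option Obj} {ph ph' : Fin n → Phase}
  {u : Finset ℕ} {l l' : Loc} {v : Cell}

theorem leads_read_free (hp : ph p = .ready op a l) (hl : l.cmd = .read X)
    (hmode : lockMode op.name (.read X) = none) (hv : m X = v) (hl' : l.afterRead op a v = l')
    (hph' : Function.update ph p (.ready op a l') = ph') :
    Leads (At m q h ph u) [(p, .invRead X), (p, .resRead X)] (At m q h ph' u) := by
  have := leads_call (m := m) (m' := m) (q := q) (q' := q) (h := h) (h' := h) (u := u) (v := v)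
    (ph' := ph') hp
    (fun ℓ hℓ => ⟨_, .cons (.read X (by rw [hl]; rfl) (by rw [hl]; simp [start, Cmd.toCall, hmode]))
      (.nil _ _ _), ?_, ?_, ?_⟩) (fun _ _ => rfl) (by rw [← hph', ← hl']; simp [Phase.after, hl])
  · rwa [hl] at this
  · rw [hl]; simp [start, Cmd.toCall, hmode, next, releaseAction]
  · intro _; rw [hl]; simp [start, Cmd.toCall, hmode, hv]
  · rw [hl]; simp [start, Cmd.toCall, hmode, hℓ]

theorem granted_self (p : Fin n) (b : Bool) : granted [(p, b)] p b := by
  simp [granted]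

theorem start_of_mode {nm : OpName} {k : Call} {b : Bool} (hk : k ≠ .complete)
    (hmode : lockMode nm k = some b) (ℓ : Local) :
    start nm k ℓ = ⟨k, some b, .request, ℓ.held, none, ℓ.out⟩ := by
  cases k <;> simp_all [start]

theorem prims_lock {ℓ : Local} {b : Bool} (hX : ℓ.call.obj? = some X) (hpc : ℓ.pc = .request)
    (hmode : ℓ.mode = some b) (hqX : q X = []) {q' : Obj → List (Fin n × Bool)} {ℓ' : Local}
    (hrest : Prims p m (Function.update q X [(p, b)]) { ℓ with pc := .access } m' q' ℓ') :
    Prims p m q ℓ m' q' ℓ' := by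
  obtain ⟨call, mode, pc, held, old, out⟩ := ℓ
  cases hpc
  cases hmode
  have h1 := Prim.request (p := p) (m := m) (q := q) (ℓ := ⟨call, some b, .request, held, old, out⟩)
    X hX rfl
  rw [hqX, List.nil_append] at h1
  have h2 := Prim.grant (p := p) (m := m) (q := Function.update q X [(p, b)])
    (ℓ := ⟨call, some b, .wait, held, old, out⟩) X hX rfl (by simp [granted_self])
  exact .cons h1 (.cons h2 hrest)

theorem leads_read_lock {b : Bool} (hp : ph p = .ready op a l) (hl : l.cmd = .read X)
    (hmode : lockMode op.name (.read X) = some b) (hheld : h p = none) (hqX : q X = [])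
    (hv : m X = v) (hl' : l.afterRead op a v = l')
    (hph' : Function.update ph p (.ready op a l') = ph')
    (hh' : Function.update h p (some X) = h') :
    Leads (At m q h ph u) [(p, .invRead X), (p, .resRead X)]
      (At m (Function.update q X [(p, b)]) h' ph' u) := by
  have := leads_call (m := m) (m' := m) (q := q) (q' := Function.update q X [(p, b)]) (h := h)
    (h' := h') (u := u) (v := v) (ph' := ph') hp (fun ℓ hℓ => ?_)
    (fun p' hp' => by rw [← hh', Function.update_of_ne hp'])
    (by rw [← hph', ← hl']; simp [Phase.after, hl])
  · rwa [hl] at this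
  · rw [hl]
    simp only [Cmd.toCall]
    rw [start_of_mode (by simp) hmode]
    refine ⟨_, prims_lock rfl rfl rfl hqX (.cons (.read X rfl rfl) (.nil _ _ _)), ?_, fun _ => ?_, ?_⟩
    · simp [next, releaseAction, hℓ, hheld]
    · simp [hv]
    · simp [← hh']

/-- The hand-over-hand step: the lock on `X` is acquired before the one on `Y` is released. -/
theorem leads_read_next {b b' : Bool} {Y : Obj} (hp : ph p = .ready op a l) (hl : l.cmd = .read X)
    (hmode : lockMode op.name (.read X) = some b) (hheld : h p = some Y) (hqX : q X = [])
    (hXY : Y ≠ X) (hqY : q Y = [(p, b')])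
    (hv : m X = v) (hl' : l.afterRead op a v = l')
    (hph' : Function.update ph p (.ready op a l') = ph')
    (hh' : Function.update h p (some X) = h') :
    Leads (At m q h ph u) [(p, .invRead X), (p, .resRead X)]
      (At m (Function.update (Function.update q X [(p, b)]) Y []) h' ph' u) := by
  have := leads_call (m := m) (m' := m) (q := q)
    (q' := Function.update (Function.update q X [(p, b)]) Y []) (h := h)
    (h' := h') (u := u) (v := v) (ph' := ph') hp (fun ℓ hℓ => ?_)
    (fun p' hp' => by rw [← hh', Function.update_of_ne hp'])
    (by rw [← hph', ← hl']; simp [Phase.after, hl])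
  · rwa [hl] at this
  · rw [hl]
    simp only [Cmd.toCall]
    rw [start_of_mode (by simp) hmode]
    have h1 := Prim.unlock (p := p) (m := m) (q := Function.update q X [(p, b)])
      (ℓ := ⟨.read X, some b, .release, some X, some Y, m X⟩) Y (Or.inr rfl) rfl
    rw [Function.update_of_ne hXY, hqY] at h1
    simp only [ne_eq, not_true_eq_false, decide_false, Bool.false_eq_true, not_false_eq_true,
      List.filter_cons_of_neg, List.filter_nil] at h1
    have h2 := Prim.read (p := p) (m := m) (q := Function.update q X [(p, b)])
      (ℓ := ⟨.read X, some b, .access, some Y, none, ℓ.out⟩) X rfl rfl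
    refine ⟨_, prims_lock rfl rfl rfl hqX (.cons ?_ (.cons h1 (.nil _ _ _))), ?_, fun _ => ?_, ?_⟩
    · rw [hℓ, hheld]
      exact h2
    · simp [next, releaseAction]
    · simp [hv]
    · simp [← hh']

theorem leads_write_free (hp : ph p = .ready op a l) (hl : l.cmd = .write X v)
    (hmode : lockMode op.name (.write X v) = none) (hl' : l.afterWrite = l')
    (hph' : Function.update ph p (.ready op a l') = ph') :
    Leads (At m q h ph u) [(p, .invWrite X v), (p, .resWrite X)]
      (At (Function.update m X v) q h ph' u) := by
  have := leads_call (m := m) (m' := Function.update m X v) (q := q) (q' := q) (h := h) (h' := h)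
    (u := u) (v := initMem .tail) (ph' := ph') hp (fun ℓ hℓ => ?_) (fun _ _ => rfl)
    (by rw [← hph', ← hl']; simp [Phase.after, hl])
  · rwa [hl] at this
  · rw [hl]
    have h1 : start op.name (.write X v) ℓ = ⟨.write X v, none, .access, ℓ.held, none, ℓ.out⟩ := by
      simp [start, hmode]
    refine ⟨_, .cons (.write X v ?_ ?_) (.nil _ _ _), ?_, fun ⟨_, h⟩ => (by cases h), ?_⟩
    · simp only [Cmd.toCall, h1]
    · simp only [Cmd.toCall, h1]
    · simp [Cmd.toCall, h1, next, releaseAction]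
    · simp [Cmd.toCall, h1, hℓ]

theorem leads_write_lock (hp : ph p = .ready op a l) (hl : l.cmd = .write X v)
    (hmode : lockMode op.name (.write X v) = some true) (hqX : q X = []) (hl' : l.afterWrite = l')
    (hph' : Function.update ph p (.ready op a l') = ph') :
    Leads (At m q h ph u) [(p, .invWrite X v), (p, .resWrite X)]
      (At (Function.update m X v) q h ph' u) := by
  have := leads_call (m := m) (m' := Function.update m X v) (q := q) (q' := q) (h := h) (h' := h)
    (u := u) (v := initMem .tail) (ph' := ph') hp (fun ℓ hℓ => ?_) (fun _ _ => rfl)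
    (by rw [← hph', ← hl']; simp [Phase.after, hl])
  · rwa [hl] at this
  · rw [hl]
    simp only [Cmd.toCall]
    rw [start_of_mode (by simp) hmode]
    have h1 := Prim.unlock (p := p) (m := Function.update m X v) (q := Function.update q X [(p, true)])
      (ℓ := ⟨.write X v, some true, .release, ℓ.held, some X, ℓ.out⟩) X (Or.inr rfl) rfl
    rw [Function.update_self] at h1
    simp only [ne_eq, not_true_eq_false, decide_false, Bool.false_eq_true, not_false_eq_true,
      List.filter_cons_of_neg, List.filter_nil] at h1
    have hid : Function.update (Function.update q X [(p, true)]) X [] = q := by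
      rw [Function.update_idem, ← hqX, Function.update_eq_self]
    rw [hid] at h1
    exact ⟨_, prims_lock rfl rfl rfl hqX (.cons (.write X v rfl rfl) (.cons h1 (.nil _ _ _))),
      by simp [next, releaseAction], fun ⟨_, h⟩ => (by cases h), hℓ⟩

theorem leads_complete {Y : Obj} {b : Bool} {r : Bool} (hp : ph p = .ready op a (.done r))
    (hheld : h p = some Y) (hqY : q Y = [(p, b)])
    (hph' : Function.update ph p .idle = ph') (hh' : Function.update h p none = h') :
    Leads (At m q h ph u) [(p, .resOp)] (At m (Function.update q Y []) h' ph' u) := by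
  have := leads_call (m := m) (m' := m) (q := q)
    (q' := Function.update q Y []) (h := h)
    (h' := h') (u := u) (v := initMem .tail) (ph' := ph') hp (fun ℓ hℓ => ?_)
    (fun p' hp' => by rw [← hh', Function.update_of_ne hp']) hph'
  · exact this
  · have h1 := Prim.unlock (p := p) (m := m) (q := q)
      (ℓ := ⟨.complete, none, .release, none, some Y, ℓ.out⟩) Y (Or.inr rfl) rfl
    rw [hqY] at h1
    simp only [ne_eq, not_true_eq_false, decide_false, Bool.false_eq_true, not_false_eq_true,
      List.filter_cons_of_neg, List.filter_nil] at h1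
    refine ⟨⟨.complete, none, .release, none, none, ℓ.out⟩, .cons ?_ (.nil _ _ _), ?_, fun h => (by obtain ⟨_, h⟩ := h; cases h), ?_⟩
    · simp only [Loc.cmd, Cmd.toCall, start, hℓ, hheld]
      exact h1
    · simp [next, releaseAction]
    · simp [← hh']

end calls

end HandOverHand

/-- A schedule that is accepted by the hand-over-hand implementation: `contains 5` is overtaken by
`remove 2` behind it, and by `insert 5` in front of it. -/
def lockSchedule {n : ℕ} (p p' : Fin n) : Schedule n :=
  [(p, .invOp (.insert 2)), (p, .invRead .head), (p, .resRead .head),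
    (p, .invRead .tail), (p, .resRead .tail),
    (p, .invWrite (.node 0) ⟨keyVal 2, .tail⟩), (p, .resWrite (.node 0)),
    (p, .invWrite .head ⟨⊥, .node 0⟩), (p, .resWrite .head), (p, .resOp),
    (p, .invOp (.insert 4)), (p, .invRead .head), (p, .resRead .head),
    (p, .invRead (.node 0)), (p, .resRead (.node 0)), (p, .invRead .tail), (p, .resRead .tail),
    (p, .invWrite (.node 1) ⟨keyVal 4, .tail⟩), (p, .resWrite (.node 1)),
    (p, .invWrite (.node 0) ⟨keyVal 2, .node 1⟩), (p, .resWrite (.node 0)), (p, .resOp),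
    (p, .invOp (.contains 5)), (p, .invRead .head), (p, .resRead .head),
    (p, .invRead (.node 0)), (p, .resRead (.node 0)),
    (p', .invOp (.remove 2)), (p', .invRead .head), (p', .resRead .head),
    (p', .invRead (.node 0)), (p', .resRead (.node 0)),
    (p', .invWrite .head ⟨⊥, .node 1⟩), (p', .resWrite .head), (p', .resOp),
    (p', .invOp (.insert 5)), (p', .invRead .head), (p', .resRead .head),
    (p', .invRead (.node 1)), (p', .resRead (.node 1)), (p', .invRead .tail), (p', .resRead .tail),
    (p', .invWrite (.node 4) ⟨keyVal 5, .tail⟩), (p', .resWrite (.node 4)),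
    (p', .invWrite (.node 1) ⟨keyVal 4, .node 4⟩), (p', .resWrite (.node 1)), (p', .resOp),
    (p, .invRead (.node 1)), (p, .resRead (.node 1)),
    (p, .invRead (.node 4)), (p, .resRead (.node 4)), (p, .resOp)]

theorem afterRead_lt {prev curr : Obj} {pc c : Cell} (h : c.val < key op) :
    Loc.afterRead op a (.traverse prev pc curr) c = .traverse curr c c.next := by
  simp [Loc.afterRead, h]

theorem afterRead_insert {v : ℤ} {prev curr : Obj} {pc c : Cell} (h : keyVal v < c.val) :
    Loc.afterRead (.insert v) a (.traverse prev pc curr) c =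
      .create prev pc (.node a) ⟨keyVal v, curr⟩ := by
  have h' : keyVal v < c.val := h
  simp [Loc.afterRead, key_eq, SetOp.arg, not_lt.2 h'.le, h'.ne']

theorem afterRead_remove {v : ℤ} {prev curr : Obj} {pc c : Cell} (h : c.val = keyVal v) :
    Loc.afterRead (.remove v) a (.traverse prev pc curr) c = .update prev ⟨pc.val, c.next⟩ := by
  simp [Loc.afterRead, key_eq, SetOp.arg, h]

theorem afterRead_contains {v : ℤ} {prev curr : Obj} {pc c : Cell} (h : c.val = keyVal v) :
    Loc.afterRead (.contains v) a (.traverse prev pc curr) c = .done true := by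
  simp [Loc.afterRead, key_eq, SetOp.arg, h]

namespace HandOverHand

/-- No lock is ever contended. When process `p'` removes 2, the traversal of `p` holds only node 0,
which is read by `p'` without a lock; the removal writes the head. The insertion of 5 locks the
nodes 4 and 1 for its writes, and releases them before the traversal moves on to node 1. -/
theorem accepts_lockSchedule (hpp : p' ≠ p) :
    Accepts (handOverHand n) (lockSchedule p p') := by
  have h0 : At (fun X => initMem X) (fun _ => []) (pair p p' none none none)
      (pair p p' .idle .idle .idle) ∅ (Config.initial (handOverHand n)) :=
    ⟨rfl, rfl, fun q => by rw [pair_self]; rfl, funext fun q => by rw [pair_self]; rfl, rfl⟩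
  have pl {α : Type} := pair_left (α := α) p p'
  have pr {α : Type} := pair_right (α := α) hpp
  have ul {α : Type} := update_pair_left (α := α) p p'
  have ur {α : Type} := update_pair_right (α := α) hpp
  have a1 := leads_invoke (m := fun X => initMem X) (q := fun _ => []) (h := pair p p' none none none)
    (ph := pair p p' .idle .idle .idle) (u := ∅) p (.insert 2) 0 (pl _ _ _) (by simp) (ul _ _ _ _)
  have a2 := a1.trans (leads_read_lock (v := ⟨⊥, .tail⟩)
    (l' := .traverse .head ⟨⊥, .tail⟩ .tail) (pl _ _ _) rfl rfl (pl _ _ _) rfl rfl rfl (ul _ _ _ _) (ul _ _ _ _))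
  have a3 := a2.trans (leads_read_free (v := ⟨⊤, .tail⟩)
    (l' := .create .head ⟨⊥, .tail⟩ (.node 0) ⟨keyVal 2, .tail⟩) (pl _ _ _) rfl rfl rfl (afterRead_insert (keyVal_lt_top _)) (ul _ _ _ _))
  have a4 := a3.trans (leads_write_lock (l' := .update .head ⟨⊥, .node 0⟩) (pl _ _ _) rfl rfl rfl rfl (ul _ _ _ _))
  have a5 := a4.trans (leads_write_free (l' := .done true) (pl _ _ _) rfl rfl rfl (ul _ _ _ _))
  have a6 := a5.trans (leads_complete (pl _ _ _) (pl _ _ _) rfl (ul _ _ _ _) (ul _ _ _ _))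
  have a7 := a6.trans (leads_invoke p (.insert 4) 1 (pl _ _ _) (by simp) (ul _ _ _ _))
  have a8 := a7.trans (leads_read_lock (v := ⟨⊥, .node 0⟩)
    (l' := .traverse .head ⟨⊥, .node 0⟩ (.node 0)) (pl _ _ _) rfl rfl (pl _ _ _) rfl rfl rfl (ul _ _ _ _) (ul _ _ _ _))
  have a9 := a8.trans (leads_read_free (v := ⟨keyVal 2, .tail⟩)
    (l' := .traverse (.node 0) ⟨keyVal 2, .tail⟩ .tail) (pl _ _ _) rfl rfl rfl (afterRead_lt (keyVal_lt.2 (by simp [SetOp.arg]))) (ul _ _ _ _))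
  have a10 := a9.trans (leads_read_free (v := ⟨⊤, .tail⟩)
    (l' := .create (.node 0) ⟨keyVal 2, .tail⟩ (.node 1) ⟨keyVal 4, .tail⟩) (pl _ _ _) rfl rfl rfl (afterRead_insert (keyVal_lt_top _)) (ul _ _ _ _))
  have a11 := a10.trans (leads_write_lock (l' := .update (.node 0) ⟨keyVal 2, .node 1⟩) (pl _ _ _) rfl rfl rfl rfl (ul _ _ _ _))
  have a12 := a11.trans (leads_write_lock (l' := .done true) (pl _ _ _) rfl rfl rfl rfl (ul _ _ _ _))
  have a13 := a12.trans (leads_complete (pl _ _ _) (pl _ _ _) rfl (ul _ _ _ _) (ul _ _ _ _))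
  have a14 := a13.trans (leads_invoke p (.contains 5) 2 (pl _ _ _) (by simp) (ul _ _ _ _))
  have a15 := a14.trans (leads_read_lock (v := ⟨⊥, .node 0⟩)
    (l' := .traverse .head ⟨⊥, .node 0⟩ (.node 0)) (pl _ _ _) rfl rfl (pl _ _ _) rfl rfl rfl (ul _ _ _ _) (ul _ _ _ _))
  have a16 := a15.trans (leads_read_next (v := ⟨keyVal 2, .node 1⟩)
    (l' := .traverse (.node 0) ⟨keyVal 2, .node 1⟩ (.node 1)) (pl _ _ _) rfl rfl (pl _ _ _) rfl (by simp) rfl rfl (afterRead_lt (keyVal_lt.2 (by simp [SetOp.arg]))) (ul _ _ _ _) (ul _ _ _ _))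
  have a17 := a16.trans (leads_invoke p' (.remove 2) 3 (pr _ _ _) (by simp) (ur _ _ _ _))
  have a18 := a17.trans (leads_read_lock (v := ⟨⊥, .node 0⟩)
    (l' := .traverse .head ⟨⊥, .node 0⟩ (.node 0)) (pr _ _ _) rfl rfl (pr _ _ _) rfl rfl rfl (ur _ _ _ _) (ur _ _ _ _))
  have a19 := a18.trans (leads_read_free (v := ⟨keyVal 2, .node 1⟩)
    (l' := .update .head ⟨⊥, .node 1⟩) (pr _ _ _) rfl rfl rfl (afterRead_remove rfl) (ur _ _ _ _))
  have a20 := a19.trans (leads_write_free (l' := .done true) (pr _ _ _) rfl rfl rfl (ur _ _ _ _))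
  have a21 := a20.trans (leads_complete (pr _ _ _) (pr _ _ _) rfl (ur _ _ _ _) (ur _ _ _ _))
  have a22 := a21.trans (leads_invoke p' (.insert 5) 4 (pr _ _ _) (by simp) (ur _ _ _ _))
  have a23 := a22.trans (leads_read_lock (v := ⟨⊥, .node 1⟩)
    (l' := .traverse .head ⟨⊥, .node 1⟩ (.node 1)) (pr _ _ _) rfl rfl (pr _ _ _) rfl rfl rfl (ur _ _ _ _) (ur _ _ _ _))
  have a24 := a23.trans (leads_read_free (v := ⟨keyVal 4, .tail⟩)
    (l' := .traverse (.node 1) ⟨keyVal 4, .tail⟩ .tail) (pr _ _ _) rfl rfl rfl (afterRead_lt (keyVal_lt.2 (by simp [SetOp.arg]))) (ur _ _ _ _))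
  have a25 := a24.trans (leads_read_free (v := ⟨⊤, .tail⟩)
    (l' := .create (.node 1) ⟨keyVal 4, .tail⟩ (.node 4) ⟨keyVal 5, .tail⟩) (pr _ _ _) rfl rfl rfl (afterRead_insert (keyVal_lt_top _)) (ur _ _ _ _))
  have a26 := a25.trans (leads_write_lock (l' := .update (.node 1) ⟨keyVal 4, .node 4⟩) (pr _ _ _) rfl rfl rfl rfl (ur _ _ _ _))
  have a27 := a26.trans (leads_write_lock (l' := .done true) (pr _ _ _) rfl rfl rfl rfl (ur _ _ _ _))
  have a28 := a27.trans (leads_complete (pr _ _ _) (pr _ _ _) rfl (ur _ _ _ _) (ur _ _ _ _))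
  have a29 := a28.trans (leads_read_next (v := ⟨keyVal 4, .node 4⟩)
    (l' := .traverse (.node 1) ⟨keyVal 4, .node 4⟩ (.node 4)) (pl _ _ _) rfl rfl (pl _ _ _) rfl (by simp) rfl rfl (afterRead_lt (keyVal_lt.2 (by simp [SetOp.arg]))) (ul _ _ _ _) (ul _ _ _ _))
  have a30 := a29.trans (leads_read_next (v := ⟨keyVal 5, .tail⟩)
    (l' := .done true) (pl _ _ _) rfl rfl (pl _ _ _) rfl (by simp) rfl rfl (afterRead_contains rfl) (ul _ _ _ _) (ul _ _ _ _))
  have a31 := a30.trans (leads_complete (pl _ _ _) (pl _ _ _) rfl (ul _ _ _ _) (ul _ _ _ _))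
  have h := a31.accepts h0 fun c hc q => by rw [hc.phase, pair_self]
  simp only [List.cons_append, List.nil_append] at h
  exact h

end HandOverHand

/-! ### The local histories of the processes -/

/-- Visible events of a process whose operations are not aborted. -/
inductive ProcStep : Phase → Event n → Phase → Prop
  | invoke (e : Event n) (op : SetOp) : e.act = .invOp op →
      ProcStep .idle e (.ready op e.oid .start)
  | call (e : Event n) (op : SetOp) (l : Loc) : (∀ r, l.cmd ≠ .ret r) → e.act = l.cmd.start →
      ProcStep (.ready op e.oid l) e (.busy op e.oid l)
  | finish (e : Event n) (op : SetOp) (l : Loc) (c : Cell) : (∀ r, l.cmd ≠ .ret r) →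
      e.act = l.cmd.finish c → ProcStep (.busy op e.oid l) e (Phase.after op e.oid l c)
  | ret (e : Event n) (op : SetOp) (r : Bool) : e.act = .resOp r →
      ProcStep (.ready op e.oid (.done r)) e .idle

inductive ProcRun : Phase → List (Event n) → Phase → Prop
  | nil (s : Phase) : ProcRun s [] s
  | cons {s s' s'' : Phase} {e : Event n} {E : List (Event n)} :
      ProcStep s e s' → ProcRun s' E s'' → ProcRun s (e :: E) s''

theorem ProcRun.snoc {s s' s'' : Phase} {E : List (Event n)} (h : ProcRun s E s')
    (h' : ProcStep s' e s'') : ProcRun s (E ++ [e]) s'' := by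
  induction h with
  | nil => exact .cons h' (.nil _)
  | cons h1 _ ih => exact .cons h1 (ih h')

theorem ProcRun.split {s s'' : Phase} {E F : List (Event n)} (h : ProcRun s (E ++ F) s'') :
    ∃ s', ProcRun s E s' ∧ ProcRun s' F s'' := by
  induction E generalizing s with
  | nil => exact ⟨s, .nil s, h⟩
  | cons e E ih =>
    cases h with
    | cons h1 h2 =>
      obtain ⟨s', h3, h4⟩ := ih h2
      exact ⟨s', .cons h1 h3, h4⟩

open Classical in
/-- The phase of a process, with regard to the visible events of the operations in `K`. -/
noncomputable def Phase.visible (K : ℕ → Prop) : Phase → Phase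
  | .idle => .idle
  | .ready op a l => if K a then .ready op a l else .idle
  | .busy op a l => if K a then
      match l with
      | .done r => .ready op a (.done r)
      | l => .busy op a l
    else .idle

theorem Phase.visible_of_not {K : ℕ → Prop} {ph : Phase} (h : ∀ a, ph.oid = some a → ¬ K a) :
    ph.visible K = .idle := by
  cases ph with
  | idle => rfl
  | ready op a l => simp [Phase.visible, h a rfl]
  | busy op a l => simp [Phase.visible, h a rfl]

open Classical in
/-- The visible events of process `p` in the operations in `K`. -/
noncomputable def visibleEvents (K : ℕ → Prop) (t : List (Event n)) (p : Fin n) : List (Event n) :=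
  t.filter (fun e => e.proc = p ∧ K e.oid ∧ e.act.toSched.isSome)

theorem visibleEvents_snoc_of_not {K : ℕ → Prop}
    (h : ¬ (e.proc = p ∧ K e.oid ∧ e.act.toSched.isSome)) :
    visibleEvents K (t ++ [e]) p = visibleEvents K t p := by
  simp only [visibleEvents, List.filter_append]
  rw [List.filter_cons_of_neg (by simpa using h)]
  simp

theorem visibleEvents_snoc {K : ℕ → Prop} (h : K e.oid) (h' : e.act.toSched.isSome) :
    visibleEvents K (t ++ [e]) e.proc = visibleEvents K t e.proc ++ [e] := by
  simp only [visibleEvents, List.filter_append]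
  rw [List.filter_cons_of_pos (by simp [h, h'])]
  simp

/-- An operation outside `K` has no visible events, and during it the process counts as idle; so
what is visible of a process is again a run of the sequential code. Aborts, which have no place in
such a run, are kept outside `K`. -/
theorem Reach.procRun {K : ℕ → Prop} (h : Reach I t c)
    (hK : ∀ e ∈ t, e.act = .abort → ¬ K e.oid) (p : Fin n) :
    ProcRun .idle (visibleEvents K t p) ((c.phase p).visible K) := by
  induction h with
  | nil => exact .nil _
  | @snoc t c c' e h1 h2 ih =>
    have ih := ih fun e' he' => hK e' (by simp [he'])
    by_cases hp : e.proc = p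
    · subst hp
      by_cases hKe : K e.oid
      · cases h2 with
        | invoke p op a hidle ha =>
          rw [visibleEvents_snoc hKe rfl]
          rw [hidle] at ih
          refine ih.snoc ?_
          simp only [Function.update_self, Phase.visible, if_pos hKe]
          exact .invoke ⟨p, a, .invOp op⟩ op rfl
        | call p op a l hph =>
          simp only [hph, Phase.visible, if_pos hKe] at ih
          simp only [Function.update_self, Phase.visible, if_pos hKe]
          cases l with
          | done r =>
            rw [visibleEvents_snoc_of_not (by simp [Loc.cmd, Cmd.start, Act.toSched])]
            exact ih
          | _ =>
            rw [visibleEvents_snoc hKe rfl]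
            exact ih.snoc (.call ⟨p, a, _⟩ op _ (by simp [Loc.cmd]) rfl)
        | prim p op a l b f hph hn =>
          rw [visibleEvents_snoc_of_not (by simp [Act.toSched])]
          exact ih
        | abort p op a l hph hn => exact absurd hKe (hK _ (by simp) rfl)
        | ret p op a l v hph hn =>
          simp only [hph, Phase.visible, if_pos hKe] at ih
          simp only [Function.update_self]
          cases l with
          | done r =>
            rw [visibleEvents_snoc hKe rfl]
            exact ih.snoc (.ret ⟨p, a, _⟩ op r rfl)
          | start =>
            rw [visibleEvents_snoc hKe rfl]
            have := ih.snoc (.finish ⟨p, a, _⟩ op .start v (by simp [Loc.cmd]) rfl)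
            simpa [Phase.after, Loc.cmd, Cmd.finish, Phase.visible, hKe] using this
          | traverse prev pcell curr =>
            rw [visibleEvents_snoc hKe rfl]
            have := ih.snoc (.finish ⟨p, a, _⟩ op (.traverse prev pcell curr) v (by simp [Loc.cmd]) rfl)
            simpa [Phase.after, Loc.cmd, Cmd.finish, Phase.visible, hKe] using this
          | create prev pcell new w =>
            rw [visibleEvents_snoc hKe rfl]
            have := ih.snoc (.finish ⟨p, a, _⟩ op (.create prev pcell new w) v (by simp [Loc.cmd]) rfl)
            simpa [Phase.after, Loc.cmd, Cmd.finish, Phase.visible, hKe] using this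
          | update prev w =>
            rw [visibleEvents_snoc hKe rfl]
            have := ih.snoc (.finish ⟨p, a, _⟩ op (.update prev w) v (by simp [Loc.cmd]) rfl)
            simpa [Phase.after, Loc.cmd, Cmd.finish, Phase.visible, hKe] using this
      · rw [visibleEvents_snoc_of_not (by tauto)]
        have h3 : (c.phase e.proc).visible K = .idle ∧ (c'.phase e.proc).visible K = .idle := by
          rcases h2.cases_stat with ⟨op, h3, -, -, h4, -⟩ | ⟨op, s, s', h3, -, -, h4, -⟩
          · rw [h3, h4, Function.update_self]
            exact ⟨rfl, Phase.visible_of_not fun a ha => by cases ha; exact hKe⟩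
          · rw [h3, h4, Function.update_self]
            exact ⟨Phase.visible_of_not fun a ha => by rw [← (Stat.oid_phase.1 ha).2]; exact hKe,
              Phase.visible_of_not fun a ha => by rw [← (Stat.oid_phase.1 ha).2]; exact hKe⟩
        rw [h3.2]
        rw [h3.1] at ih
        exact ih
    · rw [visibleEvents_snoc_of_not (by tauto)]
      have : c'.phase p = c.phase p := by
        rcases h2.cases_stat with ⟨op, -, -, -, h4, -⟩ | ⟨op, s, s', -, -, -, h4, -⟩ <;>
          rw [h4, Function.update_of_ne (Ne.symm hp)]
      rw [this]
      exact ih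

theorem mem_history_of_resOp (h : e ∈ t) {r : Bool} (he : e.act = .resOp r) : e ∈ history t := by
  induction t with
  | nil => simp at h
  | cons e' t ih =>
    rw [history]
    rcases List.mem_cons.1 h with rfl | h
    · simp [he]
    · have := ih h
      cases e'.act <;> dsimp only <;> first | exact this | (split <;> simp [this]) | simp [this]

theorem committed_history : Committed (history t) a ↔ Committed t a := by
  constructor
  · rintro ⟨r, e, he, h1, h2⟩
    exact ⟨r, e, mem_history he, h1, h2⟩
  · rintro ⟨r, e, he, h1, h2⟩
    exact ⟨r, e, mem_history_of_resOp he h2, h1, h2⟩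

open Classical in
/-- The complete part of a history consists of the visible events of the completed operations. -/
theorem completePart_history (h : ∀ a, Committed t a → ¬ Aborted t a) :
    completePart (history t) = t.filter (fun e => Committed t e.oid ∧ e.act.toSched.isSome) := by
  have key : ∀ u : List (Event n), (∀ e ∈ u, e ∈ t) →
      (history u).filter (fun e => Committed t e.oid) =
        u.filter (fun e => Committed t e.oid ∧ e.act.toSched.isSome) := by
    intro u
    induction u with
    | nil => intro _; rfl
    | cons e u ih =>
      intro hu
      have ih := ih fun e' he' => hu e' (by simp [he'])
      have hna : Committed t e.oid → ¬ ReturnsAbort u e.oid := by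
        intro hc hr
        rw [returnsAbort_iff] at hr
        obtain ⟨e', he', hea, hact⟩ := mem_acts.1 (List.mem_of_find?_eq_some hr)
        exact h _ hc ⟨e', hu e' (by simp [he']), hea, hact⟩
      rw [history]
      by_cases hc : Committed t e.oid
      · have hna := hna hc
        cases hact : e.act with
        | abort => exact absurd ⟨e, hu e (by simp), rfl, hact⟩ (h _ hc)
        | _ => simp [hact, hc, hna, Act.toSched, ih]
      · cases hact : e.act with
        | invRead X => by_cases hr : ReturnsAbort u e.oid <;> simp [hr, hc, ih]
        | invWrite X c => by_cases hr : ReturnsAbort u e.oid <;> simp [hr, hc, ih]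
        | _ => simp [hc, ih]
  unfold completePart
  simp only [committed_history]
  exact key t fun e he => he

/-- The completed operations of an execution, as seen in its schedule. -/
theorem Reach.schedule (h : Reach I t c) :
    ∃ H : List (Event n), H.Sublist t ∧ (∀ e ∈ H, Committed t e.oid) ∧
      scheduleOf (completePart (history t)) = scheduleOf H ∧
      (∀ e ∈ H, e.act.toSched.isSome) ∧
      ∀ p, ∃ s, ProcRun .idle (H.filter (fun e => e.proc = p)) s := by
  classical
  have hca : ∀ a, Committed t a → ¬ Aborted t a := by
    rintro a ⟨r, hr⟩ hab
    obtain ⟨p, op, s, hs⟩ := h.traceInv.state a (Committed.appears ⟨r, hr⟩)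
    have h1 := (hs.responded r).1 hr
    rw [hs.aborted.1 hab] at h1
    cases h1
  refine ⟨_, List.filter_sublist, ?_, by rw [completePart_history hca], ?_, fun p => ?_⟩
  · intro e he
    have := (List.mem_filter.1 he).2
    simp only [decide_eq_true_eq] at this
    exact this.1
  · intro e he
    have := (List.mem_filter.1 he).2
    simp only [decide_eq_true_eq] at this
    exact this.2
  · have := h.procRun (K := Committed t) (fun e he ha hc => hca _ hc ⟨e, he, rfl, ha⟩) p
    refine ⟨(c.phase p).visible (Committed t), ?_⟩
    rw [List.filter_filter]
    convert this using 3
    simp [visibleEvents]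

/-! Inversion of runs, event by event. -/

theorem ProcStep.inv {s s' : Phase} (h : ProcStep s e s') :
    (∃ op, s = .idle ∧ e.act = .invOp op ∧ s' = .ready op e.oid .start) ∨
    (∃ op l, s = .ready op e.oid l ∧ (∀ r, l.cmd ≠ .ret r) ∧ e.act = l.cmd.start ∧
      s' = .busy op e.oid l) ∨
    (∃ op l c, s = .busy op e.oid l ∧ (∀ r, l.cmd ≠ .ret r) ∧ e.act = l.cmd.finish c ∧
      s' = Phase.after op e.oid l c) ∨
    (∃ op r, s = .ready op e.oid (.done r) ∧ e.act = .resOp r ∧ s' = .idle) := by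
  cases h with
  | invoke op h => exact Or.inl ⟨_, rfl, by assumption, rfl⟩
  | call op l h h' => exact Or.inr (Or.inl ⟨_, _, rfl, by assumption, by assumption, rfl⟩)
  | finish op l c h h' => exact Or.inr (Or.inr (Or.inl ⟨_, _, _, rfl, by assumption, by assumption, rfl⟩))
  | ret op r h => exact Or.inr (Or.inr (Or.inr ⟨_, _, rfl, by assumption, rfl⟩))

theorem ProcRun.inv {s s' : Phase} {E : List (Event n)} (h : ProcRun s (e :: E) s') :
    ∃ s₁, ProcStep s e s₁ ∧ ProcRun s₁ E s' := by
  cases h with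
  | cons h1 h2 => exact ⟨_, h1, h2⟩

theorem toSched_start {k : Cmd} (hk : ∀ r, k ≠ .ret r) :
    (∀ op, k.start.toSched ≠ some (.invOp op)) ∧ k.start.toSched ≠ some .resOp ∧
    (∀ X, k.start.toSched = some (.invRead X) → k = .read X) ∧
    (∀ X c, k.start.toSched = some (.invWrite X c) → k = .write X c) := by
  cases k <;> simp_all [Cmd.start, Act.toSched]

theorem toSched_finish {k : Cmd} (hk : ∀ r, k ≠ .ret r) (c : Cell) :
    (∀ op, (k.finish c).toSched ≠ some (.invOp op)) ∧ (k.finish c).toSched ≠ some .resOp ∧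
    (∀ X, (k.finish c).toSched ≠ some (.invRead X)) ∧
    (∀ X c', (k.finish c).toSched ≠ some (.invWrite X c')) := by
  cases k <;> simp_all [Cmd.finish, Act.toSched]

theorem ProcRun.inv_invoke {s s' : Phase} {E : List (Event n)}
    (h : ProcRun s (e :: E) s') (he : e.act.toSched = some (.invOp op)) :
    s = .idle ∧ e.act = .invOp op ∧ ProcRun (.ready op e.oid .start) E s' := by
  obtain ⟨s₁, h1, h2⟩ := h.inv
  rcases h1.inv with ⟨op', rfl, ha, rfl⟩ | ⟨op', l, rfl, hl, ha, rfl⟩ | ⟨op', l, c, rfl, hl, ha, rfl⟩ |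
    ⟨op', r, rfl, ha, rfl⟩
  · rw [ha] at he
    cases he
    exact ⟨rfl, ha, h2⟩
  · rw [ha] at he; exact absurd he ((toSched_start hl).1 _)
  · rw [ha] at he; exact absurd he ((toSched_finish hl c).1 _)
  · rw [ha] at he; cases he

theorem ProcRun.inv_call {s' : Phase} {E : List (Event n)}
 (h : ProcRun (.ready op a l) (e :: f :: E) s') (he : e.act.toSched ≠ some .resOp) :
    e.oid = a ∧ f.oid = a ∧ (∀ r, l.cmd ≠ .ret r) ∧ e.act = l.cmd.start ∧ ∃ c, f.act = l.cmd.finish c ∧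
      ProcRun (Phase.after op a l c) E s' := by
  obtain ⟨s₁, h1, h2⟩ := h.inv
  obtain ⟨s₂, h3, h4⟩ := h2.inv
  rcases h1.inv with ⟨op', h5, -⟩ | ⟨op', l', h5, hl, ha, rfl⟩ | ⟨op', l', c, h5, -⟩ |
    ⟨op', r, h5, ha, rfl⟩
  · cases h5
  · cases h5
    rcases h3.inv with ⟨op', h5, -⟩ | ⟨op', l', h5, -⟩ | ⟨op', l', c, h5, hl', ha', rfl⟩ |
      ⟨op', r, h5, -⟩
    · cases h5
    · cases h5
    · injection h5 with h6 h7 h8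
      subst h6 h8
      rw [h7]
      rw [← h7] at h4
      exact ⟨rfl, rfl, hl, ha, c, ha', h7 ▸ h4⟩
    · cases h5
  · cases h5
  · rw [ha] at he; exact absurd rfl he

theorem ProcRun.inv_read {s' : Phase} {E : List (Event n)}
 (h : ProcRun (.ready op a l) (e :: f :: E) s') (he : e.act.toSched = some (.invRead X)) :
    l.cmd = .read X ∧ e.oid = a ∧ f.oid = a ∧ ∃ c, f.act = .resRead X c ∧
      ProcRun (.ready op a (l.afterRead op a c)) E s' := by
  obtain ⟨h1, h2, h3, h4, c, h5, h6⟩ := h.inv_call (by rw [he]; simp)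
  rw [h4] at he
  have hk := (toSched_start h3).2.2.1 X he
  simp only [Phase.after, hk] at h6
  exact ⟨hk, h1, h2, c, by rw [h5, hk]; rfl, h6⟩

theorem ProcRun.inv_write {s' : Phase} {E : List (Event n)}
 {v : Cell} (h : ProcRun (.ready op a l) (e :: f :: E) s')
    (he : e.act.toSched = some (.invWrite X v)) :
    l.cmd = .write X v ∧ e.oid = a ∧ f.oid = a ∧ f.act = .resWrite X v ∧
      ProcRun (.ready op a l.afterWrite) E s' := by
  obtain ⟨h1, h2, h3, h4, c, h5, h6⟩ := h.inv_call (by rw [he]; simp)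
  rw [h4] at he
  have hk := (toSched_start h3).2.2.2 X v he
  simp only [Phase.after, hk] at h6
  exact ⟨hk, h1, h2, by rw [h5, hk]; rfl, h6⟩

theorem ProcRun.inv_ret {s' : Phase} {E : List (Event n)}
 (h : ProcRun (.ready op a l) (e :: E) s') (he : e.act.toSched = some .resOp) :
    e.oid = a ∧ ∃ r, l = .done r ∧ e.act = .resOp r ∧ ProcRun .idle E s' := by
  obtain ⟨s₁, h1, h2⟩ := h.inv
  rcases h1.inv with ⟨op', h5, -⟩ | ⟨op', l', h5, hl, ha, rfl⟩ | ⟨op', l', c, h5, -⟩ |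
    ⟨op', r, h5, ha, rfl⟩
  · cases h5
  · rw [ha] at he; exact absurd he (toSched_start hl).2.1
  · cases h5
  · cases h5
    exact ⟨rfl, r, rfl, ha, h2⟩

/-! Inversion of control points. -/

theorem afterRead_eq_read {prev curr X : Obj} {pc c : Cell}
    (h : (Loc.afterRead op a (.traverse prev pc curr) c).cmd = .read X) :
    c.val < key op ∧ c.next = X ∧
      Loc.afterRead op a (.traverse prev pc curr) c = .traverse curr c X := by
  by_cases hlt : c.val < key op
  · rw [afterRead_lt hlt] at h
    cases h
    exact ⟨hlt, rfl, afterRead_lt hlt⟩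
  · exfalso
    simp only [Loc.afterRead, if_neg hlt] at h
    cases op with
    | contains v => cases h
    | insert v => dsimp only at h; split at h <;> cases h
    | remove v => dsimp only at h; split at h <;> cases h

theorem afterRead_eq_write {prev curr X : Obj} {pc c v : Cell}
    (h : (Loc.afterRead op a (.traverse prev pc curr) c).cmd = .write X v) :
    ¬ c.val < key op ∧
    ((op.IsInsert ∧ c.val ≠ key op ∧ X = .node a ∧
        Loc.afterRead op a (.traverse prev pc curr) c = .create prev pc (.node a) v) ∨
      (op.IsRemove ∧ c.val = key op ∧ X = prev ∧
        Loc.afterRead op a (.traverse prev pc curr) c = .update prev v)) := by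
  by_cases hlt : c.val < key op
  · rw [afterRead_lt hlt] at h
    cases h
  · refine ⟨hlt, ?_⟩
    simp only [Loc.afterRead, if_neg hlt] at h ⊢
    cases op with
    | contains v => cases h
    | insert w =>
      dsimp only at h ⊢
      by_cases he : c.val = key (.insert w)
      · rw [if_pos he] at h; cases h
      · rw [if_neg he] at h ⊢
        cases h
        exact Or.inl ⟨⟨w, rfl⟩, he, rfl, rfl⟩
    | remove w =>
      dsimp only at h ⊢
      by_cases he : c.val = key (.remove w)
      · rw [if_pos he] at h ⊢
        cases h
        exact Or.inr ⟨⟨w, rfl⟩, he, rfl, rfl⟩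
      · rw [if_neg he] at h; cases h

/-! ### Serial executions -/

theorem serial_append (t : List (Event n)) (L L' : List ℕ) :
    serial t (L ++ L') = serial t L ++ serial t L' := by
  simp [serial]

theorem memAfter_serial_snoc (t : List (Event n)) (L : List ℕ) (a : ℕ) :
    memAfter (serial t (L ++ [a])) = (acts t a).foldl actMem (memAfter (serial t L)) := by
  simp [memAfter_eq, serial, acts]

theorem legal_serial_snoc {L : List ℕ} :
    Legal (serial t (L ++ [a])) ↔
      Legal (serial t L) ∧ LegalFrom (memAfter (serial t L)) (acts t a) := by
  rw [legal_iff, legal_iff, serial_append, List.map_append, LegalFrom.append, memAfter_eq]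
  simp [serial, acts]

theorem legal_of_append {L L' : List ℕ} (h : Legal (serial t (L ++ L'))) :
    Legal (serial t L) := by
  rw [legal_iff, serial_append, List.map_append, LegalFrom.append] at h
  rw [legal_iff]
  exact h.1

/-- An operation that reads from a well-formed memory reads elements of the list. -/
theorem OpRun.linked_of_legal
 (hm : WF V m) (ha : ¬ Made m (.node a)) (hV : V a = op.arg)
    (h : OpRun op a s xs s') (hs : StatOK V op a m m' s) (hl : LegalFrom m' xs) {c : Cell}
    (hX : .resRead X c ∈ xs) : Linked m X := by
  induction h generalizing m' with
  | nil => simp at hX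
  | @cons s s1 s2 x xs h1 h2 ih =>
    have h3 := (OpRun.statOK hm ha hV (.cons h1 (.nil s1)) hs).2 ⟨hl.1, trivial⟩
    rcases List.mem_cons.1 hX with rfl | hX
    · generalize hx : Act.resRead X c = x at h1
      cases h1 with
      | call l => cases l <;> cases hx
      | step l => cases hx
      | abort l => cases hx
      | ret l c' =>
        obtain ⟨hcmd, -⟩ : l.cmd = .read X ∧ c' = c := by
          cases hc : l.cmd <;> rw [hc] at hx <;> cases hx
          exact ⟨rfl, rfl⟩
        exact (LocOK.read hm hs hcmd).2.1
    · exact ih h3 hl.2 hX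

theorem OpState.legal_iff
 (h : OpState t c a p op s) (hV : ∀ a op, Invoked t a op → V a = op.arg) (hm : WF V m)
    (ha : ¬ Made m (.node a)) :
    LegalFrom m (acts t a) ↔ ∀ X c, .resRead X c ∈ acts t a → c = m X := by
  obtain ⟨xs, hxs, hrun⟩ := h.run
  rw [hxs]
  have := (hrun.statOK hm ha (hV a op h.invoked) (m' := m) (by rfl)).1
  simp [LegalFrom, actMem, this]

theorem OpState.statOK
 (h : OpState t c a p op s) (hV : ∀ a op, Invoked t a op → V a = op.arg) (hm : WF V m)
    (ha : ¬ Made m (.node a)) (hl : LegalFrom m (acts t a)) :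
    StatOK V op a m ((acts t a).foldl actMem m) s ∧
      ∀ X c, .resRead X c ∈ acts t a → Linked m X ∧ c = m X := by
  have hr := (h.legal_iff hV hm ha).1 hl
  obtain ⟨xs, hxs, hrun⟩ := h.run
  rw [hxs] at hl hr ⊢
  refine ⟨(hrun.statOK hm ha (hV a op h.invoked) (m' := m) (by rfl)).2 hl.2, fun X c hX => ?_⟩
  refine ⟨hrun.linked_of_legal hm ha (hV a op h.invoked) (m' := m) (by rfl) hl.2 (X := X) (c := c) ?_,
    hr X c hX⟩
  simpa using hX

/-- The operation reached its end. -/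
theorem OpState.effect
 (h : OpState t c a p op s) (hV : ∀ a op, Invoked t a op → V a = op.arg) (hm : WF V m)
    (ha : ¬ Made m (.node a)) (hl : LegalFrom m (acts t a))
    (hc : Committed t a ∨ CommitPending t a) :
    ∃ r, (∀ r', Responded t a r' → r' = r) ∧ Effect V op a r m ((acts t a).foldl actMem m) := by
  have := (h.statOK hV hm ha hl).1
  rcases hc with ⟨r, hc⟩ | hc
  · rw [(h.responded r).1 hc] at this
    refine ⟨r, fun r' hr' => ?_, this⟩
    have := ((h.responded r').1 hr').symm.trans ((h.responded r).1 hc)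
    injection this
  · obtain ⟨r, rfl⟩ := h.commitPending.1 hc
    exact ⟨r, fun r' hr' => (by cases (h.responded r').1 hr'), this⟩

/-- The memory after the serial execution of `W` is a list, made of elements allocated in `W`,
and the responses in `W` are those of the type `set`. -/
structure SerialOK (V : ℕ → ℤ) (t : List (Event n)) (W : List ℕ) (m : Obj → Cell) : Prop where
  wf : WF V m
  made : ∀ b, Made m (.node b) → b ∈ W
  abs : ∃ (L : List (ℕ × SetOp × Bool)) (q : Finset ℤ), L.map Prod.fst = W ∧
    (∀ x ∈ L, Invoked t x.1 x.2.1 ∧ ∀ r, Responded t x.1 r → r = x.2.2) ∧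
    SetPath ∅ (L.map Prod.snd) q ∧ Abs V m q

/-- Induction along the serialization. Each transaction starts from a well-formed list in which its
own node is not made, since nodes bear the identifiers of earlier transactions; it reads legally and
has reached the end of its code, so `OpState.effect` gives the next list and set. -/
theorem Reach.serialOK (h : Reach I t c)
    (hV : ∀ a op, Invoked t a op → V a = op.arg) {L : List ℕ} (hL : L.Nodup)
    (hc : ∀ a ∈ L, Committed t a ∨ CommitPending t a) (hl : Legal (serial t L)) :
    SerialOK V t L (memAfter (serial t L)) := by
  induction L using List.reverseRecOn with
  | nil => exact ⟨WF.initMem V, fun b hb => absurd hb (not_made_initMem b),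
    [], ∅, rfl, by simp, rfl, Abs.initMem V⟩
  | append_singleton L a ih =>
    obtain ⟨hl1, hl2⟩ := legal_serial_snoc.1 hl
    have hn := List.nodup_append.1 hL
    obtain ⟨h1, h2, P, q, hP1, hP2, hP3, h3⟩ := ih hn.1 (fun b hb => hc b (by simp [hb])) hl1
    have hca := hc a (by simp)
    have happ : Appears t a := by
      rcases hca with hca | ⟨⟨e, he, hea, -⟩, -⟩
      · exact hca.appears
      · exact ⟨e, he, hea⟩
    obtain ⟨p, op, s, hst⟩ := h.traceInv.state a happ
    have hna : ¬ Made (memAfter (serial t L)) (.node a) := fun hm =>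
      hn.2.2 a (h2 a hm) a (by simp) rfl
    obtain ⟨r, hr, he⟩ := hst.effect hV h1 hna hl2 hca
    rw [memAfter_serial_snoc]
    obtain ⟨q', hq', hd⟩ := he.delta q h3
    refine ⟨he.wf, fun b hb => ?_, P ++ [(a, op, r)], q', by simp [hP1], fun x hx => ?_, ?_, hq'⟩
    · rcases he.made b hb with hb | rfl
      · simp [h2 b hb]
      · simp
    · rcases List.mem_append.1 hx with hx | hx
      · exact hP2 x hx
      · rw [List.mem_singleton.1 hx]
        exact ⟨hst.invoked, hr⟩
    · rw [List.map_append]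
      exact hP3.append ⟨q', hd, rfl⟩

/-- A completed operation at its place in a serialization. -/
theorem Reach.serial_split (h : Reach I t c)
    (hV : ∀ a op, Invoked t a op → V a = op.arg) {L₁ L₂ : List ℕ} (hL : (L₁ ++ a :: L₂).Nodup)
    (hc : ∀ b ∈ L₁ ++ a :: L₂, Committed t b ∨ CommitPending t b)
    (hl : Legal (serial t (L₁ ++ a :: L₂))) :
    SerialOK V t L₁ (memAfter (serial t L₁)) ∧
    (∀ X c, .resRead X c ∈ acts t a →
      Linked (memAfter (serial t L₁)) X ∧ c = memAfter (serial t L₁) X) ∧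
    ∃ op r, Invoked t a op ∧
      Effect V op a r (memAfter (serial t L₁)) (memAfter (serial t (L₁ ++ [a]))) := by
  have hl' : Legal (serial t (L₁ ++ [a])) := by
    refine legal_of_append (L' := L₂) ?_
    simpa using hl
  obtain ⟨hl1, hl2⟩ := legal_serial_snoc.1 hl'
  have hn := List.nodup_append.1 hL
  have hs := h.serialOK hV hn.1 (fun b hb => hc b (by simp [hb])) hl1
  have hca := hc a (by simp)
  have happ : Appears t a := by
    rcases hca with hca | ⟨⟨e, he, hea, -⟩, -⟩
    · exact hca.appears
    · exact ⟨e, he, hea⟩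
  obtain ⟨p, op, s, hst⟩ := h.traceInv.state a happ
  have hna : ¬ Made (memAfter (serial t L₁)) (.node a) := fun hm =>
    hn.2.2 a (hs.made a hm) a (by simp) rfl
  obtain ⟨r, -, he⟩ := hst.effect hV hs.wf hna hl2 hca
  refine ⟨hs, (hst.statOK hV hs.wf hna hl2).2, op, r, hst.invoked, ?_⟩
  rw [memAfter_serial_snoc]
  exact he

/-- In a serialization, an element that was removed before an operation is not read by it. -/
theorem not_strictlySerializable_of_removed (h : Reach I t c)
    {x y z b : ℕ} {v : ℤ} {cb cx cz : Cell}
    (hx : Committed t x) (hy : Committed t y) (hz : Committed t z)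
    (hop : Invoked t y (.remove v)) (hyz : Precedes t y z) (hyb : .resRead (.node b) cb ∈ acts t y)
    (hcb : cb.val = keyVal v) (hxh : .resRead .head cx ∈ acts t x) (hcx : cx.next = .node b)
    (hxz : .resRead (.node z) cz ∈ acts t x) : ¬ StrictlySerializable t := by
  rintro ⟨L, hnd, hcom, hcp, hprec, hleg⟩
  obtain ⟨V, hV⟩ := h.exists_arg
  obtain ⟨A, B, rfl⟩ := List.append_of_mem (hcom x hx)
  obtain ⟨hAok, hAr, -⟩ := h.serial_split hV hnd hcp hleg
  -- `x` reads the node of `z`, which therefore has been made before `x` in the serialization.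
  have hzA : z ∈ A := hAok.made z ((hAr _ _ hxz).1.made hAok.wf)
  have hn := List.nodup_append.1 hnd
  -- The order of `y` and `z` in real time puts `y` before `z`, hence also before `x`.
  have hyA : y ∈ A := by
    have hsub := hprec y (hcom y hy) z (hcom z hz) hyz
    obtain ⟨l₁, l₂, h1, h2, h3⟩ := List.sublist_append_iff.1 hsub
    match l₁, h1 with
    | [], h1 =>
      rw [List.nil_append] at h1
      rw [← h1] at h3
      exact absurd rfl (hn.2.2 z hzA z (h3.subset (by simp)))
    | w :: l₁, h1 =>
      rw [List.cons_append] at h1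
      injection h1 with h1 _
      subst h1
      exact h2.subset (by simp)
  -- `x` finds `b` behind the head, so `b` is on the list when `x` runs.
  have hbx : Linked (memAfter (serial t A)) (.node b) := by
    have h1 := (Linked.head (memAfter (serial t A))).next (by simp)
    rwa [← (hAr _ _ hxh).2, hcx] at h1
  obtain ⟨A₁, A₂, rfl⟩ := List.append_of_mem hyA
  have hsplit : A₁ ++ y :: A₂ ++ x :: B = A₁ ++ y :: (A₂ ++ x :: B) := by simp
  rw [hsplit] at hnd hcp hleg
  obtain ⟨hok, hr, op, r, hinv, heff⟩ := h.serial_split hV hnd hcp hleg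
  have hlb := hr _ _ hyb
  have hbA : b ∈ A₁ := hok.made b (hlb.1.made hok.wf)
  have hVb : V b = v := by
    have h1 := hok.wf.val (hlb.1.made hok.wf)
    rw [← hlb.2, hcb] at h1
    exact (keyVal_inj.1 h1).symm
  obtain ⟨p, op', s, hst⟩ := h.traceInv.state y hy.appears
  obtain rfl : op = .remove v := by rw [hst.invoked_unique hinv, hst.invoked_unique hop]
  obtain ⟨-, q, -, -, -, hq⟩ := hok.abs
  obtain ⟨q', hq', hd⟩ := heff.delta q hq
  -- After the removal `v` is not in the set, while `b` has the value `v`.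
  have hnl : ¬ Linked (memAfter (serial t (A₁ ++ [y]))) (.node b) := by
    intro hl
    have := (hq' v).2 ⟨b, hl, hVb⟩
    rw [hd.1] at this
    simp at this
  -- A removed node never returns: a later transaction adds no element to the list except its own
  -- node, and `b` belongs to a transaction before `y`.
  suffices ∀ A₃, A₃ <+: A₂ → ¬ Linked (memAfter (serial t (A₁ ++ [y] ++ A₃))) (.node b) by
    have h1 := this A₂ List.prefix_rfl
    rw [List.append_assoc, List.singleton_append] at h1
    exact h1 hbx
  intro A₃
  induction A₃ using List.reverseRecOn with
  | nil => intro _; simpa using hnl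
  | append_singleton A₃ w ih =>
    rintro ⟨A₄, rfl⟩ hl
    have he : A₁ ++ y :: (A₃ ++ [w] ++ A₄ ++ x :: B) =
        (A₁ ++ [y] ++ A₃) ++ w :: (A₄ ++ x :: B) := by simp
    have hbw : w ≠ b := by
      rintro rfl
      exact (List.nodup_append.1 hnd).2.2 w hbA w (by simp) rfl
    rw [he] at hnd hcp hleg
    obtain ⟨-, -, op, r, -, heff⟩ := h.serial_split hV hnd hcp hleg
    rw [List.append_assoc _ A₃] at heff
    rw [← List.append_assoc] at hl
    rcases heff.linked _ (by simpa using hl) with h1 | h1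
    · exact ih ⟨[w] ++ A₄, by simp⟩ (by simpa using h1)
    · cases h1; exact hbw rfl

/-! ### The schedule that is not accepted by transactions -/

theorem forall₂_of_scheduleOf {H : List (Event n)} (h : ∀ e ∈ H, e.act.toSched.isSome) :
    List.Forall₂ (fun e x => e.proc = x.1 ∧ e.act.toSched = some x.2) H (scheduleOf H) := by
  induction H with
  | nil => exact .nil
  | cons e H ih =>
    obtain ⟨x, hx⟩ := Option.isSome_iff_exists.1 (h e (by simp))
    have : scheduleOf (e :: H) = (e.proc, x) :: scheduleOf H := by simp [scheduleOf, hx]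
    rw [this]
    exact .cons ⟨rfl, hx⟩ (ih fun e' he' => h e' (by simp [he']))

theorem forall₂_filter_proc {H : List (Event n)} {σ : Schedule n} (p : Fin n)
    (h : List.Forall₂ (fun e x => e.proc = x.1 ∧ e.act.toSched = some x.2) H σ) :
    List.Forall₂ (fun e x => e.act.toSched = some x) (H.filter (fun e => e.proc = p))
      ((σ.filter (fun x => x.1 = p)).map Prod.snd) := by
  induction h with
  | nil => exact .nil
  | @cons e x H σ h1 _ ih =>
    by_cases hp : x.1 = p
    · rw [List.filter_cons_of_pos (by simpa [h1.1] using hp),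
        List.filter_cons_of_pos (by simpa using hp)]
      exact .cons h1.2 ih
    · rw [List.filter_cons_of_neg (by simpa [h1.1] using hp),
        List.filter_cons_of_neg (by simpa using hp)]
      exact ih

/-- The part of one process in an accepted schedule. -/
theorem Reach.procSchedule (h : Reach I t c) {σ : Schedule n}
    (hσ : scheduleOf (completePart (history t)) = σ) (p : Fin n) :
    ∃ E : List (Event n), E.Sublist t ∧ (∀ e ∈ E, Committed t e.oid) ∧
      List.Forall₂ (fun e x => e.act.toSched = some x) E
        ((σ.filter (fun x => x.1 = p)).map Prod.snd) ∧ ∃ s, ProcRun .idle E s := by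
  obtain ⟨H, h1, h2, h3, h4, h5⟩ := h.schedule
  refine ⟨H.filter (fun e => e.proc = p), List.filter_sublist.trans h1,
    fun e he => h2 e (List.mem_of_mem_filter he), ?_, h5 p⟩
  rw [← hσ, h3]
  exact forall₂_filter_proc p (forall₂_of_scheduleOf h4)

theorem mem_acts_of_sublist {E t : List (Event n)} (h : E.Sublist t) (he : e ∈ E)
 {x : Act} (ha : e.oid = a) (hx : e.act = x) : x ∈ acts t a :=
  mem_acts.2 ⟨e, h.subset he, ha, hx⟩

theorem afterRead_start (op : SetOp) (a : ℕ) (c : Cell) :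
    Loc.afterRead op a .start c = .traverse .head c c.next := rfl

/-- The control flow forced by the schedule yields the data for
`not_strictlySerializable_of_removed`. The operation `remove 2` goes on to write, so the node 0 that
it has read holds 2; the creation of node 4 reveals the identifier of `insert 5`; and `contains`
finds node 0 behind the head and later reads node 4. -/
theorem ClassSM.not_accepts_lockSchedule (hI : ClassSM I) (hpp : p' ≠ p) :
    ¬ Accepts I (lockSchedule p p') := by
  rintro ⟨t, ⟨c, ht⟩, hσ⟩
  have hss := (hI.safe t ⟨c, ht⟩).1
  obtain ⟨E, hE, hEc, hf, s, hrun⟩ := ht.procSchedule hσ p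
  obtain ⟨E', hE', hEc', hf', s', hrun'⟩ := ht.procSchedule hσ p'
  simp only [lockSchedule, List.filter_cons, hpp, hpp.symm, decide_true, decide_false, if_true,
    Bool.false_eq_true, if_false, List.filter_nil, List.map_cons, List.map_nil] at hf hf'
  rcases hf' with _ | ⟨g0, _ | ⟨g1, _ | ⟨-, _ | ⟨g3, _ | ⟨-, _ | ⟨g5, _ | ⟨-, _ | ⟨g7, hf'⟩⟩⟩⟩⟩⟩⟩⟩
  rcases hf' with _ | ⟨k0, _ | ⟨k1, _ | ⟨-, _ | ⟨k3, _ | ⟨-, _ | ⟨k5, _ | ⟨-, _ | ⟨k7, hf'⟩⟩⟩⟩⟩⟩⟩⟩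
  rcases hf' with _ | ⟨-, -⟩
  obtain ⟨-, ha0, hrun'⟩ := hrun'.inv_invoke g0
  obtain ⟨-, -, ho1, b1, ha1, hrun'⟩ := hrun'.inv_read g1
  obtain ⟨hcmd3, -, ho4, b2, ha4, hrun'⟩ := hrun'.inv_read g3
  obtain ⟨hcmd, -, -, -, hrun'⟩ := hrun'.inv_write g5
  obtain ⟨ho7, ry, -, ha7, hrun'⟩ := hrun'.inv_ret g7
  obtain ⟨-, hz0, hrun'⟩ := hrun'.inv_invoke k0
  obtain ⟨-, -, -, d1, -, hrun'⟩ := hrun'.inv_read k1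
  obtain ⟨-, -, -, d2, -, hrun'⟩ := hrun'.inv_read k3
  obtain ⟨hcmd5, -, -, d3, -, hrun'⟩ := hrun'.inv_read k5
  obtain ⟨hcmd7, -, -, -, -⟩ := hrun'.inv_write k7
  have hb2 : b2.val = keyVal 2 := by
    rcases (afterRead_eq_write hcmd).2 with ⟨⟨w, hw⟩, -⟩ | ⟨-, hb2, -⟩
    · cases hw
    · exact hb2
  rw [afterRead_start] at hcmd5 hcmd7
  rw [(afterRead_eq_read hcmd5).2.2] at hcmd7
  rcases (afterRead_eq_write hcmd7).2 with ⟨-, -, hz, -⟩ | ⟨⟨w, hw⟩, -⟩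
  swap
  · cases hw
  injection hz with hz
  -- the last operation of `p`
  have hf := List.forall₂_drop 22 hf
  rw [← List.take_append_drop 22 E] at hE hEc hrun
  obtain ⟨s₀, -, hrun⟩ := hrun.split
  have hE := (List.sublist_append_right _ _).trans hE
  replace hEc := fun e he => hEc e (List.mem_append_right _ he)
  generalize List.drop 22 E = F at *
  simp only [List.drop_succ_cons, List.drop_zero] at hf
  rcases hf with _ | ⟨g0, _ | ⟨g1, _ | ⟨-, _ | ⟨g3, _ | ⟨-, hf⟩⟩⟩⟩⟩
  rcases hf with _ | ⟨g5, _ | ⟨-, _ | ⟨g7, _ | ⟨-, _ | ⟨-, -⟩⟩⟩⟩⟩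
  obtain ⟨-, -, hrun⟩ := hrun.inv_invoke g0
  obtain ⟨-, -, hx1, c1, hc1, hrun⟩ := hrun.inv_read g1
  obtain ⟨hcmd1, -, -, c2, -, hrun⟩ := hrun.inv_read g3
  obtain ⟨hcmd2, -, -, c3, -, hrun⟩ := hrun.inv_read g5
  rw [afterRead_start] at hcmd1 hcmd2 hrun
  rw [(afterRead_eq_read hcmd2).2.2] at hrun
  obtain ⟨hcmd3, -, hx4, c4, hc4, -⟩ := hrun.inv_read g7
  -- Without the seven events of `remove 2` that precede its response, the list starts with this
  -- response and the invocation of the insertion.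
  have hres : List.Sublist _ t := (List.drop_sublist 7 _).trans hE'
  refine not_strictlySerializable_of_removed ht (v := 2) (b := 0) (hEc _ (by simp)) (hEc' _ (by simp))
    (hEc' _ ?_) ⟨_, hE'.subset (by simp), rfl, ha0⟩
    ⟨_, _, (List.Sublist.cons_cons _ (List.Sublist.cons_cons _ (List.nil_sublist _))).trans hres,
      ho7, rfl, Or.inl ⟨ry, ha7⟩, _, hz0⟩
    (mem_acts_of_sublist hE' (by simp) ho4 ha4) hb2
    (mem_acts_of_sublist hE (by simp) hx1 hc1) ?_
    (mem_acts_of_sublist hE (by simp) hx4 (hz ▸ hc4)) hss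
  · simp
  · injection hcmd1

/-! ### Change of parameters -/

open Classical in
/-- The parameter of the operations in `K` is replaced by `v`. -/
noncomputable def reparam (v : ℤ) (K : ℕ → Prop) (e : Event n) : Event n :=
  if K e.oid ∧ ∃ op, e.act = .invOp op then ⟨e.proc, e.oid, .invOp (.insert v)⟩ else e

theorem reparam_of_not {v : ℤ} {K : ℕ → Prop} (h : ∀ op, e.act ≠ .invOp op) :
    reparam v K e = e :=
  if_neg fun h' => h _ h'.2.choose_spec

/-- Control points of a traversal that has not passed the first node. -/
def Loc.Early (X : Obj) (l : Loc) : Prop := l = .start ∨ ∃ pc, l = .traverse .head pc X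

/-- The phase of a process after the change of parameters. -/
inductive PhaseRel (v : ℤ) (X : Obj) (K : ℕ → Prop) : Phase → Phase → Prop
  | same (ph : Phase) : (∀ b, ph.oid = some b → ¬ K b) → PhaseRel v X K ph ph
  | ready (op : SetOp) (b : ℕ) (l : Loc) : K b → l.Early X →
      PhaseRel v X K (.ready op b l) (.ready (.insert v) b l)
  | busy (op : SetOp) (b : ℕ) (l : Loc) : K b → l.Early X →
      PhaseRel v X K (.busy op b l) (.busy (.insert v) b l)
  -- From the read of `X` on, the control points may differ: the new insertion creates its node, the
  -- old one may be anywhere but at a read.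
  | last (op : SetOp) (b : ℕ) (l : Loc) (pc c : Cell) : K b → (∀ Y, l.cmd ≠ .read Y) →
      PhaseRel v X K (.ready op b l) (.ready (.insert v) b (.create .head pc (.node b) c))

structure ConfigRel (v : ℤ) (X : Obj) (K : ℕ → Prop) (c d : Config I) : Prop where
  base : d.base = c.base
  loc : d.loc = c.loc
  used : d.used = c.used
  phase : ∀ q, PhaseRel v X K (c.phase q) (d.phase q)

theorem PhaseRel.update {v : ℤ} {K : ℕ → Prop} {f g : Fin n → Phase}
    {a b : Phase} (h : ∀ q, PhaseRel v X K (f q) (g q)) (hab : PhaseRel v X K a b) (q : Fin n) :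
    PhaseRel v X K (Function.update f p a q) (Function.update g p b q) := by
  by_cases hq : q = p
  · subst hq; simpa using hab
  · simpa [hq] using h q

theorem PhaseRel.idle {v : ℤ} {K : ℕ → Prop} : PhaseRel v X K .idle .idle :=
  .same _ (by simp [Phase.oid])

theorem mem_acts_append_left {x : Act} (h : x ∈ acts t a) :
    x ∈ acts (t ++ [e]) a := by
  rw [acts_append]; exact List.mem_append_left _ h

/-- The insertions in `K`, which read only the head and its successor `X`, cannot be told apart
from insertions of a smaller integer `v`. -/
theorem Reach.reparam {v : ℤ} (hX : X ≠ .head) {K : ℕ → Prop}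
 (h : Reach I t c) (hop : ∀ b op, K b → Invoked t b op → op.IsInsert ∧ v < op.arg)
    (hr : ∀ b op Y w, K b → Invoked t b op → .resRead Y w ∈ acts t b →
      Y = .head ∧ w.next = X ∨ Y = X ∧ ¬ w.val < key op)
    (hw : ∀ b Y w, K b → .invWrite Y w ∉ acts t b) (hc : ∀ b, K b → .startCommit ∉ acts t b) :
    ∃ d, Reach I (t.map (reparam v K)) d ∧ ConfigRel v X K c d := by
  induction h with
  | nil => exact ⟨_, .nil, rfl, rfl, rfl, fun _ => .idle⟩
  | @snoc t c c' e h1 h2 ih =>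
    have hinv : ∀ b op, Invoked t b op → Invoked (t ++ [e]) b op := by
      rintro b op ⟨e', he', h⟩
      exact ⟨e', by simp [he'], h⟩
    obtain ⟨d, hd, hrel⟩ := ih (fun b op hb ho => hop b op hb (hinv b op ho))
      (fun b op Y w hb ho hm => hr b op Y w hb (hinv b op ho) (mem_acts_append_left hm))
      (fun b Y w hb hm => hw b Y w hb (mem_acts_append_left hm))
      (fun b hb hm => hc b hb (mem_acts_append_left hm))
    have hlast : e.act ∈ acts (t ++ [e]) e.oid := mem_acts.2 ⟨e, by simp, rfl, rfl⟩
    have hst2 := h2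
    rw [List.map_append, List.map_singleton]
    have hph := hrel.phase
    suffices ∃ d', Step I d (ListSet.reparam v K e) d' ∧ ConfigRel v X K c' d' by
      obtain ⟨d', h3, h4⟩ := this
      exact ⟨d', .snoc hd h3, h4⟩
    cases h2 with
    | invoke p op a hidle ha =>
      have h3 := hph p
      rw [hidle] at h3
      generalize hg : d.phase p = g at h3
      cases h3
      by_cases hK : K a
      · have he : ListSet.reparam v K (⟨p, a, .invOp op⟩ : Event n) = ⟨p, a, .invOp (.insert v)⟩ :=
          if_pos ⟨hK, op, rfl⟩
        rw [he]
        refine ⟨_, .invoke d p (.insert v) a hg (by rwa [hrel.used]), hrel.base, hrel.loc,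
          by simp [hrel.used], PhaseRel.update hph (.ready op a _ hK (Or.inl rfl))⟩
      · have he : ListSet.reparam v K (⟨p, a, .invOp op⟩ : Event n) = ⟨p, a, .invOp op⟩ :=
          if_neg fun h => hK h.1
        rw [he]
        refine ⟨_, .invoke d p op a hg (by rwa [hrel.used]), hrel.base, hrel.loc,
          by simp [hrel.used], PhaseRel.update hph (.same _ fun b hb => ?_)⟩
        cases hb
        exact hK
    | call p op a l hpc =>
      have hst := h1.pending_invoked (s := .ready l) hpc trivial
      rw [reparam_of_not (by cases l <;> simp [Loc.cmd, Cmd.start])]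
      have h3 := hph p
      rw [hpc] at h3
      generalize hg : d.phase p = g at h3
      cases h3 with
      | same _ hK =>
        refine ⟨_, .call d p op a l hg, hrel.base, by simp [hrel.loc], hrel.used,
          PhaseRel.update hph (.same _ fun b hb => ?_)⟩
        exact hK b hb
      | ready _ _ _ hK hl =>
        obtain ⟨⟨w, rfl⟩, -⟩ := hop a op hK (hinv a op hst.invoked)
        -- Both operations have the name `insert`, which is all that the algorithm is told about
        -- them.
        exact ⟨_, .call d p (.insert v) a l hg, hrel.base, by simp [hrel.loc, SetOp.name], hrel.used,
          PhaseRel.update hph (.busy _ a l hK hl)⟩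
      | last _ _ _ pc w hK hl =>
        -- The original operation could only start a write or its completion here, and neither
        -- occurs in the execution.
        exfalso
        cases hcmd : l.cmd with
        | read Y => exact hl Y hcmd
        | write Y w => exact hw a Y w hK (by simpa [hcmd, Cmd.start] using hlast)
        | ret r => exact hc a hK (by simpa [hcmd, Cmd.start] using hlast)
    | prim p op a l b f hpc hn =>
      rw [reparam_of_not (by simp)]
      have h3 := hph p
      rw [hpc] at h3
      generalize hg : d.phase p = g at h3
      have : ∃ op', d.phase p = .busy op' a l := by
        cases h3 <;> exact ⟨_, hg⟩
      obtain ⟨op', hg'⟩ := this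
      refine ⟨_, .prim d p op' a l b f hg' (by rwa [hrel.loc]), ?_, ?_, hrel.used, hph⟩
      · simp [hrel.base]
      · simp [hrel.base, hrel.loc]
    | abort p op a l hpc hn =>
      rw [reparam_of_not (by simp)]
      have h3 := hph p
      rw [hpc] at h3
      generalize hg : d.phase p = g at h3
      have : ∃ op', d.phase p = .busy op' a l := by
        cases h3 <;> exact ⟨_, hg⟩
      obtain ⟨op', hg'⟩ := this
      exact ⟨_, .abort d p op' a l hg' (by rwa [hrel.loc]), hrel.base, hrel.loc, hrel.used,
        PhaseRel.update hph .idle⟩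
    | ret p op a l w hpc hn =>
      have hst := h1.pending_invoked (s := .busy l) hpc trivial
      rw [reparam_of_not (by cases l <;> simp [Loc.cmd, Cmd.finish])]
      have h3 := hph p
      rw [hpc] at h3
      generalize hg : d.phase p = g at h3
      cases h3 with
      | same _ hK =>
        refine ⟨_, .ret d p op a l w hg (by rwa [hrel.loc]), hrel.base, hrel.loc, hrel.used,
          PhaseRel.update hph (.same _ fun b hb => ?_)⟩
        rw [Phase.after_eq, Stat.oid_phase] at hb
        rw [← hb.2]
        exact hK a rfl
      | busy _ _ _ hK hl =>
        obtain ⟨⟨w', rfl⟩, hlt⟩ := hop a op hK (hinv a op hst.invoked)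
        refine ⟨_, .ret d p (.insert v) a l w hg (by rwa [hrel.loc]), hrel.base, hrel.loc, hrel.used,
          PhaseRel.update hph ?_⟩
        have hr := fun Y hm => hr a _ Y w hK (hinv a _ hst.invoked) hm
        rcases hl with rfl | ⟨pc, rfl⟩
        · rcases hr .head hlast with ⟨-, h4⟩ | ⟨h4, -⟩
          · exact .ready _ a _ hK (Or.inr ⟨w, by rw [← h4]; rfl⟩)
          · exact absurd h4.symm hX
        · have h4 : ¬ w.val < keyVal w' := by
            rcases hr X hlast with ⟨h4, -⟩ | ⟨-, h4⟩
            · exact absurd h4 hX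
            · exact h4
          -- The value of `X` is at least the old parameter, hence above `v`: the new insertion also
          -- stops at `X`, and it does not find `v` there.
          have h5 : keyVal v < w.val := (keyVal_lt.2 hlt).trans_le (not_lt.1 h4)
          simp only [Phase.after, Loc.cmd]
          rw [afterRead_insert h5]
          refine .last _ a _ _ _ hK fun Y hY => ?_
          exact h4 (afterRead_eq_read hY).1

/-! ### Completion of the pending operations -/

/-- A process with a pending operation can take a step. -/
theorem exists_step (h : c.phase p ≠ .idle) :
    ∃ e c', Step I c e c' ∧ e.proc = p ∧ ∀ op, e.act ≠ .invOp op := by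
  cases hp : c.phase p with
  | idle => exact absurd hp h
  | ready op a l =>
    exact ⟨_, _, .call c p op a l hp, rfl, by cases l <;> simp [Loc.cmd, Cmd.start]⟩
  | busy op a l =>
    cases hn : I.next p (c.loc p) with
    | prim b f => exact ⟨_, _, .prim c p op a l b f hp hn, rfl, by simp⟩
    | ret r =>
      cases r with
      | none => exact ⟨_, _, .abort c p op a l hp hn, rfl, by simp⟩
      | some v => exact ⟨_, _, .ret c p op a l v hp hn, rfl, by cases l <;> simp [Loc.cmd, Cmd.finish]⟩

/-- A process keeps its operation pending until it returns. -/
theorem Step.phase_ne_idle (h : Step I c e c')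
    (hr : ∀ r, e.act ≠ .resOp r) (ha : e.act ≠ .abort) (hp : c.phase p ≠ .idle) :
    c'.phase p ≠ .idle := by
  by_cases hpe : p = e.proc
  · subst hpe
    rcases h.cases_stat with ⟨op, h1, -⟩ | ⟨op, s, s', h1, h2, h3, h4, -⟩
    · exact absurd h1 hp
    · rw [h4, Function.update_self, Stat.phase_ne_idle]
      generalize hx : e.act = x at h3 hr ha
      cases h3 with
      | call l => trivial
      | step l => trivial
      | abort l => exact absurd rfl ha
      | ret l c =>
        cases l <;> first | trivial | exact absurd rfl (hr _)
  · have : c'.phase p = c.phase p := by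
      rcases h.cases_stat with ⟨op, -, -, -, h4, -⟩ | ⟨op, s, s', -, -, -, h4, -⟩ <;>
        rw [h4, Function.update_of_ne hpe]
    rwa [this]

/-- An infinite continuation of a finite execution. -/
theorem Reach.infExecution (h : Reach I t c)
    {d : ℕ → Config I} {f : ℕ → Event n} (h0 : d 0 = c) (hs : ∀ i, Step I (d i) (f i) (d (i + 1))) :
    ∃ (d' : ℕ → Config I) (f' : ℕ → Event n), IsInfExecution I d' f' ∧
      (∀ i, d' (t.length + i) = d i) ∧ ∀ i, f' (t.length + i) = f i := by
  obtain ⟨cs, h1, h2, h3, -⟩ := h.configs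
  refine ⟨fun i => if i < t.length then cs i else d (i - t.length),
    fun i => if hi : i < t.length then t[i] else f (i - t.length), ⟨?_, fun i => ?_⟩, ?_, ?_⟩
  · by_cases hl : 0 < t.length
    · simpa [hl] using h1
    · have : t.length = 0 := by omega
      simp only [hl, if_false, Nat.zero_sub, h0]
      rw [← h2, this, h1]
  · by_cases hi : i < t.length
    · simp only [hi, if_true, dif_pos]
      by_cases hi' : i + 1 < t.length
      · simp only [hi', if_true]
        exact h3 i hi
      · have : i + 1 = t.length := by omega
        have h4 : cs (i + 1) = cs t.length := by rw [this]
        simp only [this, lt_irrefl, if_false, Nat.sub_self, h0, ← h2]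
        rw [← h4]
        exact h3 i hi
    · have hi' : ¬ i + 1 < t.length := by omega
      simp only [hi, hi', if_false, dif_neg, not_false_eq_true]
      rw [show i + 1 - t.length = i - t.length + 1 by omega]
      exact hs _
  · intro i; simp
  · intro i; simp

open Classical in
/-- A step of process `p`, which is not an invocation. -/
noncomputable def someStep (c : Config I) (p : Fin n) : Event n × Config I :=
  if h : c.phase p ≠ .idle then
    ⟨(exists_step h).choose, (exists_step h).choose_spec.choose⟩
  else ⟨⟨p, 0, .step⟩, c⟩

theorem someStep_spec (h : c.phase p ≠ .idle) :
    Step I c (someStep c p).1 (someStep c p).2 ∧ (someStep c p).1.proc = p ∧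
      ∀ op, (someStep c p).1.act ≠ .invOp op := by
  unfold someStep
  rw [dif_pos h]
  exact (exists_step h).choose_spec.choose_spec

/-- Without new invocations, some pending operation returns. -/
theorem ClassP.exists_response (hI : ClassP I) (h : Reach I t c) (hp : c.phase p ≠ .idle) :
    ∃ u d d' e, Run I c u d ∧ (∀ e ∈ u, ∀ op, e.act ≠ .invOp op) ∧ Step I d e d' ∧
      ∃ r, e.act = .resOp r := by
  classical
  by_contra hcon
  have hn : 0 < n := p.pos
  -- Round robin over all processes, with `p` standing in for idle ones. Under the contrary
  -- assumption `p` never returns, so a step can always be taken.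
  let sched : ℕ → Config I → Fin n := fun i c =>
    if c.phase ⟨i % n, Nat.mod_lt _ hn⟩ ≠ .idle then ⟨i % n, Nat.mod_lt _ hn⟩ else p
  let d : ℕ → Config I := fun i =>
    Nat.rec c (fun i c => (someStep c (sched i c)).2) i
  have hinv : ∀ i, (∃ u, Run I c u (d i) ∧ ∀ e ∈ u, ∀ op, e.act ≠ .invOp op) ∧
      ∀ q, c.phase q ≠ .idle → (d i).phase q ≠ .idle := by
    intro i
    induction i with
    | zero => exact ⟨⟨[], .nil _, by simp⟩, fun _ hq => hq⟩
    | succ i ih =>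
      obtain ⟨⟨u, hu, hui⟩, hpend⟩ := ih
      have hsch : (d i).phase (sched i (d i)) ≠ .idle := by
        simp only [sched]
        split
        · assumption
        · exact hpend p hp
      obtain ⟨h1, h2, h3⟩ := someStep_spec hsch
      have h1 : Step I (d i) (someStep (d i) (sched i (d i))).1 (d (i + 1)) := h1
      refine ⟨⟨_, hu.snoc h1, ?_⟩, fun q hq => h1.phase_ne_idle (fun r hr => ?_) (fun ha => ?_) (hpend q hq)⟩
      · intro e he
        rcases List.mem_append.1 he with he | he
        · exact hui e he
        · rw [List.mem_singleton.1 he]; exact h3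
      · exact hcon ⟨u, _, _, _, hu, hui, h1, r, hr⟩
      · exact hI.pessimistic _ ⟨_, (h.run hu).snoc h1⟩ _
          ⟨(someStep (d i) (sched i (d i))).1, by simp, rfl, ha⟩
  have hsch : ∀ i, (d i).phase (sched i (d i)) ≠ .idle := by
    intro i
    simp only [sched]
    split
    · assumption
    · exact (hinv i).2 p hp
  obtain ⟨d', f', hinf, hd, hf⟩ := h.infExecution (d := d)
    (f := fun i => (someStep (d i) (sched i (d i))).1) rfl (fun i => (someStep_spec (hsch i)).1)
  have hfair : ∀ q i, (d' i).phase q ≠ .idle → ∃ j ≥ i, (f' j).proc = q := by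
    intro q i hq
    by_cases hex : ∃ j ≥ i, (f' j).proc = q
    · exact hex
    · exfalso
      have hstay : ∀ k, (d' (i + k)).phase q = (d' i).phase q := by
        intro k
        induction k with
        | zero => rfl
        | succ k ih =>
          rw [← ih]
          have hne : q ≠ (f' (i + k)).proc := fun he => hex ⟨i + k, by omega, he.symm⟩
          have := hinf.2 (i + k)
          rcases this.cases_stat with ⟨op, -, -, -, h4, -⟩ | ⟨op, s, s', -, -, -, h4, -⟩ <;>
            rw [← Nat.add_assoc, h4, Function.update_of_ne hne]
      -- An index beyond `i` at which the round robin comes to `q`.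
      let m := (i + 1) * n + q
      have hm : m % n = q := by
        simp only [m]
        rw [Nat.mul_add_mod_self_right, Nat.mod_eq_of_lt q.isLt]
      have hmi : i ≤ m := by
        have : i + 1 ≤ (i + 1) * n := Nat.le_mul_of_pos_right _ hn
        simp only [m]; omega
      have hdm : (d m).phase q ≠ .idle := by
        rw [← hd m]
        obtain ⟨k, hk⟩ := Nat.exists_eq_add_of_le (show i ≤ t.length + m by omega)
        rw [hk, hstay k]
        exact hq
      have hs : sched m (d m) = q := by
        have hq' : (⟨m % n, Nat.mod_lt _ hn⟩ : Fin n) = q := Fin.ext hm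
        simp only [sched, hq', if_pos hdm]
      refine hex ⟨t.length + m, by omega, ?_⟩
      rw [hf m, (someStep_spec (hsch m)).2.1, hs]
  obtain ⟨j, hj, r, hr⟩ := hI.deadlockFree d' f' hinf hfair t.length
    ⟨p, by rw [← Nat.add_zero t.length, hd 0]; exact hp⟩
  obtain ⟨k, rfl⟩ := Nat.exists_eq_add_of_le hj
  rw [hf k] at hr
  obtain ⟨⟨u, hu, hui⟩, -⟩ := hinv k
  exact hcon ⟨u, _, _, _, hu, hui, (someStep_spec (hsch k)).1, r, hr⟩

theorem Step.phase_idle (h : Step I c e c')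
    (hi : ∀ op, e.act ≠ .invOp op) (hp : c.phase p = .idle) : c'.phase p = .idle := by
  rcases h.cases_stat with ⟨op, -, -, h3, -⟩ | ⟨op, s, s', h1, h2, h3, h4, -⟩
  · exact absurd h3 (hi op)
  · rw [h4, Function.update_of_ne, hp]
    rintro rfl
    exact Stat.phase_ne_idle.2 h2 (h1.symm.trans hp)

theorem Run.phase_idle (h : Run I c u c')
    (hi : ∀ e ∈ u, ∀ op, e.act ≠ .invOp op) (hp : c.phase p = .idle) :
    c'.phase p = .idle := by
  induction h with
  | nil => exact hp
  | snoc h1 h2 ih =>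
    exact h2.phase_idle (hi _ (by simp)) (ih fun e he => hi e (by simp [he]))

/-- Without new invocations, all the pending operations return. -/
theorem ClassP.exists_quiescent (hI : ClassP I) (h : Reach I t c) :
    ∃ u d, Run I c u d ∧ (∀ e ∈ u, ∀ op, e.act ≠ .invOp op) ∧ ∀ p, d.phase p = .idle := by
  classical
  -- Induction on the number of pending operations: `exists_response` ends one of them, and none is
  -- invoked meanwhile.
  induction hN : (Finset.univ.filter (fun p => c.phase p ≠ .idle)).card using Nat.strong_induction_on
    generalizing t c with
  | _ N ih =>
    by_cases hp : ∃ p, c.phase p ≠ .idle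
    · obtain ⟨p, hp⟩ := hp
      obtain ⟨u, d, d', e, hu, hui, hs, r, hr⟩ := hI.exists_response h hp
      have hei : ∀ op, e.act ≠ .invOp op := by simp [hr]
      obtain ⟨op, hbusy⟩ := hs.resOp hr
      have hidle : d'.phase e.proc = .idle := by
        rcases hs.cases_stat with ⟨op, -, -, h3, -⟩ | ⟨op, s, s', h1, h2, h3, h4, -⟩
        · exact absurd h3 (hei op)
        · rw [h4, Function.update_self]
          rw [hr] at h3
          rw [(OpRun.cons h3 (.nil _)).resOp_mem (r := r) (by simp)]
          rfl
      have hlt : (Finset.univ.filter (fun p => d'.phase p ≠ .idle)).card < N := by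
        rw [← hN]
        refine Finset.card_lt_card ⟨fun q hq => ?_, fun hsub => ?_⟩
        · simp only [Finset.mem_filter, Finset.mem_univ, true_and] at hq ⊢
          exact fun hq' => hq (hs.phase_idle hei (hu.phase_idle hui hq'))
        · have h5 : c.phase e.proc ≠ .idle := fun h5 => by
            rw [hu.phase_idle hui h5] at hbusy
            cases hbusy
          have := hsub (by simpa using h5)
          simp [hidle] at this
      obtain ⟨u', d'', hu', hui', hall⟩ := ih _ hlt ((h.run hu).snoc hs) rfl
      refine ⟨u ++ [e] ++ u', d'', (hu.snoc hs).trans hu', ?_, hall⟩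
      intro e' he'
      simp only [List.mem_append, List.mem_singleton] at he'
      rcases he' with (he' | rfl) | he'
      · exact hui e' he'
      · exact hei
      · exact hui' e' he'
    · push Not at hp
      exact ⟨[], c, .nil c, by simp, hp⟩

/-! ### Two insertions of the same integer -/

/-- After a successful insertion `v` stays in the set, because nothing removes it; a second
insertion cannot succeed. The first conjunct carries this through the induction. -/
theorem SetConsistent.insert_unique {v : ℤ} {L : List (ℕ × SetOp × Bool)} {q : Finset ℤ}
    (h : SetConsistent q (L.map Prod.snd)) (hr : ∀ x ∈ L, x.2.1 ≠ .remove v) :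
    (v ∈ q → ∀ x ∈ L, x.2 ≠ (.insert v, true)) ∧
      ∀ x ∈ L, ∀ y ∈ L, x.2 = (.insert v, true) → y.2 = (.insert v, true) → x = y := by
  induction L generalizing q with
  | nil => simp
  | cons z L ih =>
    obtain ⟨a, op, r⟩ := z
    obtain ⟨q', hd, h⟩ := h
    obtain ⟨i1, i2⟩ := ih h fun x hx => hr x (by simp [hx])
    have hop : op ≠ .remove v := hr (a, op, r) (by simp)
    have hmono : v ∈ q → v ∈ q' := by
      intro hv
      cases op with
      | insert w => rw [hd.1]; exact Finset.mem_insert_of_mem hv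
      | contains w => rw [hd.1]; exact hv
      | remove w => rw [hd.1]; exact Finset.mem_erase.2 ⟨fun he => hop (by rw [he]), hv⟩
    have hins : (op, r) = (.insert v, true) → v ∉ q ∧ v ∈ q' := by
      intro he
      cases he
      refine ⟨by simpa using hd.2.symm, ?_⟩
      rw [hd.1]
      exact Finset.mem_insert_self v q
    refine ⟨fun hv x hx he => ?_, fun x hx y hy hex hey => ?_⟩
    · rcases List.mem_cons.1 hx with rfl | hx
      · exact (hins he).1 hv
      · exact i1 (hmono hv) x hx he
    · rcases List.mem_cons.1 hx with rfl | hx <;> rcases List.mem_cons.1 hy with rfl | hy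
      · rfl
      · exact absurd hey (i1 (hins hex).2 y hy)
      · exact absurd hex (i1 (hins hey).2 x hx)
      · exact i2 x hx y hy hex hey

/-- The operation will return `true`. -/
def Stat.Wins : Stat → Prop
  | .ready (.create ..) | .busy (.create ..) | .ready (.update ..) | .busy (.update ..) => True
  | .ready (.done r) | .busy (.done r) | .fin r => r = true
  | .aborted => True
  | _ => False

/-- From `create` on, the code has no more choice: it can only write, write again and return `true`,
or abort. -/
theorem OpRun.wins (h : OpRun op a s xs s') (hs : s.Wins) : s'.Wins := by
  induction h with
  | nil => exact hs
  | cons h1 _ ih =>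
    refine ih ?_
    cases h1 with
    | call l => cases l <;> exact hs
    | step l => exact hs
    | abort l => trivial
    | ret l c => cases l <;> first | exact hs | trivial

theorem OpRun.split {s s'' : Stat} {xs ys : List Act}
    (h : OpRun op a s (xs ++ ys) s'') : ∃ s', OpRun op a s xs s' ∧ OpRun op a s' ys s'' := by
  induction xs generalizing s with
  | nil => exact ⟨s, .nil s, h⟩
  | cons x xs ih =>
    cases h with
    | cons h1 h2 =>
      obtain ⟨s', h3, h4⟩ := ih h2
      exact ⟨s', .cons h1 h3, h4⟩

theorem OpStep.det {s s₁ s₂ : Stat} {x : Act} (h₁ : OpStep op a s x s₁)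
    (h₂ : OpStep op a s x s₂) : s₁ = s₂ := by
  cases h₁ with
  | call l => cases h₂; rfl
  | step l =>
    generalize hx : Act.step = x at h₂
    cases h₂ with
    | step => rfl
    | abort => cases hx
    | ret _ c => cases l <;> cases hx
  | abort l =>
    generalize hx : Act.abort = x at h₂
    cases h₂ with
    | step => cases hx
    | abort => rfl
    | ret _ c => cases l <;> cases hx
  | ret l c =>
    generalize hx : l.cmd.finish c = x at h₂
    cases h₂ with
    | step => cases l <;> cases hx
    | abort => cases l <;> cases hx
    | ret _ c' => cases l <;> cases hx <;> rfl

theorem OpRun.det {s s₁ s₂ : Stat} (h₁ : OpRun op a s xs s₁)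
    (h₂ : OpRun op a s xs s₂) : s₁ = s₂ := by
  induction h₁ with
  | nil => cases h₂; rfl
  | cons h _ ih =>
    cases h₂ with
    | cons hstep hrun =>
      rw [h.det hstep] at ih
      exact ih hrun

theorem ProcStep.det {s s₁ s₂ : Phase} (h₁ : ProcStep s e s₁) (h₂ : ProcStep s e s₂) : s₁ = s₂ := by
  rcases h₁.inv with ⟨op, rfl, ha, rfl⟩ | ⟨op, l, rfl, hl, ha, rfl⟩ | ⟨op, l, c, rfl, hl, ha, rfl⟩ |
    ⟨op, r, rfl, ha, rfl⟩ <;>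
  rcases h₂.inv with ⟨op', h, ha', rfl⟩ | ⟨op', l', h, hl', ha', rfl⟩ |
    ⟨op', l', c', h, hl', ha', rfl⟩ | ⟨op', r', h, ha', rfl⟩ <;> cases h
  · rw [ha] at ha'; cases ha'; rfl
  · rfl
  · exact absurd rfl (hl r')
  · rw [ha] at ha'
    cases l <;> cases ha' <;> rfl
  · exact absurd rfl (hl' r)
  · rfl

theorem ProcRun.det {s s₁ s₂ : Phase} {E : List (Event n)} (h₁ : ProcRun s E s₁)
    (h₂ : ProcRun s E s₂) : s₁ = s₂ := by
  induction h₁ with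
  | nil => cases h₂; rfl
  | cons h _ ih =>
    cases h₂ with
    | cons hstep hrun =>
      rw [h.det hstep] at ih
      exact ih hrun

/-- A pessimistic implementation does not let two insertions of an absent integer both
determine where to insert it. -/
theorem ClassP.not_both_create (hI : ClassP I)
    (h : Reach I t c) (hpp : p' ≠ p) {a a' : ℕ} {v : ℤ} {Y Y' N N' : Obj}
    {pc pc' w w' : Cell} (hp : c.phase p = .ready (.insert v) a (.create Y pc N w))
    (hp' : c.phase p' = .ready (.insert v) a' (.create Y' pc' N' w'))
    (hother : ∀ b op, Invoked t b op → b ≠ a → b ≠ a' → op.arg ≠ v) : False := by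
  -- Let both operations finish, without any new ones.
  obtain ⟨u, d, hu, hui, hidle⟩ := hI.exists_quiescent h
  have htu := h.run hu
  have key : ∀ q b X pc N w, c.phase q = .ready (.insert v) b (.create X pc N w) →
      Invoked (t ++ u) b (.insert v) ∧ (∀ op, Invoked (t ++ u) b op → op = .insert v) ∧
      Responded (t ++ u) b true := by
    intro q b X pc N w hq
    have hst := h.pending_invoked (s := .ready (.create X pc N w)) hq trivial
    have happ : Appears (t ++ u) b := by
      obtain ⟨e, he, hb⟩ := hst.invoked.appears
      exact ⟨e, by simp [he], hb⟩
    obtain ⟨q', op, s, hst'⟩ := htu.traceInv.state b happ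
    obtain rfl : SetOp.insert v = op := by
      refine hst'.invoked_unique ?_
      obtain ⟨e, he, hb⟩ := hst.invoked
      exact ⟨e, by simp [he], hb⟩
    refine ⟨hst'.invoked, fun op hop => hst'.invoked_unique hop, ?_⟩
    obtain ⟨xs, hxs, hrun⟩ := hst.run
    obtain ⟨ys, hys, hrun'⟩ := hst'.run
    rw [acts_append, hxs, List.cons_append] at hys
    injection hys with _ hys
    subst hys
    obtain ⟨s₁, h1, h2⟩ := hrun'.split
    rw [← hrun.det h1] at h2
    have hw := h2.wins trivial
    rw [hst'.responded]
    have hnp : ¬ s.Pending := fun hs => by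
      have := hst'.phase hs
      rw [hidle] at this
      exact Stat.phase_ne_idle.2 hs this.symm
    cases s with
    | ready l => exact absurd trivial hnp
    | busy l => exact absurd trivial hnp
    | fin r => rw [show r = true from hw]
    | aborted => exact absurd (hst'.aborted.2 rfl) (hI.pessimistic _ ⟨d, htu⟩ b)
  obtain ⟨k1, k2, k3⟩ := key p a _ _ _ _ hp
  obtain ⟨k1', k2', k3'⟩ := key p' a' _ _ _ _ hp'
  obtain ⟨L, -, hL, hcom, -, hcons⟩ := (hI.lsl _ ⟨d, htu⟩).2
  have hmem : ∀ b, (∀ op, Invoked (t ++ u) b op → op = .insert v) → Responded (t ++ u) b true →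
      (b, .insert v, true) ∈ L := by
    intro b h1 h2
    obtain ⟨⟨b', op, r⟩, hx, rfl⟩ := List.mem_map.1 (hcom b ⟨_, h2⟩)
    obtain ⟨h3, -, h4⟩ := hL _ hx
    have h3 := h1 _ h3
    have h5 : true = r := h4 _ h2
    simp only at h3
    subst h3 h5
    exact hx
  have hno : ∀ x ∈ L, x.2.1 ≠ .remove v := by
    intro x hx he
    -- A removal of `v` is neither of the two insertions; by assumption it was not invoked before,
    -- and nothing is invoked in the continuation.
    have h1 := (hL x hx).1
    rw [he] at h1
    by_cases hxa : x.1 = a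
    · rw [hxa] at h1; cases k2 _ h1
    by_cases hxa' : x.1 = a'
    · rw [hxa'] at h1; cases k2' _ h1
    obtain ⟨e, he, hb, hact⟩ := h1
    rcases List.mem_append.1 he with he | he
    · exact hother _ _ ⟨e, he, hb, hact⟩ hxa hxa' rfl
    · exact hui e he _ hact
  have := (hcons.insert_unique hno).2 _ (hmem a k2 k3) _ (hmem a' k2' k3') rfl rfl
  injection this with haa
  subst haa
  exact hpp (h.pending_unique (a := a) (by rw [hp']; rfl) (by rw [hp]; rfl))

/-! ### The schedule that is not accepted by pessimistic implementations -/

/-- Process `p` inserts `5`, and then `3`; when it has found where to insert `3`, process `p'`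
fails to insert `5`. -/
def overlapSchedule (p p' : Fin n) : Schedule n :=
  [(p, .invOp (.insert 5)), (p, .invRead .head), (p, .resRead .head),
    (p, .invRead .tail), (p, .resRead .tail),
    (p, .invWrite (.node 0) ⟨keyVal 5, .tail⟩), (p, .resWrite (.node 0)),
    (p, .invWrite .head ⟨⊥, .node 0⟩), (p, .resWrite .head), (p, .resOp),
    (p, .invOp (.insert 3)), (p, .invRead .head), (p, .resRead .head),
    (p, .invRead (.node 0)), (p, .resRead (.node 0)),
    (p', .invOp (.insert 5)), (p', .invRead .head), (p', .resRead .head),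
    (p', .invRead (.node 0)), (p', .resRead (.node 0)), (p', .resOp),
    (p, .invWrite (.node 1) ⟨keyVal 3, .node 0⟩), (p, .resWrite (.node 1)),
    (p, .invWrite .head ⟨⊥, .node 1⟩), (p, .resWrite .head), (p, .resOp)]

/-- An insertion does nothing before its invocation. -/
theorem Reach.not_before_invOp (h : Reach I t c)
    (hef : List.Sublist [e, f] t) (hf : f.act = .invOp op) : e.oid ≠ f.oid := by
  intro heq
  obtain ⟨p, op', s, hst⟩ := h.traceInv.state f.oid ⟨f, hef.subset (by simp), rfl⟩
  obtain ⟨xs, hxs, hrun⟩ := hst.run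
  have h1 : List.Sublist (acts [e, f] f.oid) (acts t f.oid) := (hef.filter _).map _
  have h2 : acts [e, f] f.oid = [e.act, f.act] := by simp [acts, opEvents, heq]
  rw [h2, hxs, hf] at h1
  have h3 : List.Sublist [Act.invOp op] xs := by
    generalize e.act = y at h1
    cases h1 with
    | cons _ h1 => exact (List.sublist_cons_self _ _).trans h1
    | cons_cons _ h1 => exact h1
  exact hrun.no_invOp (op' := op) (h3.subset (by simp))

/-- The last operation of a process that has read the head and then `X`. -/
theorem Reach.two_reads {K : ℕ → Prop} (h : Reach I t c)
    (hab : ∀ e ∈ t, e.act ≠ .abort) {A E₀ : List (Event n)} (hE : visibleEvents K t p = A ++ E₀)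
    (hf : List.Forall₂ (fun (e : Event n) x => e.act.toSched = some x) E₀
      [.invOp op, .invRead .head, .resRead .head, .invRead X, .resRead X]) :
    ∃ a c₁ c₂, K a ∧ Invoked t a op ∧ c₁.next = X ∧
      (c.phase p).visible K = .ready op a (Loc.afterRead op a (.traverse .head c₁ X) c₂) ∧
      ∀ x ∈ acts t a, x.toSched.isSome →
        x ∈ [.invOp op, .invRead .head, .resRead .head c₁, .invRead X, .resRead X c₂] := by
  have hrun := h.procRun (K := K) (fun e he ha => absurd ha (hab e he)) p
  rw [hE] at hrun
  obtain ⟨s₀, -, hrun⟩ := hrun.split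
  obtain ⟨e0, E, g0, hf0, rfl⟩ := List.forall₂_cons_right_iff.1 hf
  obtain ⟨e1, E1, g1, hf1, rfl⟩ := List.forall₂_cons_right_iff.1 hf0
  obtain ⟨e2, E2, -, hf2, rfl⟩ := List.forall₂_cons_right_iff.1 hf1
  obtain ⟨e3, E3, g3, hf3, rfl⟩ := List.forall₂_cons_right_iff.1 hf2
  obtain ⟨e4, E4, -, hf4, rfl⟩ := List.forall₂_cons_right_iff.1 hf3
  cases hf4
  obtain ⟨-, ha0, hrun⟩ := hrun.inv_invoke g0
  obtain ⟨-, h1, h2, c₁, ha2, hrun⟩ := hrun.inv_read g1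
  rw [afterRead_start] at hrun
  obtain ⟨hcmd, h3, h4, c₂, ha4, hrun⟩ := hrun.inv_read g3
  have hX : c₁.next = X := by injection hcmd
  have hmem : e0 ∈ visibleEvents K t p := by rw [hE]; simp
  have he0 := List.mem_filter.1 hmem
  simp only [decide_eq_true_eq] at he0
  refine ⟨e0.oid, c₁, c₂, he0.2.2.1, ⟨e0, he0.1, rfl, ha0⟩, hX, ?_, ?_⟩
  · generalize hv : (c.phase p).visible K = ph at hrun
    cases hrun
    rw [hX]
  · intro x hx hxs
    obtain ⟨e, he, hea, rfl⟩ := mem_acts.1 hx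
    obtain ⟨p₀, op₀, s, hst⟩ := h.traceInv.state _ ⟨e, he, hea⟩
    have hev : e ∈ visibleEvents K t p := by
      refine List.mem_filter.2 ⟨he, ?_⟩
      simp only [decide_eq_true_eq]
      refine ⟨?_, by rw [hea]; exact he0.2.2.1, hxs⟩
      rw [hst.proc e he hea, ← hst.proc e0 he0.1 rfl, he0.2.1]
    rw [hE] at hev
    rcases List.mem_append.1 hev with hev | hev
    · refine absurd hea (h.not_before_invOp (f := e0) ?_ ha0)
      refine List.Sublist.trans (l₂ := visibleEvents K t p) ?_ List.filter_sublist
      rw [hE]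
      exact (List.singleton_sublist.2 hev).append (List.singleton_sublist.2 (by simp))
    · have hact : ∀ {x : Act} {Y : Obj}, x.toSched = some (.invRead Y) → x = .invRead Y := by
        intro x Y
        cases x <;> simp [Act.toSched]
      simp only [List.mem_cons, List.not_mem_nil, or_false] at hev ⊢
      rcases hev with rfl | rfl | rfl | rfl | rfl
      · exact Or.inl ha0
      · exact Or.inr (Or.inl (hact g1))
      · exact Or.inr (Or.inr (Or.inl ha2))
      · exact Or.inr (Or.inr (Or.inr (Or.inl (hact g3))))
      · exact Or.inr (Or.inr (Or.inr (Or.inr ha4)))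

theorem Phase.visible_eq_ready {K : ℕ → Prop} {ph : Phase} (h : ph.visible K = .ready op a l) :
    ph = .ready op a l ∨ ∃ r, l = .done r ∧ ph = .busy op a (.done r) := by
  cases ph with
  | idle => cases h
  | ready op' a' l' =>
    simp only [Phase.visible] at h
    split at h
    · exact Or.inl h
    · cases h
  | busy op' a' l' =>
    simp only [Phase.visible] at h
    split at h
    · cases l' <;> cases h
      exact Or.inr ⟨_, rfl, rfl⟩
    · cases h

theorem Step.ready_of_resRead (h : Step I c e c')
    {w : Cell} (he : e.act = .resRead X w) : ∃ op l, c'.phase e.proc = .ready op e.oid l := by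
  cases h with
  | ret p op a l v hp hn =>
    cases l <;> cases he
    · exact ⟨op, _, Function.update_self ..⟩
    · exact ⟨op, _, Function.update_self ..⟩
  | call p op a l => cases l <;> cases he
  | _ => cases he

theorem Reach.not_startCommit (h : Reach I t c)
 (hp : c.phase p = .ready op a l) : .startCommit ∉ acts t a := by
  intro hm
  obtain ⟨xs, hxs, hrun⟩ := (h.pending_invoked (s := .ready l) hp trivial).run
  rw [hxs] at hm
  exact hrun.startCommit_mem (Or.inl (by simpa using hm))

theorem visibleEvents_eq {K : ℕ → Prop} {t H : List (Event n)}
    [DecidablePred fun e : Event n => K e.oid ∧ e.act.toSched.isSome]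
    (h : t.filter (fun e => K e.oid ∧ e.act.toSched.isSome) = H) :
    visibleEvents K t p = H.filter (fun e => e.proc = p) := by
  rw [← h, List.filter_filter]
  unfold visibleEvents
  congr 1
  funext e
  simp

open Classical in
/-- An execution is cut at an event of its schedule. -/
theorem Reach.cut {K : ℕ → Prop} (h : Reach I t c)
    (hab : ∀ e ∈ t, e.act ≠ .abort) {σ₁ σ₂ : Schedule n} {x : Fin n × SchedAct}
    (hσ : scheduleOf (t.filter (fun e => K e.oid ∧ e.act.toSched.isSome)) = σ₁ ++ x :: σ₂) :
    ∃ t₁ t₂ f d, t = t₁ ++ [f] ++ t₂ ∧ Reach I (t₁ ++ [f]) d ∧ f.proc = x.1 ∧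
      f.act.toSched = some x.2 ∧ ∀ q,
        List.Forall₂ (fun (e : Event n) x => e.act.toSched = some x) (visibleEvents K (t₁ ++ [f]) q)
          (((σ₁ ++ [x]).filter (fun x => x.1 = q)).map Prod.snd) ∧
        ∃ E s, List.Forall₂ (fun (e : Event n) x => e.act.toSched = some x) E
            ((σ₂.filter (fun x => x.1 = q)).map Prod.snd) ∧
          ProcRun ((d.phase q).visible K) E s := by
  have hf := forall₂_of_scheduleOf (H := t.filter (fun e => K e.oid ∧ e.act.toSched.isSome))
    (by simp)
  rw [hσ] at hf
  generalize hH : t.filter (fun e => K e.oid ∧ e.act.toSched.isSome) = H at hf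
  have hf₁ := List.forall₂_take_append H σ₁ (x :: σ₂) hf
  have hf₂ := List.forall₂_drop_append H σ₁ (x :: σ₂) hf
  rw [← List.take_append_drop σ₁.length H] at hH
  generalize H.take σ₁.length = H₁ at hf₁ hH
  generalize H.drop σ₁.length = H₂ at hf₂ hH
  obtain ⟨f, R, ⟨hfp, hfa⟩, hR, rfl⟩ := List.forall₂_cons_right_iff.1 hf₂
  obtain ⟨u, u', rfl, hu, hu'⟩ := List.filter_eq_append_iff.1 hH
  obtain ⟨w, t₂, rfl, hw, hPf, ht₂⟩ := List.filter_eq_cons_iff.1 hu'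
  have heq : u ++ (w ++ f :: t₂) = (u ++ w) ++ [f] ++ t₂ := by simp
  have hfil : ((u ++ w) ++ [f]).filter (fun e => K e.oid ∧ e.act.toSched.isSome) = H₁ ++ [f] := by
    rw [List.filter_append, List.filter_append, hu, List.filter_eq_nil_iff.2 hw, List.append_nil]
    congr 1
    exact List.filter_cons_of_pos hPf
  rw [heq] at h hab
  obtain ⟨d, hd, -⟩ := h.split
  refine ⟨u ++ w, t₂, f, d, heq, hd, hfp, hfa, fun q => ⟨?_, R.filter (fun e => e.proc = q), ?_⟩⟩
  · rw [visibleEvents_eq hfil]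
    exact forall₂_filter_proc q (List.rel_append hf₁ (.cons ⟨hfp, hfa⟩ .nil))
  · have h1 := hd.procRun (K := K) (fun e he ha => absurd ha (hab e (List.mem_append_left t₂ he))) q
    have h2 := h.procRun (K := K) (fun e he ha => absurd ha (hab e he)) q
    unfold visibleEvents at h1 h2
    rw [List.filter_append] at h2
    obtain ⟨s, h3, h4⟩ := h2.split
    rw [h1.det h3]
    refine ⟨(c.phase q).visible K, forall₂_filter_proc q hR, ?_⟩
    rw [← visibleEvents_eq ht₂]
    exact h4

/-- Cut the execution when both insertions have read the head and node 0. The future of the schedule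
shows that neither would have passed node 0: `p` goes on to write, `p'` to return. So both can be
turned into insertions of one new small integer by `Reach.reparam`, and `ClassP.not_both_create`
applies. The execution may contain further operations that never complete; they do not appear in the
schedule and keep their parameters. -/
theorem ClassP.not_accepts_overlapSchedule (hI : ClassP I) (hpp : p' ≠ p) :
    ¬ Accepts I (overlapSchedule p p') := by
  classical
  rintro ⟨t, ⟨c, ht⟩, hσ⟩
  have hna : ∀ u, IsExecution I u → ∀ e ∈ u, e.act ≠ .abort := fun u hu e he ha =>
    hI.pessimistic u hu e.oid ⟨e, he, rfl, ha⟩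
  rw [completePart_history (fun a _ => hI.pessimistic t ⟨c, ht⟩ a)] at hσ
  -- Nineteen events of the schedule precede the one at which `p'` has read node 0.
  obtain ⟨t₁, t₂, f, d, -, hd, hfp, hfa, hcut⟩ := ht.cut (σ₁ := (overlapSchedule p p').take 19)
    (x := (p', .resRead (.node 0))) (σ₂ := (overlapSchedule p p').drop 20) (hna t ⟨c, ht⟩) hσ
  generalize Committed t = K at hcut
  have hna₁ := hna _ ⟨d, hd⟩
  obtain ⟨hp, E, s, hE, hrun⟩ := hcut p
  obtain ⟨hp', E', s', hE', hrun'⟩ := hcut p'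
  simp only [overlapSchedule, List.take_succ_cons, List.take_zero, List.drop_succ_cons,
    List.drop_zero, List.cons_append, List.nil_append, List.filter_cons, hpp, hpp.symm,
    decide_true, decide_false, if_true, Bool.false_eq_true, if_false, List.filter_nil,
    List.map_cons, List.map_nil] at hp hp' hE hE'
  -- The first ten events of `p` belong to its first insertion.
  have hp₂ := List.forall₂_drop 10 hp
  obtain ⟨a, c₁, c₂, -, hinv, hc₁, hph, hacts⟩ := hd.two_reads (p := p) hna₁
    (List.take_append_drop 10 _).symm hp₂
  obtain ⟨a', d₁, d₂, -, hinv', hd₁, hph', hacts'⟩ := hd.two_reads (p := p') hna₁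
    (List.nil_append _).symm hp'
  rcases hE with _ | ⟨g, _ | ⟨-, -⟩⟩
  rcases hE' with _ | ⟨g', -⟩
  rw [hph] at hrun
  rw [hph'] at hrun'
  obtain ⟨hcmd, -⟩ := hrun.inv_write g
  obtain ⟨-, r, hdone, -⟩ := hrun'.inv_ret g'
  have hphase : d.phase p = .ready (.insert 3) a
      (Loc.afterRead (.insert 3) a (.traverse .head c₁ (.node 0)) c₂) := by
    rcases Phase.visible_eq_ready hph with h | ⟨r, h, -⟩
    · exact h
    · rw [h] at hcmd; cases hcmd
  have hphase' : d.phase p' = .ready (.insert 5) a'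
      (Loc.afterRead (.insert 5) a' (.traverse .head d₁ (.node 0)) d₂) := by
    -- The start of a completion is invisible in the schedule, but it is excluded here: the cut
    -- comes right after the return of the last read of `p'`.
    rcases Phase.visible_eq_ready hph' with h | ⟨r, -, h⟩
    · exact h
    · obtain ⟨d₀, -, hs⟩ := hd.inv_snoc
      obtain ⟨w, hw⟩ : ∃ w, f.act = .resRead (.node 0) w := by
        cases hx : f.act <;> rw [hx] at hfa <;> cases hfa
        exact ⟨_, rfl⟩
      obtain ⟨op, l, hr⟩ := hs.ready_of_resRead hw
      rw [hfp, h] at hr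
      cases hr
  have hlt : ¬ c₂.val < key (.insert 3) := (afterRead_eq_write hcmd).1
  have hlt' : ¬ d₂.val < key (.insert 5) := fun h => by
    rw [afterRead_lt h] at hdone
    cases hdone
  obtain ⟨V, hV⟩ := hd.exists_arg
  -- A lower bound of all parameters in use; `v - 1` is then smaller than each of them.
  obtain ⟨v, hv⟩ := (d.used.image V).bddBelow
  have hVv : ∀ b op, Invoked (t₁ ++ [f]) b op → v - 1 < op.arg := by
    intro b op hb
    have := hv (Finset.mem_coe.2 (Finset.mem_image_of_mem V ((hd.traceInv.used b).2 hb.appears)))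
    rw [← hV b op hb]
    omega
  have huniq : ∀ b op op', Invoked (t₁ ++ [f]) b op → Invoked (t₁ ++ [f]) b op' → op' = op := by
    intro b op op' h h'
    obtain ⟨q, o, s, hst⟩ := hd.traceInv.state b h.appears
    rw [hst.invoked_unique h, hst.invoked_unique h']
  have hrep : ∃ d', Reach I ((t₁ ++ [f]).map (ListSet.reparam (v - 1) (fun b => b = a ∨ b = a'))) d' ∧
      ConfigRel (v - 1) (.node 0) (fun b => b = a ∨ b = a') d d' := by
    refine hd.reparam (by simp) (fun b op hb ho => ⟨?_, hVv b op ho⟩) ?_ ?_ ?_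
    · rcases hb with rfl | rfl
      · exact ⟨3, huniq _ _ _ hinv ho⟩
      · exact ⟨5, huniq _ _ _ hinv' ho⟩
    · rintro b op Y w (rfl | rfl) ho hm
      · have h := hacts _ hm rfl
        rw [huniq _ _ _ hinv ho]
        simp only [List.mem_cons, List.not_mem_nil, or_false, Act.resRead.injEq, reduceCtorEq,
          false_or] at h
        rcases h with ⟨rfl, rfl⟩ | ⟨rfl, rfl⟩
        · exact Or.inl ⟨rfl, hc₁⟩
        · exact Or.inr ⟨rfl, hlt⟩
      · have h := hacts' _ hm rfl
        rw [huniq _ _ _ hinv' ho]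
        simp only [List.mem_cons, List.not_mem_nil, or_false, Act.resRead.injEq, reduceCtorEq,
          false_or] at h
        rcases h with ⟨rfl, rfl⟩ | ⟨rfl, rfl⟩
        · exact Or.inl ⟨rfl, hd₁⟩
        · exact Or.inr ⟨rfl, hlt'⟩
    · rintro b Y w (rfl | rfl) hm
      · simpa using hacts _ hm rfl
      · simpa using hacts' _ hm rfl
    · rintro b (rfl | rfl)
      · exact hd.not_startCommit hphase
      · exact hd.not_startCommit hphase'
  obtain ⟨d', hd', hrel⟩ := hrep
  have hlast : ∀ q op b l, d.phase q = .ready op b l → (b = a ∨ b = a') → ¬ l.Early (.node 0) →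
      ∃ pc w, d'.phase q = .ready (.insert (v - 1)) b (.create .head pc (.node b) w) := by
    intro q op b l hq hb hl
    have h := hrel.phase q
    rw [hq] at h
    generalize d'.phase q = ph at h
    cases h with
    | same _ h => exact absurd hb (h b rfl)
    | ready _ _ _ _ h => exact absurd h hl
    | last _ _ _ pc w => exact ⟨pc, w, rfl⟩
  have hne : ∀ l : Loc, l.Early (.node 0) → ∃ X, l.cmd = .read X := by
    rintro l (rfl | ⟨pc, rfl⟩)
    · exact ⟨_, rfl⟩
    · exact ⟨_, rfl⟩
  obtain ⟨pc, w, hq⟩ := hlast p _ a _ hphase (Or.inl rfl) fun he => by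
    obtain ⟨X, hX⟩ := hne _ he
    rw [hX] at hcmd
    cases hcmd
  obtain ⟨pc', w', hq'⟩ := hlast p' _ a' _ hphase' (Or.inr rfl) fun he => by
    obtain ⟨X, hX⟩ := hne _ he
    rw [hdone] at hX
    cases hX
  -- All other operations have kept their parameters, which exceed `v - 1`.
  refine hI.not_both_create hd' hpp hq hq' ?_
  rintro b op ⟨e, he, rfl, hact⟩ hba hba'
  obtain ⟨e', he', rfl⟩ := List.mem_map.1 he
  have hoid : (ListSet.reparam (v - 1) (fun b => b = a ∨ b = a') e').oid = e'.oid := by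
    unfold ListSet.reparam
    split <;> rfl
  rw [hoid] at hba hba'
  have hsame : ListSet.reparam (v - 1) (fun b => b = a ∨ b = a') e' = e' :=
    if_neg fun h => h.1.elim hba hba'
  rw [hsame] at hact
  exact (hVv _ _ ⟨e', he', rfl, hact⟩).ne'

/-! ### Serializations that respect the order of commits -/

/-- `W` is a serialization of `t`; the operations outside of `W` read from a prefix of it. -/
structure Serialized (t : List (Event n)) (W : List ℕ) : Prop where
  nodup : W.Nodup
  committed : ∀ a, Committed t a → a ∈ W
  pending : ∀ a ∈ W, Committed t a ∨ CommitPending t a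
  precedes : ∀ a ∈ W, ∀ b ∈ W, Precedes t a b → List.Sublist [a, b] W
  legal : Legal (serial t W)
  safe : ∀ a, a ∉ W → ∃ W₁, W₁ <+: W ∧ LegalFrom (memAfter (serial t W₁)) (acts t a)

/-- A transaction in `W` observes what precedes it in `W`; for the other ones the prefix comes from
`Serialized.safe`. -/
theorem Serialized.exists_prefix {W : List ℕ} (h : Serialized t W) (a : ℕ) :
    ∃ L : List ℕ, L <+: W ∧ a ∉ L ∧ Legal (serial t (L ++ [a])) := by
  by_cases ha : a ∈ W
  · obtain ⟨A, B, rfl⟩ := List.append_of_mem ha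
    have hn := List.nodup_append.1 h.nodup
    refine ⟨A, ⟨a :: B, rfl⟩, fun hA => hn.2.2 a hA a (by simp) rfl, ?_⟩
    have h1 := h.legal
    rw [show A ++ a :: B = (A ++ [a]) ++ B by simp] at h1
    exact legal_of_append h1
  · obtain ⟨W₁, ⟨B, rfl⟩, h2⟩ := h.safe a ha
    exact ⟨W₁, ⟨B, rfl⟩, fun hm => ha (by simp [hm]), legal_serial_snoc.2 ⟨legal_of_append h.legal, h2⟩⟩

/-- The prefix of an execution up to the last event of `a` is itself an execution, and its own
serialization supplies the transactions observed by `a`. -/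
theorem safeStrictSerializable_of_serialized (h : ∀ t, IsExecution I t → ∃ W, Serialized t W)
 (ht : IsExecution I t) : SafeStrictSerializable t := by
  obtain ⟨W, hW⟩ := h t ht
  refine ⟨⟨W, hW.nodup, hW.committed, hW.pending, hW.precedes, hW.legal⟩, fun a _ _ => ?_⟩
  have hpre : IsExecution I (prefixUpTo t a) := by
    obtain ⟨c, hc⟩ := ht
    obtain ⟨u, hu⟩ := List.rdropWhile_prefix (fun e : Event n => (e.oid ≠ a : Bool)) (l := t)
    unfold prefixUpTo
    rw [← hu] at hc
    obtain ⟨d, hd, -⟩ := hc.split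
    exact ⟨d, hd⟩
  obtain ⟨W', hW'⟩ := h _ hpre
  obtain ⟨L, hL, haL, hleg⟩ := hW'.exists_prefix a
  exact ⟨L, hW'.nodup.sublist hL.sublist, haL, fun b hb => hW'.pending b (hL.subset hb), hleg⟩

/-- Every operation reads legally after a prefix of the serialization, where the memory is a
well-formed list without its node; so its reads are good, and local serializability follows. The
serialization with the responses from `SerialOK` is the linearization. -/
theorem Serialized.lsLinearizable {W : List ℕ} (h : Serialized t W)
 (hc : Reach I t c) : LSLinearizable t := by
  obtain ⟨V, hV⟩ := hc.exists_arg
  constructor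
  · refine hc.locallySerializable hV fun e he X v hact => ?_
    obtain ⟨L, hL, haL, hleg⟩ := h.exists_prefix e.oid
    obtain ⟨h1, h2⟩ := legal_serial_snoc.1 hleg
    have hok := hc.serialOK hV (h.nodup.sublist hL.sublist)
      (fun b hb => h.pending b (hL.subset hb)) h1
    obtain ⟨p, op, s, hst⟩ := hc.traceInv.state e.oid ⟨e, he, rfl⟩
    obtain ⟨hlink, rfl⟩ := (hst.statOK hV hok.wf (fun hm => haL (hok.made _ hm)) h2).2 X v
      (mem_acts.2 ⟨e, he, rfl, hact⟩)
    have hmade := hlink.made hok.wf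
    refine ⟨hok.wf.good hmade, fun hn => haL (hok.made _ ?_)⟩
    rw [← hn]
    exact hok.wf.made_next hmade
  · obtain ⟨L, q, h1, h2, h3, -⟩ := (hc.serialOK hV h.nodup h.pending h.legal).abs
    refine ⟨L, by rw [h1]; exact h.nodup, fun x hx => ⟨(h2 x hx).1, fun hab => ?_, (h2 x hx).2⟩,
      fun a ha => by rw [h1]; exact h.committed a ha, by rw [h1]; exact h.precedes, h3.consistent⟩
    obtain ⟨p, op, s, hst⟩ := hc.traceInv.state x.1 (h2 x hx).1.appears
    have hs := hst.aborted.1 hab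
    rcases h.pending x.1 (by rw [← h1]; exact List.mem_map_of_mem hx) with ⟨r, hr⟩ | hp
    · rw [(hst.responded r).1 hr] at hs; cases hs
    · exact hp.2.2 hab

/-! ### Conflicts -/

/-- Two concurrent transactions that access a common object. -/
def ConflictIn (t : List (Event n)) (a b : ℕ) : Prop :=
  b ≠ a ∧ Concurrent t a b ∧
    ∃ X, Accesses t a X ∧ Accesses t b X ∧ (Writes t a X ∨ Writes t b X)

theorem precedes_snoc
    (h : Precedes (t ++ [e]) a b) : Precedes t a b ∨ e.oid = b ∧ ∃ op, e.act = .invOp op := by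
  obtain ⟨f, g, hfg, hf, hg, hres, op, hop⟩ := h
  obtain ⟨l₁, l₂, h1, h2, h3⟩ := List.sublist_append_iff.1 hfg
  rcases l₁ with _ | ⟨x, _ | ⟨y, l₁⟩⟩
  · have := h3.length_le
    simp [← show [f, g] = l₂ by simpa using h1] at this
  · obtain ⟨rfl, rfl⟩ : f = x ∧ [g] = l₂ := by simpa using h1
    have := List.singleton_sublist.1 h3
    rw [List.mem_singleton.1 this] at hg hop
    exact Or.inr ⟨hg, op, hop⟩
  · obtain ⟨rfl, rfl, -⟩ : f = x ∧ g = y ∧ [] = l₁ ++ l₂ := by simpa using h1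
    exact Or.inl ⟨f, g, ((List.nil_sublist l₁).cons_cons _ |>.cons_cons _).trans h2, hf, hg, hres, op, hop⟩

/-- A new event orders two operations only if it invokes one of them, and both have been invoked
already. -/
theorem Concurrent.snoc (hc : Reach I t c)
    (he : Step I c e c') (h : Concurrent t a b) : Concurrent (t ++ [e]) a b := by
  obtain ⟨h2, h3, h4, h5⟩ := h
  have hno : ∀ x, Appears t x → ¬ (e.oid = x ∧ ∃ op, e.act = .invOp op) := by
    rintro x hx ⟨rfl, op, hop⟩
    exact (he.invOp hop).1 ((hc.traceInv.used _).2 hx)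
  exact ⟨appears_snoc.2 (Or.inl h2), appears_snoc.2 (Or.inl h3),
    fun hp => (precedes_snoc hp).elim h4 (hno b h3), fun hp => (precedes_snoc hp).elim h5 (hno a h2)⟩

theorem ConflictIn.snoc (hc : Reach I t c)
    (he : Step I c e c') (h : ConflictIn t a b) : ConflictIn (t ++ [e]) a b := by
  obtain ⟨h1, h2, X, h3, h4, h5⟩ := h
  have hw : ∀ {x}, Writes t x X → Writes (t ++ [e]) x X :=
    fun ⟨f, hf, h⟩ => ⟨f, List.mem_append_left _ hf, h⟩
  have ha : ∀ {x}, Accesses t x X → Accesses (t ++ [e]) x X :=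
    Or.imp (fun ⟨f, hf, h⟩ => ⟨f, List.mem_append_left _ hf, h⟩) hw
  exact ⟨h1, h2.snoc hc he, X, ha h3, ha h4, h5.imp hw hw⟩

theorem Reach.not_precedes_of_pending (h : Reach I t c)
 (hp : (c.phase p).oid = some a) : ¬ Precedes t a b := by
  rintro ⟨e, f, hef, hea, -, hres, -⟩
  have he : e ∈ t := hef.subset (by simp)
  obtain ⟨p', op, s, hst⟩ := h.traceInv.state a ⟨e, he, hea⟩
  have hs := (hst.only p hp).2
  rcases hres with ⟨r, hr⟩ | hab
  · rw [(hst.responded r).1 ⟨e, he, hea, hr⟩] at hs; exact hs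
  · rw [hst.aborted.1 ⟨e, he, hea, hab⟩] at hs; exact hs

/-- Reads, writes and completions return after they started. -/
theorem OpRun.start_mem (h : OpRun op a s xs s') (hs : ∀ l, s ≠ .busy l) :
    (∀ l, s' = .busy l → l.cmd.start ∈ xs) ∧ (∀ X c, .resRead X c ∈ xs → .invRead X ∈ xs) ∧
      ∀ X c, .resWrite X c ∈ xs → .invWrite X c ∈ xs := by
  -- `ys` stands for the events before the present status, among which the start of the current call
  -- is found.
  suffices ∀ ys, (∀ l, s = .busy l → l.cmd.start ∈ ys) →
      (∀ l, s' = .busy l → l.cmd.start ∈ ys ++ xs) ∧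
      (∀ X c, .resRead X c ∈ xs → .invRead X ∈ ys ++ xs) ∧
      ∀ X c, .resWrite X c ∈ xs → .invWrite X c ∈ ys ++ xs by
    simpa using this [] fun l hl => absurd hl (hs l)
  clear hs
  induction h with
  | nil s => exact fun ys hys => ⟨by simpa using hys, by simp, by simp⟩
  | @cons s s₁ s₂ x xs h1 h2 ih =>
    intro ys hys
    have key : (∀ l, s₁ = .busy l → l.cmd.start ∈ ys ++ [x]) ∧
        (∀ X c, x = .resRead X c → .invRead X ∈ ys) ∧
        (∀ X c, x = .resWrite X c → .invWrite X c ∈ ys) := by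
      cases h1 with
      | call l =>
        refine ⟨fun l' hl => ?_, ?_, ?_⟩
        · cases hl; simp
        · intro X c hx; cases l <;> cases hx
        · intro X c hx; cases l <;> cases hx
      | step l => exact ⟨fun l' hl => List.mem_append_left _ (hys l' hl), by simp, by simp⟩
      | abort l => simp
      | ret l c =>
        have := hys l rfl
        refine ⟨fun l' hl => ?_, fun X w hx => ?_, fun X w hx => ?_⟩
        · cases l <;> cases hl
        · cases l <;> cases hx <;> exact this
        · cases l <;> cases hx <;> exact this
    obtain ⟨i1, i2, i3⟩ := ih (ys ++ [x]) key.1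
    simp only [List.append_assoc, List.singleton_append] at i1 i2 i3
    refine ⟨i1, fun X c hm => ?_, fun X c hm => ?_⟩
    · rcases List.mem_cons.1 hm with hm | hm
      · exact List.mem_append_left _ (key.2.1 X c hm.symm)
      · exact i2 X c hm
    · rcases List.mem_cons.1 hm with hm | hm
      · exact List.mem_append_left _ (key.2.2 X c hm.symm)
      · exact i3 X c hm

theorem OpState.start_mem
 (h : OpState t c a p op s) :
    (∀ l, s = .busy l → l.cmd.start ∈ acts t a) ∧
      (∀ X c, .resRead X c ∈ acts t a → .invRead X ∈ acts t a) ∧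
      ∀ X c, .resWrite X c ∈ acts t a → .invWrite X c ∈ acts t a := by
  obtain ⟨xs, hxs, hrun⟩ := h.run
  obtain ⟨h1, h2, h3⟩ := hrun.start_mem (by simp)
  rw [hxs]
  refine ⟨fun l hl => List.mem_cons_of_mem _ (h1 l hl), fun X c hm => ?_, fun X c hm => ?_⟩
  · exact List.mem_cons_of_mem _ (h2 X c (by simpa using hm))
  · exact List.mem_cons_of_mem _ (h3 X c (by simpa using hm))

/-! ### Reads and writes of a sequence of events -/

def Act.isAccess : Act → Bool
  | .resRead _ _ => true
  | .resWrite _ _ => true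
  | _ => false

theorem actMem_of_not_isAccess {x : Act} (h : x.isAccess = false) (m : Obj → Cell) :
    actMem m x = m := by
  cases x <;> first | rfl | cases h

theorem foldl_filter_isAccess (m : Obj → Cell) (xs : List Act) :
    (xs.filter Act.isAccess).foldl actMem m = xs.foldl actMem m := by
  induction xs generalizing m with
  | nil => rfl
  | cons x xs ih =>
    cases hx : x.isAccess
    · rw [List.filter_cons_of_neg (by simp [hx]), List.foldl_cons, actMem_of_not_isAccess hx, ih]
    · rw [List.filter_cons_of_pos hx, List.foldl_cons, List.foldl_cons, ih]

theorem legalFrom_filter_isAccess :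
    LegalFrom m (xs.filter Act.isAccess) ↔ LegalFrom m xs := by
  induction xs generalizing m with
  | nil => rfl
  | cons x xs ih =>
    cases hx : x.isAccess
    · rw [List.filter_cons_of_neg (by simp [hx]), LegalFrom, actMem_of_not_isAccess hx, ih]
      refine ⟨fun h => ⟨?_, h⟩, And.right⟩
      rintro X c rfl
      cases hx
    · rw [List.filter_cons_of_pos hx, LegalFrom, LegalFrom, ih]

theorem foldl_actMem_of_notMem (h : ∀ c, .resWrite X c ∉ xs)
    (m : Obj → Cell) : xs.foldl actMem m X = m X := by
  induction xs generalizing m with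
  | nil => rfl
  | cons x xs ih =>
    rw [List.foldl_cons, ih fun c hc => h c (List.mem_cons_of_mem _ hc)]
    cases x with
    | resWrite Y c =>
      refine Function.update_of_ne ?_ _ _
      rintro rfl
      exact h c (by simp)
    | _ => rfl

theorem LegalFrom.congr (h : LegalFrom m xs)
    (hm : ∀ X c, .resRead X c ∈ xs → m X = m' X) : LegalFrom m' xs := by
  induction xs generalizing m m' with
  | nil => trivial
  | cons x xs ih =>
    refine ⟨fun X c hx => ?_, ih h.2 fun X c hX => ?_⟩
    · rw [h.1 X c hx, hm X c (by simp [hx])]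
    · have := hm X c (List.mem_cons_of_mem _ hX)
      cases x with
      | resWrite Y w =>
        by_cases hY : X = Y
        · subst hY
          simp [actMem]
        · simpa [actMem, hY] using this
      | _ => exact this

/-- The reads and writes that operation `a` completed. -/
def accesses (t : List (Event n)) (a : ℕ) : List Act := (acts t a).filter Act.isAccess

theorem accesses_snoc_quiet (h : e.act.isAccess = false) (a : ℕ) :
    accesses (t ++ [e]) a = accesses t a := by
  rw [accesses, acts_append, List.filter_append]
  by_cases ha : e.oid = a
  · subst ha
    rw [acts_singleton_self, List.filter_cons_of_neg (by simp [h])]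
    simp [accesses]
  · rw [acts_singleton_ne ha]
    simp [accesses]

theorem accesses_snoc_of_ne (h : e.oid ≠ a) :
    accesses (t ++ [e]) a = accesses t a := by
  rw [accesses, acts_append, acts_singleton_ne h, List.append_nil, accesses]

theorem accesses_snoc_self (h : e.act.isAccess = true) :
    accesses (t ++ [e]) e.oid = accesses t e.oid ++ [e.act] := by
  rw [accesses, acts_append, acts_singleton_self, List.filter_append, List.filter_cons_of_pos h]
  rfl

theorem accesses_of_not_appears (h : ¬ Appears t a) :
    accesses t a = [] := by
  rw [accesses, acts_eq_nil.2 h]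
  rfl

theorem memAfter_serial (t : List (Event n)) (W : List ℕ) :
    memAfter (serial t W) = (W.flatMap (accesses t)).foldl actMem initMem := by
  induction W using List.reverseRecOn with
  | nil => rfl
  | append_singleton W a ih =>
    rw [memAfter_serial_snoc, ih, List.flatMap_append, List.foldl_append]
    simp [accesses, foldl_filter_isAccess]

theorem legal_serial (t : List (Event n)) (W : List ℕ) :
    Legal (serial t W) ↔ LegalFrom initMem (W.flatMap (accesses t)) := by
  induction W using List.reverseRecOn with
  | nil => simp [serial, legal_iff]
  | append_singleton W a ih =>
    rw [legal_serial_snoc, ih, List.flatMap_append, LegalFrom.append, memAfter_serial]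
    simp [accesses, legalFrom_filter_isAccess]

theorem memAfter_filter_snoc_quiet (h : e.act.isAccess = false)
    (P : Event n → Bool) : memAfter ((t ++ [e]).filter P) = memAfter (t.filter P) := by
  rw [List.filter_append]
  cases hP : P e
  · simp [hP]
  · simp [hP, memAfter_snoc, actMem_of_not_isAccess h]

/-! ### A progressive transactional memory -/

namespace Locking

/-- The committed memory, and the reads and writes of the pending transaction of every process. -/
structure State (n : ℕ) where
  mem : Obj → Cell
  log : Fin n → List Act

/-- The memory as seen by `p`. -/
def State.view (s : State n) (p : Fin n) : Obj → Cell := (s.log p).foldl actMem s.mem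

/-- A call of `p` conflicts with a pending transaction. -/
def State.Conflict (s : State n) (p : Fin n) : Call → Prop
  | .read X => ∃ q, q ≠ p ∧ ∃ c, .resWrite X c ∈ s.log q
  | .write X _ => ∃ q, q ≠ p ∧ ∃ c, .resWrite X c ∈ s.log q ∨ .resRead X c ∈ s.log q
  | .complete => False

def State.push (s : State n) (p : Fin n) (x : Act) : State n :=
  { s with log := Function.update s.log p (s.log p ++ [x]) }

def State.clear (s : State n) (p : Fin n) : State n :=
  { s with log := Function.update s.log p [] }

def State.commit (s : State n) (p : Fin n) : State n :=
  ⟨s.view p, Function.update s.log p []⟩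

open Classical in
/-- The effect of a call: a transaction aborts as soon as it conflicts with another one. -/
noncomputable def exec (p : Fin n) (k : Call) (s : State n) : State n × Option Cell :=
  if s.Conflict p k then (s.clear p, none)
  else match k with
    | .read X => (s.push p (.resRead X (s.view p X)), some (s.view p X))
    | .write X v => (s.push p (.resWrite X v), some v)
    | .complete => (s.commit p, some (s.view p .head))

/-- The call to execute, or its result. -/
abbrev Local := Call ⊕ Option Cell

/-- Accesses are legal, and no transaction accesses an object written by another one. -/
structure State.OK (s : State n) : Prop where
  legal : ∀ p, LegalFrom s.mem (s.log p)
  excl : ∀ p q, p ≠ q → ∀ X c c', .resWrite X c ∈ s.log p →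
    .resWrite X c' ∉ s.log q ∧ .resRead X c' ∉ s.log q

theorem State.OK.clear {s : State n} (h : s.OK) (p : Fin n) : (s.clear p).OK := by
  have hsub : ∀ q x, x ∈ (s.clear p).log q → x ∈ s.log q := by
    intro q x
    by_cases hq : q = p
    · subst hq; simp [State.clear]
    · simp [State.clear, hq]
  refine ⟨fun q => ?_, fun q q' hq X c c' hX => ?_⟩
  · by_cases hq : q = p
    · subst hq; simp [State.clear, LegalFrom]
    · simpa [State.clear, hq] using h.legal q
  · obtain ⟨h1, h2⟩ := h.excl q q' hq X c c' (hsub q _ hX)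
    exact ⟨fun hm => h1 (hsub q' _ hm), fun hm => h2 (hsub q' _ hm)⟩

/-- The commit changes only objects written by `p`, and no other pending transaction has read any of
them; so the other logs remain legal. -/
theorem State.OK.commit {s : State n} (h : s.OK) (p : Fin n) : (s.commit p).OK := by
  refine ⟨fun q => ?_, (h.clear p).excl⟩
  by_cases hq : q = p
  · subst hq; simp [State.commit, LegalFrom]
  · have : LegalFrom s.mem ((s.commit p).log q) := by simpa [State.commit, hq] using h.legal q
    refine this.congr fun X c hX => (foldl_actMem_of_notMem (fun c' hm => ?_) _).symm
    refine (h.excl p q (Ne.symm hq) X c' c hm).2 ?_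
    simpa [State.commit, hq] using hX

theorem State.OK.push {s : State n} (h : s.OK) {x : Act} (hx : LegalFrom (s.view p) [x])
    (hc : ∀ q, q ≠ p → ∀ X c c', (x = .resWrite X c → .resWrite X c' ∉ s.log q ∧
      .resRead X c' ∉ s.log q) ∧ (x = .resRead X c → .resWrite X c' ∉ s.log q)) :
    (s.push p x).OK := by
  refine ⟨fun q => ?_, fun q q' hq X c c' hX => ?_⟩
  · by_cases hq : q = p
    · subst hq
      simpa [State.push, LegalFrom.append] using ⟨h.legal q, hx⟩
    · simpa [State.push, hq] using h.legal q
  · by_cases hqp : q = p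
    · subst hqp
      have hq' : (s.push q x).log q' = s.log q' := by simp [State.push, hq.symm]
      rw [hq']
      have hX' : .resWrite X c ∈ s.log q ∨ x = .resWrite X c := by
        simpa [State.push, eq_comm] using hX
      rcases hX' with hX' | hX'
      · exact h.excl q q' hq X c c' hX'
      · exact (hc q' hq.symm X c c').1 hX'
    · have hX' : .resWrite X c ∈ s.log q := by simpa [State.push, hqp] using hX
      by_cases hqp' : q' = p
      · subst hqp'
        have hm : ∀ y, y ∈ (s.push q' x).log q' → y ∈ s.log q' ∨ y = x := by
          simp [State.push]
        obtain ⟨h1, h2⟩ := h.excl q q' hq X c c' hX'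
        refine ⟨fun hy => ?_, fun hy => ?_⟩
        · exact (hm _ hy).elim h1 fun hy => ((hc q hq X c' c).1 hy.symm).1 hX'
        · exact (hm _ hy).elim h2 fun hy => (hc q hq X c' c).2 hy.symm hX'
      · have : (s.push p x).log q' = s.log q' := by simp [State.push, hqp']
        rw [this]
        exact h.excl q q' hq X c c' hX'

/-- A call aborts the transaction, or logs an access, or commits the transaction. -/
theorem State.OK.exec {s : State n} (h : s.OK) (p : Fin n) (k : Call) :
    (s.Conflict p k ∧ exec p k s = (s.clear p, none)) ∨
    (∃ cmd : Cmd, ∃ v, (∀ r, cmd ≠ .ret r) ∧ cmd.toCall = k ∧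
      Locking.exec p k s = (s.push p (cmd.finish v), some v) ∧ (s.push p (cmd.finish v)).OK) ∨
    (k = .complete ∧ ∃ v, Locking.exec p k s = (s.commit p, some v)) := by
  by_cases hk : s.Conflict p k
  · exact Or.inl ⟨hk, if_pos hk⟩
  · refine Or.inr ?_
    unfold Locking.exec
    rw [if_neg hk]
    cases k with
    | read X =>
      refine Or.inl ⟨.read X, s.view p X, by simp, rfl, rfl, h.push ⟨?_, trivial⟩ ?_⟩
      · intro Y c hc
        cases hc
        rfl
      · intro q hq Y c c'
        refine ⟨by simp [Cmd.finish], fun hx hm => hk ⟨q, hq, c', ?_⟩⟩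
        cases hx
        exact hm
    | write X v =>
      refine Or.inl ⟨.write X v, v, by simp, rfl, rfl, h.push ⟨by simp [Cmd.finish], trivial⟩ ?_⟩
      intro q hq Y c c'
      refine ⟨fun hx => ?_, by simp [Cmd.finish]⟩
      cases hx
      exact ⟨fun hm => hk ⟨q, hq, c', Or.inl hm⟩, fun hm => hk ⟨q, hq, c', Or.inr hm⟩⟩
    | complete => exact Or.inr ⟨rfl, _, rfl⟩

end Locking

/-- A transactional memory with locks on the objects, in shared mode for reads and in exclusive
mode for writes, that are kept until the end of the transaction; a transaction aborts if it
does not get a lock. -/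
noncomputable def locking (n : ℕ) : ConcImpl n where
  Base := Unit
  decBase := inferInstance
  State := fun _ => Locking.State n
  base₀ := fun _ => ⟨initMem, fun _ => []⟩
  Local := Locking.Local
  local₀ := fun _ => .inr none
  call := fun _ _ k _ => .inl k
  next := fun p ℓ => match ℓ with
    | .inl k => .prim () (fun s => ((Locking.exec p k s).1, .inr (Locking.exec p k s).2))
    | .inr r => .ret r

theorem Step.phase_of_ne (h : Step I c e c') {q : Fin n}
    (hq : q ≠ e.proc) : c'.phase q = c.phase q := by
  rcases h.cases_stat with ⟨op, -, -, -, h4, -⟩ | ⟨op, s, s', -, -, -, h4, -⟩ <;>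
    rw [h4, Function.update_of_ne hq]

theorem Step.oid_after (h : Step I c e c') (ha : (c'.phase e.proc).oid = some a) :
    a = e.oid ∧ ((c.phase e.proc).oid = some a ∨ e.oid ∉ c.used) := by
  rcases h.cases_stat with ⟨op, -, h2, -, h4, -⟩ | ⟨op, s, s', h1, h2, -, h4, -⟩
  · rw [h4, Function.update_self] at ha
    cases ha
    exact ⟨rfl, Or.inr h2⟩
  · rw [h4, Function.update_self, Stat.oid_phase] at ha
    rw [h1, Stat.oid_phase]
    exact ⟨ha.2.symm, Or.inl ⟨h2, ha.2⟩⟩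

theorem Reach.oid_inj (h : Reach I t c) {p q : Fin n}
    (hp : (c.phase p).oid = some a) (hq : (c.phase q).oid = some a) : p = q := by
  obtain ⟨p', op, s, hst⟩ := h.traceInv.state a ((h.traceInv.used a).1 (h.traceInv.pending p a hp))
  rw [(hst.only p hp).1, (hst.only q hq).1]

theorem Reach.appears_of_pending (h : Reach I t c)
 (hp : (c.phase p).oid = some a) : Appears t a :=
  (h.traceInv.used a).1 (h.traceInv.pending p a hp)

theorem Reach.concurrent_of_pending (h : Reach I t c)
    {p q : Fin n} (hp : (c.phase p).oid = some a) (hq : (c.phase q).oid = some b) :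
    Concurrent t a b :=
  ⟨h.appears_of_pending hp, h.appears_of_pending hq, h.not_precedes_of_pending hp,
    h.not_precedes_of_pending hq⟩

theorem Reach.opState_of_busy (h : Reach I t c)
 (hp : c.phase p = .busy op a l) :
    ∃ op, OpState t c a p op (.busy l) := by
  have hoid : (c.phase p).oid = some a := by rw [hp]; rfl
  obtain ⟨p', op', s, hst⟩ := h.traceInv.state a (h.appears_of_pending hoid)
  obtain ⟨rfl, hs⟩ := hst.only p hoid
  have := hst.phase hs
  rw [hp] at this
  cases s <;> cases this
  exact ⟨_, hst⟩

theorem writes_of_mem {w : Cell} (h : .invWrite X w ∈ acts t a) : Writes t a X := by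
  obtain ⟨f, hf, h3, h4⟩ := mem_acts.1 h
  exact ⟨f, hf, h3, w, h4⟩

theorem Sequential.of_snoc (hc : Reach I t c)
    (he : Step I c e c') (h : Sequential (t ++ [e])) : Sequential t :=
  fun a b hab hcon => h a b hab (hcon.snoc hc he)

/-! ### Invariant of the transactional memory. -/

namespace Locking

def state (c : Config (locking n)) : State n := c.base ()

def loc (c : Config (locking n)) (p : Fin n) : Local := c.loc p

/-- The log of a process, given its local state and its phase. -/
def ProcOK (t : List (Event n)) (W : List ℕ) (ys : List Act) : Local → Phase → Prop
  | _, .idle => ys = []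
  | _, .ready _ a _ => ys = accesses t a ∧ a ∉ W
  | .inl k, .busy _ a l => k = l.cmd.toCall ∧ ys = accesses t a ∧ a ∉ W
  | .inr (some v), .busy _ a l =>
      -- Either the primitive has logged the access and its end is not yet in the trace, or the
      -- transaction has committed and not yet responded.
      (ys = accesses t a ++ [l.cmd.finish v] ∧ a ∉ W ∧ ∀ r, l.cmd ≠ .ret r) ∨
      ys = [] ∧ a ∈ W ∧ ∃ r, l = .done r
  | .inr none, .busy _ a _ => ys = [] ∧ a ∉ W ∧ ∃ b, ConflictIn t a b

theorem ProcOK.frame {t t' : List (Event n)} {W W' : List ℕ} {ys : List Act} {ℓ : Local}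
    {ph : Phase} (h : ProcOK t W ys ℓ ph) (hacc : ∀ a, ph.oid = some a → accesses t' a = accesses t a)
    (hW : ∀ a, ph.oid = some a → (a ∈ W' ↔ a ∈ W))
    (hc : ∀ a b, ConflictIn t a b → ConflictIn t' a b) : ProcOK t' W' ys ℓ ph := by
  cases ph with
  | idle => exact h
  | ready op a l =>
    simpa only [ProcOK, hacc a rfl, hW a rfl] using h
  | busy op a l =>
    rcases ℓ with k | _ | v
    · simpa only [ProcOK, hacc a rfl, hW a rfl] using h
    · obtain ⟨h1, h2, b, h3⟩ := h
      exact ⟨h1, (hW a rfl).not.2 h2, b, hc a b h3⟩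
    · simpa only [ProcOK, hacc a rfl, hW a rfl] using h

/-- The transactions have been committed in the order `W`. -/
structure Inv (t : List (Event n)) (c : Config (locking n)) (W : List ℕ) : Prop where
  ok : (state c).OK
  mem : (state c).mem = (W.flatMap (accesses t)).foldl actMem initMem
  legal : LegalFrom initMem (W.flatMap (accesses t))
  nodup : W.Nodup
  committed : ∀ a, Committed t a → a ∈ W
  completing : ∀ a ∈ W, Committed t a ∨ ∃ p op r, c.phase p = .busy op a (.done r)
  precedes : ∀ a ∈ W, ∀ b ∈ W, Precedes t a b → List.Sublist [a, b] W
  safe : ∀ a, a ∉ W → ∃ W₁, W₁ <+: W ∧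
    LegalFrom ((W₁.flatMap (accesses t)).foldl actMem initMem) (accesses t a)
  proc : ∀ p, ProcOK t W ((state c).log p) (loc c p) (c.phase p)
  aborted : ∀ a, Aborted t a → ∃ b, ConflictIn t a b
  -- In a sequential execution the order of the trace is the order of commits. This clause and the
  -- next one are there for obedience.
  memAfter : Sequential t → memAfter (t.filter (fun e => e.oid ∈ W)) = (state c).mem
  memAfter_pending : Sequential t → ∀ p a, (c.phase p).oid = some a → a ∉ W →
    ListSet.memAfter (t.filter (fun e => e.oid ∈ W ∨ e.oid = a)) =
      (accesses t a).foldl actMem (state c).mem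

theorem Inv.initial : Inv [] (Config.initial (locking n)) [] where
  ok := ⟨fun p => trivial, fun p q _ X c c' h => by cases h⟩
  mem := rfl
  legal := trivial
  nodup := List.nodup_nil
  committed := by rintro a ⟨r, e, he, -⟩; cases he
  completing := by simp
  precedes := by simp
  safe := fun a _ => ⟨[], List.prefix_rfl, trivial⟩
  proc := fun p => rfl
  aborted := by rintro a ⟨e, he, -⟩; cases he
  memAfter := fun _ => rfl
  memAfter_pending := fun _ p a h => by cases h

section

variable {c c' : Config (locking n)} {W : List ℕ}

theorem Inv.appears (h : Inv t c W) (hr : Reach (locking n) t c) (ha : a ∈ W) :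
    Appears t a := by
  rcases h.completing a ha with h1 | ⟨p, op, r, hp⟩
  · exact h1.appears
  · exact hr.appears_of_pending (p := p) (by rw [hp]; rfl)

theorem Inv.serialized (h : Inv t c W) (hr : Reach (locking n) t c) : Serialized t W where
  nodup := h.nodup
  committed := h.committed
  pending := by
    intro a ha
    refine (h.completing a ha).imp id ?_
    rintro ⟨p, op, r, hp⟩
    obtain ⟨op, hst⟩ := hr.opState_of_busy hp
    exact hst.commitPending.2 ⟨r, rfl⟩
  precedes := h.precedes
  legal := (legal_serial t W).2 h.legal
  safe := by
    intro a ha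
    obtain ⟨W₁, h1, h2⟩ := h.safe a ha
    exact ⟨W₁, h1, by rw [memAfter_serial]; exact legalFrom_filter_isAccess.1 h2⟩

theorem Inv.precedes_snoc (h : Inv t c W) (hr : Reach (locking n) t c) (hs : Step (locking n) c e c')
 (hb : b ∈ W) (hab : Precedes (t ++ [e]) a b) : Precedes t a b := by
  rcases ListSet.precedes_snoc hab with h1 | ⟨rfl, op, hop⟩
  · exact h1
  · exact absurd ((hr.traceInv.used _).2 (h.appears hr hb)) (hs.invOp hop).1

theorem Inv.committed_snoc (h : Inv t c W) (hres : ∀ r, e.act = .resOp r → e.oid ∈ W) (a : ℕ)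
    (ha : Committed (t ++ [e]) a) : a ∈ W := by
  obtain ⟨r, f, hf, rfl, hact⟩ := ha
  rcases List.mem_append.1 hf with hf | hf
  · exact h.committed _ ⟨r, f, hf, rfl, hact⟩
  · rw [List.mem_singleton.1 hf] at hact ⊢
    exact hres r hact

theorem Inv.aborted_snoc (h : Inv t c W) (hr : Reach (locking n) t c) (hs : Step (locking n) c e c')
    (hab : e.act = .abort → ∃ b, ConflictIn (t ++ [e]) e.oid b) (a : ℕ)
    (ha : Aborted (t ++ [e]) a) : ∃ b, ConflictIn (t ++ [e]) a b := by
  obtain ⟨f, hf, rfl, hact⟩ := ha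
  rcases List.mem_append.1 hf with hf | hf
  · obtain ⟨b, hb⟩ := h.aborted _ ⟨f, hf, rfl, hact⟩
    exact ⟨b, hb.snoc hr hs⟩
  · rw [List.mem_singleton.1 hf] at hact ⊢
    exact hab hact

theorem Inv.completing_snoc (h : Inv t c W) (hs : Step (locking n) c e c')
    (hdone : ∀ op a r, a ∈ W → c.phase e.proc = .busy op a (.done r) →
      Committed (t ++ [e]) a ∨ c'.phase e.proc = .busy op a (.done r)) (a : ℕ) (ha : a ∈ W) :
    Committed (t ++ [e]) a ∨ ∃ p op r, c'.phase p = .busy op a (.done r) := by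
  rcases h.completing a ha with ⟨r, f, hf, h1⟩ | ⟨p, op, r, hp⟩
  · exact Or.inl ⟨r, f, List.mem_append_left _ hf, h1⟩
  · by_cases hpe : p = e.proc
    · subst hpe
      exact (hdone op a r ha hp).imp id fun h => ⟨_, op, r, h⟩
    · exact Or.inr ⟨p, op, r, by rw [hs.phase_of_ne hpe, hp]⟩

theorem memAfter_filter_congr {P Q : Event n → Bool} (h : ∀ e ∈ t, P e = Q e) :
    ListSet.memAfter (t.filter P) = ListSet.memAfter (t.filter Q) := by
  rw [List.filter_congr h]

/-- Steps other than the commits and the ends of reads and writes. -/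
theorem Inv.quiet (h : Inv t c W) (hr : Reach (locking n) t c) (hs : Step (locking n) c e c')
    (hq : e.act.isAccess = false) (hok : (state c').OK) (hmem : (state c').mem = (state c).mem)
    (hlog : ∀ q, q ≠ e.proc → (state c').log q = (state c).log q ∧ loc c' q = loc c q)
    (hproc : ProcOK (t ++ [e]) W ((state c').log e.proc) (loc c' e.proc) (c'.phase e.proc))
    (hdone : ∀ op a r, a ∈ W → c.phase e.proc = .busy op a (.done r) →
      Committed (t ++ [e]) a ∨ c'.phase e.proc = .busy op a (.done r))
    (hres : ∀ r, e.act = .resOp r → e.oid ∈ W)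
    (hab : e.act = .abort → ∃ b, ConflictIn (t ++ [e]) e.oid b) : Inv (t ++ [e]) c' W := by
  have hacc : accesses (t ++ [e]) = accesses t := funext (accesses_snoc_quiet hq)
  refine ⟨hok, by rw [hmem, hacc, h.mem], by rw [hacc]; exact h.legal, h.nodup,
    h.committed_snoc hres, h.completing_snoc hs hdone,
    fun a ha b hb hab => h.precedes a ha b hb (h.precedes_snoc hr hs hb hab),
    by rw [hacc]; exact h.safe, fun q => ?_, h.aborted_snoc hr hs hab, fun hseq => ?_,
    fun hseq q b hb hbW => ?_⟩
  · by_cases hqe : q = e.proc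
    · subst hqe; exact hproc
    · rw [(hlog q hqe).1, (hlog q hqe).2, hs.phase_of_ne hqe]
      exact (h.proc q).frame (fun a _ => by rw [hacc]) (fun _ _ => Iff.rfl)
        fun a b hab => hab.snoc hr hs
  · rw [memAfter_filter_snoc_quiet hq, hmem]
    exact h.memAfter (hseq.of_snoc hr hs)
  · rw [memAfter_filter_snoc_quiet hq, hmem, hacc]
    have hseq' := hseq.of_snoc hr hs
    by_cases hqe : q = e.proc
    · subst hqe
      obtain ⟨rfl, hb' | hb'⟩ := hs.oid_after hb
      · exact h.memAfter_pending hseq' _ _ hb' hbW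
      · have hb'' : ¬ Appears t e.oid := fun hap => hb' ((hr.traceInv.used _).2 hap)
        rw [accesses_of_not_appears hb'', List.foldl_nil, ← h.memAfter hseq']
        refine memAfter_filter_congr fun f hf => ?_
        have : f.oid ≠ e.oid := fun hfe => hb'' ⟨f, hf, hfe⟩
        simp [this]
    · rw [hs.phase_of_ne hqe] at hb
      exact h.memAfter_pending hseq' _ _ hb hbW

/-- The commit of a transaction. -/
theorem Inv.commit (h : Inv t c W) (hr : Reach (locking n) t c) (hs : Step (locking n) c e c')
    (hact : e.act = .step) {r : Bool} (hph : c.phase e.proc = .busy op e.oid (.done r))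
    (hph' : c'.phase = c.phase) (hlogp : (state c).log e.proc = accesses t e.oid) (heW : e.oid ∉ W)
    (hst : state c' = (state c).commit e.proc) {v : Cell} (hlocp : loc c' e.proc = .inr (some v))
    (hloc : ∀ q, q ≠ e.proc → loc c' q = loc c q) : Inv (t ++ [e]) c' (W ++ [e.oid]) := by
  have hq : e.act.isAccess = false := by rw [hact]; rfl
  have hacc : accesses (t ++ [e]) = accesses t := funext (accesses_snoc_quiet hq)
  have hoid : (c.phase e.proc).oid = some e.oid := by rw [hph]; rfl
  have hmem : (state c').mem = (accesses t e.oid).foldl actMem (state c).mem := by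
    rw [hst]
    show ((state c).log e.proc).foldl actMem _ = _
    rw [hlogp]
  have hleg := h.ok.legal e.proc
  rw [hlogp, h.mem] at hleg
  refine ⟨by rw [hst]; exact h.ok.commit _, ?_, ?_, ?_, ?_, ?_, ?_, ?_, fun q => ?_,
    h.aborted_snoc hr hs (by simp [hact]), fun hseq => ?_, fun hseq q b hb hbW => ?_⟩
  · rw [hmem, hacc, h.mem, List.flatMap_append, List.foldl_append]
    simp
  · rw [hacc, List.flatMap_append, LegalFrom.append]
    exact ⟨h.legal, by simpa using hleg⟩
  · exact List.nodup_append.2 ⟨h.nodup, by simp, by rintro a ha b hb rfl; simp_all⟩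
  · exact fun a ha => List.mem_append_left _ (h.committed_snoc (by simp [hact]) a ha)
  · intro a ha
    rcases List.mem_append.1 ha with ha | ha
    · exact h.completing_snoc hs (fun op a r _ hp => Or.inr (by rw [hph', hp])) a ha
    · rw [List.mem_singleton.1 ha]
      exact Or.inr ⟨_, op, r, by rw [hph', hph]⟩
  · intro a ha b hb hab
    have hab' : Precedes t a b := by
      rcases ListSet.precedes_snoc hab with h1 | ⟨-, op, hop⟩
      · exact h1
      · rw [hact] at hop; cases hop
    have ha' : a ∈ W := by
      refine (List.mem_append.1 ha).resolve_right fun ha => ?_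
      rw [List.mem_singleton.1 ha] at hab'
      exact hr.not_precedes_of_pending hoid hab'
    rcases List.mem_append.1 hb with hb | hb
    · exact (h.precedes a ha' b hb hab').trans (List.sublist_append_left _ _)
    · rw [List.mem_singleton.1 hb]
      exact (List.singleton_sublist.2 ha').append (List.Sublist.refl [e.oid])
  · intro a ha
    obtain ⟨W₁, h1, h2⟩ := h.safe a (fun hm => ha (List.mem_append_left _ hm))
    rw [hacc]
    exact ⟨W₁, h1.trans (List.prefix_append _ _), h2⟩
  · by_cases hqe : q = e.proc
    · subst hqe
      rw [hlocp, hph', hph, hst]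
      exact Or.inr ⟨Function.update_self _ _ _, by simp, r, rfl⟩
    · have hlog : (state c').log q = (state c).log q := by
        rw [hst]
        exact Function.update_of_ne hqe _ _
      rw [hlog, hloc q hqe, hph']
      refine (h.proc q).frame (fun a _ => by rw [hacc]) (fun a ha => ?_) fun a b hab => hab.snoc hr hs
      have : a ≠ e.oid := by
        rintro rfl
        exact hqe (hr.oid_inj ha hoid)
      simp [this]
  · rw [memAfter_filter_snoc_quiet hq, hmem, ← h.memAfter_pending (hseq.of_snoc hr hs) _ _ hoid heW]
    exact memAfter_filter_congr fun f _ => by simp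
  · rw [hph'] at hb
    -- Any other pending operation would be concurrent with the one that commits.
    by_contra
    refine hseq.of_snoc hr hs b e.oid ?_ (hr.concurrent_of_pending hb hoid)
    rintro rfl
    exact hbW (by simp)

/-- The end of a read or a write. -/
theorem Inv.access (h : Inv t c W) (hr : Reach (locking n) t c) (hs : Step (locking n) c e c')
 {v : Cell} (hact : e.act = l.cmd.finish v) (hl : ∀ r, l.cmd ≠ .ret r)
    (hph : c.phase e.proc = .busy op e.oid l) (hph' : c'.phase e.proc = Phase.after op e.oid l v)
    (hlogp : (state c).log e.proc = accesses t e.oid ++ [l.cmd.finish v]) (heW : e.oid ∉ W)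
    (hst : state c' = state c) (hloc : loc c' = loc c) : Inv (t ++ [e]) c' W := by
  have hq : e.act.isAccess = true := by
    rw [hact]
    cases hc : l.cmd <;> first | rfl | exact absurd hc (hl _)
  have hoid : (c.phase e.proc).oid = some e.oid := by rw [hph]; rfl
  have hself : accesses (t ++ [e]) e.oid = (state c).log e.proc := by
    rw [accesses_snoc_self hq, hlogp, hact]
  have hacc : ∀ V : List ℕ, V ⊆ W →
      V.flatMap (accesses (t ++ [e])) = V.flatMap (accesses t) := fun V hV =>
    List.flatMap_congr fun a ha => accesses_snoc_of_ne fun he => heW (he ▸ hV ha)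
  have hno : e.act ≠ .abort ∧ ∀ r, e.act ≠ .resOp r := by
    constructor
    · intro ha; rw [ha] at hq; cases hq
    · intro r ha; rw [ha] at hq; cases hq
  have hmem : ListSet.memAfter ((t ++ [e]).filter (fun e => e.oid ∈ W)) =
      ListSet.memAfter (t.filter (fun e => e.oid ∈ W)) := by
    rw [List.filter_append, List.filter_cons_of_neg (by simpa using heW)]
    simp
  refine ⟨hst ▸ h.ok, by rw [hst, hacc W (List.Subset.refl _), h.mem],
    by rw [hacc W (List.Subset.refl _)]; exact h.legal, h.nodup,
    h.committed_snoc (fun r hr => absurd hr (hno.2 r)),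
    h.completing_snoc hs fun op' a r ha hp => ?_,
    fun a ha b hb hab => h.precedes a ha b hb (h.precedes_snoc hr hs hb hab),
    fun a ha => ?_, fun q => ?_, h.aborted_snoc hr hs (fun ha => absurd ha hno.1),
    fun hseq => by rw [hmem, hst]; exact h.memAfter (hseq.of_snoc hr hs), fun hseq q b hb hbW => ?_⟩
  · rw [hph] at hp
    cases hp
    exact absurd ha heW
  · by_cases hae : a = e.oid
    · subst hae
      -- At the end of an access the whole log is legal from the present committed memory, so the
      -- operation observes all of `W`. This prefix serves until its next access, even if `W` grows.
      refine ⟨W, List.prefix_rfl, ?_⟩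
      rw [hacc W (List.Subset.refl _), ← h.mem, hself]
      exact h.ok.legal e.proc
    · obtain ⟨W₁, h1, h2⟩ := h.safe a ha
      refine ⟨W₁, h1, ?_⟩
      rw [hacc W₁ h1.subset, accesses_snoc_of_ne (Ne.symm hae)]
      exact h2
  · rw [hst, hloc]
    by_cases hqe : q = e.proc
    · subst hqe
      rw [hph']
      cases hc : l.cmd with
      | ret r => exact absurd hc (hl r)
      | _ =>
        simp only [Phase.after, hc]
        exact ⟨hself.symm, heW⟩
    · rw [hs.phase_of_ne hqe]
      refine (h.proc q).frame (fun a ha => accesses_snoc_of_ne ?_) (fun _ _ => Iff.rfl)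
        fun a b hab => hab.snoc hr hs
      rintro rfl
      exact hqe (hr.oid_inj ha hoid)
  · have hseq' := hseq.of_snoc hr hs
    have hbe : b = e.oid := by
      by_cases hqe : q = e.proc
      · subst hqe
        exact (hs.oid_after hb).1
      · rw [hs.phase_of_ne hqe] at hb
        by_contra hne
        exact hseq' b e.oid hne (hr.concurrent_of_pending hb hoid)
    subst hbe
    rw [List.filter_append, List.filter_cons_of_pos (by simp), List.filter_nil, memAfter_snoc, hst,
      h.memAfter_pending hseq' _ _ hoid heW, accesses_snoc_self hq, List.foldl_append]
    rfl

/-- The accesses in a log belong to the pending operation. -/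
theorem Inv.mem_log (h : Inv t c W) (hr : Reach (locking n) t c) {q : Fin n} {x : Act}
    (hx : x ∈ (state c).log q) :
    ∃ b, (c.phase q).oid = some b ∧ (∀ X w, x = .resRead X w → .invRead X ∈ acts t b) ∧
      ∀ X w, x = .resWrite X w → .invWrite X w ∈ acts t b := by
  have hp := h.proc q
  generalize hph : c.phase q = ph at hp
  have key : ∀ b, ph.oid = some b → x ∈ accesses t b →
      (∀ X w, x = .resRead X w → .invRead X ∈ acts t b) ∧
        ∀ X w, x = .resWrite X w → .invWrite X w ∈ acts t b := by
    intro b hb hx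
    obtain ⟨p', op, s, hst⟩ := hr.traceInv.state b (hr.appears_of_pending (hph ▸ hb))
    have hx := List.mem_of_mem_filter hx
    exact ⟨fun X w hxw => hst.start_mem.2.1 X w (hxw ▸ hx),
      fun X w hxw => hst.start_mem.2.2 X w (hxw ▸ hx)⟩
  cases ph with
  | idle => rw [show (state c).log q = [] from hp] at hx; cases hx
  | ready op a l =>
    rw [hp.1] at hx
    exact ⟨a, rfl, key a rfl hx⟩
  | busy op a l =>
    generalize loc c q = ℓ at hp
    rcases ℓ with k | _ | v
    · rw [hp.2.1] at hx
      exact ⟨a, rfl, key a rfl hx⟩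
    · rw [hp.1] at hx; cases hx
    · rcases hp with ⟨hl, -⟩ | ⟨hl, -⟩
      · rw [hl] at hx
        rcases List.mem_append.1 hx with hx | hx
        · exact ⟨a, rfl, key a rfl hx⟩
        · obtain ⟨_, hst⟩ := hr.opState_of_busy hph
          have hmem := hst.start_mem.1 l rfl
          rw [List.mem_singleton.1 hx]
          refine ⟨a, rfl, fun X w hxw => ?_, fun X w hxw => ?_⟩ <;>
            cases hc : l.cmd <;> rw [hc] at hxw hmem <;> cases hxw <;> exact hmem
      · rw [hl] at hx; cases hx

/-- A conflict with a pending transaction. -/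
theorem Inv.conflictIn (h : Inv t c W) (hr : Reach (locking n) t c)
 (hp : c.phase p = .busy op a l) (hc : (state c).Conflict p l.cmd.toCall) :
    ∃ b, ConflictIn t a b := by
  have hoid : (c.phase p).oid = some a := by rw [hp]; rfl
  obtain ⟨_, hst⟩ := hr.opState_of_busy hp
  have hmem := hst.start_mem.1 l rfl
  have key : ∀ q b, q ≠ p → (c.phase q).oid = some b → b ≠ a ∧ Concurrent t a b := by
    intro q b hq hb
    refine ⟨?_, hr.concurrent_of_pending hoid hb⟩
    rintro rfl
    exact hq (hr.oid_inj hb hoid)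
  cases hcmd : l.cmd with
  | ret r => rw [hcmd] at hc; exact hc.elim
  | read X =>
    rw [hcmd] at hc hmem
    obtain ⟨q, hq, w, hw⟩ := hc
    obtain ⟨b, hb, -, h2⟩ := h.mem_log hr hw
    have hwr := writes_of_mem (h2 X w rfl)
    exact ⟨b, (key q b hq hb).1, (key q b hq hb).2, X, Or.inl (mem_acts.1 hmem), Or.inr hwr, Or.inr hwr⟩
  | write X v =>
    rw [hcmd] at hc hmem
    have hwa := writes_of_mem hmem
    obtain ⟨q, hq, w, hw | hw⟩ := hc
    · obtain ⟨b, hb, -, h2⟩ := h.mem_log hr hw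
      have hwr := writes_of_mem (h2 X w rfl)
      exact ⟨b, (key q b hq hb).1, (key q b hq hb).2, X, Or.inr hwa, Or.inr hwr, Or.inr hwr⟩
    · obtain ⟨b, hb, h2, -⟩ := h.mem_log hr hw
      exact ⟨b, (key q b hq hb).1, (key q b hq hb).2, X, Or.inr hwa,
        Or.inl (mem_acts.1 (h2 X w rfl)), Or.inl hwa⟩

end

end Locking

/-! ### Correctness of the transactional memory. -/

namespace Locking

variable {c c' : Config (locking n)} {W : List ℕ}

theorem next_eq (p : Fin n) (ℓ : Local) : (locking n).next p ℓ = (match ℓ with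
    | .inl k => .prim () (fun s => ((exec p k s).1, .inr (exec p k s).2))
    | .inr r => .ret r : Action Unit (fun _ => State n) Local) := rfl

/-- The serialization grows exactly at the primitive of a completion, by the transaction that
commits. The disjunction about the memory says that it changes only while some completion is under
way; `mem_of_run` needs this. -/
theorem Inv.step (h : Inv t c W) (hr : Reach (locking n) t c) (hs : Step (locking n) c e c') :
    ∃ W', Inv (t ++ [e]) c' W' ∧
      ((state c').mem = (state c).mem ∨ ∃ p op a r, c.phase p = .busy op a (.done r)) := by
  have hs' := hs
  cases hs with
  | invoke p op a hp ha =>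
    refine ⟨W, h.quiet hr hs' rfl h.ok rfl (fun q _ => ⟨rfl, rfl⟩) ?_
      (fun op a r _ hb => by rw [hp] at hb; cases hb) (by simp) (by simp), Or.inl rfl⟩
    have h1 := h.proc p
    have h2 : ¬ Appears t a := fun hap => ha ((hr.traceInv.used _).2 hap)
    rw [hp] at h1
    simp only [Function.update_self]
    refine ⟨?_, fun haW => h2 (h.appears hr haW)⟩
    rw [accesses_snoc_quiet rfl, accesses_of_not_appears h2]
    exact h1
  | call p op a l hp =>
    have hq : l.cmd.start.isAccess = false := by cases l <;> rfl
    refine ⟨W, h.quiet hr hs' hq h.ok rfl (fun q hqp => ⟨rfl, Function.update_of_ne hqp _ _⟩) ?_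
      (fun op a r _ hb => by rw [hp] at hb; cases hb) ?_ ?_, Or.inl rfl⟩
    · have h1 := h.proc p
      rw [hp] at h1
      simp only [Function.update_self, loc, locking, ProcOK]
      rw [accesses_snoc_quiet hq]
      exact ⟨trivial, h1⟩
    · intro r hact; cases l <;> cases hact
    · intro hact; cases l <;> cases hact
  | prim p op a l b f hp hn =>
    have h1 := h.proc p
    rw [hp] at h1
    replace hn := (next_eq p (loc c p)).symm.trans hn
    generalize hℓ : loc c p = ℓ at hn h1
    rcases ℓ with k | r
    swap
    · cases hn
    cases hn
    obtain ⟨rfl, h2, h3⟩ := h1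
    set c' : Config (locking n) := { c with
      base := Function.update c.base () (exec p l.cmd.toCall (c.base ())).1
      loc := Function.update c.loc p (.inr (exec p l.cmd.toCall (c.base ())).2) } with hc'
    have hst : state c' = (exec p l.cmd.toCall (state c)).1 := Function.update_self () _ c.base
    have hlocp : loc c' p = .inr (exec p l.cmd.toCall (state c)).2 := Function.update_self _ _ _
    have hloc : ∀ q, q ≠ p → loc c' q = loc c q := fun q hq => Function.update_of_ne hq _ _
    have hdone : ∀ op' a' r, a' ∈ W → c.phase p = .busy op' a' (.done r) →
        Committed (t ++ [⟨p, a, .step⟩]) a' ∨ c'.phase p = .busy op' a' (.done r) :=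
      fun op' a' r _ hb => Or.inr hb
    rcases h.ok.exec p l.cmd.toCall with ⟨hcon, hex⟩ | ⟨cmd, v, hcmd, hk, hex, hok⟩ | ⟨hk, v, hex⟩
    · rw [hex] at hst hlocp
      refine ⟨W, h.quiet hr hs' rfl (hst ▸ h.ok.clear p) (by rw [hst]; rfl) (fun q hq => ⟨?_, hloc q hq⟩)
        ?_ hdone (by simp) (by simp), Or.inl (by rw [hst]; rfl)⟩
      · rw [hst]; exact Function.update_of_ne hq _ _
      · obtain ⟨b, hb⟩ := h.conflictIn hr hp hcon
        rw [hst, hlocp, hp]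
        exact ⟨Function.update_self _ _ _, h3, b, hb.snoc hr hs'⟩
    · rw [hex] at hst hlocp
      refine ⟨W, h.quiet hr hs' rfl (hst ▸ hok) (by rw [hst]; rfl) (fun q hq => ⟨?_, hloc q hq⟩)
        ?_ hdone (by simp) (by simp), Or.inl (by rw [hst]; rfl)⟩
      · rw [hst]; exact Function.update_of_ne hq _ _
      · have hl : cmd.finish v = l.cmd.finish v ∧ ∀ r, l.cmd ≠ .ret r := by
          cases hlc : l.cmd <;> rw [hlc] at hk <;> cases cmd <;> cases hk <;>
            first | exact ⟨rfl, by simp⟩ | exact absurd rfl (hcmd _)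
        rw [hst, hlocp, hp]
        refine Or.inl ⟨?_, h3, hl.2⟩
        rw [accesses_snoc_quiet rfl, ← h2, ← hl.1]
        exact Function.update_self _ _ _
    · rw [hex] at hst hlocp
      obtain ⟨r, rfl⟩ : ∃ r, l = .done r := by
        cases l <;> cases hk
        exact ⟨_, rfl⟩
      exact ⟨_, h.commit hr hs' rfl hp rfl h2 h3 hst hlocp hloc, Or.inr ⟨p, op, a, r, hp⟩⟩
  | ret p op a l v hp hn =>
    have h1 := h.proc p
    rw [hp] at h1
    replace hn := (next_eq p (loc c p)).symm.trans hn
    generalize loc c p = ℓ at hn h1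
    rcases ℓ with k | r
    · cases hn
    cases hn
    rcases h1 with ⟨h2, h3, h4⟩ | ⟨h2, h3, r, rfl⟩
    · exact ⟨W, h.access hr hs' rfl h4 hp (Function.update_self _ _ _) h2 h3 rfl rfl, Or.inl rfl⟩
    · refine ⟨W, h.quiet hr hs' rfl h.ok rfl (fun q _ => ⟨rfl, rfl⟩) ?_ ?_ (fun _ _ => h3)
        (by simp [Loc.cmd, Cmd.finish]), Or.inl rfl⟩
      · simp only [Function.update_self]
        exact h2
      · intro op' a' r' _ hb
        rw [hp] at hb
        cases hb
        exact Or.inl ⟨r, _, List.mem_append_right _ (List.mem_singleton_self _), rfl, rfl⟩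
  | abort p op a l hp hn =>
    have h1 := h.proc p
    rw [hp] at h1
    replace hn := (next_eq p (loc c p)).symm.trans hn
    generalize loc c p = ℓ at hn h1
    rcases ℓ with k | r
    · cases hn
    cases hn
    obtain ⟨h2, h3, b, hb⟩ := h1
    refine ⟨W, h.quiet hr hs' rfl h.ok rfl (fun q _ => ⟨rfl, rfl⟩) ?_ ?_ (by simp)
      (fun _ => ⟨b, hb.snoc hr hs'⟩), Or.inl rfl⟩
    · simp only [Function.update_self]
      exact h2
    · intro op' a' r' ha' hb
      rw [hp] at hb
      cases hb
      exact absurd ha' h3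

theorem exists_inv (hr : Reach (locking n) t c) : ∃ W, Inv t c W := by
  induction hr with
  | nil => exact ⟨[], Inv.initial⟩
  | snoc h1 h2 ih =>
    obtain ⟨W, hW⟩ := ih
    obtain ⟨W', hW', -⟩ := hW.step h1 h2
    exact ⟨W', hW'⟩

theorem serialized (ht : IsExecution (locking n) t) : ∃ W, Serialized t W := by
  obtain ⟨c, hc⟩ := ht
  obtain ⟨W, hW⟩ := exists_inv hc
  exact ⟨W, hW.serialized hc⟩

theorem progressive (n : ℕ) : Progressive (locking n) := by
  rintro t ⟨c, hc⟩ a ha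
  obtain ⟨W, hW⟩ := exists_inv hc
  exact hW.aborted a ha

theorem readSequence_act {ρ : List (Event n)} (h : ReadSequence ρ) :
    ∀ e ∈ ρ, e.act ≠ .startCommit ∧ ∀ X w, e.act ≠ .resWrite X w := by
  induction h with
  | nil => simp
  | invoke p a op _ ih =>
    intro e he
    rcases List.mem_append.1 he with he | he
    · exact ih e he
    · rw [List.mem_singleton.1 he]; simp
  | read p a X w _ hs ih =>
    intro e he
    simp only [List.mem_append, List.mem_cons, List.not_mem_nil, or_false] at he
    rcases he with he | rfl | he | rfl
    · exact ih e he
    · simp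
    · rw [hs e he]; simp
    · simp

/-- Without completions, the committed memory does not change. -/
theorem mem_of_run {d : Config (locking n)} (hr : Reach (locking n) t c)
    (hu : Run (locking n) c u d) (hc : Complete t) (hact : ∀ e ∈ u, e.act ≠ .startCommit) :
    (state d).mem = (state c).mem := by
  induction hu with
  | nil => rfl
  | @snoc d d' u e h1 h2 ih =>
    specialize ih fun e he => hact e (List.mem_append_left _ he)
    have hrd := hr.run h1
    obtain ⟨W, hW⟩ := exists_inv hrd
    obtain ⟨-, -, h3 | ⟨p, op, a, r, hp⟩⟩ := hW.step hrd h2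
    · rw [h3, ih]
    · exfalso
      obtain ⟨op, hst⟩ := hrd.opState_of_busy hp
      obtain ⟨f, hf, rfl, hfa⟩ := mem_acts.1 (hst.start_mem.1 _ rfl)
      have hf' := (List.mem_append.1 hf).resolve_right fun hf =>
        hact f (List.mem_append_left _ hf) hfa
      have hcp := hst.commitPending.2 ⟨r, rfl⟩
      rcases hc f.oid ⟨f, hf', rfl⟩ with ⟨r', g, hg, h4⟩ | ⟨g, hg, h4⟩
      · exact hcp.2.1 ⟨r', g, List.mem_append_left _ hg, h4⟩
      · exact hcp.2.2 ⟨g, List.mem_append_left _ hg, h4⟩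

/-- After a complete sequential execution the committed memory is the result of the writes of the
operations that were not aborted. A sequence of reads contains no completions, so this memory stays,
and no writes, so the readers see nothing else. -/
theorem obedient (n : ℕ) : Obedient (locking n) := by
  rintro t ρ ⟨c, hc⟩ hcomp hseq hρ e he X v hact
  obtain ⟨ρ₁, ρ₂, rfl⟩ := List.append_of_mem he
  have hρa := readSequence_act hρ
  rw [show t ++ (ρ₁ ++ e :: ρ₂) = (t ++ ρ₁ ++ [e]) ++ ρ₂ by simp] at hc
  obtain ⟨c₂, hc₂, -⟩ := hc.split
  obtain ⟨c₁, hc₁, hs⟩ := hc₂.inv_snoc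
  obtain ⟨c₀, hc₀, hrun⟩ := hc₁.split
  have hmem := mem_of_run hc₀ hrun hcomp fun f hf => (hρa f (by simp [hf])).1
  obtain ⟨W₀, hW₀⟩ := exists_inv hc₀
  have hmem₀ : memAfter (nonAborted t) = (state c₀).mem := by
    rw [← hW₀.memAfter hseq]
    refine memAfter_filter_congr fun f hf => ?_
    rw [decide_eq_decide]
    refine ⟨fun hna => hW₀.committed _ ((hcomp _ ⟨f, hf, rfl⟩).resolve_right hna), fun hfW hab => ?_⟩
    obtain ⟨p, op, s, hst⟩ := hc₀.traceInv.state f.oid ⟨f, hf, rfl⟩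
    have hsa := hst.aborted.1 hab
    rcases (hW₀.serialized hc₀).pending _ hfW with ⟨r, hr⟩ | hp
    · rw [(hst.responded r).1 hr] at hsa; cases hsa
    · exact hp.2.2 hab
  rw [hmem₀, ← hmem]
  obtain ⟨W, hW⟩ := exists_inv hc₁
  generalize hk : e.act = k at hact
  cases hs with
  | ret p op a l w hp hn =>
    have h1 := hW.proc p
    have hl1 := hW.ok.legal p
    rw [hp] at h1
    replace hn := (next_eq p (loc c₁ p)).symm.trans hn
    generalize loc c₁ p = ℓ at hn h1
    rcases ℓ with k | r
    · cases hn
    cases hn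
    have hfin : l.cmd.finish w = .resRead X v := hk.trans hact
    rcases h1 with ⟨h2, -, -⟩ | ⟨-, -, r, rfl⟩
    swap
    · cases hfin
    rw [h2, LegalFrom.append] at hl1
    rw [hl1.2.1 X v hfin]
    -- The reader has not written `X` itself: a write in `t` would belong to an operation that has
    -- already returned, and `ρ` contains no writes.
    refine foldl_actMem_of_notMem (fun w' hw' => ?_) _
    obtain ⟨f, hf, hfa, hfw⟩ := mem_acts.1 (List.mem_of_mem_filter hw')
    rcases List.mem_append.1 hf with hf | hf
    · obtain ⟨op, hst⟩ := hc₁.opState_of_busy hp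
      rcases hcomp a ⟨f, hf, hfa⟩ with ⟨r', g, hg, h4⟩ | ⟨g, hg, h4⟩
      · cases (hst.responded r').1 ⟨g, List.mem_append_left _ hg, h4⟩
      · cases hst.aborted.1 ⟨g, List.mem_append_left _ hg, h4⟩
    · exact (hρa f (by simp [hf])).2 X w' hfw
  | call p op a l hp => subst hact; cases l <;> cases hk
  | _ => subst hact; cases hk

theorem classSM (n : ℕ) : ClassSM (locking n) where
  obedient := obedient n
  lsl := by
    rintro t ⟨c, hc⟩
    obtain ⟨W, hW⟩ := exists_inv hc
    exact (hW.serialized hc).lsLinearizable hc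
  tmBased := fun _ _ _ _ _ => rfl
  safe := fun _ ht => safeStrictSerializable_of_serialized (fun _ => serialized) ht

/-! ### Overlapping insertions -/

/-- The configurations with a given committed memory, logs, phases, and identifiers. -/
structure At (m : Obj → Cell) (g : Fin n → List Act) (ph : Fin n → Phase) (u : Finset ℕ)
    (c : Config (locking n)) : Prop where
  mem : (state c).mem = m
  log : (state c).log = g
  phase : c.phase = ph
  used : c.used = u

section leads

variable {ys : List Act} {g g' : Fin n → List Act} {ph ph' : Fin n → Phase} {u : Finset ℕ}
  {l l' : Loc} {v : Cell} {r : Bool}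

theorem leads_invoke (p : Fin n) (op : SetOp) (a : ℕ) (hp : ph p = .idle) (ha : a ∉ u)
    (hph' : Function.update ph p (.ready op a .start) = ph') :
    Leads (At m g ph u) [(p, .invOp op)] (At m g ph' (insert a u)) := by
  refine Leads.of_step fun c hc => ?_
  obtain ⟨rfl, rfl, rfl, rfl⟩ := hc
  exact ⟨_, _, .invoke c p op a hp ha, rfl, by simp, rfl, rfl, hph', rfl⟩

theorem leads_call (hp : ph p = .ready op a l)
    (hex : exec p l.cmd.toCall ⟨m, g⟩ = (⟨m', g'⟩, some v))
    (hph' : Function.update ph p (Phase.after op a l v) = ph') :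
    Leads (At m g ph u)
      (((l.cmd.start).toSched.map (fun s => (p, s))).toList ++
        ((l.cmd.finish v).toSched.map (fun s => (p, s))).toList) (At m' g' ph' u) := by
  intro c hc
  obtain ⟨rfl, rfl, rfl, rfl⟩ := hc
  obtain ⟨c₁, hs₁, i1, i2, i3, i4⟩ : ∃ d, Step (locking n) c ⟨p, a, l.cmd.start⟩ d ∧
      state d = state c ∧ d.loc p = .inl l.cmd.toCall ∧
      d.phase = Function.update c.phase p (.busy op a l) ∧ d.used = c.used :=
    ⟨_, .call c p op a l hp, rfl, Function.update_self _ _ _, rfl, rfl⟩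
  obtain ⟨c₂, hs₂, j1, j2, j3, j4⟩ : ∃ d, Step (locking n) c₁ ⟨p, a, .step⟩ d ∧
      state d = ⟨m', g'⟩ ∧ d.loc p = .inr (some v) ∧ d.phase = c₁.phase ∧ d.used = c₁.used := by
    refine ⟨_, .prim c₁ p op a l () _ (by rw [i3, Function.update_self]) (by rw [i2]; rfl),
      ?_, ?_, rfl, rfl⟩
    · refine (Function.update_self () _ c₁.base).trans ?_
      exact congrArg Prod.fst ((congrArg (exec p l.cmd.toCall) i1).trans hex)
    · refine (Function.update_self _ _ _).trans ?_
      exact congrArg (fun x : State n × Option Cell => (.inr x.2 : Local))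
        ((congrArg (exec p l.cmd.toCall) i1).trans hex)
  obtain ⟨c₃, hs₃, k1, k2, k3⟩ : ∃ d, Step (locking n) c₂ ⟨p, a, l.cmd.finish v⟩ d ∧
      state d = state c₂ ∧ d.phase = Function.update c₂.phase p (Phase.after op a l v) ∧
      d.used = c₂.used :=
    ⟨_, .ret c₂ p op a l v (by rw [j3, i3, Function.update_self]) (by rw [j2]; rfl), rfl, rfl, rfl⟩
  refine ⟨_, c₃, ((Run.single hs₁).trans (Run.single hs₂)).trans (Run.single hs₃), ?_, ?_, ?_⟩
  · rw [scheduleOf_append, scheduleOf_append]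
    simp only [scheduleOf, List.filterMap_cons, List.filterMap_nil]
    cases l.cmd.start.toSched <;> cases (l.cmd.finish v).toSched <;> rfl
  · intro e he
    rw [List.mem_append, List.mem_append, List.mem_singleton, List.mem_singleton,
      List.mem_singleton] at he
    rcases he with (rfl | rfl) | rfl
    · cases l <;> simp [Loc.cmd, Cmd.start]
    · simp
    · cases l <;> simp [Loc.cmd, Cmd.finish]
  · exact ⟨by rw [k1, j1], by rw [k1, j1], by rw [k2, j3, i3, Function.update_idem, hph'],
      by rw [k3, j4, i4]⟩

theorem leads_read (hp : ph p = .ready op a l) (hg : g p = ys) (hl : l.cmd = .read X)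
    (hq : ∀ q, q ≠ p → ∀ w, .resWrite X w ∉ g q) (hv : ys.foldl actMem m X = v)
    (hl' : l.afterRead op a v = l')
    (hg' : Function.update g p (ys ++ [.resRead X v]) = g')
    (hph' : Function.update ph p (.ready op a l') = ph') :
    Leads (At m g ph u) [(p, .invRead X), (p, .resRead X)] (At m g' ph' u) := by
  subst hl' hg
  have hc : ¬ State.Conflict ⟨m, g⟩ p (.read X) := fun ⟨q, hqp, w, hw⟩ => hq q hqp w hw
  have := leads_call (m := m) (g := g) (m' := m) (g' := g') (u := u) (v := v) (ph' := ph') hp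
    (by
      rw [hl]
      unfold exec
      rw [Cmd.toCall, if_neg hc]
      subst hv hg'
      rfl) (by simpa [Phase.after, hl] using hph')
  rwa [hl] at this

theorem leads_write (hp : ph p = .ready op a l) (hg : g p = ys) (hl : l.cmd = .write X v)
    (hq : ∀ q, q ≠ p → ∀ w, .resWrite X w ∉ g q ∧ .resRead X w ∉ g q) (hl' : l.afterWrite = l')
    (hg' : Function.update g p (ys ++ [.resWrite X v]) = g')
    (hph' : Function.update ph p (.ready op a l') = ph') :
    Leads (At m g ph u) [(p, .invWrite X v), (p, .resWrite X)] (At m g' ph' u) := by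
  subst hl' hg
  have hc : ¬ State.Conflict ⟨m, g⟩ p (.write X v) := by
    rintro ⟨q, hqp, w, hw | hw⟩
    · exact (hq q hqp w).1 hw
    · exact (hq q hqp w).2 hw
  have := leads_call (m := m) (g := g) (m' := m) (g' := g') (u := u) (v := v) (ph' := ph') hp
    (by
      rw [hl]
      unfold exec
      rw [Cmd.toCall, if_neg hc]
      subst hg'
      rfl) (by simpa [Phase.after, hl] using hph')
  rwa [hl] at this

theorem leads_complete (hp : ph p = .ready op a (.done r)) (hg : g p = ys)
    (hm' : ys.foldl actMem m = m') (hg' : Function.update g p [] = g') (hph' : Function.update ph p .idle = ph') :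
    Leads (At m g ph u) [(p, .resOp)] (At m' g' ph' u) := by
  subst hg
  have hc : ¬ State.Conflict ⟨m, g⟩ p .complete := id
  refine leads_call (m := m) (g := g) (m' := m') (g' := g') (u := u) (ph' := ph')
    (v := (g p).foldl actMem m .head) hp ?_ hph'
  unfold exec
  rw [Loc.cmd, Cmd.toCall, if_neg hc]
  subst hm' hg'
  rfl

end leads

theorem forall_pair {α : Type*} {p p' r : Fin n} (P : α → Prop) {z x y : α} (hz : P z)
    (hx : r ≠ p → P x) (hy : r ≠ p' → P y) : ∀ q, q ≠ r → P (pair p p' z x y q) := by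
  intro q hq
  unfold pair
  by_cases hqp : q = p
  · subst hqp
    rw [Function.update_self]
    exact hx hq.symm
  · rw [Function.update_of_ne hqp]
    by_cases hqp' : q = p'
    · subst hqp'
      rw [Function.update_self]
      exact hy hq.symm
    · rwa [Function.update_of_ne hqp']

theorem afterRead_insert_eq {v : ℤ} {prev curr : Obj} {pc c : Cell} (h : c.val = keyVal v) :
    Loc.afterRead (.insert v) a (.traverse prev pc curr) c = .done false := by
  have h' : c.val = key (.insert v) := h
  simp [Loc.afterRead, h']

/-- Until the commit of `p'` both processes only read. When `p` writes the head, which both have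
read, the log of `p'` is empty again, and nothing conflicts. -/
theorem accepts_overlapSchedule (hpp : p' ≠ p) :
    Accepts (locking n) (overlapSchedule p p') := by
  have h0 : At (fun X => initMem X) (pair p p' [] [] []) (pair p p' .idle .idle .idle) ∅
      (Config.initial (locking n)) :=
    ⟨rfl, funext fun q => by rw [pair_self]; rfl, funext fun q => by rw [pair_self]; rfl, rfl⟩
  have pl {α : Type} := pair_left (α := α) p p'
  have pr {α : Type} := pair_right (α := α) hpp
  have ul {α : Type} := update_pair_left (α := α) p p'
  have ur {α : Type} := update_pair_right (α := α) hpp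
  have nr : ∀ {r : Fin n} {X : Obj} {x y : List Act}, (r ≠ p → ∀ w, .resWrite X w ∉ x) →
      (r ≠ p' → ∀ w, .resWrite X w ∉ y) → ∀ q, q ≠ r → ∀ w, .resWrite X w ∉ pair p p' [] x y q :=
    fun {_ X _ _} => forall_pair (fun ys : List Act => ∀ w, .resWrite X w ∉ ys) (by simp)
  have nw : ∀ {r : Fin n} {X : Obj} {x y : List Act},
      (r ≠ p → ∀ w, .resWrite X w ∉ x ∧ .resRead X w ∉ x) →
      (r ≠ p' → ∀ w, .resWrite X w ∉ y ∧ .resRead X w ∉ y) →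
      ∀ q, q ≠ r → ∀ w, .resWrite X w ∉ pair p p' [] x y q ∧ .resRead X w ∉ pair p p' [] x y q :=
    fun {_ X _ _} => forall_pair (fun ys : List Act => ∀ w, .resWrite X w ∉ ys ∧ .resRead X w ∉ ys)
      (by simp)
  have a1 := leads_invoke (m := fun X => initMem X) (g := pair p p' [] [] [])
    (ph := pair p p' .idle .idle .idle) (u := ∅) p (.insert 5) 0 (pl _ _ _) (by simp) (ul _ _ _ _)
  have a2 := a1.trans (leads_read (v := ⟨⊥, .tail⟩) (l' := .traverse .head ⟨⊥, .tail⟩ .tail)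
    (pl _ _ _) (pl _ _ _) rfl (nr (by simp) (by simp)) rfl rfl (ul _ _ _ _) (ul _ _ _ _))
  have a3 := a2.trans (leads_read (v := ⟨⊤, .tail⟩)
    (l' := .create .head ⟨⊥, .tail⟩ (.node 0) ⟨keyVal 5, .tail⟩) (pl _ _ _) (pl _ _ _) rfl
    (nr (by simp) (by simp)) rfl (afterRead_insert (keyVal_lt_top _)) (ul _ _ _ _)
    (ul _ _ _ _))
  have a4 := a3.trans (leads_write (l' := .update .head ⟨⊥, .node 0⟩) (pl _ _ _) (pl _ _ _) rfl
    (nw (by simp) (by simp)) rfl (ul _ _ _ _) (ul _ _ _ _))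
  have a5 := a4.trans (leads_write (l' := .done true) (pl _ _ _) (pl _ _ _) rfl
    (nw (by simp) (by simp)) rfl (ul _ _ _ _) (ul _ _ _ _))
  have a6 := a5.trans (leads_complete (pl _ _ _) (pl _ _ _) rfl (ul _ _ _ _) (ul _ _ _ _))
  have a7 := a6.trans (leads_invoke p (.insert 3) 1 (pl _ _ _) (by simp) (ul _ _ _ _))
  have a8 := a7.trans (leads_read (v := ⟨⊥, .node 0⟩)
    (l' := .traverse .head ⟨⊥, .node 0⟩ (.node 0)) (pl _ _ _) (pl _ _ _) rfl
    (nr (by simp) (by simp)) rfl rfl (ul _ _ _ _) (ul _ _ _ _))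
  have a9 := a8.trans (leads_read (v := ⟨keyVal 5, .tail⟩)
    (l' := .create .head ⟨⊥, .node 0⟩ (.node 1) ⟨keyVal 3, .node 0⟩) (pl _ _ _) (pl _ _ _) rfl
    (nr (by simp) (by simp)) rfl (afterRead_insert (keyVal_lt.2 (by simp)))
    (ul _ _ _ _) (ul _ _ _ _))
  have a10 := a9.trans (leads_invoke p' (.insert 5) 2 (pr _ _ _) (by simp) (ur _ _ _ _))
  have a11 := a10.trans (leads_read (v := ⟨⊥, .node 0⟩)
    (l' := .traverse .head ⟨⊥, .node 0⟩ (.node 0)) (pr _ _ _) (pr _ _ _) rfl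
    (nr (by simp) (by simp)) rfl rfl (ur _ _ _ _) (ur _ _ _ _))
  have a12 := a11.trans (leads_read (v := ⟨keyVal 5, .tail⟩) (l' := .done false)
    (pr _ _ _) (pr _ _ _) rfl (nr (by simp) (by simp)) rfl (afterRead_insert_eq rfl)
    (ur _ _ _ _) (ur _ _ _ _))
  have a13 := a12.trans (leads_complete (pr _ _ _) (pr _ _ _) rfl (ur _ _ _ _) (ur _ _ _ _))
  have a14 := a13.trans (leads_write (l' := .update .head ⟨⊥, .node 1⟩) (pl _ _ _) (pl _ _ _) rfl
    (nw (by simp) (by simp)) rfl (ul _ _ _ _) (ul _ _ _ _))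
  have a15 := a14.trans (leads_write (l' := .done true) (pl _ _ _) (pl _ _ _) rfl
    (nw (by simp) (by simp)) rfl (ul _ _ _ _) (ul _ _ _ _))
  have a16 := a15.trans (leads_complete (pl _ _ _) (pl _ _ _) rfl (ul _ _ _ _) (ul _ _ _ _))
  have h := a16.accepts h0 fun c hc q => by rw [hc.phase, pair_self]
  simp only [List.cons_append, List.nil_append] at h
  exact h

end Locking

end ListSet

theorem theorem1 (n : ℕ) (hn : 2 ≤ n) :
    ∃ σ₀ σ : ListSet.Schedule n,
      (ListSet.ClassP (ListSet.handOverHand n) ∧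
        ListSet.Accepts (ListSet.handOverHand n) σ₀ ∧
        ∀ I : ListSet.ConcImpl n, ListSet.ClassSM I → ¬ ListSet.Accepts I σ₀) ∧
      ((∃ IC : ListSet.ConcImpl n, ListSet.ClassSM IC ∧ ListSet.Progressive IC ∧
          ListSet.Accepts IC σ) ∧
        ∀ I : ListSet.ConcImpl n, ListSet.ClassP I → ¬ ListSet.Accepts I σ) := by
  let p : Fin n := ⟨0, by omega⟩
  let p' : Fin n := ⟨1, by omega⟩
  have hpp : p' ≠ p := by simp [p, p']
  exact ⟨ListSet.lockSchedule p p', ListSet.overlapSchedule p p',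
    ⟨ListSet.HandOverHand.classP, ListSet.HandOverHand.accepts_lockSchedule hpp,
      fun _ hI => hI.not_accepts_lockSchedule hpp⟩,
    ⟨ListSet.locking n, ListSet.Locking.classSM n, ListSet.Locking.progressive n,
      ListSet.Locking.accepts_overlapSchedule hpp⟩,
    fun _ hI => hI.not_accepts_overlapSchedule hpp⟩
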